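/- **Setting.** *Types* are generated from a base type $N$ by $\sigma\to\tau$. A *sequent* $\vec\sigma\Rightarrow\tau$ has an associated type $\vec\sigma\to\tau$. Consider the following typing rules (premisses / conclusion), for all lists of types $\vec\rho,\vec\sigma$ and types $\rho,\sigma,\tau$: - $\mathsf{ex}$: $\ \vec\rho,\sigma,\rho,\vec\sigma\Rightarrow\tau\ /\ \vec\rho,\rho,\sigma,\vec\sigma\Rightarrow\tau$; - $\mathsf{wk}$: $\ \vec\sigma\Rightarrow\tau\ /\ \vec\sigma,\sigma\Rightarrow\tau$; - $\mathsf{cntr}$: $\ \vec\sigma,\sigma,\sigma\Rightarrow\tau\ /\ \vec\sigma,\sigma\Rightarrow\tau$; - $\mathsf{cut}$: $\ \vec\sigma\Rightarrow\sigma$ and $\vec\sigma,\sigma\Rightarrow\tau\ /\ \vec\sigma\Rightarrow\tau$; - $\mathsf{id}$: $\ /\ \sigma\Rightarrow\sigma$; - $\mathsf{L}$: $\ \vec\sigma\Rightarrow\rho$ and $\vec\sigma,\sigma\Rightarrow\tau\ /\ \vec\sigma,\rho\to\sigma\Rightarrow\tau$; - $\mathsf{R}$: $\ \vec\sigma,\sigma\Rightarrow\tau\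 /\ \vec\sigma\Rightarrow\sigma\to\tau$; - $0$: $\ /\ \Rightarrow N$; $\quad\mathsf{s}$: $\ /\ N\Rightarrow N$; - $\mathsf{rec}$: $\ \vec\sigma\Rightarrow\tau$ and $\vec\sigma,N,\tau\Rightarrow\tau\ /\ \vec\sigma,N\Rightarrow\tau$; - $\mathsf{cond}$: $\ \vec\sigma\Rightarrow\tau$ and $\vec\sigma,N\Rightarrow\tau\ /\ \vec\sigma,N\Rightarrow\tau$. Each rule instance with premisses $S_1,\dots,S_k$ ($k\le 2$) and conclusion $S$ is a *constant*, whose type is that of $S_1$ to $\cdots$ to that of $S_k$ to that of $S$. *Coterms* are possibly infinite trees built from typed variables and constants by binary typed application. A *coderivation* of $S$ is a possibly infinite, locally correct tree of rule instances other than $\mathsf{rec}$ with conclusion $S$. It is identified with the coterm $\mathsf r\,t_1\cdots t_k$, where $\mathsf r$ is the rule instance at its root and the $t_i$ are the (coterms of the) immediate sub-coderivations. It is *regular* if it has only finitely many distinct sub-coterms. A *farc* is a well-typed finite application of regular coderivations, variables and constants. *Reduction* $\rightsquigarrow$ is the least relation on coterms that is closed under (finite) contexts and contains all instances of $$\begin{aligned}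 \mathsf{id}\,x&\rightsquigarrow x & \mathsf{ex}\,t\,\vec x\,x\,y\,\vec y&\rightsquigarrow t\,\vec x\,y\,x\,\vec y\\ \mathsf{wk}\,t\,\vec x\,x&\rightsquigarrow t\,\vec x & \mathsf{cntr}\,t\,\vec x\,x&\rightsquigarrow t\,\vec x\,x\,x\\ \mathsf{cut}\,s\,t\,\vec x&\rightsquigarrow t\,\vec x\,(s\,\vec x) & \mathsf{L}\,s\,t\,\vec x\,y&\rightsquigarrow t\,\vec x\,(y\,(s\,\vec x))\\ \mathsf{R}\,t\,\vec x\,x&\rightsquigarrow t\,\vec x\,x & &\\ \mathsf{rec}\,s\,t\,\vec x\,0&\rightsquigarrow s\,\vec x & \mathsf{rec}\,s\,t\,\vec x\,(\mathsf s\,y)&\rightsquigarrow t\,\vec x\,y\,(\mathsf{rec}\,s\,t\,\vec x\,y)\\ \mathsf{cond}\,s\,t\,\vec x\,0&\rightsquigarrow s\,\vec x & \mathsf{cond}\,s\,t\,\vec x\,(\mathsf s\,y)&\rightsquigarrow t\,\vec x\,y \end{aligned}$$ where the lengths of $\vec x,\vec y$ are those of the corresponding lists of types in the rule instance. Let $\rightsquigarrow^*$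 be its reflexive transitive closure and $\approx$ its reflexive symmetric transitive closure (*conversion*). A coterm is *normal* if it has no $\rightsquigarrow$-reduct. **Theorem (Church–Rosser).** 1. Let $t$ be a farc of type $\sigma$. If $t\rightsquigarrow^*t_0$ and $t\rightsquigarrow^*t_1$, then there is a farc $t'$ of type $\sigma$ with $t_0\rightsquigarrow^*t'$ and $t_1\rightsquigarrow^*t'$. 2. For farcs $s,t$: $s\approx t$ if and only if there is $r$ with $s\rightsquigarrow^*r$ and $t\rightsquigarrow^*r$. 3. If $t$ is a farc, $s_0,s_1$ are normal, $t\rightsquigarrow^*s_0$ and $t\rightsquigarrow^*s_1$, then $s_0=s_1$. 4. If $s_0,t,s_1$ are farcs, $s_0,s_1$ are normal and $s_0\approx t\approx s_1$, then $s_0=s_1$. Moreover 1–4 are provable in $\mathsf{RCA}_0$, in the following sense. In arithmetic, regular coderivations are presented by finite graphs whose nodes are labelled by rule instances (coded by numbers), farcs by finite application trees over variables, constants and nodes of such graphs, and equality of coterms is bisimilarity of presentations. Being a presentation of a farc of a given type, bisimilarity, one-step reduction up to bisimilarity between presentations of farcs of the same type, $\rightsquigarrow^*$ and $\approx$ are expressed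 by formulas that assert the existence of a finite derivation, coded with Gödel's $\beta$ function. Then each of the four sentences of arithmetic obtained from 1–4 in this way is a theorem of $\mathsf{RCA}_0$ (basic axioms, $\Sigma^0_1$ induction and $\Delta^0_1$ comprehension, both with parameters), i.e. holds in every model of $\mathsf{RCA}_0$, standard or not. -/

import Mathlib

universe u

namespace CT

/-! ## Types, sequents, constants -/

/-- Simple types: the base type `N` and function types. -/
inductive Ty : Type
  | N : Ty
  | arr : Ty → Ty → Ty

/-- `arrows [σ₁, …, σₙ] τ` is the type `σ₁ → ⋯ → σₙ → τ`. -/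
def arrows (Γ : List Ty) (τ : Ty) : Ty := Γ.foldr Ty.arr τ

/-- A sequent `Γ ⇒ τ` is a list of types together with a type. -/
abbrev Sequent : Type := List Ty × Ty

/-- The type determined by a sequent. -/
def Sequent.ty (S : Sequent) : Ty := arrows S.1 S.2

/-- The constants: one for every instance of a typing rule.  The recursor is called `recr`. -/
inductive Const : Type
  | ex (Γ : List Ty) (ρ σ : Ty) (Δ : List Ty) (τ : Ty)
  | wk (Γ : List Ty) (σ τ : Ty)
  | cntr (Γ : List Ty) (σ τ : Ty)
  | cut (Γ : List Ty) (σ τ : Ty)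
  | id (σ : Ty)
  | L (Γ : List Ty) (ρ σ τ : Ty)
  | R (Γ : List Ty) (σ τ : Ty)
  | zero
  | succ
  | recr (Γ : List Ty) (τ : Ty)
  | cond (Γ : List Ty) (τ : Ty)

/-- The premisses of a rule instance, from left to right. -/
def Const.premisses : Const → List Sequent
  | .ex Γ ρ σ Δ τ => [(Γ ++ σ :: ρ :: Δ, τ)]
  | .wk Γ _ τ => [(Γ, τ)]
  | .cntr Γ σ τ => [(Γ ++ [σ, σ], τ)]
  | .cut Γ σ τ => [(Γ, σ), (Γ ++ [σ], τ)]
  | .id _ => []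
  | .L Γ ρ σ τ => [(Γ, ρ), (Γ ++ [σ], τ)]
  | .R Γ σ τ => [(Γ ++ [σ], τ)]
  | .zero => []
  | .succ => []
  | .recr Γ τ => [(Γ, τ), (Γ ++ [Ty.N, τ], τ)]
  | .cond Γ τ => [(Γ, τ), (Γ ++ [Ty.N], τ)]

/-- The conclusion of a rule instance. -/
def Const.conclusion : Const → Sequent
  | .ex Γ ρ σ Δ τ => (Γ ++ ρ :: σ :: Δ, τ)
  | .wk Γ σ τ => (Γ ++ [σ], τ)
  | .cntr Γ σ τ => (Γ ++ [σ], τ)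
  | .cut Γ _ τ => (Γ, τ)
  | .id σ => ([σ], σ)
  | .L Γ ρ σ τ => (Γ ++ [Ty.arr ρ σ], τ)
  | .R Γ σ τ => (Γ, Ty.arr σ τ)
  | .zero => ([], Ty.N)
  | .succ => ([Ty.N], Ty.N)
  | .recr Γ τ => (Γ ++ [Ty.N], τ)
  | .cond Γ τ => (Γ ++ [Ty.N], τ)

/-- The type of a constant: types of the premisses, then the type of the conclusion. -/
def Const.ty (r : Const) : Ty := arrows (r.premisses.map Sequent.ty) r.conclusion.ty

/-- The instances of the recursion rule; coderivations do not use them. -/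
def Const.IsRecr : Const → Prop
  | .recr _ _ => True
  | _ => False

/-! ## Coterms -/

/-- Node labels of coterms. -/
inductive Label : Type
  | var (σ : Ty) (n : ℕ)
  | const (r : Const)
  | app

/-- Variables and constants are leaves; application nodes have two children
(`true` for the function, `false` for the argument). -/
abbrev Label.Child : Label → Type
  | .var _ _ => Empty
  | .const _ => Empty
  | .app => Bool

abbrev coF : PFunctor.{0, 0} := ⟨Label, Label.Child⟩

/-- Possibly infinite binary application trees over typed variables and constants.  Typing is
imposed by the predicates below. The type annotations of the application nodes are determined
by the leaves whenever left spines are finite, as they are in all farcs, and are not repeated. -/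
abbrev Coterm : Type := coF.M

def var (σ : Ty) (n : ℕ) : Coterm := PFunctor.M.mk ⟨Label.var σ n, Empty.elim⟩

def const (r : Const) : Coterm := PFunctor.M.mk ⟨Label.const r, Empty.elim⟩

def app (s t : Coterm) : Coterm :=
  PFunctor.M.mk ⟨Label.app, fun b : Bool => if b = true then s else t⟩

/-- `apps h [t₁, …, tₙ]` is `h t₁ ⋯ tₙ`. -/
def apps (h : Coterm) (ts : List Coterm) : Coterm := ts.foldl app h

/-- `Sub t u`: `u` is a sub-coterm of `t`. -/
inductive Sub (t : Coterm) : Coterm → Prop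
  | refl : Sub t t
  | left {a b : Coterm} : Sub t (app a b) → Sub t a
  | right {a b : Coterm} : Sub t (app a b) → Sub t b

/-- A coterm is regular if it has only finitely many distinct sub-coterms. -/
def Regular (t : Coterm) : Prop := {u : Coterm | Sub t u}.Finite

/-- `t` is (the coterm of) a coderivation of `S`: coinductively, `t = r t₁ ⋯ tₖ` for a rule
instance `r`, not a recursion rule, with conclusion `S`, where the `tᵢ` are coderivations of the
premisses of `r`. -/
def IsCoderivation (t : Coterm) (S : Sequent) : Prop :=
  ∃ P : Coterm → Sequent → Prop,
    (∀ t S, P t S → ∃ r : Const, ¬ r.IsRecr ∧ r.conclusion = S ∧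
      ∃ ts : List Coterm, List.Forall₂ P ts r.premisses ∧ t = apps (const r) ts) ∧
    P t S

/-- `Farc t σ`: `t` is a farc of type `σ`, that is, a well-typed finite application of regular
coderivations, variables and constants. -/
inductive Farc : Coterm → Ty → Prop
  | var (σ : Ty) (n : ℕ) : Farc (var σ n) σ
  | const (r : Const) : Farc (const r) r.ty
  | coder {t : Coterm} {S : Sequent} : IsCoderivation t S → Regular t → Farc t S.ty
  | app {s t : Coterm} {σ τ : Ty} : Farc s (Ty.arr σ τ) → Farc t σ → Farc (app s t) τ

def IsFarc (t : Coterm) : Prop := ∃ σ, Farc t σ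

/-- One-step reduction. The vectors `xs`, `ys` of arguments have the lengths prescribed by the
rule instance. -/
inductive Red : Coterm → Coterm → Prop
  | id (σ : Ty) (x : Coterm) : Red (app (const (.id σ)) x) x
  | ex (Γ : List Ty) (ρ σ : Ty) (Δ : List Ty) (τ : Ty) (t x y : Coterm) (xs ys : List Coterm)
      (hx : xs.length = Γ.length) (hy : ys.length = Δ.length) :
      Red (apps (const (.ex Γ ρ σ Δ τ)) ([t] ++ xs ++ [x, y] ++ ys))
        (apps t (xs ++ [y, x] ++ ys))
  | wk (Γ : List Ty) (σ τ : Ty) (t x : Coterm) (xs : List Coterm) (hx : xs.length = Γ.length) :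
      Red (apps (const (.wk Γ σ τ)) ([t] ++ xs ++ [x])) (apps t xs)
  | cntr (Γ : List Ty) (σ τ : Ty) (t x : Coterm) (xs : List Coterm)
      (hx : xs.length = Γ.length) :
      Red (apps (const (.cntr Γ σ τ)) ([t] ++ xs ++ [x])) (apps t (xs ++ [x, x]))
  | cut (Γ : List Ty) (σ τ : Ty) (s t : Coterm) (xs : List Coterm)
      (hx : xs.length = Γ.length) :
      Red (apps (const (.cut Γ σ τ)) ([s, t] ++ xs)) (apps t (xs ++ [apps s xs]))
  | L (Γ : List Ty) (ρ σ τ : Ty) (s t y : Coterm) (xs : List Coterm)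
      (hx : xs.length = Γ.length) :
      Red (apps (const (.L Γ ρ σ τ)) ([s, t] ++ xs ++ [y]))
        (apps t (xs ++ [app y (apps s xs)]))
  | R (Γ : List Ty) (σ τ : Ty) (t x : Coterm) (xs : List Coterm) (hx : xs.length = Γ.length) :
      Red (apps (const (.R Γ σ τ)) ([t] ++ xs ++ [x])) (apps t (xs ++ [x]))
  | recr_zero (Γ : List Ty) (τ : Ty) (s t : Coterm) (xs : List Coterm)
      (hx : xs.length = Γ.length) :
      Red (apps (const (.recr Γ τ)) ([s, t] ++ xs ++ [const .zero])) (apps s xs)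
  | recr_succ (Γ : List Ty) (τ : Ty) (s t y : Coterm) (xs : List Coterm)
      (hx : xs.length = Γ.length) :
      Red (apps (const (.recr Γ τ)) ([s, t] ++ xs ++ [app (const .succ) y]))
        (apps t (xs ++ [y, apps (const (.recr Γ τ)) ([s, t] ++ xs ++ [y])]))
  | cond_zero (Γ : List Ty) (τ : Ty) (s t : Coterm) (xs : List Coterm)
      (hx : xs.length = Γ.length) :
      Red (apps (const (.cond Γ τ)) ([s, t] ++ xs ++ [const .zero])) (apps s xs)
  | cond_succ (Γ : List Ty) (τ : Ty) (s t y : Coterm) (xs : List Coterm)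
      (hx : xs.length = Γ.length) :
      Red (apps (const (.cond Γ τ)) ([s, t] ++ xs ++ [app (const .succ) y]))
        (apps t (xs ++ [y]))
  | left {s s' : Coterm} (t : Coterm) : Red s s' → Red (app s t) (app s' t)
  | right (s : Coterm) {t t' : Coterm} : Red t t' → Red (app s t) (app s t')

/-- Reduction sequences: the reflexive transitive closure of `Red`. -/
def Reds : Coterm → Coterm → Prop := Relation.ReflTransGen Red

/-- Conversion: the reflexive, symmetric, transitive closure of `Red`. -/
def Conv : Coterm → Coterm → Prop := Relation.EqvGen Red

def Normal (t : Coterm) : Prop := ∀ u, ¬ Red t u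

/-! ## Second-order arithmetic and the theory RCA₀ -/

/-- Number terms of second-order arithmetic; number variables are named by natural numbers. -/
inductive Tm : Type
  | var : ℕ → Tm
  | zero : Tm
  | one : Tm
  | add : Tm → Tm → Tm
  | mul : Tm → Tm → Tm

/-- Formulas of second-order arithmetic; number and set variables are named by natural
numbers. -/
inductive Fml : Type
  | eq : Tm → Tm → Fml
  | lt : Tm → Tm → Fml
  | mem : Tm → ℕ → Fml
  | neg : Fml → Fml
  | and : Fml → Fml → Fml
  | or : Fml → Fml → Fml
  | imp : Fml → Fml → Fml
  | all : ℕ → Fml → Fml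
  | ex : ℕ → Fml → Fml
  | allSet : ℕ → Fml → Fml
  | exSet : ℕ → Fml → Fml

/-- Structures for second-order arithmetic: a number part, and a collection of sets of
numbers over which the set quantifiers range. -/
structure Structure2 : Type (u + 1) where
  Num : Type u
  zero : Num
  one : Num
  add : Num → Num → Num
  mul : Num → Num → Num
  lt : Num → Num → Prop
  sets : Set (Set Num)

def Tm.eval (A : Structure2.{u}) (e : ℕ → A.Num) : Tm → A.Num
  | .var n => e n
  | .zero => A.zero
  | .one => A.one
  | .add s t => A.add (s.eval A e) (t.eval A e)
  | .mul s t => A.mul (s.eval A e) (t.eval A e)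

/-- Satisfaction under an assignment `e` of numbers and an assignment `E` of sets. -/
def Fml.Sat (A : Structure2.{u}) : (ℕ → A.Num) → (ℕ → Set A.Num) → Fml → Prop
  | e, _, .eq s t => s.eval A e = t.eval A e
  | e, _, .lt s t => A.lt (s.eval A e) (t.eval A e)
  | e, E, .mem t X => t.eval A e ∈ E X
  | e, E, .neg φ => ¬ Fml.Sat A e E φ
  | e, E, .and φ ψ => Fml.Sat A e E φ ∧ Fml.Sat A e E ψ
  | e, E, .or φ ψ => Fml.Sat A e E φ ∨ Fml.Sat A e E ψ
  | e, E, .imp φ ψ => Fml.Sat A e E φ → Fml.Sat A e E ψ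
  | e, E, .all n φ => ∀ a : A.Num, Fml.Sat A (Function.update e n a) E φ
  | e, E, .ex n φ => ∃ a : A.Num, Fml.Sat A (Function.update e n a) E φ
  | e, E, .allSet X φ => ∀ S ∈ A.sets, Fml.Sat A e (Function.update E X S) φ
  | e, E, .exSet X φ => ∃ S ∈ A.sets, Fml.Sat A e (Function.update E X S) φ

/-- `A` satisfies (the universal closure of) `φ`. -/
def Structure2.Models (A : Structure2.{u}) (φ : Fml) : Prop :=
  ∀ (e : ℕ → A.Num) (E : ℕ → Set A.Num), (∀ k, E k ∈ A.sets) → φ.Sat A e E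

def Tm.Occurs (n : ℕ) : Tm → Prop
  | .var m => m = n
  | .zero => False
  | .one => False
  | .add s t => s.Occurs n ∨ t.Occurs n
  | .mul s t => s.Occurs n ∨ t.Occurs n

/-- Bounded-quantifier formulas (set parameters are allowed, set quantifiers are not). -/
inductive Fml.Bounded : Fml → Prop
  | eq (s t : Tm) : Bounded (.eq s t)
  | lt (s t : Tm) : Bounded (.lt s t)
  | mem (t : Tm) (X : ℕ) : Bounded (.mem t X)
  | neg {φ : Fml} : Bounded φ → Bounded (.neg φ)
  | and {φ ψ : Fml} : Bounded φ → Bounded ψ → Bounded (.and φ ψ)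
  | or {φ ψ : Fml} : Bounded φ → Bounded ψ → Bounded (.or φ ψ)
  | imp {φ ψ : Fml} : Bounded φ → Bounded ψ → Bounded (.imp φ ψ)
  | ball {n : ℕ} {t : Tm} {φ : Fml} : ¬ t.Occurs n → Bounded φ →
      Bounded (.all n (.imp (.lt (.var n) t) φ))
  | bex {n : ℕ} {t : Tm} {φ : Fml} : ¬ t.Occurs n → Bounded φ →
      Bounded (.ex n (.and (.lt (.var n) t) φ))

def Fml.IsSigma1 (φ : Fml) : Prop := ∃ n θ, Fml.Bounded θ ∧ φ = .ex n θ

def Fml.IsPi1 (φ : Fml) : Prop := ∃ n θ, Fml.Bounded θ ∧ φ = .all n θ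

/-- `A` is a model of RCA₀: the basic axioms, induction for `Σ⁰₁` formulas and comprehension
for `Δ⁰₁` predicates, with number and set parameters. -/
structure Structure2.IsModelRCA0 (A : Structure2.{u}) : Prop where
  sets_nonempty : A.sets.Nonempty
  succ_ne_zero : ∀ m, A.add m A.one ≠ A.zero
  succ_inj : ∀ m n, A.add m A.one = A.add n A.one → m = n
  add_zero : ∀ m, A.add m A.zero = m
  add_succ : ∀ m n, A.add m (A.add n A.one) = A.add (A.add m n) A.one
  mul_zero : ∀ m, A.mul m A.zero = A.zero
  mul_succ : ∀ m n, A.mul m (A.add n A.one) = A.add (A.mul m n) m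
  not_lt_zero : ∀ m, ¬ A.lt m A.zero
  lt_succ : ∀ m n, A.lt m (A.add n A.one) ↔ A.lt m n ∨ m = n
  induction : ∀ φ : Fml, φ.IsSigma1 → ∀ (k : ℕ) (e : ℕ → A.Num) (E : ℕ → Set A.Num),
    (∀ i, E i ∈ A.sets) →
    φ.Sat A (Function.update e k A.zero) E →
    (∀ a, φ.Sat A (Function.update e k a) E →
      φ.Sat A (Function.update e k (A.add a A.one)) E) →
    ∀ a, φ.Sat A (Function.update e k a) E
  comprehension : ∀ φ ψ : Fml, φ.IsSigma1 → ψ.IsPi1 →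
    ∀ (k : ℕ) (e : ℕ → A.Num) (E : ℕ → Set A.Num), (∀ i, E i ∈ A.sets) →
    (∀ a, φ.Sat A (Function.update e k a) E ↔ ψ.Sat A (Function.update e k a) E) →
    {a | φ.Sat A (Function.update e k a) E} ∈ A.sets

/-- `φ` is a theorem of RCA₀, as logical consequence: `φ` holds in every (not necessarily
standard) model of RCA₀. -/
def RCA0Proves (φ : Fml) : Prop := ∀ A : Structure2.{u}, A.IsModelRCA0 → A.Models φ

/-! ## Arithmetisation

Syntactic objects and statements about them (judgments) are coded by numbers. The judgments are
specified by a list of clauses, and a judgment holds if there is a finite derivation of it, a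
finite sequence of numbers coded by Gödel's `β` function in which every entry is the conclusion
of an instance of a clause. In an ordinary clause the premisses have to occur earlier in the
sequence; in a circular clause they may occur anywhere in it, so that the judgments defined by
circular clauses (local correctness of a finite graph, bisimilarity of finite graphs) are witnessed
by finite, possibly circular, derivations. -/

namespace Arith

instance : Coe ℕ Tm := ⟨Tm.var⟩

/-- The pairing function `(s + t)² + s`. -/
def pair (s t : Tm) : Tm := .add (.mul (.add s t) (.add s t)) s

def numeral : ℕ → Tm
  | 0 => .zero
  | k + 1 => .add (numeral k) .one

/-- `code k [t₁, …, tₙ] = ⟨k, ⟨t₁, ⟨…, ⟨tₙ, 0⟩…⟩⟩⟩`, a compound object with constructor number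
`k`. -/
def code (k : ℕ) (ts : List Tm) : Tm := pair (numeral k) (ts.foldr pair .zero)

/- Variables for clauses. Those of a clause are existentially quantified in each of its uses. -/
abbrev Γ : ℕ := 0
abbrev Δ : ℕ := 1
abbrev Θ : ℕ := 2
abbrev Θ' : ℕ := 3
abbrev ρ : ℕ := 4
abbrev σ : ℕ := 5
abbrev τ : ℕ := 6
abbrev θ : ℕ := 7
abbrev θ₁ : ℕ := 8
abbrev θ₂ : ℕ := 9
abbrev S : ℕ := 10
abbrev S₁ : ℕ := 11
abbrev S₂ : ℕ := 12
abbrev r : ℕ := 13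
abbrev s : ℕ := 14
abbrev s' : ℕ := 15
abbrev t : ℕ := 16
abbrev t' : ℕ := 17
abbrev u : ℕ := 18
abbrev v : ℕ := 19
abbrev v' : ℕ := 20
abbrev w : ℕ := 21
abbrev w' : ℕ := 22
abbrev x : ℕ := 23
abbrev y : ℕ := 24
abbrev a : ℕ := 25
abbrev b : ℕ := 26
abbrev i : ℕ := 27
abbrev j : ℕ := 28
abbrev k : ℕ := 29

/- Variables used in the definition of derivability. -/
abbrev vA : ℕ := 40
abbrev vB : ℕ := 41
abbrev vN : ℕ := 42
abbrev vI : ℕ := 43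
abbrev vJ : ℕ := 44
abbrev vY : ℕ := 45
abbrev vX : ℕ := 46
abbrev vQ : ℕ := 47

/-- `x` is the remainder of `a` modulo `1 + (i + 1) b`: entry `i` of the sequence coded by
`a`, `b`. -/
def beta (a b i x : Tm) : Fml :=
  let m : Tm := .add .one (.mul (.add i .one) b)
  .and (.ex vQ (.eq a (.add (.mul vQ m) x))) (.lt x m)

/- Types. -/
def N : Tm := code 1 []
def arr (σ τ : Tm) : Tm := code 2 [σ, τ]

/- Lists of types, growing on the right. -/
def nil : Tm := code 3 []
def snoc (Γ σ : Tm) : Tm := code 4 [Γ, σ]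

/- Rule instances. -/
def rEx (Γ ρ σ Δ τ : Tm) : Tm := code 5 [Γ, ρ, σ, Δ, τ]
def rWk (Γ σ τ : Tm) : Tm := code 6 [Γ, σ, τ]
def rCntr (Γ σ τ : Tm) : Tm := code 7 [Γ, σ, τ]
def rCut (Γ σ τ : Tm) : Tm := code 8 [Γ, σ, τ]
def rId (σ : Tm) : Tm := code 9 [σ]
def rL (Γ ρ σ τ : Tm) : Tm := code 10 [Γ, ρ, σ, τ]
def rR (Γ σ τ : Tm) : Tm := code 11 [Γ, σ, τ]
def rZero : Tm := code 12 []
def rSucc : Tm := code 13 []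
def rRecr (Γ τ : Tm) : Tm := code 14 [Γ, τ]
def rCond (Γ τ : Tm) : Tm := code 15 [Γ, τ]

/- Presentations of farcs: variables, constants, applications, and nodes of finite graphs. The
sequence coded by `a`, `b` lists the nodes of a graph, its entry number `k` being `⟨r, ⟨i, j⟩⟩`
where `r` is the rule instance at the node and `i`, `j` are the numbers of its children (those
not needed for `r` are ignored); `K (graph a b k)` presents the unfolding of the graph from
node `k`. -/
def V (σ k : Tm) : Tm := code 16 [σ, k]
def K (r : Tm) : Tm := code 17 [r]
def A (s t : Tm) : Tm := code 18 [s, t]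
def node (a b k : Tm) : Tm := code 19 [a, b, k]

/- Sequents. -/
def seq (Γ τ : Tm) : Tm := code 20 [Γ, τ]

/- Judgments: `σ` is a type; `Γ` is a list of types; `θ` is the type `Γ → τ`; `Θ` is the
concatenation of `Γ` and `Δ`. -/
def jTy (σ : Tm) : Tm := code 21 [σ]
def jCtx (Γ : Tm) : Tm := code 22 [Γ]
def jArrow (Γ τ θ : Tm) : Tm := code 23 [Γ, τ, θ]
def jAppend (Γ Δ Θ : Tm) : Tm := code 24 [Γ, Δ, Θ]

/- Judgments: `r` is an instance, with no, one or two premisses, of a rule other than recursion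
(premisses first, conclusion last); `r` is a constant of type `θ`. -/
def jInst0 (r S : Tm) : Tm := code 25 [r, S]
def jInst1 (r S₁ S : Tm) : Tm := code 26 [r, S₁, S]
def jInst2 (r S₁ S₂ S : Tm) : Tm := code 27 [r, S₁, S₂, S]
def jConst (r θ : Tm) : Tm := code 28 [r, θ]

/- Judgments: the unfolding of the graph `a`, `b` from `k` is a coderivation of `S`; `t` presents
a farc of type `θ`. -/
def jCoder (a b k S : Tm) : Tm := code 29 [a, b, k, S]
def jFarc (t θ : Tm) : Tm := code 30 [t, θ]

/- Judgments: `u` is the one-step unfolding of the graph node `t`; `s` and `t` present the same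
coterm. -/
def jUnf (t u : Tm) : Tm := code 31 [t, u]
def jEq (s t : Tm) : Tm := code 32 [s, t]

/- Judgment: for some arguments `x₁ ⋯ xₙ`, as many as the length of `Γ`, `u` is `s x₁ ⋯ xₙ` and
`v` is `t x₁ ⋯ xₙ`. -/
def jSpine (Γ s u t v : Tm) : Tm := code 33 [Γ, s, u, t, v]

/- Judgments: `s` contracts to `t` as presentations; and, for presentations of farcs of type `θ`,
`s` reduces to `t` in one step, in finitely many steps, `s` converts to `t`. -/
def jStep (s t : Tm) : Tm := code 34 [s, t]
def jRed (θ s t : Tm) : Tm := code 35 [θ, s, t]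
def jReds (θ s t : Tm) : Tm := code 36 [θ, s, t]
def jConv (θ s t : Tm) : Tm := code 37 [θ, s, t]

/-- A clause: premisses, a side condition, a conclusion, and whether it is circular. -/
structure Clause where
  prems : List Tm
  concl : Tm
  side : Fml := .eq .zero .zero
  circular : Bool := false

/-- Entry `k` of the graph `a`, `b` is `⟨r, ⟨i, j⟩⟩`. -/
def entry : Fml := beta a b k (pair r (pair i j))

def typeClauses : List Clause :=
  [ { prems := [], concl := jTy N },
    { prems := [jTy σ, jTy τ], concl := jTy (arr σ τ) },
    { prems := [], concl := jCtx nil },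
    { prems := [jCtx Γ, jTy σ], concl := jCtx (snoc Γ σ) },
    { prems := [], concl := jArrow nil τ τ },
    { prems := [jArrow Γ (arr σ τ) θ], concl := jArrow (snoc Γ σ) τ θ },
    { prems := [], concl := jAppend Γ nil Γ },
    { prems := [jAppend Γ Δ Θ], concl := jAppend Γ (snoc Δ σ) (snoc Θ σ) } ]

def ruleClauses : List Clause :=
  [ { prems := [jTy σ], concl := jInst0 (rId σ) (seq (snoc nil σ) σ) },
    { prems := [], concl := jInst0 rZero (seq nil N) },
    { prems := [], concl := jInst0 rSucc (seq (snoc nil N) N) },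
    { prems := [jCtx Γ, jTy ρ, jTy σ, jCtx Δ, jTy τ,
        jAppend (snoc (snoc Γ ρ) σ) Δ Θ, jAppend (snoc (snoc Γ σ) ρ) Δ Θ'],
      concl := jInst1 (rEx Γ ρ σ Δ τ) (seq Θ' τ) (seq Θ τ) },
    { prems := [jCtx Γ, jTy σ, jTy τ],
      concl := jInst1 (rWk Γ σ τ) (seq Γ τ) (seq (snoc Γ σ) τ) },
    { prems := [jCtx Γ, jTy σ, jTy τ],
      concl := jInst1 (rCntr Γ σ τ) (seq (snoc (snoc Γ σ) σ) τ) (seq (snoc Γ σ) τ) },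
    { prems := [jCtx Γ, jTy σ, jTy τ],
      concl := jInst1 (rR Γ σ τ) (seq (snoc Γ σ) τ) (seq Γ (arr σ τ)) },
    { prems := [jCtx Γ, jTy σ, jTy τ],
      concl := jInst2 (rCut Γ σ τ) (seq Γ σ) (seq (snoc Γ σ) τ) (seq Γ τ) },
    { prems := [jCtx Γ, jTy ρ, jTy σ, jTy τ],
      concl := jInst2 (rL Γ ρ σ τ) (seq Γ ρ) (seq (snoc Γ σ) τ) (seq (snoc Γ (arr ρ σ)) τ) },
    { prems := [jCtx Γ, jTy τ],
      concl := jInst2 (rCond Γ τ) (seq Γ τ) (seq (snoc Γ N) τ) (seq (snoc Γ N) τ) },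
    { prems := [jInst0 r (seq Γ τ), jArrow Γ τ θ], concl := jConst r θ },
    { prems := [jInst1 r (seq Δ σ) (seq Γ τ), jArrow Δ σ θ₁, jArrow Γ τ θ],
      concl := jConst r (arr θ₁ θ) },
    { prems := [jInst2 r (seq Δ σ) (seq Θ ρ) (seq Γ τ), jArrow Δ σ θ₁, jArrow Θ ρ θ₂,
        jArrow Γ τ θ],
      concl := jConst r (arr θ₁ (arr θ₂ θ)) },
    { prems := [jCtx Γ, jTy τ, jArrow Γ τ θ₁, jArrow (snoc (snoc Γ N) τ) τ θ₂,
        jArrow (snoc Γ N) τ θ],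
      concl := jConst (rRecr Γ τ) (arr θ₁ (arr θ₂ θ)) } ]

def farcClauses : List Clause :=
  [ { circular := true, side := entry, prems := [jInst0 r S], concl := jCoder a b k S },
    { circular := true, side := entry, prems := [jInst1 r S₁ S, jCoder a b i S₁],
      concl := jCoder a b k S },
    { circular := true, side := entry,
      prems := [jInst2 r S₁ S₂ S, jCoder a b i S₁, jCoder a b j S₂],
      concl := jCoder a b k S },
    { prems := [jTy σ], concl := jFarc (V σ k) σ },
    { prems := [jConst r θ], concl := jFarc (K r) θ },
    { prems := [jCoder a b k (seq Γ τ), jArrow Γ τ θ], concl := jFarc (node a b k) θ },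
    { prems := [jFarc s (arr σ τ), jFarc t σ], concl := jFarc (A s t) τ } ]

def eqClauses : List Clause :=
  [ { side := entry, prems := [jInst0 r S], concl := jUnf (node a b k) (K r) },
    { side := entry, prems := [jInst1 r S₁ S],
      concl := jUnf (node a b k) (A (K r) (node a b i)) },
    { side := entry, prems := [jInst2 r S₁ S₂ S],
      concl := jUnf (node a b k) (A (A (K r) (node a b i)) (node a b j)) },
    { circular := true, prems := [], concl := jEq (V σ k) (V σ k) },
    { circular := true, prems := [], concl := jEq (K r) (K r) },
    { circular := true, prems := [jEq s s', jEq t t'], concl := jEq (A s t) (A s' t') },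
    { circular := true, prems := [jUnf (node a b k) u, jEq u t],
      concl := jEq (node a b k) t },
    { circular := true, prems := [jUnf (node a b k) u, jEq s u],
      concl := jEq s (node a b k) } ]

def stepClauses : List Clause :=
  [ { prems := [], concl := jSpine nil s s t t },
    { prems := [jSpine Γ s u t v], concl := jSpine (snoc Γ σ) s (A u x) t (A v x) },
    { prems := [], concl := jStep (A (K (rId σ)) x) x },
    { prems := [jSpine Γ (A (K (rEx Γ ρ σ Δ τ)) t) u t v,
        jSpine Δ (A (A u x) y) w (A (A v y) x) w'],
      concl := jStep w w' },
    { prems := [jSpine Γ (A (K (rWk Γ σ τ)) t) u t v], concl := jStep (A u x) v },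
    { prems := [jSpine Γ (A (K (rCntr Γ σ τ)) t) u t v],
      concl := jStep (A u x) (A (A v x) x) },
    { prems := [jSpine Γ (A (A (K (rCut Γ σ τ)) s) t) u s v,
        jSpine Γ (A (A (K (rCut Γ σ τ)) s) t) u t v'],
      concl := jStep u (A v' v) },
    { prems := [jSpine Γ (A (A (K (rL Γ ρ σ τ)) s) t) u s v,
        jSpine Γ (A (A (K (rL Γ ρ σ τ)) s) t) u t v'],
      concl := jStep (A u y) (A v' (A y v)) },
    { prems := [jSpine Γ (A (K (rR Γ σ τ)) t) u t v], concl := jStep (A u x) (A v x) },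
    { prems := [jSpine Γ (A (A (K (rRecr Γ τ)) s) t) u s v],
      concl := jStep (A u (K rZero)) v },
    { prems := [jSpine Γ (A (A (K (rRecr Γ τ)) s) t) u t v],
      concl := jStep (A u (A (K rSucc) y)) (A (A v y) (A u y)) },
    { prems := [jSpine Γ (A (A (K (rCond Γ τ)) s) t) u s v],
      concl := jStep (A u (K rZero)) v },
    { prems := [jSpine Γ (A (A (K (rCond Γ τ)) s) t) u t v],
      concl := jStep (A u (A (K rSucc) y)) (A v y) },
    { prems := [jStep s s'], concl := jStep (A s t) (A s' t) },
    { prems := [jStep t t'], concl := jStep (A s t) (A s t') } ]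

/-- One-step reduction of farcs is `jStep` up to equality of the presented coterms. -/
def redClauses : List Clause :=
  [ { prems := [jFarc s θ, jFarc s' θ, jFarc t' θ, jFarc t θ, jEq s s', jStep s' t', jEq t' t],
      concl := jRed θ s t },
    { prems := [jFarc s θ, jFarc t θ, jEq s t], concl := jReds θ s t },
    { prems := [jReds θ s t, jRed θ t u], concl := jReds θ s u },
    { prems := [jFarc s θ, jFarc t θ, jEq s t], concl := jConv θ s t },
    { prems := [jConv θ s t, jRed θ t u], concl := jConv θ s u },
    { prems := [jConv θ s t, jRed θ u t], concl := jConv θ s u } ]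

def clauses : List Clause :=
  typeClauses ++ ruleClauses ++ farcClauses ++ eqClauses ++ stepClauses ++ redClauses

def conj (φs : List Fml) : Fml := φs.foldr .and (.eq .zero .zero)

def disj (φs : List Fml) : Fml := φs.foldr .or (.neg (.eq .zero .zero))

/-- `vY` is the conclusion of an instance of `c` whose premisses occur in the sequence coded by
`vA`, `vB`: before position `vI` or, if `c` is circular, up to position `vN`. -/
def Clause.applies (c : Clause) : Fml :=
  (List.range 30).foldr Fml.ex
    (.and (.eq vY c.concl) (.and c.side (conj (c.prems.map fun p =>
      .ex vJ (.and (.lt vJ (if c.circular then .add vN .one else (vI : Tm)))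
        (beta vA vB vJ p))))))

/-- `vX` is the last entry, at position `vN`, of a derivation coded by `vA`, `vB`. -/
def derivable : Fml :=
  .ex vA (.ex vB (.ex vN (.and (beta vA vB vN vX)
    (.all vI (.imp (.lt vI (.add vN .one)) (.all vY (.imp (beta vA vB vI vY)
      (disj (clauses.map Clause.applies)))))))))

/-- The judgment `p`, a term in the variables of clauses, is derivable. -/
def holds (p : Tm) : Fml := .ex vX (.and (.eq vX p) derivable)

/-- `s` is normal, as a farc of type `θ`. -/
def normal (s : Tm) : Fml := .all w (.neg (holds (jRed θ s w)))

/-- Universal quantification over number variables. -/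
def alls (ns : List ℕ) (φ : Fml) : Fml := ns.foldr Fml.all φ

/-- If a farc `t` of type `θ` reduces to `u` and to `v`, then `u` and `v` reduce to some farc `t'`
of type `θ`. -/
def churchRosser : Fml :=
  alls [θ, t, u, v] (.imp (conj [holds (jFarc t θ), holds (jReds θ t u), holds (jReds θ t v)])
    (.ex t' (conj [holds (jFarc t' θ), holds (jReds θ u t'), holds (jReds θ v t')])))

/-- Farcs `s`, `t` of type `θ` are convertible if and only if they have a common reduct. -/
def peaksAndValleys : Fml :=
  alls [θ, s, t] (.imp (conj [holds (jFarc s θ), holds (jFarc t θ)])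
    (.and
      (.imp (holds (jConv θ s t)) (.ex u (conj [holds (jReds θ s u), holds (jReds θ t u)])))
      (.imp (.ex u (conj [holds (jReds θ s u), holds (jReds θ t u)])) (holds (jConv θ s t)))))

/-- Normal forms of a farc `t` of type `θ` under reduction are equal. -/
def uniqueNormalReds : Fml :=
  alls [θ, t, u, v] (.imp
    (conj [holds (jFarc t θ), normal u, normal v, holds (jReds θ t u), holds (jReds θ t v)])
    (holds (jEq u v)))

/-- Normal farcs of type `θ` that are convertible to the same farc are equal. -/
def uniqueNormalConv : Fml :=
  alls [θ, t, u, v] (.imp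
    (conj [holds (jFarc t θ), normal u, normal v, holds (jConv θ u t), holds (jConv θ t v)])
    (holds (jEq u v)))

end Arith

end CT

/-! The proof follows Tait and Martin-Löf. One-step reduction is enclosed in a parallel reduction
`Par`, which lies between one step and finitely many steps and has the diamond property; confluence,
the description of conversion by common reducts and the uniqueness of normal forms are consequences.
A coterm may have infinitely many redexes, so there is no complete development to aim at. But a
parallel reduction has a finite derivation, and the diamond is proved by induction on it. `Par` is
given in the form of superdevelopments: an application may be contracted after its two components
have been reduced. Two facts carry the argument. A constant with too few arguments for a redex keeps
its shape under `Par` (`Par.apps_const_inv`); in particular `0` and `s y` are stable. And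
contraction commutes with reduction of the arguments (`Contr.par`), because the rules are
left-linear and do not overlap. That reducts of farcs are farcs is subject reduction: the premisses
of a regular coderivation are again regular coderivations, so every farc can be taken apart like a
finite application.

For provability in `RCA₀` the same argument is carried out inside an arbitrary model, on numbers
that code presentations. The numbers form an ordered semiring, and `Σ⁰₁` induction yields
collection, Gödel's `β` lemma and bounded `Σ⁰₁` comprehension. Definability is tracked semantically
by the classes `Sg` and `Fn`, whose instances reconstruct the formulas. Derivability `Der` is `Σ⁰₁`,
admits inversion and induction, and for circular clauses a principle of coinduction
(`Der.coinduct`), from which bisimilarity `jEq` is seen to be symmetric, transitive and, on typed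
presentations, reflexive. Lists of arguments may have nonstandard length, so redexes are described
by coded sequences (`Ctr`) and everything is done up to `jEq`.

What remains delicate is the complexity of the induction statements. The diamond for equal but
differently presented coterms has a `Σ⁰₁` hypothesis and a `Σ⁰₁` conclusion, which is not a `Σ⁰₁`
statement. Only the finitely many numbers occurring in two given derivations matter, however, and on
these bounded comprehension makes the hypothesis `Δ⁰₁`, so that `Σ⁰₁` induction applies
(`Pr.diamond`, `jStep.pr`). -/

namespace CT

/-! ## Coterms: constructors, spines -/

/-- The label at the root. -/
def rootLabel (t : Coterm) : Label := (PFunctor.M.dest t).1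

@[simp] theorem rootLabel_var (σ : Ty) (n : ℕ) : rootLabel (var σ n) = .var σ n :=
  congrArg Sigma.fst (PFunctor.M.dest_mk _)

@[simp] theorem rootLabel_const (r : Const) : rootLabel (const r) = .const r :=
  congrArg Sigma.fst (PFunctor.M.dest_mk _)

@[simp] theorem rootLabel_app (s t : Coterm) : rootLabel (app s t) = .app :=
  congrArg Sigma.fst (PFunctor.M.dest_mk _)

theorem app_inj {s t s' t' : Coterm} : app s t = app s' t' ↔ s = s' ∧ t = t' := by
  constructor
  · intro h
    have h1 := (PFunctor.M.dest_mk (F := coF) ⟨Label.app, fun b : Bool => if b = true then s else t⟩).symm.trans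
      ((congrArg PFunctor.M.dest h).trans
        (PFunctor.M.dest_mk (F := coF) ⟨Label.app, fun b : Bool => if b = true then s' else t'⟩))
    have h2 := eq_of_heq (Sigma.mk.inj h1).2
    exact ⟨by simpa using congrFun h2 true, by simpa using congrFun h2 false⟩
  · rintro ⟨rfl, rfl⟩; rfl

theorem const_inj {r r' : Const} : const r = const r' ↔ r = r' := by
  constructor
  · intro h
    simpa using congrArg rootLabel h
  · rintro rfl; rfl

theorem app_ne_const {s t : Coterm} {r : Const} : app s t ≠ const r := by
  intro h
  simpa using congrArg rootLabel h

theorem apps_append (h : Coterm) (xs ys : List Coterm) :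
    apps h (xs ++ ys) = apps (apps h xs) ys := List.foldl_append

theorem apps_snoc (h : Coterm) (xs : List Coterm) (x : Coterm) :
    apps h (xs ++ [x]) = app (apps h xs) x := by rw [apps_append]; rfl

/-- Spines are compared from the right, one argument at a time, until the constant at the head is
reached. Hence the constant and the arguments of a redex can be read off. -/
theorem apps_const_inj {r r' : Const} {xs ys : List Coterm}
    (h : apps (const r) xs = apps (const r') ys) : r = r' ∧ xs = ys := by
  induction xs using List.reverseRecOn generalizing ys with
  | nil =>
    rcases List.eq_nil_or_concat ys with rfl | ⟨zs, z, rfl⟩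
    · exact ⟨const_inj.1 h, rfl⟩
    · rw [List.concat_eq_append, apps_snoc] at h
      exact (app_ne_const h.symm).elim
  | append_singleton xs x ih =>
    rcases List.eq_nil_or_concat ys with rfl | ⟨zs, z, rfl⟩
    · rw [apps_snoc] at h
      exact (app_ne_const h).elim
    · rw [List.concat_eq_append, apps_snoc, apps_snoc, app_inj] at h
      obtain ⟨rfl, rfl⟩ := ih h.1
      simp [h.2]

theorem app_eq_apps_const {s t : Coterm} {r : Const} {xs : List Coterm}
    (h : app s t = apps (const r) xs) :
    ∃ ys, xs = ys ++ [t] ∧ s = apps (const r) ys := by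
  rcases List.eq_nil_or_concat xs with rfl | ⟨zs, z, rfl⟩
  · exact (app_ne_const h).elim
  · rw [List.concat_eq_append, apps_snoc, app_inj] at h
    exact ⟨zs, by simp [h.2], h.1⟩

/-! ## Contraction at the root -/

/-- `Contr r xs w`: the redex consisting of the constant `r` and the arguments `xs` contracts
to `w`. -/
inductive Contr : Const → List Coterm → Coterm → Prop
  | id (σ : Ty) (x : Coterm) : Contr (.id σ) [x] x
  | ex (Γ : List Ty) (ρ σ : Ty) (Δ : List Ty) (τ : Ty) (t x y : Coterm) (xs ys : List Coterm)
      (hx : xs.length = Γ.length) (hy : ys.length = Δ.length) :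
      Contr (.ex Γ ρ σ Δ τ) ([t] ++ xs ++ [x, y] ++ ys) (apps t (xs ++ [y, x] ++ ys))
  | wk (Γ : List Ty) (σ τ : Ty) (t x : Coterm) (xs : List Coterm) (hx : xs.length = Γ.length) :
      Contr (.wk Γ σ τ) ([t] ++ xs ++ [x]) (apps t xs)
  | cntr (Γ : List Ty) (σ τ : Ty) (t x : Coterm) (xs : List Coterm)
      (hx : xs.length = Γ.length) :
      Contr (.cntr Γ σ τ) ([t] ++ xs ++ [x]) (apps t (xs ++ [x, x]))
  | cut (Γ : List Ty) (σ τ : Ty) (s t : Coterm) (xs : List Coterm)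
      (hx : xs.length = Γ.length) :
      Contr (.cut Γ σ τ) ([s, t] ++ xs) (apps t (xs ++ [apps s xs]))
  | L (Γ : List Ty) (ρ σ τ : Ty) (s t y : Coterm) (xs : List Coterm)
      (hx : xs.length = Γ.length) :
      Contr (.L Γ ρ σ τ) ([s, t] ++ xs ++ [y]) (apps t (xs ++ [app y (apps s xs)]))
  | R (Γ : List Ty) (σ τ : Ty) (t x : Coterm) (xs : List Coterm) (hx : xs.length = Γ.length) :
      Contr (.R Γ σ τ) ([t] ++ xs ++ [x]) (apps t (xs ++ [x]))
  | recr_zero (Γ : List Ty) (τ : Ty) (s t : Coterm) (xs : List Coterm)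
      (hx : xs.length = Γ.length) :
      Contr (.recr Γ τ) ([s, t] ++ xs ++ [const .zero]) (apps s xs)
  | recr_succ (Γ : List Ty) (τ : Ty) (s t y : Coterm) (xs : List Coterm)
      (hx : xs.length = Γ.length) :
      Contr (.recr Γ τ) ([s, t] ++ xs ++ [app (const .succ) y])
        (apps t (xs ++ [y, apps (const (.recr Γ τ)) ([s, t] ++ xs ++ [y])]))
  | cond_zero (Γ : List Ty) (τ : Ty) (s t : Coterm) (xs : List Coterm)
      (hx : xs.length = Γ.length) :
      Contr (.cond Γ τ) ([s, t] ++ xs ++ [const .zero]) (apps s xs)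
  | cond_succ (Γ : List Ty) (τ : Ty) (s t y : Coterm) (xs : List Coterm)
      (hx : xs.length = Γ.length) :
      Contr (.cond Γ τ) ([s, t] ++ xs ++ [app (const .succ) y]) (apps t (xs ++ [y]))

/-- The number of arguments of a redex headed by a given constant; for `zero` and `succ`, which
head no redex, a bound exceeding the number of their arguments. -/
def Const.redexArity : Const → ℕ
  | .ex Γ _ _ Δ _ => Γ.length + Δ.length + 3
  | .wk Γ _ _ => Γ.length + 2
  | .cntr Γ _ _ => Γ.length + 2
  | .cut Γ _ _ => Γ.length + 2
  | .id _ => 1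
  | .L Γ _ _ _ => Γ.length + 3
  | .R Γ _ _ => Γ.length + 2
  | .zero => 2
  | .succ => 2
  | .recr Γ _ => Γ.length + 3
  | .cond Γ _ => Γ.length + 3

theorem Contr.length {r : Const} {xs : List Coterm} {w : Coterm} (h : Contr r xs w) :
    xs.length = r.redexArity := by
  cases h <;> simp [Const.redexArity] <;> omega

theorem Contr.red {r : Const} {xs : List Coterm} {w : Coterm} (h : Contr r xs w) :
    Red (apps (const r) xs) w := by
  cases h
  · exact Red.id _ _
  · exact Red.ex _ _ _ _ _ _ _ _ _ _ ‹_› ‹_›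
  · exact Red.wk _ _ _ _ _ _ ‹_›
  · exact Red.cntr _ _ _ _ _ _ ‹_›
  · exact Red.cut _ _ _ _ _ _ ‹_›
  · exact Red.L _ _ _ _ _ _ _ _ ‹_›
  · exact Red.R _ _ _ _ _ _ ‹_›
  · exact Red.recr_zero _ _ _ _ _ ‹_›
  · exact Red.recr_succ _ _ _ _ _ _ ‹_›
  · exact Red.cond_zero _ _ _ _ _ ‹_›
  · exact Red.cond_succ _ _ _ _ _ _ ‹_›

/-- Gathers the eleven contraction rules into one case, so that inductions on one-step reduction
have three cases only. -/
theorem Red.induction_contr {P : Coterm → Coterm → Prop}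
    (contr : ∀ r xs w, Contr r xs w → P (apps (const r) xs) w)
    (left : ∀ s s' t, Red s s' → P s s' → P (app s t) (app s' t))
    (right : ∀ s t t', Red t t' → P t t' → P (app s t) (app s t'))
    {t t' : Coterm} (h : Red t t') : P t t' := by
  induction h with
  | id => exact contr _ _ _ (.id _ _)
  | ex _ _ _ _ _ _ _ _ _ _ hx hy => exact contr _ _ _ (.ex _ _ _ _ _ _ _ _ _ _ hx hy)
  | wk _ _ _ _ _ _ hx => exact contr _ _ _ (.wk _ _ _ _ _ _ hx)
  | cntr _ _ _ _ _ _ hx => exact contr _ _ _ (.cntr _ _ _ _ _ _ hx)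
  | cut _ _ _ _ _ _ hx => exact contr _ _ _ (.cut _ _ _ _ _ _ hx)
  | L _ _ _ _ _ _ _ _ hx => exact contr _ _ _ (.L _ _ _ _ _ _ _ _ hx)
  | R _ _ _ _ _ _ hx => exact contr _ _ _ (.R _ _ _ _ _ _ hx)
  | recr_zero _ _ _ _ _ hx => exact contr _ _ _ (.recr_zero _ _ _ _ _ hx)
  | recr_succ _ _ _ _ _ _ hx => exact contr _ _ _ (.recr_succ _ _ _ _ _ _ hx)
  | cond_zero _ _ _ _ _ hx => exact contr _ _ _ (.cond_zero _ _ _ _ _ hx)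
  | cond_succ _ _ _ _ _ _ hx => exact contr _ _ _ (.cond_succ _ _ _ _ _ _ hx)
  | left _ h ih => exact left _ _ _ h ih
  | right _ h ih => exact right _ _ _ h ih

/-! ## Parallel reduction -/

/-- Parallel reduction, in the form of superdevelopments: a redex that arises when the immediate
subterms have been reduced may be contracted. -/
inductive Par : Coterm → Coterm → Prop
  | refl (t : Coterm) : Par t t
  | app {s s' t t' : Coterm} : Par s s' → Par t t' → Par (app s t) (app s' t')
  | root {s s' t t' w : Coterm} {r : Const} {xs : List Coterm} : Par s s' → Par t t' →
      app s' t' = apps (const r) xs → Contr r xs w → Par (app s t) w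

theorem Par.apps {s s' : Coterm} {xs ys : List Coterm} (h : Par s s')
    (hx : List.Forall₂ Par xs ys) : Par (apps s xs) (apps s' ys) := by
  induction hx generalizing s s' with
  | nil => exact h
  | cons h1 _ ih => exact ih (h.app h1)

theorem Par.const_inv {r : Const} {t : Coterm} (h : Par (const r) t) : t = const r := by
  generalize hs : const r = s at h
  cases h with
  | refl => rfl
  | app => exact (app_ne_const hs.symm).elim
  | root => exact (app_ne_const hs.symm).elim

theorem forall₂_par_refl (xs : List Coterm) : List.Forall₂ Par xs xs :=
  List.forall₂_same.2 fun x _ => .refl x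

theorem forall₂_append_iff {α β : Type*} {R : α → β → Prop} {l₁ l₂ : List α} {m₁ m₂ : List β}
    (h : l₁.length = m₁.length) :
    List.Forall₂ R (l₁ ++ l₂) (m₁ ++ m₂) ↔ List.Forall₂ R l₁ m₁ ∧ List.Forall₂ R l₂ m₂ := by
  induction l₁ generalizing m₁ with
  | nil => cases m₁ <;> simp_all
  | cons a l ih =>
    cases m₁ with
    | nil => simp at h
    | cons b m => simp [ih (by simpa using h), and_assoc]

theorem forall₂_append_left {α β : Type*} {R : α → β → Prop} {l₁ l₂ : List α} {m : List β}
    (h : List.Forall₂ R (l₁ ++ l₂) m) :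
    ∃ m₁ m₂, m = m₁ ++ m₂ ∧ List.Forall₂ R l₁ m₁ ∧ List.Forall₂ R l₂ m₂ :=
  ⟨_, _, (List.take_append_drop l₁.length m).symm, by
    refine (forall₂_append_iff ?_).1 ((List.take_append_drop l₁.length m).symm ▸ h)
    simp [← h.length_eq]⟩

theorem forall₂_singleton_left {α β : Type*} {R : α → β → Prop} {a : α} {m : List β}
    (h : List.Forall₂ R [a] m) : ∃ b, m = [b] ∧ R a b := by
  cases h with
  | cons h1 h2 => cases h2; exact ⟨_, rfl, h1⟩

theorem forall₂_pair_left {α β : Type*} {R : α → β → Prop} {a a' : α} {m : List β}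
    (h : List.Forall₂ R [a, a'] m) : ∃ b b', m = [b, b'] ∧ R a b ∧ R a' b' := by
  cases h with
  | cons h1 h2 => obtain ⟨b', rfl, h'⟩ := forall₂_singleton_left h2; exact ⟨_, _, rfl, h1, h'⟩

/-- Reducing arguments does not change their number, so a spine that is too short never becomes a
redex and the `root` rule cannot apply: it would need `redexArity` arguments. -/
theorem Par.apps_const_inv {r : Const} {xs : List Coterm} {w : Coterm}
    (h : Par (CT.apps (const r) xs) w) (hr : xs.length < r.redexArity) :
    ∃ ys, w = CT.apps (const r) ys ∧ List.Forall₂ Par xs ys := by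
  induction xs using List.reverseRecOn generalizing w with
  | nil => exact ⟨[], h.const_inv, .nil⟩
  | append_singleton xs x ih =>
    rw [apps_snoc] at h
    simp only [List.length_append, List.length_cons, List.length_nil, zero_add] at hr
    generalize hs : CT.app (CT.apps (const r) xs) x = s at h
    cases h with
    | refl => exact ⟨xs ++ [x], by rw [apps_snoc, hs], forall₂_par_refl _⟩
    | app h1 h2 =>
      obtain ⟨rfl, rfl⟩ := app_inj.1 hs
      obtain ⟨ys, rfl, hys⟩ := ih h1 (by omega)
      exact ⟨ys ++ [_], by rw [apps_snoc],
        (forall₂_append_iff hys.length_eq).2 ⟨hys, .cons h2 .nil⟩⟩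
    | root h1 h2 he hc =>
      obtain ⟨rfl, rfl⟩ := app_inj.1 hs
      obtain ⟨ys, rfl, hys⟩ := ih h1 (by omega)
      rw [← apps_snoc] at he
      obtain ⟨rfl, rfl⟩ := apps_const_inj he
      have := hc.length
      have := hys.length_eq
      simp at *
      omega

theorem Par.zero_inv {t : Coterm} (h : Par (CT.const .zero) t) : t = CT.const .zero := h.const_inv

theorem Par.succ_inv {y t : Coterm} (h : Par (CT.app (const .succ) y) t) :
    ∃ y', t = CT.app (const .succ) y' ∧ Par y y' := by
  obtain ⟨ys, rfl, hys⟩ := Par.apps_const_inv (r := .succ) (xs := [y]) h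
    (by simp [Const.redexArity])
  obtain ⟨y', rfl, hy⟩ := forall₂_singleton_left hys
  exact ⟨y', rfl, hy⟩

/-- The pattern of a redex consists of a constant, a number of arguments and possibly `0` or `s y`
in the last place. All of this survives parallel reduction of the arguments, and the contractum is
an application of the same arguments, so it reduces along with them. -/
theorem Contr.par {r : Const} {xs ys : List Coterm} {w : Coterm} (h : Contr r xs w)
    (hp : List.Forall₂ Par xs ys) : ∃ w', Contr r ys w' ∧ Par w w' := by
  have app2 {l l' m m' : List Coterm} (h : List.Forall₂ Par l l') (h' : List.Forall₂ Par m m') :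
      List.Forall₂ Par (l ++ m) (l' ++ m') := (forall₂_append_iff h.length_eq).2 ⟨h, h'⟩
  have one {x x' : Coterm} (h : Par x x') : List.Forall₂ Par [x] [x'] := .cons h .nil
  have two {x x' y y' : Coterm} (h : Par x x') (h' : Par y y') :
      List.Forall₂ Par [x, y] [x', y'] := .cons h (.cons h' .nil)
  cases h with
  | id =>
    obtain ⟨x', rfl, hx⟩ := forall₂_singleton_left hp
    exact ⟨x', .id _ _, hx⟩
  | ex _ _ _ _ _ t x y xs ys hx hy =>
    obtain ⟨m, ys', rfl, h1, hys⟩ := forall₂_append_left hp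
    obtain ⟨m, n, rfl, h2, hn⟩ := forall₂_append_left h1
    obtain ⟨m, xs', rfl, h3, hxs⟩ := forall₂_append_left h2
    obtain ⟨x', y', rfl, hx', hy'⟩ := forall₂_pair_left hn
    obtain ⟨t', rfl, ht⟩ := forall₂_singleton_left h3
    exact ⟨_, .ex _ _ _ _ _ _ _ _ _ _ (hxs.length_eq ▸ hx) (hys.length_eq ▸ hy),
      ht.apps (app2 (app2 hxs (two hy' hx')) hys)⟩
  | wk _ _ _ t x xs hx =>
    obtain ⟨m, n, rfl, h, hn⟩ := forall₂_append_left hp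
    obtain ⟨x', rfl, hx'⟩ := forall₂_singleton_left hn
    obtain ⟨m, xs', rfl, h, hxs⟩ := forall₂_append_left h
    obtain ⟨t', rfl, ht⟩ := forall₂_singleton_left h
    exact ⟨_, .wk _ _ _ _ _ _ (hxs.length_eq ▸ hx), ht.apps hxs⟩
  | cntr _ _ _ t x xs hx =>
    obtain ⟨m, n, rfl, h, hn⟩ := forall₂_append_left hp
    obtain ⟨x', rfl, hx'⟩ := forall₂_singleton_left hn
    obtain ⟨m, xs', rfl, h, hxs⟩ := forall₂_append_left h
    obtain ⟨t', rfl, ht⟩ := forall₂_singleton_left h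
    exact ⟨_, .cntr _ _ _ _ _ _ (hxs.length_eq ▸ hx), ht.apps (app2 hxs (two hx' hx'))⟩
  | cut _ _ _ s t xs hx =>
    obtain ⟨m, xs', rfl, h, hxs⟩ := forall₂_append_left hp
    obtain ⟨s', t', rfl, hs, ht⟩ := forall₂_pair_left h
    exact ⟨_, .cut _ _ _ _ _ _ (hxs.length_eq ▸ hx), ht.apps (app2 hxs (one (hs.apps hxs)))⟩
  | L _ _ _ _ s t y xs hx =>
    obtain ⟨m, n, rfl, h, hn⟩ := forall₂_append_left hp
    obtain ⟨y', rfl, hy'⟩ := forall₂_singleton_left hn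
    obtain ⟨m, xs', rfl, h, hxs⟩ := forall₂_append_left h
    obtain ⟨s', t', rfl, hs, ht⟩ := forall₂_pair_left h
    exact ⟨_, .L _ _ _ _ _ _ _ _ (hxs.length_eq ▸ hx),
      ht.apps (app2 hxs (one (hy'.app (hs.apps hxs))))⟩
  | R _ _ _ t x xs hx =>
    obtain ⟨m, n, rfl, h, hn⟩ := forall₂_append_left hp
    obtain ⟨x', rfl, hx'⟩ := forall₂_singleton_left hn
    obtain ⟨m, xs', rfl, h, hxs⟩ := forall₂_append_left h
    obtain ⟨t', rfl, ht⟩ := forall₂_singleton_left h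
    exact ⟨_, .R _ _ _ _ _ _ (hxs.length_eq ▸ hx), ht.apps (app2 hxs (one hx'))⟩
  | recr_zero _ _ s t xs hx =>
    obtain ⟨m, n, rfl, h, hn⟩ := forall₂_append_left hp
    obtain ⟨z, rfl, hz⟩ := forall₂_singleton_left hn
    obtain rfl := hz.zero_inv
    obtain ⟨m, xs', rfl, h, hxs⟩ := forall₂_append_left h
    obtain ⟨s', t', rfl, hs, ht⟩ := forall₂_pair_left h
    exact ⟨_, .recr_zero _ _ _ _ _ (hxs.length_eq ▸ hx), hs.apps hxs⟩
  | recr_succ _ _ s t y xs hx =>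
    obtain ⟨m, n, rfl, h, hn⟩ := forall₂_append_left hp
    obtain ⟨z, rfl, hz⟩ := forall₂_singleton_left hn
    obtain ⟨y', rfl, hy⟩ := hz.succ_inv
    obtain ⟨m, xs', rfl, h, hxs⟩ := forall₂_append_left h
    obtain ⟨s', t', rfl, hs, ht⟩ := forall₂_pair_left h
    -- The contractum contains the arguments twice, once below a new recursor; both copies are
    -- reduced in the same way.
    exact ⟨_, .recr_succ _ _ _ _ _ _ (hxs.length_eq ▸ hx), ht.apps (app2 hxs (two hy
      ((Par.refl _).apps (app2 (app2 (two hs ht) hxs) (one hy)))))⟩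
  | cond_zero _ _ s t xs hx =>
    obtain ⟨m, n, rfl, h, hn⟩ := forall₂_append_left hp
    obtain ⟨z, rfl, hz⟩ := forall₂_singleton_left hn
    obtain rfl := hz.zero_inv
    obtain ⟨m, xs', rfl, h, hxs⟩ := forall₂_append_left h
    obtain ⟨s', t', rfl, hs, ht⟩ := forall₂_pair_left h
    exact ⟨_, .cond_zero _ _ _ _ _ (hxs.length_eq ▸ hx), hs.apps hxs⟩
  | cond_succ _ _ s t y xs hx =>
    obtain ⟨m, n, rfl, h, hn⟩ := forall₂_append_left hp
    obtain ⟨z, rfl, hz⟩ := forall₂_singleton_left hn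
    obtain ⟨y', rfl, hy⟩ := hz.succ_inv
    obtain ⟨m, xs', rfl, h, hxs⟩ := forall₂_append_left h
    obtain ⟨s', t', rfl, hs, ht⟩ := forall₂_pair_left h
    exact ⟨_, .cond_succ _ _ _ _ _ _ (hxs.length_eq ▸ hx), ht.apps (app2 hxs (one hy))⟩

theorem append_singleton_inj' {l m : List Coterm} {x y : Coterm} (h : l ++ [x] = m ++ [y]) :
    l = m ∧ x = y := by simpa using List.append_inj' h rfl

/-- The constant selects the rule. Only `recr` and `cond` have two rules, told apart by the last
argument, which is a constant in one and an application in the other. -/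
theorem Contr.functional {r : Const} {xs : List Coterm} {w w' : Coterm} (h : Contr r xs w)
    (h' : Contr r xs w') : w = w' := by
  generalize hz : xs = zs at h'
  cases h
  case id => cases h'; simp_all
  case ex hx hy =>
    cases h' with
    | ex _ _ _ _ _ t x y xs ys hx' hy' =>
      obtain ⟨h1, rfl⟩ := List.append_inj' hz (by omega)
      obtain ⟨h1, h2⟩ := List.append_inj' h1 rfl
      simp_all
  case wk hx =>
    cases h'
    obtain ⟨h1, rfl⟩ := append_singleton_inj' hz
    simp_all
  case cntr hx =>
    cases h'
    obtain ⟨h1, rfl⟩ := append_singleton_inj' hz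
    simp_all
  case cut hx => cases h'; simp_all
  case L hx =>
    cases h'
    obtain ⟨h1, rfl⟩ := append_singleton_inj' hz
    simp_all
  case R hx =>
    cases h'
    obtain ⟨h1, rfl⟩ := append_singleton_inj' hz
    simp_all
  all_goals
    cases h' <;> obtain ⟨h1, h2⟩ := append_singleton_inj' hz <;>
      first
        | (exact (app_ne_const h2).elim)
        | (exact (app_ne_const h2.symm).elim)
        | (simp_all [app_inj])

/-- The function part of a redex is one argument short of the redex arity, so it keeps its head and
the whole application is still a redex after its components have been reduced. -/
theorem Par.app_contr {s s' t t' w : Coterm} {r : Const} {xs : List Coterm} (hs : Par s s')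
    (ht : Par t t') (he : CT.app s t = CT.apps (const r) xs) (hc : Contr r xs w) :
    ∃ ys w', CT.app s' t' = CT.apps (const r) ys ∧ Contr r ys w' ∧ Par w w' := by
  obtain ⟨zs, rfl, rfl⟩ := app_eq_apps_const he
  obtain ⟨ys, rfl, hys⟩ := hs.apps_const_inv (by rw [← hc.length]; simp)
  obtain ⟨w', hw', hp⟩ := hc.par ((forall₂_append_iff hys.length_eq).2 ⟨hys, .cons ht .nil⟩)
  exact ⟨_, w', (apps_snoc _ _ _).symm, hw', hp⟩

/-- The components are joined by the induction hypotheses. A contraction on one side is matched on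
the other by the `root` rule, which contracts after the components have been reduced to their common
reducts; this is why the rule has the form of a superdevelopment. If both sides contract, the joined
components form one redex, whose contractum is unique. -/
theorem Par.diamond {s t u : Coterm} (h : Par s t) (h' : Par s u) : ∃ v, Par t v ∧ Par u v := by
  induction h generalizing u with
  | refl t => exact ⟨u, h', .refl u⟩
  | app h1 h2 ih1 ih2 =>
    generalize hs : CT.app _ _ = s at h'
    cases h' with
    | refl => subst hs; exact ⟨_, .refl _, .app h1 h2⟩
    | app h1' h2' =>
      obtain ⟨rfl, rfl⟩ := app_inj.1 hs
      obtain ⟨v1, a1, b1⟩ := ih1 h1'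
      obtain ⟨v2, a2, b2⟩ := ih2 h2'
      exact ⟨_, a1.app a2, b1.app b2⟩
    | root h1' h2' he hc =>
      obtain ⟨rfl, rfl⟩ := app_inj.1 hs
      obtain ⟨v1, a1, b1⟩ := ih1 h1'
      obtain ⟨v2, a2, b2⟩ := ih2 h2'
      obtain ⟨ys, w', he', hc', hp⟩ := b1.app_contr b2 he hc
      exact ⟨w', .root a1 a2 he' hc', hp⟩
  | root h1 h2 he hc ih1 ih2 =>
    generalize hs : CT.app _ _ = s at h'
    cases h' with
    | refl => subst hs; exact ⟨_, .refl _, .root h1 h2 he hc⟩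
    | app h1' h2' =>
      obtain ⟨rfl, rfl⟩ := app_inj.1 hs
      obtain ⟨v1, a1, b1⟩ := ih1 h1'
      obtain ⟨v2, a2, b2⟩ := ih2 h2'
      obtain ⟨ys, w', he', hc', hp⟩ := a1.app_contr a2 he hc
      exact ⟨w', hp, .root b1 b2 he' hc'⟩
    | root h1' h2' he2 hc2 =>
      obtain ⟨rfl, rfl⟩ := app_inj.1 hs
      obtain ⟨v1, a1, b1⟩ := ih1 h1'
      obtain ⟨v2, a2, b2⟩ := ih2 h2'
      obtain ⟨ys, w', he', hc', hp⟩ := a1.app_contr a2 he hc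
      obtain ⟨zs, w'', he'', hc'', hp'⟩ := b1.app_contr b2 he2 hc2
      obtain ⟨rfl, rfl⟩ := apps_const_inj (he'.symm.trans he'')
      exact ⟨w', hp, hc'.functional hc'' ▸ hp'⟩

theorem Red.par {t t' : Coterm} (h : Red t t') : Par t t' := by
  refine Red.induction_contr (P := Par) ?_ (fun _ _ _ _ ih => .app ih (.refl _))
    (fun _ _ _ _ ih => .app (.refl _) ih) h
  · intro r xs w h
    rcases List.eq_nil_or_concat xs with rfl | ⟨zs, z, rfl⟩
    -- No redex is a bare constant, since every redex arity is positive.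
    · have := h.length
      cases r <;> simp [Const.redexArity] at this
    · rw [List.concat_eq_append] at h ⊢
      exact (apps_snoc _ _ _).symm ▸ .root (.refl _) (.refl _) (apps_snoc _ _ _).symm h

theorem Reds.app {s s' t t' : Coterm} (hs : Reds s s') (ht : Reds t t') :
    Reds (app s t) (app s' t') :=
  .trans (Relation.ReflTransGen.lift (fun x => CT.app x t) (fun _ _ h => Red.left t h) _ _ hs)
    (Relation.ReflTransGen.lift (fun x => CT.app s' x) (fun _ _ h => Red.right s' h) _ _ ht)

theorem Par.reds {t t' : Coterm} (h : Par t t') : Reds t t' := by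
  induction h with
  | refl => exact .refl
  | app _ _ ih1 ih2 => exact ih1.app ih2
  | root _ _ he hc ih1 ih2 => exact (ih1.app ih2).tail (he ▸ hc.red)

theorem Reds.confluent {t t₀ t₁ : Coterm} (h₀ : Reds t t₀) (h₁ : Reds t t₁) :
    ∃ t', Reds t₀ t' ∧ Reds t₁ t' := by
  have toPar {a b : Coterm} (h : Reds a b) : Relation.ReflTransGen Par a b :=
    Relation.ReflTransGen.mono (fun _ _ => Red.par) _ _ h
  have ofPar {a b : Coterm} (h : Relation.ReflTransGen Par a b) : Reds a b := by
    induction h with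
    | refl => exact .refl
    | tail _ h ih => exact ih.trans h.reds
  obtain ⟨t', h, h'⟩ := Relation.church_rosser (r := Par)
    (fun a b c hb hc => let ⟨d, h1, h2⟩ := Par.diamond hb hc; ⟨d, .single h1, .single h2⟩)
    (toPar h₀) (toPar h₁)
  exact ⟨t', ofPar h, ofPar h'⟩

theorem Reds.conv {s t : Coterm} (h : Reds s t) : Conv s t := by
  induction h with
  | refl => exact .refl _
  | tail _ h ih => exact .trans _ _ _ ih (.rel _ _ h)

theorem conv_iff {s t : Coterm} : Conv s t ↔ ∃ r, Reds s r ∧ Reds t r := by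
  constructor
  · intro h
    induction h with
    | rel a b h => exact ⟨b, .single h, .refl⟩
    | refl a => exact ⟨a, .refl, .refl⟩
    | symm a b _ ih => exact ih.imp fun r h => h.symm
    | trans a b c _ _ ih1 ih2 =>
      obtain ⟨r, h1, h2⟩ := ih1
      obtain ⟨r', h3, h4⟩ := ih2
      obtain ⟨v, h5, h6⟩ := h2.confluent h3
      exact ⟨v, h1.trans h5, h4.trans h6⟩
  · rintro ⟨r, h1, h2⟩
    exact .trans _ _ _ h1.conv (.symm _ _ h2.conv)

theorem Normal.eq_of_reds {s t : Coterm} (h : Normal s) (hr : Reds s t) : t = s := by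
  rcases Relation.ReflTransGen.cases_head hr with rfl | ⟨c, hc, -⟩
  · rfl
  · exact (h c hc).elim

/-! ## Subject reduction -/

theorem arrows_append (Γ Δ : List Ty) (τ : Ty) : arrows (Γ ++ Δ) τ = arrows Γ (arrows Δ τ) :=
  List.foldr_append

theorem arrows_inj {Γ Δ : List Ty} {τ τ' : Ty} (h : arrows Γ τ = arrows Δ τ')
    (hl : Γ.length = Δ.length) : Γ = Δ ∧ τ = τ' := by
  induction Γ generalizing Δ with
  | nil => cases Δ <;> simp_all [arrows]
  | cons a Γ ih =>
    cases Δ with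
    | nil => simp at hl
    | cons b Δ =>
      simp only [arrows, List.foldr_cons, Ty.arr.injEq] at h
      obtain ⟨rfl, rfl⟩ := ih h.2 (by simpa using hl)
      simp [h.1]

theorem Farc.apps {h : Coterm} {xs : List Coterm} {Γ : List Ty} {τ : Ty}
    (hh : Farc h (arrows Γ τ)) (hx : List.Forall₂ Farc xs Γ) : Farc (CT.apps h xs) τ := by
  induction hx generalizing h with
  | nil => exact hh
  | cons h1 _ ih => exact ih (hh.app h1)

theorem Regular.sub {t u : Coterm} (ht : Regular t) (h : Sub t u) : Regular u := by
  refine Set.Finite.subset ht fun v hv => ?_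
  induction hv with
  | refl => exact h
  | left _ ih => exact ih.left
  | right _ ih => exact ih.right

theorem Sub.apps_head {t h : Coterm} {xs : List Coterm} (hs : Sub t (apps h xs)) : Sub t h := by
  induction xs generalizing h with
  | nil => exact hs
  | cons x xs ih => exact (ih hs).left

theorem Sub.apps_arg {t h x : Coterm} {xs : List Coterm} (hs : Sub t (apps h xs)) (hx : x ∈ xs) :
    Sub t x := by
  induction xs generalizing h with
  | nil => simp at hx
  | cons y xs ih =>
    rcases List.mem_cons.1 hx with rfl | hx
    · exact (Sub.apps_head (xs := xs) hs).right
    · exact ih hs hx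

/-- One unfolding of a coderivation: its immediate sub-coderivations are coderivations by the same
invariant `P`, and regular because they are sub-coterms, hence they are farcs. -/
theorem IsCoderivation.farc_inv {t : Coterm} {S : Sequent} (h : IsCoderivation t S)
    (ht : Regular t) : ∃ (r : Const) (ts : List Coterm), t = apps (const r) ts ∧
      List.Forall₂ Farc ts (r.premisses.map Sequent.ty) ∧ r.conclusion = S := by
  obtain ⟨P, hP, hS⟩ := h
  obtain ⟨r, hr, hc, ts, hts, rfl⟩ := hP _ _ hS
  refine ⟨r, ts, rfl, ?_, hc⟩
  rw [List.forall₂_map_right_iff]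
  have hreg : ∀ x ∈ ts, Regular x := fun x hx => ht.sub (Sub.refl.apps_arg hx)
  generalize r.premisses = l at hts
  clear hS ht
  induction hts with
  | nil => exact .nil
  | cons h1 _ ih =>
    simp only [List.mem_cons, forall_eq_or_imp] at hreg
    exact .cons (.coder ⟨P, hP, h1⟩ hreg.1) (ih hreg.2)

/-- The case that matters is a coderivation that is itself an application. It is a rule constant
applied to farcs, and dropping the last of them leaves a well-typed application. -/
theorem Farc.app_inv {s t : Coterm} {τ : Ty} (h : Farc (CT.app s t) τ) :
    ∃ σ, Farc s (.arr σ τ) ∧ Farc t σ := by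
  generalize hu : CT.app s t = u at h
  cases h with
  | var =>
    simpa using congrArg rootLabel hu
  | const => exact (app_ne_const hu).elim
  | app h1 h2 => obtain ⟨rfl, rfl⟩ := app_inj.1 hu; exact ⟨_, h1, h2⟩
  | coder h hr =>
    obtain ⟨r, ts, rfl, hts, rfl⟩ := h.farc_inv hr
    obtain ⟨ys, rfl, rfl⟩ := app_eq_apps_const hu
    obtain ⟨Γ, Δ, he, h1, h2⟩ := forall₂_append_left hts
    obtain ⟨σ, rfl, h3⟩ := forall₂_singleton_left h2
    refine ⟨σ, Farc.apps (Γ := Γ) ?_ h1, h3⟩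
    have := Farc.const r
    rwa [Const.ty, he, arrows_append] at this

/-- A constant without premisses can also be typed as a coderivation; the two typings agree. -/
theorem Farc.const_inv {r : Const} {τ : Ty} (h : Farc (CT.const r) τ) : τ = r.ty := by
  generalize hu : CT.const r = u at h
  cases h with
  | var =>
    simpa using congrArg rootLabel hu
  | const => rw [const_inj.1 hu]
  | app => exact (app_ne_const hu.symm).elim
  | coder h hr =>
    obtain ⟨r', ts, rfl, hts, rfl⟩ := h.farc_inv hr
    obtain ⟨rfl, rfl⟩ := apps_const_inj (xs := []) hu
    simp only [List.forall₂_nil_left_iff, List.map_eq_nil_iff] at hts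
    simp [Const.ty, hts, arrows]

theorem Farc.apps_inv {h : Coterm} {xs : List Coterm} {τ : Ty} (hh : Farc (CT.apps h xs) τ) :
    ∃ Γ, Farc h (arrows Γ τ) ∧ List.Forall₂ Farc xs Γ := by
  induction xs generalizing h with
  | nil => exact ⟨[], hh, .nil⟩
  | cons x xs ih =>
    obtain ⟨Γ, h1, h2⟩ := ih hh
    obtain ⟨σ, h3, h4⟩ := h1.app_inv
    exact ⟨σ :: Γ, h3, .cons h4 h2⟩

theorem Contr.farc {r : Const} {xs : List Coterm} {w : Coterm} {τ : Ty} (h : Contr r xs w)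
    (ht : Farc (apps (const r) xs) τ) : Farc w τ := by
  obtain ⟨Θ, h1, h2⟩ := ht.apps_inv
  have h3 := h1.const_inv
  have hl := h2.length_eq
  -- The constant at the head has only one type. Once the number of arguments is known, it
  -- determines the types of the arguments and of the whole redex.
  have key : ∀ (Γ Δ : List Ty) (τ' : Ty), r.ty = arrows Γ (arrows Δ τ') →
      (Γ ++ Δ).length = xs.length → Θ = Γ ++ Δ ∧ τ = τ' := fun Γ Δ τ' h' hl' =>
    arrows_inj (by rw [h3, h', arrows_append]) (by rw [← hl, hl'])
  have app2 {l m : List Coterm} {l' m' : List Ty} (h : List.Forall₂ Farc l l')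
      (h' : List.Forall₂ Farc m m') : List.Forall₂ Farc (l ++ m) (l' ++ m') :=
    (forall₂_append_iff h.length_eq).2 ⟨h, h'⟩
  have one {x : Coterm} {σ : Ty} (h : Farc x σ) : List.Forall₂ Farc [x] [σ] := .cons h .nil
  have two {x y : Coterm} {σ ρ : Ty} (h : Farc x σ) (h' : Farc y ρ) :
      List.Forall₂ Farc [x, y] [σ, ρ] := .cons h (.cons h' .nil)
  have split1 {t x : Coterm} {l : List Coterm} {θ σ : Ty} {Γ : List Ty}
      (h : List.Forall₂ Farc ([t] ++ l ++ [x]) ([θ] ++ (Γ ++ [σ]))) (hl : l.length = Γ.length) :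
      Farc t θ ∧ List.Forall₂ Farc l Γ ∧ Farc x σ := by
    rw [← List.append_assoc, forall₂_append_iff (by simp [hl]), forall₂_append_iff (by simp)] at h
    simpa [and_assoc] using h
  have split2 {s t x : Coterm} {l : List Coterm} {θ θ' σ : Ty} {Γ : List Ty}
      (h : List.Forall₂ Farc ([s, t] ++ l ++ [x]) ([θ, θ'] ++ (Γ ++ [σ])))
      (hl : l.length = Γ.length) :
      Farc s θ ∧ Farc t θ' ∧ List.Forall₂ Farc l Γ ∧ Farc x σ := by
    rw [← List.append_assoc, forall₂_append_iff (by simp [hl]), forall₂_append_iff (by simp)] at h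
    simpa [and_assoc] using h
  have farc_succ {y : Coterm} (h : Farc (app (const .succ) y) .N) : Farc y .N := by
    obtain ⟨σ, h1, h2⟩ := h.app_inv
    have := h1.const_inv
    simp only [Const.ty, Const.premisses, Const.conclusion, Sequent.ty, arrows, List.foldr,
      List.map, Ty.arr.injEq, and_true] at this
    exact this ▸ h2
  cases h with
  | id σ x =>
    obtain ⟨rfl, rfl⟩ := key [] [σ] σ rfl rfl
    simpa using h2
  | ex Γ ρ σ Δ τ' t x y xs ys hx hy =>
    obtain ⟨rfl, rfl⟩ := key [_] (Γ ++ ρ :: σ :: Δ) τ' rfl (by simp; omega)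
    have h2' : List.Forall₂ Farc ([t] ++ xs ++ [x, y] ++ ys)
      ([arrows (Γ ++ σ :: ρ :: Δ) τ] ++ Γ ++ [ρ, σ] ++ Δ) := by simpa [Sequent.ty] using h2
    rw [forall₂_append_iff (by simp [hx]), forall₂_append_iff (by simp [hx]),
      forall₂_append_iff (by simp)] at h2'
    simp only [List.forall₂_cons, List.forall₂_nil_left_iff, and_true, and_assoc] at h2'
    obtain ⟨a1, a2, a3, a4, a5⟩ := h2'
    refine a1.apps ?_
    simpa using app2 a2 (app2 (two a4 a3) a5)
  | wk Γ σ τ' t x xs hx =>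
    obtain ⟨rfl, rfl⟩ := key [_] (Γ ++ [σ]) τ' rfl (by simp; omega)
    obtain ⟨a1, a2, a3⟩ := split1 h2 hx
    exact a1.apps a2
  | cntr Γ σ τ' t x xs hx =>
    obtain ⟨rfl, rfl⟩ := key [_] (Γ ++ [σ]) τ' rfl (by simp; omega)
    obtain ⟨a1, a2, a3⟩ := split1 h2 hx
    exact a1.apps (app2 a2 (two a3 a3))
  | cut Γ σ τ' s t xs hx =>
    obtain ⟨rfl, rfl⟩ := key [_, _] Γ τ' rfl (by simp; omega)
    rw [forall₂_append_iff (by simp)] at h2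
    obtain ⟨h2, a3⟩ := h2
    simp only [List.forall₂_cons, List.forall₂_nil_left_iff, and_true] at h2
    exact h2.2.apps (app2 a3 (one (h2.1.apps a3)))
  | L Γ ρ σ τ' s t y xs hx =>
    obtain ⟨rfl, rfl⟩ := key [_, _] (Γ ++ [.arr ρ σ]) τ' rfl (by simp; omega)
    obtain ⟨a1, a2, a3, a4⟩ := split2 h2 hx
    exact a2.apps (app2 a3 (one (a4.app (a1.apps a3))))
  | R Γ σ τ' t x xs hx =>
    -- The succedent of the conclusion is itself an arrow type; its domain is moved into the list to
    -- type the extra argument.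
    obtain ⟨rfl, rfl⟩ := key [_] (Γ ++ [σ]) τ' (by rw [arrows_append]; rfl) (by simp; omega)
    obtain ⟨a1, a2, a3⟩ := split1 h2 hx
    exact a1.apps (app2 a2 (one a3))
  | recr_zero Γ τ' s t xs hx =>
    obtain ⟨rfl, rfl⟩ := key [_, _] (Γ ++ [.N]) τ' rfl (by simp; omega)
    obtain ⟨a1, a2, a3, a4⟩ := split2 h2 hx
    exact a1.apps a3
  | recr_succ Γ τ' s t y xs hx =>
    obtain ⟨rfl, rfl⟩ := key [_, _] (Γ ++ [.N]) τ' rfl (by simp; omega)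
    obtain ⟨a1, a2, a3, a4⟩ := split2 h2 hx
    refine a2.apps (app2 a3 (two (farc_succ a4) (Farc.apps (Γ := _ ++ (Γ ++ [.N])) h1 ?_)))
    rw [← List.append_assoc]
    exact app2 (app2 (two a1 a2) a3) (one (farc_succ a4))
  | cond_zero Γ τ' s t xs hx =>
    obtain ⟨rfl, rfl⟩ := key [_, _] (Γ ++ [.N]) τ' rfl (by simp; omega)
    obtain ⟨a1, a2, a3, a4⟩ := split2 h2 hx
    exact a1.apps a3
  | cond_succ Γ τ' s t y xs hx =>
    obtain ⟨rfl, rfl⟩ := key [_, _] (Γ ++ [.N]) τ' rfl (by simp; omega)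
    obtain ⟨a1, a2, a3, a4⟩ := split2 h2 hx
    exact a2.apps (app2 a3 (one (farc_succ a4)))

theorem Farc.red {t t' : Coterm} {σ : Ty} (ht : Farc t σ) (h : Red t t') : Farc t' σ := by
  refine Red.induction_contr (P := fun t t' => ∀ σ, Farc t σ → Farc t' σ)
    (fun r xs w h σ ht => h.farc ht) (fun s s' t _ ih σ ht => ?_) (fun s t t' _ ih σ ht => ?_) h σ ht
  · obtain ⟨ρ, h1, h2⟩ := ht.app_inv; exact (ih _ h1).app h2
  · obtain ⟨ρ, h1, h2⟩ := ht.app_inv; exact h1.app (ih _ h2)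

theorem Farc.reds {t t' : Coterm} {σ : Ty} (ht : Farc t σ) (h : Reds t t') : Farc t' σ := by
  induction h with
  | refl => exact ht
  | tail _ h ih => exact ih.red h

/-! ## Renaming of number variables -/

def Tm.rename (g : ℕ → ℕ) : Tm → Tm
  | .var n => .var (g n)
  | .zero => .zero
  | .one => .one
  | .add s t => .add (s.rename g) (t.rename g)
  | .mul s t => .mul (s.rename g) (t.rename g)

def Fml.rename (g : ℕ → ℕ) : Fml → Fml
  | .eq s t => .eq (s.rename g) (t.rename g)
  | .lt s t => .lt (s.rename g) (t.rename g)
  | .mem t X => .mem (t.rename g) X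
  | .neg φ => .neg (φ.rename g)
  | .and φ ψ => .and (φ.rename g) (ψ.rename g)
  | .or φ ψ => .or (φ.rename g) (ψ.rename g)
  | .imp φ ψ => .imp (φ.rename g) (ψ.rename g)
  | .all n φ => .all (g n) (φ.rename g)
  | .ex n φ => .ex (g n) (φ.rename g)
  | .allSet X φ => .allSet X (φ.rename g)
  | .exSet X φ => .exSet X (φ.rename g)

theorem Tm.eval_rename (A : Structure2.{u}) (g : ℕ → ℕ) (e : ℕ → A.Num) (t : Tm) :
    (t.rename g).eval A e = t.eval A (e ∘ g) := by
  induction t <;> simp_all [Tm.rename, Tm.eval]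

theorem Tm.occurs_rename {g : ℕ → ℕ} {n : ℕ} {t : Tm} :
    (t.rename g).Occurs n ↔ ∃ m, g m = n ∧ t.Occurs m := by
  induction t with
  | var k => simp [Tm.rename, Tm.Occurs]
  | zero => simp [Tm.rename, Tm.Occurs]
  | one => simp [Tm.rename, Tm.Occurs]
  | add s t h1 h2 => simp only [Tm.rename, Tm.Occurs, h1, h2, and_or_left, exists_or]
  | mul s t h1 h2 => simp only [Tm.rename, Tm.Occurs, h1, h2, and_or_left, exists_or]

/-- Bound variables are renamed too; injectivity keeps them apart from the free ones. -/
theorem Fml.sat_rename (A : Structure2.{u}) {g : ℕ → ℕ} (hg : Function.Injective g) (φ : Fml)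
    (e : ℕ → A.Num) (E : ℕ → Set A.Num) :
    (φ.rename g).Sat A e E ↔ φ.Sat A (e ∘ g) E := by
  have hu (e : ℕ → A.Num) (n : ℕ) (a : A.Num) :
      Function.update e (g n) a ∘ g = Function.update (e ∘ g) n a :=
    Function.update_comp_eq_of_injective e hg n a
  induction φ generalizing e E <;> simp_all [Fml.rename, Fml.Sat, Tm.eval_rename]

theorem Fml.Bounded.rename {g : ℕ → ℕ} (hg : Function.Injective g) {φ : Fml} (h : φ.Bounded) :
    (φ.rename g).Bounded := by
  induction h with
  | eq => exact .eq _ _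
  | lt => exact .lt _ _
  | mem => exact .mem _ _
  | neg _ ih => exact .neg ih
  | and _ _ h1 h2 => exact .and h1 h2
  | or _ _ h1 h2 => exact .or h1 h2
  | imp _ _ h1 h2 => exact .imp h1 h2
  | ball hn _ ih =>
    refine .ball (fun h => hn ?_) ih
    obtain ⟨m, hm, ho⟩ := Tm.occurs_rename.1 h
    exact hg hm ▸ ho
  | bex hn _ ih =>
    refine .bex (fun h => hn ?_) ih
    obtain ⟨m, hm, ho⟩ := Tm.occurs_rename.1 h
    exact hg hm ▸ ho

/-! ## Contexts

A context is a nonempty product `A.Num × ⋯ × A.Num`. Its coordinates are represented by the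
number variables with even names; odd names are used for parameters. -/

class Ctx (A : outParam Structure2.{u}) (C : Type u) where
  len : ℕ
  Rep : C → (ℕ → A.Num) → Prop
  congr : ∀ {c : C} {e e' : ℕ → A.Num}, (∀ i < len, e (2 * i) = e' (2 * i)) → Rep c e → Rep c e'
  exists_rep : ∀ (c : C) (q : ℕ → A.Num), ∃ e, Rep c e ∧ ∀ j, e (2 * j + 1) = q j

section

variable {A : Structure2.{u}}

instance : Ctx A A.Num where
  len := 1
  Rep x e := e 0 = x
  congr h := by intro h'; rw [← h', ← h 0 one_pos]
  exists_rep c q := ⟨Function.update (fun i => q (i / 2)) 0 c, by simp, fun j => by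
    rw [Function.update_of_ne (by omega), show (2 * j + 1) / 2 = j by omega]⟩

instance {C : Type u} [Ctx A C] : Ctx A (C × A.Num) where
  len := Ctx.len C + 1
  Rep c e := Ctx.Rep c.1 e ∧ e (2 * Ctx.len C) = c.2
  congr h h' := ⟨Ctx.congr (fun i hi => h i (by omega)) h'.1, by rw [← h'.2, h _ (by omega)]⟩
  exists_rep c q := by
    obtain ⟨e, he, hq⟩ := Ctx.exists_rep c.1 q
    refine ⟨Function.update e (2 * Ctx.len C) c.2, ⟨Ctx.congr (fun i hi => ?_) he, by simp⟩,
      fun j => by rw [Function.update_of_ne (by omega), hq]⟩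
    rw [Function.update_of_ne (by omega)]

theorem Ctx.Rep.update {C : Type u} [Ctx A C] {c : C} {e : ℕ → A.Num} (h : Ctx.Rep c e)
    (x : A.Num) : Ctx.Rep (c, x) (Function.update e (2 * Ctx.len C) x) := by
  refine ⟨Ctx.congr (fun i hi => ?_) h, by simp⟩
  rw [Function.update_of_ne (by omega)]

/-- The variables that a term over the context `C` may use. -/
def Ctx.Var (C : Type u) [Ctx A C] (n : ℕ) : Prop := ∀ i, n = 2 * i → i < Ctx.len C

/-- `f` is given by a term of arithmetic with parameters. -/
def PolFn {C : Type u} [Ctx A C] (f : C → A.Num) : Prop :=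
  ∃ (t : Tm) (q : ℕ → A.Num), (∀ n, t.Occurs n → Ctx.Var C n) ∧
    ∀ c e, Ctx.Rep c e → (∀ j, e (2 * j + 1) = q j) → t.eval A e = f c

/-- `P` is given by a bounded formula with parameters; `E` interprets the set variables. -/
def D0 (E : ℕ → Set A.Num) {C : Type u} [Ctx A C] (P : C → Prop) : Prop :=
  ∃ (φ : Fml) (q : ℕ → A.Num), φ.Bounded ∧
    ∀ c e, Ctx.Rep c e → (∀ j, e (2 * j + 1) = q j) → (φ.Sat A e E ↔ P c)

/-- Even numbers are fixed, odd numbers are mapped injectively to odd numbers. -/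
def oddShift (k n : ℕ) : ℕ := if n % 2 = 0 then n else 2 * (n - 1) + 1 + 2 * k

theorem oddShift_even (k i : ℕ) : oddShift k (2 * i) = 2 * i := by simp [oddShift]

theorem oddShift_odd (k j : ℕ) : oddShift k (2 * j + 1) = 2 * (2 * j + k) + 1 := by
  simp [oddShift]; omega

theorem oddShift_injective (k : ℕ) : Function.Injective (oddShift k) := by
  intro m n h
  simp only [oddShift] at h
  split_ifs at h <;> omega

/-- The parameters `q` at even, `q'` at odd positions. -/
def interleave {α : Type*} (q q' : ℕ → α) (n : ℕ) : α := if n % 2 = 0 then q (n / 2) else q' (n / 2)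

theorem interleave_even {α : Type*} (q q' : ℕ → α) (n : ℕ) : interleave q q' (2 * n) = q n := by
  simp [interleave]

theorem interleave_odd {α : Type*} (q q' : ℕ → α) (n : ℕ) :
    interleave q q' (2 * n + 1) = q' n := by
  simp [interleave, show (2 * n + 1) / 2 = n by omega]

section

variable {C : Type u} [Ctx A C]

/-- The two terms come with separate assignments of parameters. Parameter `j` of the first becomes
parameter `2j`, that of the second becomes parameter `2j + 1`, and the coordinates stay where they
are. -/
theorem PolFn.merge {f g : C → A.Num} (hf : PolFn f) (hg : PolFn g) :
    ∃ (s t : Tm) (q : ℕ → A.Num), (∀ n, s.Occurs n → Ctx.Var C n) ∧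
      (∀ n, t.Occurs n → Ctx.Var C n) ∧ ∀ c e, Ctx.Rep c e → (∀ j, e (2 * j + 1) = q j) →
        s.eval A e = f c ∧ t.eval A e = g c := by
  obtain ⟨s, q, hs, h⟩ := hf
  obtain ⟨t, q', ht, h'⟩ := hg
  have hv (k n : ℕ) (h : Ctx.Var C n) : Ctx.Var C (oddShift k n) := by
    intro i hi
    simp only [oddShift] at hi
    split_ifs at hi with h0
    · exact h i hi
    · omega
  refine ⟨s.rename (oddShift 0), t.rename (oddShift 1), interleave q q', fun n hn => ?_,
    fun n hn => ?_, fun c e hc he => ?_⟩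
  · obtain ⟨m, rfl, hm⟩ := Tm.occurs_rename.1 hn
    exact hv _ _ (hs _ hm)
  · obtain ⟨m, rfl, hm⟩ := Tm.occurs_rename.1 hn
    exact hv _ _ (ht _ hm)
  · rw [Tm.eval_rename, Tm.eval_rename]
    refine ⟨h c _ (Ctx.congr (fun i _ => by simp [oddShift_even]) hc) fun j => ?_,
      h' c _ (Ctx.congr (fun i _ => by simp [oddShift_even]) hc) fun j => ?_⟩
    · rw [Function.comp_apply, oddShift_odd, he, ← interleave_even q q', add_zero]
    · rw [Function.comp_apply, oddShift_odd, he, ← interleave_odd q q']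

theorem PolFn.const (a : A.Num) : PolFn (fun _ : C => a) :=
  ⟨.var 1, fun _ => a, by intro n hn i hi; have : 1 = n := hn; omega, fun c e _ h => h 0⟩

theorem PolFn.add {f g : C → A.Num} (hf : PolFn f) (hg : PolFn g) :
    PolFn (fun c => A.add (f c) (g c)) := by
  obtain ⟨s, t, q, hs, ht, h⟩ := hf.merge hg
  refine ⟨.add s t, q, ?_, fun c e hc he => ?_⟩
  · rintro n (hn | hn)
    exacts [hs n hn, ht n hn]
  · simp [Tm.eval, h c e hc he]

theorem PolFn.mul {f g : C → A.Num} (hf : PolFn f) (hg : PolFn g) :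
    PolFn (fun c => A.mul (f c) (g c)) := by
  obtain ⟨s, t, q, hs, ht, h⟩ := hf.merge hg
  refine ⟨.mul s t, q, ?_, fun c e hc he => ?_⟩
  · rintro n (hn | hn)
    exacts [hs n hn, ht n hn]
  · simp [Tm.eval, h c e hc he]

theorem PolFn.id : PolFn (fun x : A.Num => x) :=
  ⟨.var 0, fun i => A.zero, by intro n hn i hi; have : 0 = n := hn; simp [Ctx.len]; omega,
    fun c e h _ => h⟩

theorem PolFn.snd : PolFn (fun c : C × A.Num => c.2) :=
  ⟨.var (2 * Ctx.len C), fun i => A.zero,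
    by intro n hn i hi; have : 2 * Ctx.len C = n := hn; simp [Ctx.len]; omega, fun c e h _ => h.2⟩

theorem PolFn.fst {f : C → A.Num} (hf : PolFn f) : PolFn (fun c : C × A.Num => f c.1) := by
  obtain ⟨t, q, ht, h⟩ := hf
  refine ⟨t, q, fun n hn i hi => ?_, fun c e hc he => h _ e hc.1 he⟩
  have := ht n hn i hi
  simp only [Ctx.len]
  omega

variable {E : ℕ → Set A.Num}

theorem D0.eq {f g : C → A.Num} (hf : PolFn f) (hg : PolFn g) : D0 E (fun c => f c = g c) := by
  obtain ⟨s, t, q, -, -, h⟩ := hf.merge hg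
  exact ⟨.eq s t, q, .eq _ _, fun c e hc he => by simp [Fml.Sat, h c e hc he]⟩

theorem D0.lt {f g : C → A.Num} (hf : PolFn f) (hg : PolFn g) :
    D0 E (fun c => A.lt (f c) (g c)) := by
  obtain ⟨s, t, q, -, -, h⟩ := hf.merge hg
  exact ⟨.lt s t, q, .lt _ _, fun c e hc he => by simp [Fml.Sat, h c e hc he]⟩

theorem D0.not {P : C → Prop} (hP : D0 E P) : D0 E (fun c => ¬ P c) := by
  obtain ⟨φ, q, hφ, h⟩ := hP
  exact ⟨.neg φ, q, .neg hφ, fun c e hc he => not_congr (h c e hc he)⟩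

theorem D0.congr {P Q : C → Prop} (hP : D0 E P) (h : ∀ c, P c ↔ Q c) : D0 E Q := by
  rwa [← show P = Q from funext fun c => propext (h c)]

theorem D0.and {P Q : C → Prop} (hP : D0 E P) (hQ : D0 E Q) : D0 E (fun c => P c ∧ Q c) := by
  obtain ⟨φ, q, hφ, h⟩ := hP
  obtain ⟨ψ, q', hψ, h'⟩ := hQ
  refine ⟨.and (φ.rename (oddShift 0)) (ψ.rename (oddShift 1)), interleave q q',
    .and (hφ.rename (oddShift_injective _)) (hψ.rename (oddShift_injective _)),
    fun c e hc he => ?_⟩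
  simp only [Fml.Sat, Fml.sat_rename A (oddShift_injective _)]
  refine and_congr (h c _ (Ctx.congr (fun i _ => by simp [oddShift_even]) hc) fun j => ?_)
    (h' c _ (Ctx.congr (fun i _ => by simp [oddShift_even]) hc) fun j => ?_)
  · rw [Function.comp_apply, oddShift_odd, he, ← interleave_even q q', add_zero]
  · rw [Function.comp_apply, oddShift_odd, he, ← interleave_odd q q']

theorem D0.or {P Q : C → Prop} (hP : D0 E P) (hQ : D0 E Q) : D0 E (fun c => P c ∨ Q c) :=
  (hP.not.and hQ.not).not.congr fun c => by tauto

/-- The quantifier binds the first coordinate beyond `C`. A bounded quantifier requires that its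
bound does not contain the bound variable, which is the reason for the occurrence condition in
`PolFn`. -/
theorem D0.ball {P : C × A.Num → Prop} (hP : D0 E P) {f : C → A.Num} (hf : PolFn f) :
    D0 E (fun c => ∀ x, A.lt x (f c) → P (c, x)) := by
  obtain ⟨φ, q, hφ, h⟩ := hP
  obtain ⟨t, q', ht, h'⟩ := hf
  refine ⟨.all (2 * Ctx.len C) (.imp (.lt (.var (2 * Ctx.len C)) (t.rename (oddShift 1)))
    (φ.rename (oddShift 0))), interleave q q', .ball (fun ho => ?_)
    (hφ.rename (oddShift_injective _)), fun c e hc he => ?_⟩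
  · obtain ⟨m, hm, ho⟩ := Tm.occurs_rename.1 ho
    rw [← oddShift_even 1] at hm
    exact lt_irrefl _ (ht m ho (Ctx.len C) (oddShift_injective _ hm))
  · simp only [Fml.Sat, Fml.sat_rename A (oddShift_injective _), Tm.eval_rename]
    refine forall_congr' fun x => ?_
    have hc' := hc.update x
    generalize hg : Function.update e (2 * Ctx.len C) x = e' at hc'
    have he' (j : ℕ) : e' (2 * j + 1) = interleave q q' j := by
      rw [← hg, Function.update_of_ne (by omega), he]
    refine imp_congr ?_ (h (c, x) _ (Ctx.congr (fun i _ => by simp [oddShift_even]) hc')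
      fun j => ?_)
    · rw [h' c (e' ∘ oddShift 1) (Ctx.congr (fun i _ => by simp [oddShift_even]) hc'.1) fun j => ?_]
      · simp [Tm.eval, hc'.2]
      · rw [Function.comp_apply, oddShift_odd, he', ← interleave_odd q q']
    · rw [Function.comp_apply, oddShift_odd, he', ← interleave_even q q', add_zero]

theorem D0.bex {P : C × A.Num → Prop} (hP : D0 E P) {f : C → A.Num} (hf : PolFn f) :
    D0 E (fun c => ∃ x, A.lt x (f c) ∧ P (c, x)) :=
  (hP.not.ball hf).not.congr fun c => by push Not; rfl

/-- Even numbers are renamed according to `g`, odd numbers are fixed. -/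
def evenMap (g : ℕ → ℕ) (n : ℕ) : ℕ := if n % 2 = 0 then 2 * g (n / 2) else n

theorem evenMap_even (g : ℕ → ℕ) (i : ℕ) : evenMap g (2 * i) = 2 * g i := by simp [evenMap]

theorem evenMap_injective {g : ℕ → ℕ} (hg : Function.Injective g) :
    Function.Injective (evenMap g) := by
  intro m n h
  simp only [evenMap] at h
  split_ifs at h with h1 h2
  · have := @hg (m / 2) (n / 2) (by omega)
    omega
  all_goals omega

/-- Only injective renamings of coordinates are available for bounded formulas. Substitution of
functions is obtained later for `Σ⁰₁` predicates, by quantifying over values. -/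
theorem D0.pullback {D : Type u} [Ctx A D] {P : D → Prop} (hP : D0 E P) {g : ℕ → ℕ}
    (hg : Function.Injective g) (σ : C → D)
    (hσ : ∀ c e, Ctx.Rep c e → Ctx.Rep (σ c) (e ∘ evenMap g)) : D0 E (fun c => P (σ c)) := by
  obtain ⟨φ, q, hφ, h⟩ := hP
  refine ⟨φ.rename (evenMap g), q, hφ.rename (evenMap_injective hg), fun c e hc he => ?_⟩
  rw [Fml.sat_rename A (evenMap_injective hg)]
  refine h _ _ (hσ _ _ hc) fun j => ?_
  rw [← he j]
  simp [evenMap, Nat.add_mod]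

/-- Insertion of a coordinate at position `k`. -/
def skip (k i : ℕ) : ℕ := if i < k then i else i + 1

theorem skip_injective (k : ℕ) : Function.Injective (skip k) := by
  intro m n h
  simp only [skip] at h
  split_ifs at h <;> omega

theorem Ctx.Rep.skip {c : C} {e : ℕ → A.Num} (hc : Ctx.Rep c e) {k : ℕ} (hk : Ctx.len C ≤ k) :
    Ctx.Rep c (e ∘ evenMap (CT.skip k)) := by
  refine Ctx.congr (fun i hi => ?_) hc
  simp [evenMap_even, CT.skip, show i < k by omega]

end

/-! ### `Σ⁰₁` predicates on contexts -/

/-- Existential quantification of a bounded formula with parameters. -/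
def S1 (E : ℕ → Set A.Num) {C : Type u} [Ctx A C] (P : C → Prop) : Prop :=
  ∃ Q : C × A.Num → Prop, D0 E Q ∧ ∀ c, P c ↔ ∃ x, Q (c, x)

/-- Passes from the induction axiom for formulas to predicates given semantically. The context and
the parameters are stored in one assignment; induction runs on the next coordinate, and the
unbounded quantifier uses the one after it. -/
theorem Structure2.IsModelRCA0.induction_S1 (hA : A.IsModelRCA0) {E : ℕ → Set A.Num}
    (hE : ∀ i, E i ∈ A.sets) {C : Type u} [Ctx A C] {P : C × A.Num → Prop} (hP : S1 E P) (c : C)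
    (h0 : P (c, A.zero)) (hs : ∀ a, P (c, a) → P (c, A.add a A.one)) (a : A.Num) : P (c, a) := by
  obtain ⟨Q, ⟨φ, q, hφ, h⟩, hQ⟩ := hP
  obtain ⟨e, hc, he⟩ := Ctx.exists_rep c q
  have key (a : A.Num) : (Fml.ex (2 * (Ctx.len C + 1)) φ).Sat A
      (Function.update e (2 * Ctx.len C) a) E ↔ P (c, a) := by
    simp only [Fml.Sat, hQ]
    refine exists_congr fun x => h ((c, a), x) _ ((hc.update a).update x) fun j => ?_
    rw [Function.update_of_ne (by omega), Function.update_of_ne (by omega), he]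
  have := hA.induction (.ex (2 * (Ctx.len C + 1)) φ) ⟨_, φ, hφ, rfl⟩ (2 * Ctx.len C) e E hE
  simp only [key] at this
  exact this h0 hs a

theorem D0.toS1 {E : ℕ → Set A.Num} {C : Type u} [Ctx A C] {P : C → Prop} (hP : D0 E P) :
    S1 E P :=
  ⟨fun d => P d.1, hP.pullback (skip_injective (Ctx.len C)) Prod.fst
    fun _ _ h => h.1.skip le_rfl, fun c => ⟨fun h => ⟨A.zero, h⟩, fun ⟨_, h⟩ => h⟩⟩

theorem S1.pullback {E : ℕ → Set A.Num} {C D : Type u} [Ctx A C] [Ctx A D] {P : D → Prop}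
    (hP : S1 E P) {g : ℕ → ℕ} (hg : Function.Injective g) (hl : g (Ctx.len D) = Ctx.len C)
    (σ : C → D) (hσ : ∀ c e, Ctx.Rep c e → Ctx.Rep (σ c) (e ∘ evenMap g)) :
    S1 E (fun c => P (σ c)) := by
  obtain ⟨Q, hQ, h⟩ := hP
  refine ⟨fun d => Q (σ d.1, d.2), hQ.pullback hg (fun d : C × A.Num => (σ d.1, d.2)) fun d e hd =>
    ⟨hσ _ _ hd.1, ?_⟩, fun c => h _⟩
  rw [Function.comp_apply, evenMap_even, hl, hd.2]

end

/-! ## The ordered semiring of numbers -/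

section

variable {A : Structure2.{u}}

/-- An interpretation of the set variables. -/
noncomputable def dfltSets (A : Structure2.{u}) [hA : Fact A.IsModelRCA0] : ℕ → Set A.Num :=
  fun _ => hA.out.sets_nonempty.choose

theorem dfltSets_mem [hA : Fact A.IsModelRCA0] (i : ℕ) : dfltSets A i ∈ A.sets :=
  hA.out.sets_nonempty.choose_spec

namespace Num

variable [hA : Fact A.IsModelRCA0]

/-- Contexts are nonempty, so the induction variable is the second coordinate and the first is a
dummy. -/
theorem induct {P : A.Num → Prop} (hP : D0 (dfltSets A) P) (h0 : P A.zero)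
    (hs : ∀ a, P a → P (A.add a A.one)) (a : A.Num) : P a :=
  hA.out.induction_S1 dfltSets_mem (C := A.Num) (P := fun d => P d.2)
    (hP.toS1.pullback (Nat.succ_injective) rfl Prod.snd fun c e h => by
      have h2 : e 2 = c.2 := h.2
      simpa [Ctx.Rep, evenMap] using h2) A.zero h0 hs a

theorem add_zero' (a : A.Num) : A.add a A.zero = a := hA.out.add_zero a
theorem add_succ' (a b : A.Num) : A.add a (A.add b A.one) = A.add (A.add a b) A.one :=
  hA.out.add_succ a b

theorem zero_add' (a : A.Num) : A.add A.zero a = a := by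
  refine induct (.eq (.add (.const _) .id) .id) (add_zero' _) (fun a h => ?_) a
  rw [add_succ', h]

theorem succ_add' (a b : A.Num) : A.add (A.add a A.one) b = A.add (A.add a b) A.one := by
  refine induct (P := fun b => A.add (A.add a A.one) b = A.add (A.add a b) A.one)
    (.eq (.add (.const _) .id) (.add (.add (.const _) .id) (.const _))) ?_ (fun b h => ?_) b
  · rw [add_zero', add_zero']
  · rw [add_succ', h, add_succ']

theorem add_comm' (a b : A.Num) : A.add a b = A.add b a := by
  refine induct (P := fun b => A.add a b = A.add b a)
    (.eq (.add (.const _) .id) (.add .id (.const _))) ?_ (fun b h => ?_) b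
  · rw [add_zero', zero_add']
  · rw [add_succ', h, succ_add']

theorem add_assoc' (a b c : A.Num) : A.add (A.add a b) c = A.add a (A.add b c) := by
  refine induct (P := fun c => A.add (A.add a b) c = A.add a (A.add b c))
    (.eq (.add (.const _) .id) (.add (.const _) (.add (.const _) .id))) ?_ (fun c h => ?_) c
  · rw [add_zero', add_zero']
  · rw [add_succ', h, add_succ', add_succ']

theorem mul_zero' (a : A.Num) : A.mul a A.zero = A.zero := hA.out.mul_zero a
theorem mul_succ' (a b : A.Num) : A.mul a (A.add b A.one) = A.add (A.mul a b) a :=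
  hA.out.mul_succ a b

theorem zero_mul' (a : A.Num) : A.mul A.zero a = A.zero := by
  refine induct (.eq (.mul (.const _) .id) (.const _)) (mul_zero' _) (fun a h => ?_) a
  rw [mul_succ', h, add_zero']

theorem succ_mul' (a b : A.Num) : A.mul (A.add a A.one) b = A.add (A.mul a b) b := by
  refine induct (P := fun b => A.mul (A.add a A.one) b = A.add (A.mul a b) b)
    (.eq (.mul (.const _) .id) (.add (.mul (.const _) .id) .id)) ?_ (fun b h => ?_) b
  · rw [mul_zero', mul_zero', add_zero']
  · rw [mul_succ', h, mul_succ', add_succ', add_succ', add_assoc' _ b a, add_assoc' _ a b,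
      add_comm' a b]

theorem mul_comm' (a b : A.Num) : A.mul a b = A.mul b a := by
  refine induct (P := fun b => A.mul a b = A.mul b a)
    (.eq (.mul (.const _) .id) (.mul .id (.const _))) ?_ (fun b h => ?_) b
  · rw [mul_zero', zero_mul']
  · rw [mul_succ', h, succ_mul']

theorem mul_add' (a b c : A.Num) : A.mul a (A.add b c) = A.add (A.mul a b) (A.mul a c) := by
  refine induct (P := fun c => A.mul a (A.add b c) = A.add (A.mul a b) (A.mul a c))
    (.eq (.mul (.const _) (.add (.const _) .id)) (.add (.const _) (.mul (.const _) .id)))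
    ?_ (fun c h => ?_) c
  · rw [add_zero', mul_zero', add_zero']
  · rw [add_succ', mul_succ', h, mul_succ', add_assoc']

theorem mul_assoc' (a b c : A.Num) : A.mul (A.mul a b) c = A.mul a (A.mul b c) := by
  refine induct (P := fun c => A.mul (A.mul a b) c = A.mul a (A.mul b c))
    (.eq (.mul (.const _) .id) (.mul (.const _) (.mul (.const _) .id))) ?_ (fun c h => ?_) c
  · rw [mul_zero', mul_zero', mul_zero']
  · rw [mul_succ', h, mul_succ', mul_add']

theorem mul_one' (a : A.Num) : A.mul a A.one = a := by
  rw [← zero_add' A.one, mul_succ', mul_zero', zero_add']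

instance : Zero A.Num := ⟨A.zero⟩
instance : One A.Num := ⟨A.one⟩
instance : Add A.Num := ⟨A.add⟩
instance : Mul A.Num := ⟨A.mul⟩

noncomputable instance : CommSemiring A.Num where
  add_assoc := add_assoc'
  zero_add := zero_add'
  add_zero := add_zero'
  add_comm := add_comm'
  nsmul := nsmulRec
  left_distrib := mul_add'
  right_distrib a b c := by
    change A.mul (A.add a b) c = A.add (A.mul a c) (A.mul b c)
    rw [mul_comm', mul_add', mul_comm' c a, mul_comm' c b]
  zero_mul := zero_mul'
  mul_zero := mul_zero'
  mul_assoc := mul_assoc'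
  one_mul a := by change A.mul A.one a = a; rw [mul_comm', mul_one']
  mul_one := mul_one'
  mul_comm := mul_comm'

theorem not_lt_zero'' (a : A.Num) : ¬ A.lt a 0 := hA.out.not_lt_zero a
theorem lt_succ'' {a b : A.Num} : A.lt a (b + 1) ↔ A.lt a b ∨ a = b := hA.out.lt_succ a b

theorem lt_trans'' {a b c : A.Num} (h : A.lt a b) : A.lt b c → A.lt a c := by
  refine induct (P := fun c => A.lt b c → A.lt a c)
    -- Bounded predicates have been shown closed under negation and disjunction; an implication is
    -- brought into this form.
    (((D0.lt (.const _) .id).not.or (.lt (.const _) .id)).congr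
      fun c => by rw [← imp_iff_not_or]) ?_ (fun c ih h' => ?_) c
  · exact fun h => (not_lt_zero'' _ h).elim
  · change A.lt b (c + 1) at h'
    change A.lt a (c + 1)
    rw [lt_succ''] at *
    rcases h' with h' | rfl
    exacts [.inl (ih h'), .inl h]

theorem lt_add_one'' (a : A.Num) : A.lt a (a + 1) := lt_succ''.2 (.inr rfl)

theorem lt_irrefl'' (a : A.Num) : ¬ A.lt a a := by
  refine induct (P := fun a => ¬ A.lt a a) (D0.lt .id .id).not (not_lt_zero'' _) (fun a ih h => ?_) a
  rcases lt_succ''.1 h with h | h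
  · exact ih (lt_trans'' (lt_add_one'' _) h)
  · exact ih (by nth_rw 2 [← h]; exact lt_add_one'' a)

theorem succ_le'' {a b : A.Num} : A.lt a b → A.lt (a + 1) b ∨ a + 1 = b := by
  refine induct (P := fun b => A.lt a b → A.lt (a + 1) b ∨ a + 1 = b)
    (((D0.lt (.const _) .id).not.or ((D0.lt (.const _) .id).or (.eq (.const _) .id))).congr
      fun c => by rw [← imp_iff_not_or]) ?_ (fun b ih h => ?_) b
  · exact fun h => (not_lt_zero'' _ h).elim
  · change A.lt a (b + 1) at h
    change A.lt (a + 1) (b + 1) ∨ a + 1 = b + 1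
    rcases lt_succ''.1 h with h | rfl
    · rw [lt_succ'']; exact .inl (ih h)
    · exact .inr rfl

theorem trichotomy'' (a b : A.Num) : A.lt a b ∨ a = b ∨ A.lt b a := by
  refine induct (P := fun b => A.lt a b ∨ a = b ∨ A.lt b a)
    ((D0.lt (.const _) .id).or ((D0.eq (.const _) .id).or (.lt .id (.const _)))) ?_
      (fun b ih => ?_) b
  · refine induct (P := fun a => A.lt a A.zero ∨ a = A.zero ∨ A.lt A.zero a)
      ((D0.lt .id (.const _)).or ((D0.eq .id (.const _)).or (.lt (.const _) .id))) (.inr (.inl rfl))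
      (fun a ih => ?_) a
    rcases ih with h | rfl | h
    · exact (not_lt_zero'' _ h).elim
    · exact .inr (.inr (lt_add_one'' _))
    · exact .inr (.inr (lt_trans'' h (lt_add_one'' _)))
  · change A.lt a (b + 1) ∨ a = b + 1 ∨ A.lt (b + 1) a
    rcases ih with h | rfl | h
    · exact .inl (lt_trans'' h (lt_add_one'' _))
    · exact .inl (lt_add_one'' _)
    · rcases succ_le'' h with h | h
      exacts [.inr (.inr h), .inr (.inl h.symm)]

noncomputable instance : LinearOrder A.Num where
  lt := A.lt
  le a b := A.lt a b ∨ a = b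
  le_refl a := .inr rfl
  le_trans a b c := by
    rintro (h | rfl) (h' | rfl)
    exacts [.inl (lt_trans'' h h'), .inl h, .inl h', .inr rfl]
  lt_iff_le_not_ge a b := by
    constructor
    · intro h
      refine ⟨.inl h, ?_⟩
      rintro (h' | rfl)
      exacts [lt_irrefl'' _ (lt_trans'' h h'), lt_irrefl'' _ h]
    · rintro ⟨h | rfl, h'⟩
      exacts [h, (h' (.inr rfl)).elim]
  le_antisymm a b := by
    rintro (h | rfl) (h' | h')
    exacts [(lt_irrefl'' _ (lt_trans'' h h')).elim, h'.symm, rfl, rfl]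
  le_total a b := by
    rcases trichotomy'' a b with h | rfl | h
    exacts [.inl (.inl h), .inl (.inr rfl), .inr (.inl h)]
  toDecidableLE := Classical.decRel _
  toDecidableEq := Classical.decEq _
  toDecidableLT := Classical.decRel _

theorem lt_succ_iff {a b : A.Num} : a < b + 1 ↔ a ≤ b := lt_succ''

theorem lt_succ_self (a : A.Num) : a < a + 1 := lt_add_one'' a

theorem not_lt_zero (a : A.Num) : ¬ a < 0 := not_lt_zero'' a

theorem zero_le' (a : A.Num) : 0 ≤ a := by
  rcases trichotomy'' 0 a with h | h | h
  exacts [le_of_lt h, le_of_eq h, (not_lt_zero'' _ h).elim]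

theorem succ_le_iff {a b : A.Num} : a + 1 ≤ b ↔ a < b :=
  ⟨fun h => lt_of_lt_of_le (lt_add_one'' a) h, fun h => succ_le'' h⟩

theorem add_lt_add_right'' {a b : A.Num} (h : a < b) (c : A.Num) : a + c < b + c := by
  refine induct (P := fun c => a + c < b + c)
    (.lt (.add (.const _) .id) (.add (.const _) .id)) ?_ (fun c ih => ?_) c
  · change a + 0 < b + 0
    simpa using h
  · change a + (c + 1) < b + (c + 1)
    rw [← add_assoc, ← add_assoc, lt_succ_iff, succ_le_iff]
    exact ih

instance : IsOrderedCancelAddMonoid A.Num where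
  add_le_add_left a b h c := by
    rcases h with h | rfl
    exacts [(add_lt_add_right'' h c).le, le_rfl]
  le_of_add_le_add_left a b c h := by
    by_contra h'
    rw [not_le] at h'
    have := add_lt_add_right'' h' a
    rw [add_comm c, add_comm b] at this
    exact absurd h (not_le.2 this)

theorem zero_lt_one'' : (0 : A.Num) < 1 := by
  have := lt_add_one'' (0 : A.Num)
  rwa [zero_add] at this

theorem mul_lt_mul'' {a b c : A.Num} (h : a < b) : 0 < c → a * c < b * c := by
  refine induct (P := fun c => A.lt A.zero c → A.lt (A.mul a c) (A.mul b c))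
    (((D0.lt (.const _) .id).not.or (.lt (.mul (.const _) .id) (.mul (.const _) .id))).congr
      fun c => by rw [← imp_iff_not_or]) ?_ (fun c ih _ => ?_) c
  · exact fun h => (not_lt_zero'' _ h).elim
  · change a * (c + 1) < b * (c + 1)
    rw [mul_add, mul_add, mul_one, mul_one]
    rcases (zero_le' c).lt_or_eq with h' | rfl
    · exact add_lt_add (ih h') h
    · simpa using h

instance : IsStrictOrderedRing A.Num where
  zero_le_one := zero_lt_one''.le
  exists_pair_ne := ⟨0, 1, zero_lt_one''.ne⟩
  mul_lt_mul_of_pos_left a ha b c h := by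
    rw [mul_comm a, mul_comm a]; exact mul_lt_mul'' h ha
  mul_lt_mul_of_pos_right a ha b c h := mul_lt_mul'' h ha

/-- For induction on `b` the statement has to be bounded, hence the difference is sought below `b +
1`. -/
theorem exists_add_of_le' {a b : A.Num} (h : a ≤ b) : ∃ c, b = a + c := by
  have : ∀ b : A.Num, b < a ∨ ∃ c, A.lt c (b + 1) ∧ b = a + c := by
    refine induct (D0.or (.lt .id (.const _)) (D0.bex (P := fun d : A.Num × A.Num =>
      d.1 = A.add a d.2) (.eq (PolFn.fst .id) (.add (.const _) .snd)) (.add .id (.const _)))) ?_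
        (fun b ih => ?_)
    · rcases (zero_le' a).lt_or_eq with h | rfl
      · exact .inl h
      · exact .inr ⟨0, lt_add_one'' _, (add_zero _).symm⟩
    · change b + 1 < a ∨ ∃ c, A.lt c (b + 1 + 1) ∧ b + 1 = a + c
      rcases ih with h | ⟨c, hc, rfl⟩
      · rcases (succ_le_iff.2 h).lt_or_eq with h | h
        · exact .inl h
        · exact .inr ⟨0, lt_of_le_of_lt (zero_le' _) (lt_add_one'' _), by rw [h, add_zero]⟩
      · exact .inr ⟨c + 1, add_lt_add_right'' hc 1, add_assoc _ _ _⟩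
  rcases this b with h' | ⟨c, -, h⟩
  exacts [absurd h (not_le.2 h'), ⟨c, h⟩]

instance : CanonicallyOrderedAdd A.Num where
  exists_add_of_le h := exists_add_of_le' h
  le_self_add _ b := le_add_of_nonneg_right (zero_le' b)
  le_add_self _ b := le_add_of_nonneg_left (zero_le' b)

end Num

end

/-! ## Definability by `Σ⁰₁` formulas -/

section

variable {A : Structure2.{u}} [hA : Fact A.IsModelRCA0]

section

variable {C : Type u} [Ctx A C]

/-- `P` is defined by a `Σ⁰₁` formula with parameters. -/
class Sg (P : C → Prop) : Prop where
  out : S1 (dfltSets A) P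

/-- `P` is defined by a `Π⁰₁` formula with parameters. -/
abbrev Pg (P : C → Prop) : Prop := Sg (fun c => ¬ P c)

/-- The graph of `f` is defined by a `Σ⁰₁` formula with parameters. -/
class Fn (f : C → A.Num) : Prop where
  out : Sg (fun d : C × A.Num => d.2 = f d.1)

/-- Projections between contexts. -/
class Proj {D : Type u} [Ctx A D] (g : C → D) : Prop where
  out : ∀ f : D → A.Num, PolFn f → PolFn (fun c => f (g c))

theorem Sg.congr {P Q : C → Prop} (hP : Sg P) (h : ∀ c, Q c ↔ P c) : Sg Q := by
  rwa [show Q = P from funext fun c => propext (h c)]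

theorem D0.sg {P : C → Prop} (hP : D0 (dfltSets A) P) : Sg P := ⟨hP.toS1⟩

theorem D0.bex_lt {P : C × A.Num → Prop} (hP : D0 (dfltSets A) P) {f : C → A.Num} (hf : PolFn f) :
    D0 (dfltSets A) (fun c => ∃ x < f c, P (c, x)) := hP.bex hf

theorem D0.ball_lt {P : C × A.Num → Prop} (hP : D0 (dfltSets A) P) {f : C → A.Num}
    (hf : PolFn f) : D0 (dfltSets A) (fun c => ∀ x < f c, P (c, x)) := hP.ball hf

/-- The bound in front of the last coordinate. -/
theorem D0.insert {Q : C × A.Num → Prop} (hQ : D0 (dfltSets A) Q) :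
    D0 (dfltSets A) (fun d : (C × A.Num) × A.Num => Q (d.1.1, d.2)) :=
  hQ.pullback (skip_injective (Ctx.len C)) (fun d : (C × A.Num) × A.Num => (d.1.1, d.2))
    fun d e h => ⟨h.1.1.skip le_rfl, by
      rw [Function.comp_apply, evenMap_even, skip, if_neg (lt_irrefl _)]; exact h.2⟩

theorem D0.insert₂ {Q : (C × A.Num) × A.Num → Prop} (hQ : D0 (dfltSets A) Q) :
    D0 (dfltSets A) (fun d : ((C × A.Num) × A.Num) × A.Num => Q ((d.1.1.1, d.1.2), d.2)) :=
  hQ.pullback (skip_injective (Ctx.len C))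
    (fun d : ((C × A.Num) × A.Num) × A.Num => ((d.1.1.1, d.1.2), d.2))
    fun d e h => ⟨⟨h.1.1.1.skip le_rfl, by
      rw [Function.comp_apply, evenMap_even, skip, if_neg (lt_irrefl _)]; exact h.1.2⟩, by
      rw [Function.comp_apply, evenMap_even, skip, if_neg (by simp [Ctx.len])]
      exact h.2⟩

/-- The two witnesses lie below a common bound, and this bound becomes the single unbounded
variable. The same device contracts two existential quantifiers in `Sg.ex`. -/
instance Sg.and {P Q : C → Prop} [hP : Sg P] [hQ : Sg Q] : Sg (fun c => P c ∧ Q c) := by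
  obtain ⟨R, hR, h⟩ := hP.out
  obtain ⟨R', hR', h'⟩ := hQ.out
  refine ⟨fun d => (∃ x < d.2, R (d.1, x)) ∧ (∃ x < d.2, R' (d.1, x)),
    (hR.insert.bex_lt .snd).and (hR'.insert.bex_lt .snd), fun c => ?_⟩
  simp only [h, h']
  constructor
  · rintro ⟨⟨x, hx⟩, ⟨y, hy⟩⟩
    exact ⟨max x y + 1, ⟨x, Num.lt_succ_iff.2 (le_max_left _ _), hx⟩,
      ⟨y, Num.lt_succ_iff.2 (le_max_right _ _), hy⟩⟩
  · rintro ⟨z, ⟨x, -, hx⟩, ⟨y, -, hy⟩⟩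
    exact ⟨⟨x, hx⟩, ⟨y, hy⟩⟩

instance Sg.or {P Q : C → Prop} [hP : Sg P] [hQ : Sg Q] : Sg (fun c => P c ∨ Q c) := by
  obtain ⟨R, hR, h⟩ := hP.out
  obtain ⟨R', hR', h'⟩ := hQ.out
  exact ⟨_, hR.or hR', fun c => by simp only [h, h', exists_or]⟩

instance Sg.ex {P : C → A.Num → Prop} [hP : Sg (fun d : C × A.Num => P d.1 d.2)] :
    Sg (fun c => ∃ x, P c x) := by
  obtain ⟨Q, hQ, h⟩ := hP.out
  refine ⟨fun d => ∃ x < d.2, ∃ y < d.2, Q ((d.1, x), y),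
    (hQ.insert₂.bex_lt (PolFn.snd.fst)).bex_lt .snd, fun c => ?_⟩
  constructor
  · rintro ⟨x, hx⟩
    obtain ⟨y, hy⟩ := (h (c, x)).1 hx
    exact ⟨max x y + 1, x, Num.lt_succ_iff.2 (le_max_left _ _), y,
      Num.lt_succ_iff.2 (le_max_right _ _), hy⟩
  · rintro ⟨z, x, -, y, -, hxy⟩
    exact ⟨x, (h (c, x)).2 ⟨y, hxy⟩⟩

theorem Sg.induction {P : C → A.Num → Prop} (hP : Sg (fun d : C × A.Num => P d.1 d.2)) (c : C)
    (h0 : P c 0) (hs : ∀ a, P c a → P c (a + 1)) (a : A.Num) : P c a :=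
  hA.out.induction_S1 dfltSets_mem hP.out c h0 hs a

/-- This is `Σ⁰₁` collection: the witnesses for the `x` below the bound have a common bound, which
is found by `Σ⁰₁` induction on the number of `x` treated so far. -/
theorem Sg.ball_pol {P : C → A.Num → Prop} (hP : Sg (fun d : C × A.Num => P d.1 d.2))
    {f : C → A.Num} (hf : PolFn f) : Sg (fun c => ∀ x < f c, P c x) := by
  obtain ⟨Q, hQ, h⟩ := hP.out
  have hQ' : D0 (dfltSets A) (fun d : C × A.Num => ∀ x < f d.1, ∃ y < d.2, Q ((d.1, x), y)) :=
    (hQ.insert₂.bex_lt (PolFn.snd.fst)).ball_lt hf.fst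
  refine ⟨_, hQ', fun c => ?_⟩
  constructor
  · intro hx
    -- The first disjunct disposes of the numbers beyond `f c`, about which nothing is assumed; the
    -- claim is used at `k = f c`.
    have key : ∀ k, f c < k ∨ ∃ z, ∀ x < k, ∃ y < z, Q ((c, x), y) := by
      have hd : Sg (fun d : C × A.Num => f d.1 < d.2 ∨ ∃ z, ∀ x < d.2, ∃ y < z, Q ((d.1, x), y)) := by
        have h1 : Sg (fun d : C × A.Num => f d.1 < d.2) := (D0.lt hf.fst .snd).sg
        have h2 : Sg (fun d : (C × A.Num) × A.Num => ∀ x < d.1.2, ∃ y < d.2, Q ((d.1.1, x), y)) := by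
          refine D0.sg (D0.ball_lt (P := fun d : ((C × A.Num) × A.Num) × A.Num =>
            ∃ y < d.1.2, Q ((d.1.1.1, d.2), y)) (D0.bex_lt (P := fun d :
              (((C × A.Num) × A.Num) × A.Num) × A.Num => Q ((d.1.1.1.1, d.1.2), d.2)) ?_
                (PolFn.snd.fst)) (PolFn.snd.fst))
          exact (hQ.insert₂).insert₂
        exact inferInstance
      refine Sg.induction (P := fun c k => f c < k ∨ ∃ z, ∀ x < k, ∃ y < z, Q ((c, x), y)) hd c
        (.inr ⟨0, fun x hx => (Num.not_lt_zero _ hx).elim⟩) fun k hk => ?_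
      rcases hk with hk | ⟨z, hz⟩
      · exact .inl (hk.trans (Num.lt_succ_self k))
      · rcases le_or_gt (f c) k with hk | hk
        · exact .inl (Num.lt_succ_iff.2 hk)
        · obtain ⟨y, hy⟩ := (h (c, k)).1 (hx k hk)
          refine .inr ⟨max z (y + 1), fun x hx => ?_⟩
          rcases (Num.lt_succ_iff.1 hx).lt_or_eq with hx | rfl
          · obtain ⟨y, hy, h⟩ := hz x hx
            exact ⟨y, lt_of_lt_of_le hy (le_max_left _ _), h⟩
          · exact ⟨y, lt_of_lt_of_le (Num.lt_succ_self y) (le_max_right _ _), hy⟩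
    rcases key (f c) with h | ⟨z, hz⟩
    exacts [absurd h (lt_irrefl _), ⟨z, hz⟩]
  · rintro ⟨z, hz⟩ x hx
    obtain ⟨y, -, hy⟩ := hz x hx
    exact (h (c, x)).2 ⟨y, hy⟩

theorem Sg.pullback {D : Type u} [Ctx A D] {P : D → Prop} (hP : Sg P) {g : ℕ → ℕ}
    (hg : Function.Injective g) (hl : g (Ctx.len D) = Ctx.len C) (σ : C → D)
    (hσ : ∀ c e, Ctx.Rep c e → Ctx.Rep (σ c) (e ∘ evenMap g)) : Sg (fun c => P (σ c)) :=
  ⟨hP.out.pullback hg hl σ hσ⟩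

/-- Weakening before the last coordinate. -/
theorem Sg.insert {P : C → A.Num → Prop} (hP : Sg (fun d : C × A.Num => P d.1 d.2)) :
    Sg (fun d : (C × A.Num) × A.Num => P d.1.1 d.2) :=
  hP.pullback (skip_injective (Ctx.len C)) (by simp [skip, Ctx.len])
    (fun d : (C × A.Num) × A.Num => (d.1.1, d.2))
    fun d e h => ⟨h.1.1.skip le_rfl, by
      rw [Function.comp_apply, evenMap_even, skip, if_neg (lt_irrefl _)]; exact h.2⟩

theorem Fn.fst {f : C → A.Num} (hf : Fn f) : Fn (fun d : C × A.Num => f d.1) :=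
  ⟨Sg.insert (P := fun c y => y = f c) hf.out⟩

/-- Substitution of a definable function. -/
theorem Sg.subst {P : C → A.Num → Prop} (hP : Sg (fun d : C × A.Num => P d.1 d.2))
    {f : C → A.Num} (hf : Fn f) : Sg (fun c => P c (f c)) := by
  have := hf.out
  exact Sg.congr (Q := fun c => P c (f c)) (P := fun c => ∃ x, x = f c ∧ P c x)
    inferInstance fun c => by simp

theorem Sg.shift {P : A.Num → Prop} (hP : Sg P) : Sg (fun d : C × A.Num => P d.2) :=
  hP.pullback (g := (· + Ctx.len C)) (add_left_injective _) (by simp [Ctx.len, add_comm])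
    (fun d : C × A.Num => d.2) fun d e h => by
      simp only [Ctx.Rep, Function.comp_apply, evenMap]
      simpa using h.2

theorem Sg.shift₂ {P : A.Num × A.Num → Prop} (hP : Sg P) :
    Sg (fun d : (C × A.Num) × A.Num => P (d.1.2, d.2)) :=
  hP.pullback (g := (· + Ctx.len C)) (add_left_injective _) (by simp [Ctx.len]; omega)
    (fun d : (C × A.Num) × A.Num => (d.1.2, d.2)) fun d e h => by
      constructor
      · simpa [Ctx.Rep, evenMap] using h.1.2
      · have h2 : e (2 * (Ctx.len C + 1)) = d.2 := h.2
        simpa [Ctx.len, evenMap, add_comm] using h2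

theorem Sg.shift₃ {P : (A.Num × A.Num) × A.Num → Prop} (hP : Sg P) :
    Sg (fun d : ((C × A.Num) × A.Num) × A.Num => P ((d.1.1.2, d.1.2), d.2)) :=
  hP.pullback (g := (· + Ctx.len C)) (add_left_injective _) (by simp [Ctx.len]; omega)
    (fun d : ((C × A.Num) × A.Num) × A.Num => ((d.1.1.2, d.1.2), d.2)) fun d e h => by
      refine ⟨⟨?_, ?_⟩, ?_⟩
      · simpa [Ctx.Rep, evenMap] using h.1.1.2
      · have h2 : e (2 * (Ctx.len C + 1)) = d.1.2 := h.1.2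
        simpa [Ctx.len, evenMap, add_comm] using h2
      · have h2 : e (2 * (Ctx.len C + 1 + 1)) = d.2 := h.2
        rw [← h2, Function.comp_apply, evenMap_even]
        exact congrArg e (by simp only [Ctx.len]; omega)

/-- Carries definability from a predicate on numbers to its composition with definable functions
over any context. In later proofs such statements serve as local instances for a predicate variable.
-/
theorem Sg.comp {P : A.Num → Prop} (hP : Sg P) (f : C → A.Num) [hf : Fn f] :
    Sg (fun c => P (f c)) :=
  Sg.subst (P := fun _ x => P x) hP.shift hf

theorem Sg.comp₂ {P : A.Num → A.Num → Prop} (hP : Sg (fun d : A.Num × A.Num => P d.1 d.2))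
    (f g : C → A.Num) [hf : Fn f] [hg : Fn g] : Sg (fun c => P (f c) (g c)) :=
  Sg.subst (P := fun c x => P x (g c))
    (Sg.subst (P := fun (d : C × A.Num) y => P d.2 y) hP.shift₂ hg.fst) hf

theorem Sg.comp₃ {P : A.Num → A.Num → A.Num → Prop}
    (hP : Sg (fun d : (A.Num × A.Num) × A.Num => P d.1.1 d.1.2 d.2))
    (f g h : C → A.Num) [hf : Fn f] [hg : Fn g] [hh : Fn h] :
    Sg (fun c => P (f c) (g c) (h c)) :=
  Sg.subst (P := fun c x => P x (g c) (h c))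
    (Sg.subst (P := fun (d : C × A.Num) y => P d.2 y (h d.1))
      (Sg.subst (P := fun (d : (C × A.Num) × A.Num) z => P d.1.2 d.2 z) hP.shift₃ hh.fst.fst)
        hg.fst) hf

theorem PolFn.fn {f : C → A.Num} (hf : PolFn f) : Fn f := ⟨(D0.eq .snd hf.fst).sg⟩

/-! ### Instances -/

instance Proj.id : Proj (fun c : C => c) := ⟨fun _ h => h⟩

instance Proj.fst {D : Type u} [Ctx A D] {g : C → D × A.Num} [hg : Proj g] :
    Proj (fun c => (g c).1) := ⟨fun _ h => hg.out _ h.fst⟩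

instance Fn.const (a : A.Num) : Fn (fun _ : C => a) := (PolFn.const a).fn

instance Fn.id : Fn (fun x : A.Num => x) := PolFn.id.fn

instance Fn.proj_snd {D : Type u} [Ctx A D] {g : C → D × A.Num} [hg : Proj g] :
    Fn (fun c => (g c).2) := (hg.out _ .snd).fn

instance Fn.proj_fst {g : C → A.Num × A.Num} [hg : Proj g] :
    Fn (fun c => (g c).1) := (hg.out _ PolFn.id.fst).fn

theorem Fn.comp₂ (F : A.Num → A.Num → A.Num)
    (hF : Sg (fun d : (A.Num × A.Num) × A.Num => d.2 = F d.1.1 d.1.2))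
    (f g : C → A.Num) [hf : Fn f] [hg : Fn g] : Fn (fun c => F (f c) (g c)) :=
  have := hf.fst
  have := hg.fst
  ⟨Sg.comp₃ (P := fun x y z => z = F x y) hF (fun d : C × A.Num => f d.1)
    (fun d : C × A.Num => g d.1) (fun d => d.2)⟩

theorem Fn.comp₁ (F : A.Num → A.Num) (hF : Sg (fun d : A.Num × A.Num => d.2 = F d.1))
    (f : C → A.Num) [hf : Fn f] : Fn (fun c => F (f c)) :=
  have := hf.fst
  ⟨Sg.comp₂ (P := fun x z => z = F x) hF (fun d : C × A.Num => f d.1) (fun d => d.2)⟩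

instance Fn.add {f g : C → A.Num} [Fn f] [Fn g] : Fn (fun c => f c + g c) :=
  Fn.comp₂ (· + ·) (D0.eq .snd (.fst (.add (.fst .id) .snd))).sg f g

instance Fn.mul {f g : C → A.Num} [Fn f] [Fn g] : Fn (fun c => f c * g c) :=
  Fn.comp₂ (· * ·) (D0.eq .snd (.fst (.mul (.fst .id) .snd))).sg f g

instance Sg.eq {f g : C → A.Num} [Fn f] [Fn g] : Sg (fun c => f c = g c) :=
  Sg.comp₂ (P := fun x y => x = y) (D0.eq (.fst .id) .snd).sg f g

instance Sg.ne {f g : C → A.Num} [Fn f] [Fn g] : Sg (fun c => f c ≠ g c) :=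
  Sg.comp₂ (P := fun x y => ¬ x = y) (D0.eq (.fst .id) .snd).not.sg f g

instance Sg.lt {f g : C → A.Num} [Fn f] [Fn g] : Sg (fun c => f c < g c) :=
  Sg.comp₂ (P := fun x y => x < y) (D0.lt (.fst .id) .snd).sg f g

instance Sg.le {f g : C → A.Num} [Fn f] [Fn g] : Sg (fun c => f c ≤ g c) :=
  (Sg.comp₂ (P := fun x y => ¬ x < y) (D0.lt (.fst .id) .snd).not.sg g f).congr
    fun _ => not_lt.symm

instance Pg.lt {f g : C → A.Num} [Fn f] [Fn g] : Pg (fun c => f c < g c) :=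
  Sg.comp₂ (P := fun x y => ¬ x < y) (D0.lt (.fst .id) .snd).not.sg f g

/-- The antecedent has to be `Π⁰₁`. This asymmetry dictates the form of the later induction
statements: a hypothesis that is only `Σ⁰₁` must be bounded, made `Δ⁰₁` or moved out. -/
instance Sg.imp {P Q : C → Prop} [Pg P] [Sg Q] : Sg (fun c => P c → Q c) :=
  (inferInstance : Sg (fun c => ¬ P c ∨ Q c)).congr fun _ => imp_iff_not_or

instance Sg.ball {f : C → A.Num} {P : C → A.Num → Prop} [hf : Fn f]
    [hP : Sg (fun d : C × A.Num => P d.1 d.2)] : Sg (fun c => ∀ x, x < f c → P c x) :=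
  Sg.subst (P := fun c y => ∀ x < y, P c x)
    (Sg.ball_pol (P := fun (d : C × A.Num) x => P d.1 x) hP.insert .snd) hf

instance Sg.ball_le {f : C → A.Num} {P : C → A.Num → Prop} [hf : Fn f]
    [hP : Sg (fun d : C × A.Num => P d.1 d.2)] : Sg (fun c => ∀ x, x ≤ f c → P c x) :=
  (inferInstance : Sg (fun c => ∀ x, x < f c + 1 → P c x)).congr fun c => by
    simp only [Num.lt_succ_iff]

instance Pg.and {P Q : C → Prop} [Pg P] [Pg Q] : Pg (fun c => P c ∧ Q c) :=
  (inferInstance : Sg (fun c => ¬ P c ∨ ¬ Q c)).congr fun _ => not_and_or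

instance Pg.or {P Q : C → Prop} [Pg P] [Pg Q] : Pg (fun c => P c ∨ Q c) :=
  (inferInstance : Sg (fun c => ¬ P c ∧ ¬ Q c)).congr fun _ => not_or

instance Pg.imp {P Q : C → Prop} [Sg P] [Pg Q] : Pg (fun c => P c → Q c) :=
  (inferInstance : Sg (fun c => P c ∧ ¬ Q c)).congr fun _ => Classical.not_imp

instance Pg.all {P : C → A.Num → Prop} [Pg (fun d : C × A.Num => P d.1 d.2)] :
    Pg (fun c => ∀ x, P c x) :=
  (inferInstance : Sg (fun c => ∃ x, ¬ P c x)).congr fun _ => not_forall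

/-- The graph is a disjunction in which the condition occurs positively and negatively, so the
condition has to be `Δ⁰₁`. -/
instance Fn.ite {P : C → Prop} {f g : C → A.Num} [Sg P] [Pg P] [hf : Fn f] [hg : Fn g]
    [∀ c, Decidable (P c)] : Fn (fun c => if P c then f c else g c) := by
  have h1 : Sg (fun d : C × A.Num => P d.1) := (inferInstance : Sg P).pullback
    (skip_injective (Ctx.len C)) (by simp [skip, Ctx.len]) Prod.fst fun _ _ h => h.1.skip le_rfl
  have h2 : Sg (fun d : C × A.Num => ¬ P d.1) := (inferInstance : Pg P).pullback
    (skip_injective (Ctx.len C)) (by simp [skip, Ctx.len]) Prod.fst fun _ _ h => h.1.skip le_rfl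
  have := hf.out
  have := hg.out
  refine ⟨(inferInstance : Sg (fun d : C × A.Num =>
    (P d.1 ∧ d.2 = f d.1) ∨ (¬ P d.1 ∧ d.2 = g d.1))).congr fun d => ?_⟩
  by_cases h : P d.1 <;> simp [h]

end

/-! ### Induction principles -/

theorem Sg.induct {P : A.Num → Prop} (hP : Sg P) (h0 : P 0) (hs : ∀ a, P a → P (a + 1))
    (a : A.Num) : P a :=
  Sg.induction (P := fun (_ : A.Num) x => P x) hP.shift 0 h0 hs a

theorem Num.cases' (a : A.Num) : a = 0 ∨ ∃ b, a = b + 1 := by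
  rcases (Num.zero_le' a).eq_or_lt with h | h
  · exact .inl h.symm
  · obtain ⟨c, rfl⟩ := Num.exists_add_of_le' (Num.succ_le_iff.2 h)
    exact .inr ⟨c, by rw [zero_add, add_comm]⟩

theorem Sg.strong {P : A.Num → Prop} (hP : Sg P) (h : ∀ a, (∀ b < a, P b) → P a) (a : A.Num) :
    P a := by
  -- A local instance: it lets instance search recognise `P` applied to any definable function.
  have := fun (C : Type u) [Ctx A C] (f : C → A.Num) [Fn f] => hP.comp f
  have key : ∀ a, ∀ b < a, P b := Sg.induct inferInstance
    (fun b hb => (Num.not_lt_zero _ hb).elim) fun a ih b hb => h b fun c hc =>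
      ih c (lt_of_lt_of_le hc (Num.lt_succ_iff.1 hb))
  exact h a (key a)

/-- The least number principle. -/
theorem Sg.least {P : A.Num → Prop} (hP : Sg P) {a : A.Num} (ha : P a) :
    ∃ b, P b ∧ ∀ c < b, ¬ P c := by
  by_contra! hn
  obtain ⟨Q, hQ, h⟩ := hP.out
  have := fun (C : Type u) [Ctx A C] (f : C → A.Num) [Fn f] => hP.comp f
  -- if `P` has no least element then neither has its bounded version
  have key : ∀ k, k ≤ a → ∃ b, b + k ≤ a ∧ P b := by
    refine fun k => Sg.induct (P := fun k => k ≤ a → ∃ b, b + k ≤ a ∧ P b) inferInstance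
      (fun _ => ⟨a, by simp, ha⟩) (fun k ih hk => ?_) k
    -- An element of `P` below `b` provides one more step of descent from `a`; after `a` steps the
    -- descent has reached `0`.
    obtain ⟨b, hb, hPb⟩ := ih ((Num.lt_succ_self k).le.trans hk)
    obtain ⟨c, hc, hPc⟩ := hn b hPb
    refine ⟨c, le_trans ?_ hb, hPc⟩
    rw [add_comm k, ← add_assoc]
    exact add_le_add_left (Num.succ_le_iff.2 hc) _
  obtain ⟨b, hb, hPb⟩ := key a le_rfl
  have : b = 0 := by
    rcases Num.cases' b with rfl | ⟨c, rfl⟩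
    · rfl
    · simp at hb
  obtain ⟨c, hc, -⟩ := hn b hPb
  exact Num.not_lt_zero _ (this ▸ hc)

/-- A failure would have a least counterexample, by the least number principle for the `Σ⁰₁`
negation. -/
theorem Pg.induct {P : A.Num → Prop} (hP : Pg P) (h0 : P 0) (hs : ∀ a, P a → P (a + 1))
    (a : A.Num) : P a := by
  by_contra h
  obtain ⟨b, hb, hm⟩ := hP.least h
  rcases Num.cases' b with rfl | ⟨c, rfl⟩
  · exact hb h0
  · exact hb (hs c (not_not.1 (hm c (Num.lt_succ_self c))))

theorem Pg.strong {P : A.Num → Prop} (hP : Pg P) (h : ∀ a, (∀ b < a, P b) → P a) (a : A.Num) :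
    P a := by
  by_contra h'
  obtain ⟨b, hb, hm⟩ := hP.least h'
  exact hb (h b fun c hc => not_not.1 (hm c hc))

end

/-! ## Sequences coded with the `β` function -/

section

variable {A : Structure2.{u}} [hA : Fact A.IsModelRCA0]

namespace Num

theorem exists_div (a : A.Num) {m : A.Num} (hm : 0 < m) : ∃ q x, a = q * m + x ∧ x < m := by
  refine Sg.induct (P := fun a => ∃ q x, a = q * m + x ∧ x < m) inferInstance
    ⟨0, 0, by simp, hm⟩ ?_ a
  rintro a ⟨q, x, rfl, hx⟩
  rcases (succ_le_iff.2 hx).lt_or_eq with h | h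
  · exact ⟨q, x + 1, add_assoc _ _ _, h⟩
  · refine ⟨q + 1, 0, ?_, hm⟩
    rw [add_assoc, h, add_zero, add_mul, one_mul]

theorem rem_unique {q q' m x x' : A.Num} (h : q * m + x = q' * m + x') (hx : x < m)
    (hx' : x' < m) : x = x' := by
  wlog hq : q ≤ q' generalizing q q' x x'
  · exact (this h.symm hx' hx (le_of_not_ge hq)).symm
  obtain ⟨c, rfl⟩ := exists_add_of_le' hq
  rw [add_mul, add_assoc] at h
  have h' := add_left_cancel h
  rcases cases' c with rfl | ⟨d, rfl⟩
  · simpa using h'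
  · exfalso
    rw [add_mul, one_mul, add_comm _ m, add_assoc] at h'
    exact absurd hx (not_lt.2 (h' ▸ le_self_add))

theorem beta_pos (b i : A.Num) : 0 < 1 + (i + 1) * b := lt_of_lt_of_le zero_lt_one'' le_self_add

end Num

/-- Entry `i` of the sequence coded by `a`, `b`. -/
noncomputable def bt (a b i : A.Num) : A.Num :=
  (Num.exists_div a (Num.beta_pos b i)).choose_spec.choose

theorem bt_lt (a b i : A.Num) : bt a b i < 1 + (i + 1) * b :=
  (Num.exists_div a (Num.beta_pos b i)).choose_spec.choose_spec.2

theorem bt_spec (a b i : A.Num) : ∃ q, a = q * (1 + (i + 1) * b) + bt a b i :=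
  ⟨_, (Num.exists_div a (Num.beta_pos b i)).choose_spec.choose_spec.1⟩

theorem eq_bt_iff {a b i x : A.Num} :
    x = bt a b i ↔ (∃ q, a = q * (1 + (i + 1) * b) + x) ∧ x < 1 + (i + 1) * b := by
  constructor
  · rintro rfl
    exact ⟨bt_spec a b i, bt_lt a b i⟩
  · rintro ⟨⟨q, hq⟩, hx⟩
    obtain ⟨q', hq'⟩ := bt_spec a b i
    exact Num.rem_unique (hq.symm.trans hq') hx (bt_lt a b i)

/-- All entries are bounded by the code itself. This later bounds everything that occurs in a coded
derivation or graph by a single number. -/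
theorem bt_le (a b i : A.Num) : bt a b i ≤ a := by
  obtain ⟨q, hq⟩ := bt_spec a b i
  nth_rw 2 [hq]
  exact le_add_self

instance Fn.bt {C : Type u} [Ctx A C] {f g h : C → A.Num} [hf : Fn f] [hg : Fn g] [hh : Fn h] :
    Fn (fun c => bt (f c) (g c) (h c)) :=
  have := hf.fst
  have := hg.fst
  have := hh.fst
  have := hf.fst.fst
  have := hg.fst.fst
  have := hh.fst.fst
  ⟨(inferInstance : Sg (fun d : C × A.Num => (∃ q, f d.1 = q * (1 + (h d.1 + 1) * g d.1) + d.2) ∧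
    d.2 < 1 + (h d.1 + 1) * g d.1)).congr fun _ => eq_bt_iff⟩

instance Fn.bt_eta (a b : A.Num) : Fn (CT.bt a b) :=
  Fn.bt (f := fun _ : A.Num => a) (g := fun _ => b) (h := fun i => i)

/-- Truncated subtraction. -/
noncomputable def monus (a b : A.Num) : A.Num :=
  if h : b ≤ a then (Num.exists_add_of_le' h).choose else 0

theorem monus_add {a b : A.Num} (h : b ≤ a) : b + monus a b = a := by
  rw [monus, dif_pos h]
  exact (Num.exists_add_of_le' h).choose_spec.symm

theorem monus_of_lt {a b : A.Num} (h : a < b) : monus a b = 0 := dif_neg (not_le.2 h)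

@[simp] theorem add_monus (a b : A.Num) : monus (a + b) a = b :=
  add_left_cancel (monus_add (le_self_add : a ≤ a + b))

theorem monus_le (a b : A.Num) : monus a b ≤ a := by
  rcases le_or_gt b a with h | h
  · nth_rw 2 [← monus_add h]; exact le_add_self
  · rw [monus_of_lt h]; exact Num.zero_le' a

theorem monus_monus {a b : A.Num} (h : b ≤ a) : monus a (monus a b) = b := by
  have h1 := monus_add (monus_le a b)
  have h2 := monus_add h
  rw [add_comm] at h2
  exact add_left_cancel (h1.trans h2.symm)

instance Fn.monus {C : Type u} [Ctx A C] {f g : C → A.Num} [Fn f] [Fn g] :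
    Fn (fun c => monus (f c) (g c)) := by
  refine Fn.comp₂ CT.monus ((inferInstance : Sg (fun d : (A.Num × A.Num) × A.Num =>
    (d.1.2 ≤ d.1.1 ∧ d.1.1 = d.1.2 + d.2) ∨ (d.1.1 < d.1.2 ∧ d.2 = 0))).congr fun d => ?_) f g
  rcases le_or_gt d.1.2 d.1.1 with h | h
  · simp only [h, true_and, not_lt.2 h, false_and, or_false]
    constructor
    · intro h'; rw [h', monus_add h]
    · intro h'; exact add_left_cancel (h'.symm.trans (monus_add h).symm)
  · simp [monus_of_lt h, h]

instance Fn.monus_eta (a : A.Num) : Fn (CT.monus a) :=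
  Fn.monus (f := fun _ : A.Num => a) (g := fun i => i)

theorem exists_bound (F : A.Num → A.Num) [Fn F] (n : A.Num) : ∃ B, ∀ i < n, F i < B := by
  have := fun (C : Type u) [Ctx A C] (f : C → A.Num) [Fn f] =>
    Fn.comp₁ F (Fn.out : Sg (fun d : A.Num × A.Num => d.2 = F d.1)) f
  refine Sg.induct (P := fun n => ∃ B, ∀ i, i < n → F i < B) inferInstance
    ⟨0, fun i hi => (Num.not_lt_zero i hi).elim⟩ ?_ n
  rintro n ⟨B, hB⟩
  refine ⟨max B (F n + 1), fun i hi => ?_⟩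
  rcases (Num.lt_succ_iff.1 hi).lt_or_eq with h | rfl
  · exact (hB i h).trans_le (le_max_left _ _)
  · exact (Num.lt_succ_self _).trans_le (le_max_right _ _)

theorem exists_common_multiple (n : A.Num) : ∃ m, 0 < m ∧ ∀ i < n, ∃ c, m = (i + 1) * c := by
  refine Sg.induct (P := fun n => ∃ m, 0 < m ∧ ∀ i, i < n → ∃ c, m = (i + 1) * c) inferInstance
    ⟨1, Num.zero_lt_one'', fun i hi => (Num.not_lt_zero i hi).elim⟩ ?_ n
  rintro n ⟨m, hm, h⟩
  refine ⟨m * (n + 1), mul_pos hm (lt_of_le_of_lt (Num.zero_le' n) (Num.lt_succ_self n)),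
    fun i hi => ?_⟩
  rcases (Num.lt_succ_iff.1 hi).lt_or_eq with hi | rfl
  · obtain ⟨c, rfl⟩ := h i hi
    exact ⟨c * (n + 1), mul_assoc _ _ _⟩
  · exact ⟨m, mul_comm _ _⟩

set_option synthInstance.maxHeartbeats 200000 in
set_option synthInstance.maxSize 2000 in
/-- Every definable function is coded by a sequence, on every initial segment. -/
theorem exists_seq (F : A.Num → A.Num) [Fn F] (n : A.Num) :
    ∃ a b, ∀ i < n, bt a b i = F i := by
  have := fun (C : Type u) [Ctx A C] (f : C → A.Num) [Fn f] =>
    Fn.comp₁ F (Fn.out : Sg (fun d : A.Num × A.Num => d.2 = F d.1)) f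
  obtain ⟨B, hB⟩ := exists_bound F n
  obtain ⟨m, hm, hd⟩ := exists_common_multiple n
  -- Being a multiple of `1, …, n`, `b` makes the moduli `1 + (i + 1) b` pairwise coprime; being
  -- larger than all values of `F`, it makes these values remainders.
  obtain ⟨b, hb⟩ : ∃ b, b = m * (B + 1) := ⟨_, rfl⟩
  have hBb : B < b := by
    refine (Num.lt_succ_self B).trans_le ?_
    have : (1 : A.Num) ≤ m := by simpa using Num.succ_le_iff.2 hm
    calc B + 1 = 1 * (B + 1) := (one_mul _).symm
      _ ≤ m * (B + 1) := mul_le_mul_of_nonneg_right this (Num.zero_le' _)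
      _ = b := hb.symm
  -- Bézout's identity without subtraction. Put `q = k + 1`, `p = j + 1`; then `p - q` divides `b`,
  -- say with quotient `c`. Over the integers `b = c p (1 + q b) - c q (1 + p b)` and `1 = (1 - p
  -- b)(1 + p b) + (p b)²`. Combining these and adding the product of the two moduli to both sides
  -- makes all coefficients nonnegative.
  have cop : ∀ k j, k < j → j < n → ∃ x y, (1 + (k + 1) * b) * x = 1 + (1 + (j + 1) * b) * y := by
    intro k j hkj hj
    obtain ⟨d', rfl⟩ := Num.exists_add_of_le' (Num.succ_le_iff.2 hkj)
    obtain ⟨c', hc'⟩ := hd d' (lt_of_le_of_lt le_add_self hj)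
    obtain ⟨c, hc⟩ : ∃ c, b = (d' + 1) * c := ⟨c' * (B + 1), by rw [hb, hc', mul_assoc]⟩
    refine ⟨c * (k + 1 + d' + 1) ^ 3 * b + (1 + (k + 1 + d' + 1) * b),
      (k + 1 + d' + 1) ^ 2 * b * c * (k + 1) + (k + 1 + d' + 1) * b + (k + 1) * b, ?_⟩
    rw [hc]
    ring
  -- Chinese remaindering: `a` solves the congruences before `k`, `p` is a common multiple of the
  -- moduli used, and `p` is invertible modulo each of the remaining ones.
  have key : ∀ k, k ≤ n → ∃ a p, (∀ i, i < k → ∃ q, a = q * (1 + (i + 1) * b) + F i) ∧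
      (∀ i, i < k → ∃ q, p = (1 + (i + 1) * b) * q) ∧
      ∀ j, j < n → k ≤ j → ∃ x y, p * x = 1 + (1 + (j + 1) * b) * y := by
    refine Sg.induct inferInstance ?_ ?_
    · exact fun _ => ⟨0, 1, fun i hi => (Num.not_lt_zero i hi).elim,
        fun i hi => (Num.not_lt_zero i hi).elim, fun j _ _ => ⟨1, 0, by simp⟩⟩
    · intro k ih hk
      obtain ⟨a, p, h1, h2, h3⟩ := ih ((Num.lt_succ_self k).le.trans hk)
      obtain ⟨x, y, hxy⟩ := h3 k (Num.succ_le_iff.1 hk) le_rfl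
      -- Modulo the new modulus `p x` is `1`, and `a (k + 1) b` takes the place of `-a`, since the
      -- two differ by a multiple of the modulus. The new value is therefore congruent to `F k`, and
      -- the old congruences are kept because `p` is a multiple of the old moduli.
      refine ⟨a + p * (x * (F k + a * ((k + 1) * b))), p * (1 + (k + 1) * b), fun i hi => ?_,
        fun i hi => ?_, fun j hj hkj => ?_⟩
      · rcases (Num.lt_succ_iff.1 hi).lt_or_eq with hi | rfl
        · obtain ⟨q, hq⟩ := h1 i hi
          obtain ⟨q', hq'⟩ := h2 i hi
          refine ⟨q + q' * (x * (F k + a * ((k + 1) * b))), ?_⟩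
          nth_rw 1 [hq]
          nth_rw 1 [hq']
          ring
        · refine ⟨a + y * (F i + a * ((i + 1) * b)), ?_⟩
          rw [← mul_assoc, hxy]
          ring
      · rcases (Num.lt_succ_iff.1 hi).lt_or_eq with hi | rfl
        · obtain ⟨q', hq'⟩ := h2 i hi
          exact ⟨q' * (1 + (k + 1) * b), by rw [hq', mul_assoc]⟩
        · exact ⟨p, mul_comm _ _⟩
      · obtain ⟨x, y, h⟩ := h3 j hj ((Num.lt_succ_self k).le.trans hkj)
        obtain ⟨x', y', h'⟩ := cop k j (Num.succ_le_iff.1 hkj) hj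
        refine ⟨x * x', y + y' + (1 + (j + 1) * b) * y * y', ?_⟩
        calc p * (1 + (k + 1) * b) * (x * x') = (p * x) * ((1 + (k + 1) * b) * x') := by ring
          _ = _ := by rw [h, h']; ring
  obtain ⟨a, p, h1, -, -⟩ := key n le_rfl
  refine ⟨a, b, fun i hi => (eq_bt_iff.2 ⟨h1 i hi, ?_⟩).symm⟩
  calc F i < b := (hB i hi).trans hBb
    _ ≤ (i + 1) * b := le_mul_of_one_le_left (Num.zero_le' _) le_add_self
    _ ≤ _ := le_add_self

theorem exists_append (a b n y : A.Num) :
    ∃ a' b', (∀ i < n, bt a' b' i = bt a b i) ∧ bt a' b' n = y := by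
  obtain ⟨a', b', h⟩ := exists_seq (fun i : A.Num => if i < n then bt a b i else y) (n + 1)
  refine ⟨a', b', fun i hi => ?_, ?_⟩
  · rw [h i (hi.trans (Num.lt_succ_self n)), if_pos hi]
  · rw [h n (Num.lt_succ_self n), if_neg (lt_irrefl n)]

theorem Num.lt_succ_cases {i n : A.Num} (h : i < n + 1) : i < n ∨ i = n :=
  (Num.lt_succ_iff.1 h).lt_or_eq

theorem Num.succ_lt_succ {i n : A.Num} (h : i < n) : i + 1 < n + 1 := Num.add_lt_add_right'' h 1

/-- Backward induction; the induction variable is the number of steps taken down from `n`. -/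
theorem Sg.descend {P : A.Num → Prop} (hP : Sg P) {n : A.Num} (hn : P n)
    (h : ∀ i < n, P (i + 1) → P i) {i : A.Num} (hi : i ≤ n) : P i := by
  have := fun (C : Type u) [Ctx A C] (f : C → A.Num) [Fn f] => hP.comp f
  have key : ∀ k, k ≤ n → P (CT.monus n k) := by
    refine Sg.induct inferInstance (fun _ => ?_) fun k ih hk => ?_
    · rwa [show CT.monus n 0 = n by simpa using add_monus 0 n]
    · obtain ⟨c, rfl⟩ := Num.exists_add_of_le' hk
      rw [add_monus]
      have ih := ih (le_trans le_self_add hk)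
      rw [show k + 1 + c = k + (c + 1) by ring, add_monus] at ih
      exact h c (lt_of_lt_of_le (Num.lt_succ_self c) (by rw [add_assoc, add_comm 1]; exact le_add_self)) ih
  have := key _ (monus_le n i)
  rwa [monus_monus hi] at this

/-- Dependent choice along a coded sequence. -/
theorem exists_chain {P : A.Num → A.Num → Prop} {S : A.Num → A.Num → A.Num → Prop}
    (hP : Sg (fun d : A.Num × A.Num => P d.1 d.2))
    (hS : Sg (fun d : (A.Num × A.Num) × A.Num => S d.1.1 d.1.2 d.2)) (n : A.Num) {x : A.Num}
    (h0 : P 0 x) (h : ∀ i < n, ∀ x, P i x → ∃ y, P (i + 1) y ∧ S i x y) :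
    ∃ a b, bt a b 0 = x ∧ (∀ i ≤ n, P i (bt a b i)) ∧
      ∀ i < n, S i (bt a b i) (bt a b (i + 1)) := by
  have := fun (C : Type u) [Ctx A C] (f g : C → A.Num) [Fn f] [Fn g] => hP.comp₂ f g
  have := fun (C : Type u) [Ctx A C] (f g h : C → A.Num) [Fn f] [Fn g] [Fn h] => hS.comp₃ f g h
  have key : ∀ k, k ≤ n → ∃ a b, bt a b 0 = x ∧ (∀ i, i ≤ k → P i (bt a b i)) ∧
      ∀ i, i < k → S i (bt a b i) (bt a b (i + 1)) := by
    refine Sg.induct inferInstance (fun _ => ?_) fun k ih hk => ?_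
    · obtain ⟨a, b, -, hab⟩ := exists_append (0 : A.Num) 0 0 x
      refine ⟨a, b, hab, fun i hi => ?_, fun i hi => (Num.not_lt_zero i hi).elim⟩
      rw [le_antisymm hi (Num.zero_le' i), hab]
      exact h0
    · obtain ⟨a, b, h1, h2, h3⟩ := ih ((Num.lt_succ_self k).le.trans hk)
      obtain ⟨y, hy, hS⟩ := h k (Num.succ_le_iff.1 hk) _ (h2 k le_rfl)
      obtain ⟨a', b', h4, h5⟩ := exists_append a b (k + 1) y
      refine ⟨a', b', ?_, fun i hi => ?_, fun i hi => ?_⟩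
      · rw [h4 0 (Num.lt_succ_iff.2 (Num.zero_le' k)), h1]
      · rcases hi.lt_or_eq with hi | rfl
        · rw [h4 i hi]; exact h2 i (Num.lt_succ_iff.1 hi)
        · rw [h5]; exact hy
      · rw [h4 i hi]
        rcases Num.lt_succ_cases hi with hi | rfl
        · rw [h4 _ (Num.succ_lt_succ hi)]; exact h3 i hi
        · rw [h5]; exact hS
  exact key n le_rfl

-- The chain is grown from its last entry. The indices are reversed with `monus` in order to apply
-- `exists_chain`, and the resulting sequence is recoded in reverse order.
set_option synthInstance.maxHeartbeats 200000 in
set_option synthInstance.maxSize 2000 in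
theorem exists_chain_descending {P : A.Num → A.Num → Prop} {S : A.Num → A.Num → A.Num → Prop}
    (hP : Sg (fun d : A.Num × A.Num => P d.1 d.2))
    (hS : Sg (fun d : (A.Num × A.Num) × A.Num => S d.1.1 d.1.2 d.2)) (n : A.Num) {x : A.Num}
    (h0 : P n x) (h : ∀ i < n, ∀ x, P (i + 1) x → ∃ y, P i y ∧ S i y x) :
    ∃ a b, bt a b n = x ∧ (∀ i ≤ n, P i (bt a b i)) ∧
      ∀ i < n, S i (bt a b i) (bt a b (i + 1)) := by
  have := fun (C : Type u) [Ctx A C] (f g : C → A.Num) [Fn f] [Fn g] => hP.comp₂ f g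
  have := fun (C : Type u) [Ctx A C] (f g h : C → A.Num) [Fn f] [Fn g] [Fn h] => hS.comp₃ f g h
  have hm {i : A.Num} (hi : i < n) : monus n i = monus n (i + 1) + 1 ∧ monus n (i + 1) < n := by
    obtain ⟨c, rfl⟩ := Num.exists_add_of_le' (Num.succ_le_iff.2 hi)
    rw [add_monus, show i + 1 + c = i + (c + 1) by ring, add_monus]
    exact ⟨rfl, lt_of_lt_of_le (Num.lt_succ_self c) le_add_self⟩
  have hS' : Sg (fun d : (A.Num × A.Num) × A.Num => S (CT.monus n (d.1.1 + 1)) d.2 d.1.2) := by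
    infer_instance
  obtain ⟨a, b, h1, h2, h3⟩ := exists_chain (P := fun i x => P (CT.monus n i) x)
    (S := fun i x y => S (CT.monus n (i + 1)) y x) inferInstance hS' n (x := x)
    (by rwa [show CT.monus n 0 = n by simpa using add_monus 0 n]) fun i hi x hx => by
      obtain ⟨h1, h2⟩ := hm hi
      rw [h1] at hx
      exact h _ h2 x hx
  obtain ⟨a', b', h4⟩ := exists_seq (fun i : A.Num => bt a b (CT.monus n i)) (n + 1)
  have hle {i : A.Num} (hi : i ≤ n) : bt a' b' i = bt a b (CT.monus n i) :=
    h4 i (Num.lt_succ_iff.2 hi)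
  refine ⟨a', b', ?_, fun i hi => ?_, fun i hi => ?_⟩
  · rw [hle le_rfl, show CT.monus n n = 0 by simpa using add_monus n 0, h1]
  · have := h2 _ (monus_le n i)
    rw [monus_monus hi] at this
    rwa [hle hi]
  · obtain ⟨h5, h6⟩ := hm hi
    have := h3 _ h6
    rwa [← h5, monus_monus hi.le, ← hle hi.le, ← hle (Num.succ_le_iff.2 hi)] at this

/-- Bounded `Σ⁰₁` comprehension. -/
theorem exists_bounded_compr {P : A.Num → Prop} (hP : Sg P) (n : A.Num) :
    ∃ Q : A.Num → Prop, Sg Q ∧ Pg Q ∧ ∀ i < n, (P i ↔ Q i) := by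
  have := fun (C : Type u) [Ctx A C] (f : C → A.Num) [Fn f] => hP.comp f
  -- `S s` says that some counter, which moves by at most one at each `j < n` and only where `P j`
  -- holds, ends at `s`. A counter with maximal end value moves exactly at the elements of `P`, and
  -- whether it moves is a `Δ⁰₁` question.
  let S : A.Num → Prop := fun s => ∃ a b, bt a b 0 = 0 ∧ (∀ j, j < n →
    bt a b (j + 1) = bt a b j ∨ (bt a b (j + 1) = bt a b j + 1 ∧ P j)) ∧ bt a b n = s
  have hS0 : S 0 := by
    obtain ⟨a, b, h⟩ := exists_seq (fun _ : A.Num => (0 : A.Num)) (n + 1)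
    refine ⟨a, b, h 0 (Num.lt_succ_iff.2 (Num.zero_le' _)), fun j hj => .inl ?_,
      h n (Num.lt_succ_self n)⟩
    rw [h _ (Num.succ_lt_succ hj), h _ (hj.trans (Num.lt_succ_self n))]
  have hSn : ∀ s, S s → s ≤ n := by
    rintro s ⟨a, b, h0, h, rfl⟩
    have : ∀ j, j ≤ n → bt a b j ≤ j := by
      refine Sg.induct inferInstance (fun _ => h0.le) fun j ih hj => ?_
      have ih := ih ((Num.lt_succ_self j).le.trans hj)
      rcases h j (Num.succ_le_iff.1 hj) with h | ⟨h, -⟩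
      · rw [h]; exact ih.trans (Num.lt_succ_self j).le
      · rw [h]; exact add_le_add_left ih 1
    exact this n le_rfl
  obtain ⟨s, hs, hs'⟩ : ∃ s, S s ∧ ¬ S (s + 1) := by
    by_contra! h
    have : S (n + 1) := Sg.induct (P := S) inferInstance hS0 h _
    exact absurd (hSn _ this) (not_le.2 (Num.lt_succ_self n))
  obtain ⟨a, b, h0, h, rfl⟩ := hs
  refine ⟨fun i => bt a b (i + 1) = bt a b i + 1, inferInstance, inferInstance, fun i hi =>
    ⟨fun hPi => ?_, fun hi' => ?_⟩⟩
  · rcases h i hi with h1 | ⟨h1, -⟩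
    -- An element of `P` that was not counted would allow a larger count: raise the counter by one
    -- from that point on.
    · refine (hs' ?_).elim
      obtain ⟨a', b', h'⟩ := exists_seq
        (fun j : A.Num => if j ≤ i then bt a b j else bt a b j + 1) (n + 1)
      refine ⟨a', b', ?_, fun j hj => ?_, ?_⟩
      · rw [h' 0 (Num.lt_succ_iff.2 (Num.zero_le' _)), if_pos (Num.zero_le' i), h0]
      · rw [h' _ (Num.succ_lt_succ hj), h' _ (hj.trans (Num.lt_succ_self n))]
        rcases lt_trichotomy j i with hji | rfl | hji
        · rw [if_pos hji.le, if_pos (Num.succ_le_iff.2 hji)]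
          exact h j hj
        · rw [if_pos le_rfl, if_neg (not_le.2 (Num.lt_succ_self j)), h1]
          exact .inr ⟨rfl, hPi⟩
        · rw [if_neg (not_le.2 hji), if_neg (not_le.2 (hji.trans (Num.lt_succ_self j)))]
          exact (h j hj).imp (fun h => by rw [h]) fun h => ⟨by rw [h.1], h.2⟩
      · rw [h' n (Num.lt_succ_self n), if_neg (not_le.2 hi)]
    · exact h1
  · rcases h i hi with h1 | ⟨-, h1⟩
    · exact absurd (h1.symm.trans hi') (Num.lt_succ_self _).ne
    · exact h1

end

/-! ## Derivations -/

section

variable {A : Structure2.{u}} [hA : Fact A.IsModelRCA0]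

/-- `y` is one of the first `n` entries of the sequence coded by `a`, `b`. -/
def In (a b n y : A.Num) : Prop := ∃ j, j < n ∧ bt a b j = y

instance Sg.inSeq {C : Type u} [Ctx A C] {f g h k : C → A.Num} [hf : Fn f] [hg : Fn g] [Fn h]
    [hk : Fn k] : Sg (fun c => In (f c) (g c) (h c) (k c)) :=
  have := hf.fst
  have := hg.fst
  have := hk.fst
  have := (inferInstance : Fn h).fst
  (inferInstance : Sg (fun c => ∃ j, j < h c ∧ bt (f c) (g c) j = k c))

/-- `y` follows by one of the finitary rules `Rl`. The premisses of an ordinary rule have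
to satisfy `P`, those of a circular rule have to satisfy `Q`. -/
def Step (Rl : Bool → List A.Num → A.Num → Prop) (P Q : A.Num → Prop) (y : A.Num) : Prop :=
  ∃ c l, Rl c l y ∧ ∀ x ∈ l, (c = false → P x) ∧ (c = true → Q x)

theorem Step.mono {Rl : Bool → List A.Num → A.Num → Prop} {P P' Q Q' : A.Num → Prop} {y : A.Num}
    (h : Step Rl P Q y) (hP : ∀ x, P x → P' x) (hQ : ∀ x, Q x → Q' x) : Step Rl P' Q' y := by
  obtain ⟨c, l, h1, h2⟩ := h
  exact ⟨c, l, h1, fun x hx => ⟨fun h => hP x ((h2 x hx).1 h), fun h => hQ x ((h2 x hx).2 h)⟩⟩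

/-- One inference step preserves `Σ⁰₁` definability; derivability by the rules is then `Σ⁰₁` itself.
-/
class Rules (Rl : Bool → List A.Num → A.Num → Prop) : Prop where
  sg : ∀ {C : Type u} [Ctx A C] {P Q : C → A.Num → Prop} {f : C → A.Num},
    Sg (fun d : C × A.Num => P d.1 d.2) → Sg (fun d : C × A.Num => Q d.1 d.2) → Fn f →
    Sg (fun c => Step Rl (P c) (Q c) (f c))

/-- Ordinary premisses are looked up before position `i`, circular ones in the whole sequence. -/
def IsDer (Rl : Bool → List A.Num → A.Num → Prop) (a b n : A.Num) : Prop :=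
  ∀ i, i < n → Step Rl (In a b i) (In a b n) (bt a b i)

def Der (Rl : Bool → List A.Num → A.Num → Prop) (y : A.Num) : Prop :=
  ∃ a b n, In a b n y ∧ IsDer Rl a b n

variable {Rl : Bool → List A.Num → A.Num → Prop} {a b n y : A.Num}

instance Sg.isDer [hR : Rules Rl] {C : Type u} [Ctx A C] {f g h : C → A.Num} [hf : Fn f]
    [hg : Fn g] [hh : Fn h] : Sg (fun c => IsDer Rl (f c) (g c) (h c)) := by
  have := hf.fst
  have := hg.fst
  have := hh.fst
  have := hf.fst.fst
  have := hg.fst.fst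
  have := hh.fst.fst
  have : Sg (fun d : C × A.Num => Step Rl (In (f d.1) (g d.1) d.2) (In (f d.1) (g d.1) (h d.1))
      (bt (f d.1) (g d.1) d.2)) := hR.sg inferInstance inferInstance inferInstance
  exact (inferInstance : Sg (fun c => ∀ i, i < h c → Step Rl (In (f c) (g c) i)
    (In (f c) (g c) (h c)) (bt (f c) (g c) i)))

theorem Sg.der (Rl : Bool → List A.Num → A.Num → Prop) [hR : Rules Rl] : Sg (Der Rl) := by
  have : Sg (fun y : A.Num => ∃ a b n, In a b n y ∧ IsDer Rl a b n) := inferInstance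
  exact this

theorem IsDer.nil : IsDer Rl a b 0 := fun i hi => (Num.not_lt_zero i hi).elim

theorem IsDer.der (h : IsDer Rl a b n) {y : A.Num} (hy : In a b n y) : Der Rl y :=
  ⟨a, b, n, hy, h⟩

theorem In.mono {m : A.Num} (h : In a b m y) (hm : m ≤ n) : In a b n y :=
  h.imp fun _ hj => ⟨hj.1.trans_le hm, hj.2⟩

theorem IsDer.step (h : IsDer Rl a b n) (hy : In a b n y) :
    Step Rl (In a b n) (In a b n) y := by
  obtain ⟨i, hi, rfl⟩ := hy
  exact (h i hi).mono (fun x hx => hx.mono hi.le) fun x hx => hx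

/-- The appended block may refer to itself, backwards for ordinary rules and in any direction for
circular ones; this is how circular derivations are built. -/
theorem IsDer.extend (h : IsDer Rl a b n) (F : A.Num → A.Num) [Fn F] (m : A.Num)
    (hF : ∀ i < m, Step Rl (fun y => In a b n y ∨ ∃ j < i, F j = y)
      (fun y => In a b n y ∨ ∃ j < m, F j = y) (F i)) :
    ∃ a' b', IsDer Rl a' b' (n + m) ∧ (∀ i < n, bt a' b' i = bt a b i) ∧
      ∀ i < m, bt a' b' (n + i) = F i := by
  have := fun (C : Type u) [Ctx A C] (f : C → A.Num) [Fn f] =>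
    Fn.comp₁ F (Fn.out : Sg (fun d : A.Num × A.Num => d.2 = F d.1)) f
  obtain ⟨a', b', hab⟩ := exists_seq
    (fun i : A.Num => if i < n then bt a b i else F (CT.monus i n)) (n + m)
  have h1 : ∀ i < n, bt a' b' i = bt a b i := fun i hi => by
    rw [hab i (hi.trans_le le_self_add), if_pos hi]
  have h2 : ∀ i < m, bt a' b' (n + i) = F i := fun i hi => by
    rw [hab _ (add_lt_add_right hi n), if_neg (not_lt.2 le_self_add), add_monus]
  refine ⟨a', b', fun i hi => ?_, h1, h2⟩
  have hl : ∀ k y, k ≤ n → In a b k y → In a' b' k y := by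
    rintro k y hk ⟨j, hj, rfl⟩
    exact ⟨j, hj, h1 j (hj.trans_le hk)⟩
  rcases lt_or_ge i n with hin | hin
  · rw [h1 i hin]
    exact (h i hin).mono (fun y => hl i y hin.le) fun y hy => (hl n y le_rfl hy).mono le_self_add
  · obtain ⟨k, rfl⟩ := Num.exists_add_of_le' hin
    have hk : k < m := lt_of_add_lt_add_left hi
    rw [h2 k hk]
    refine (hF k hk).mono ?_ ?_
    · rintro y (hy | ⟨j, hj, rfl⟩)
      · exact (hl n y le_rfl hy).mono le_self_add
      · exact ⟨n + j, add_lt_add_right hj n, h2 j (hj.trans hk)⟩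
    · rintro y (hy | ⟨j, hj, rfl⟩)
      · exact (hl n y le_rfl hy).mono le_self_add
      · exact ⟨n + j, add_lt_add_right hj n, h2 j hj⟩

theorem IsDer.merge {a' b' n' : A.Num} (h : IsDer Rl a b n) (h' : IsDer Rl a' b' n') :
    ∃ a'' b'' n'', IsDer Rl a'' b'' n'' ∧ (∀ y, In a b n y → In a'' b'' n'' y) ∧
      ∀ y, In a' b' n' y → In a'' b'' n'' y := by
  obtain ⟨a'', b'', h1, h2, h3⟩ := h.extend (bt a' b') n' fun i hi =>
    (h' i hi).mono (fun y hy => .inr hy) fun y hy => .inr hy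
  refine ⟨a'', b'', n + n', h1, ?_, ?_⟩
  · rintro y ⟨j, hj, rfl⟩
    exact ⟨j, hj.trans_le le_self_add, h2 j hj⟩
  · rintro y ⟨j, hj, rfl⟩
    exact ⟨n + j, add_lt_add_right hj n, h3 j hj⟩

/-- The premisses of a clause form a list of the metatheory, so no induction in the model is needed
to collect their derivations. -/
theorem Der.list {l : List A.Num} (hl : ∀ y ∈ l, Der Rl y) :
    ∃ a b n, IsDer Rl a b n ∧ ∀ y ∈ l, In a b n y := by
  induction l with
  | nil => exact ⟨0, 0, 0, .nil, by simp⟩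
  | cons x l ih =>
    obtain ⟨a, b, n, h1, h2⟩ := ih fun y hy => hl y (.tail _ hy)
    obtain ⟨a', b', n', h3, h4⟩ := hl x (.head _)
    obtain ⟨a'', b'', n'', h5, h6, h7⟩ := h1.merge h4
    refine ⟨a'', b'', n'', h5, fun y hy => ?_⟩
    rcases List.mem_cons.1 hy with rfl | hy
    exacts [h7 _ h3, h6 _ (h2 _ hy)]

/-- The formula `derivable` wants the judgment in the last position. An entry may be repeated at the
end, justified by the same rule. -/
theorem Der.last (hy : Der Rl y) : ∃ a b n, bt a b n = y ∧ IsDer Rl a b (n + 1) := by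
  obtain ⟨a, b, n, h, hd⟩ := hy
  obtain ⟨a', b', h1, -, h3⟩ := hd.extend (fun _ => y) 1 fun i hi =>
    (hd.step h).mono (fun y hy => .inl hy) fun y hy => .inl hy
  exact ⟨a', b', n, by simpa using h3 0 Num.zero_lt_one'', h1⟩

theorem Der.of_step (h : Step Rl (Der Rl) (Der Rl) y) : Der Rl y := by
  obtain ⟨c, l, h1, h2⟩ := h
  obtain ⟨a, b, n, h3, h4⟩ := Der.list (Rl := Rl) (l := l) fun x hx => by
    cases c
    exacts [(h2 x hx).1 rfl, (h2 x hx).2 rfl]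
  obtain ⟨a', b', h5, -, h6⟩ := h3.extend (fun _ => y) 1 fun i hi =>
    ⟨c, l, h1, fun x hx => ⟨fun _ => .inl (h4 x hx), fun _ => .inl (h4 x hx)⟩⟩
  exact h5.der ⟨n, Num.lt_succ_self n, by simpa using h6 0 Num.zero_lt_one''⟩

theorem Der.step (h : Der Rl y) : Step Rl (Der Rl) (Der Rl) y := by
  obtain ⟨a, b, n, hy, hd⟩ := h
  exact (hd.step hy).mono (fun x => hd.der) fun x => hd.der

/-- Induction on the position in the sequence. A circular premiss may stand after its conclusion, so
only ordinary premisses carry an induction hypothesis. -/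
theorem IsDer.induct (h : IsDer Rl a b n) {P : A.Num → Prop} (hP : Sg P ∨ Pg P)
    (hs : ∀ y, In a b n y → Step Rl (fun x => In a b n x ∧ P x) (In a b n) y → P y)
    (hy : In a b n y) : P y := by
  obtain ⟨i, hi, rfl⟩ := hy
  have key : ∀ i, (∀ j < i, j < n → P (bt a b j)) → i < n → P (bt a b i) := by
    refine fun i ih hi => hs _ ⟨i, hi, rfl⟩ ((h i hi).mono ?_ fun x hx => hx)
    rintro y ⟨j, hj, rfl⟩
    exact ⟨⟨j, hj.trans hi, rfl⟩, ih j hj (hj.trans hi)⟩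
  rcases hP with hP | hP
  · have := fun (C : Type u) [Ctx A C] (f : C → A.Num) [Fn f] => hP.comp f
    exact Sg.strong (P := fun i => i < n → P (bt a b i)) inferInstance key i hi
  · have := fun (C : Type u) [Ctx A C] (f : C → A.Num) [Fn f] => hP.comp f
    exact Pg.strong (P := fun i => i < n → P (bt a b i)) inferInstance key i hi

theorem Der.induct {P : A.Num → Prop} (hP : Sg P ∨ Pg P)
    (hs : ∀ y, Der Rl y → Step Rl (fun x => Der Rl x ∧ P x) (Der Rl) y → P y)
    (hy : Der Rl y) : P y := by
  obtain ⟨a, b, n, hy, hd⟩ := hy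
  exact hd.induct hP (fun y hy h => hs y (hd.der hy)
    (h.mono (fun x hx => ⟨hd.der hx.1, hx.2⟩) fun x => hd.der)) hy

/-- A bounded `Σ⁰₁` set of judgments, each of which follows from judgments that are in the set (when
the rule is circular) or already derivable, can be written down as one finite circular derivation.
Bounded comprehension replaces the set by a `Δ⁰₁` one, which can be enumerated by a coded sequence.
-/
theorem Der.coinduct [hR : Rules Rl] {W : A.Num → Prop} (hW : Sg W) (B : A.Num)
    (hB : ∀ y, W y → y < B) (h : ∀ y, W y → Step Rl (Der Rl) (fun x => W x ∨ Der Rl x) y)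
    (hy : W y) : Der Rl y := by
  obtain ⟨Q, hQ, hQ', hWQ⟩ := exists_bounded_compr hW B
  have := fun (C : Type u) [Ctx A C] (f : C → A.Num) [Fn f] => hW.comp f
  have := fun (C : Type u) [Ctx A C] (f : C → A.Num) [Fn f] => hQ.comp f
  have := fun (C : Type u) [Ctx A C] (f : C → A.Num) [Fn f] => hQ'.comp f
  have hsg : Sg (fun d : ((((A.Num × A.Num) × A.Num) × A.Num) × A.Num) =>
      Step Rl (In d.1.1.1.2 d.1.1.2 d.1.2) (fun x => W x ∨ In d.1.1.1.2 d.1.1.2 d.1.2 x) d.2) :=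
    hR.sg inferInstance inferInstance inferInstance
  -- One derivation is to contain the derivable premisses of all elements below `k`; it is built by
  -- adding those of one element at a time.
  have key : ∀ k, ∃ a b n, IsDer Rl a b n ∧ ∀ i, i < k → i < B → Q i →
      Step Rl (In a b n) (fun x => W x ∨ In a b n x) i := by
    refine Sg.induct inferInstance
      ⟨0, 0, 0, .nil, fun i hi => (Num.not_lt_zero i hi).elim⟩ ?_
    rintro k ⟨a, b, n, h1, h2⟩
    by_cases hk : k < B ∧ Q k
    · obtain ⟨c, l, h3, h4⟩ := h k ((hWQ k hk.1).2 hk.2)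
      classical
      obtain ⟨a', b', n', h5, h6⟩ := Der.list (Rl := Rl) (l := l.filter (Der Rl)) (by simp)
      obtain ⟨a'', b'', n'', h7, h8, h9⟩ := h1.merge h5
      refine ⟨a'', b'', n'', h7, fun i hi hiB hQi => ?_⟩
      rcases Num.lt_succ_cases hi with hi | rfl
      · exact (h2 i hi hiB hQi).mono h8 fun x => Or.imp_right (h8 x)
      · refine ⟨c, l, h3, fun x hx => ⟨fun hc => ?_, fun hc => ?_⟩⟩
        · exact h9 _ (h6 x (by simpa [hx] using (h4 x hx).1 hc))
        · exact ((h4 x hx).2 hc).imp_right fun hD => h9 _ (h6 x (by simpa [hx] using hD))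
    · refine ⟨a, b, n, h1, fun i hi hiB hQi => ?_⟩
      rcases Num.lt_succ_cases hi with hi | rfl
      exacts [h2 i hi hiB hQi, (hk ⟨hiB, hQi⟩).elim]
  obtain ⟨a, b, n, h1, h2⟩ := key B
  classical
  have hF : ∀ i, Q (if Q i then i else y) := fun i => by
    split_ifs with h
    exacts [h, (hWQ y (hB y hy)).1 hy]
  have hFB : ∀ i < B, (if Q i then i else y) < B := fun i hi => by
    split_ifs
    exacts [hi, hB y hy]
  -- The appended block lists all numbers below `B`, with `y` in place of those outside `Q`. Every
  -- entry then belongs to `Q`, and premisses taken from `W` are found in the block itself.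
  obtain ⟨a', b', h3, -, h4⟩ := h1.extend (fun i => if Q i then i else y) B fun i hi => by
    refine (h2 _ (hFB i hi) (hFB i hi) (hF i)).mono (fun x hx => .inl hx) fun x hx =>
      hx.symm.imp_right fun hx => ?_
    exact ⟨x, hB x hx, if_pos ((hWQ x (hB x hx)).1 hx)⟩
  have hyB := hB y hy
  refine h3.der ⟨n + y, add_lt_add_right hyB n, ?_⟩
  rw [h4 y hyB, ite_self]

end

/-! ## Derivability in arithmetic -/

theorem Fml.sat_foldr_ex {A : Structure2.{u}} {E : ℕ → Set A.Num} {φ : Fml} {vs : List ℕ}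
    {e : ℕ → A.Num} : (vs.foldr Fml.ex φ).Sat A e E ↔
      ∃ f : ℕ → A.Num, (∀ i, i ∉ vs → f i = e i) ∧ φ.Sat A f E := by
  induction vs generalizing e with
  | nil => exact ⟨fun h => ⟨e, by simp, h⟩, fun ⟨f, h1, h2⟩ =>
      by rwa [show f = e from funext fun i => h1 i (by simp)] at h2⟩
  | cons v vs ih =>
    simp only [List.foldr_cons, Fml.Sat, ih, List.mem_cons, not_or]
    constructor
    · rintro ⟨a, f, h1, h2⟩
      exact ⟨f, fun i hi => by rw [h1 i hi.2, Function.update_of_ne hi.1], h2⟩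
    · rintro ⟨f, h1, h2⟩
      refine ⟨f v, f, fun i hi => ?_, h2⟩
      by_cases h : i = v
      · rw [h, Function.update_self]
      · rw [Function.update_of_ne h, h1 i ⟨h, hi⟩]

theorem Fml.sat_conj {A : Structure2.{u}} {e : ℕ → A.Num} {E : ℕ → Set A.Num} {l : List Fml} :
    (Arith.conj l).Sat A e E ↔ ∀ φ ∈ l, φ.Sat A e E := by
  induction l with
  | nil => simp [Arith.conj, Fml.Sat]
  | cons φ l ih => simpa [Arith.conj, Fml.Sat] using fun _ => ih

theorem Fml.sat_disj {A : Structure2.{u}} {e : ℕ → A.Num} {E : ℕ → Set A.Num} {l : List Fml} :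
    (Arith.disj l).Sat A e E ↔ ∃ φ ∈ l, φ.Sat A e E := by
  induction l with
  | nil => simp [Arith.disj, Fml.Sat]
  | cons φ l ih =>
    have : (Arith.disj (φ :: l)).Sat A e E ↔ φ.Sat A e E ∨ (Arith.disj l).Sat A e E := Iff.rfl
    rw [this, ih]
    simp

/-- All variables of `t` are below `n`. -/
def Tm.Below (n : ℕ) : Tm → Bool
  | .var m => m < n
  | .zero => true
  | .one => true
  | .add s t => s.Below n && t.Below n
  | .mul s t => s.Below n && t.Below n

theorem Tm.Below.eval {A : Structure2.{u}} {n : ℕ} {t : Tm} (h : t.Below n = true)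
    {e f : ℕ → A.Num} (hef : ∀ i < n, e i = f i) : t.eval A e = t.eval A f := by
  induction t with
  | var m => exact hef m (by simpa [Tm.Below] using h)
  | zero => rfl
  | one => rfl
  | add s t hs ht =>
    simp only [Tm.Below, Bool.and_eq_true] at h
    simp only [Tm.eval, hs h.1, ht h.2]
  | mul s t hs ht =>
    simp only [Tm.Below, Bool.and_eq_true] at h
    simp only [Tm.eval, hs h.1, ht h.2]

theorem clauses_below : Arith.clauses.all
    (fun c => c.concl.Below 30 && c.prems.all (Tm.Below 30)) = true := by
  decide +kernel

theorem clauses_side : ∀ c ∈ Arith.clauses, c.side = .eq .zero .zero ∨ c.side = Arith.entry := by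
  simp [Arith.clauses, Arith.typeClauses, Arith.ruleClauses, Arith.farcClauses, Arith.eqClauses,
    Arith.stepClauses, Arith.redClauses]

section

variable {A : Structure2.{u}} [hA : Fact A.IsModelRCA0]

/-- Coded pairs. -/
def pr (s t : A.Num) : A.Num := (s + t) * (s + t) + s

instance Fn.pr {C : Type u} [Ctx A C] {f g : C → A.Num} [Fn f] [Fn g] :
    Fn (fun c => pr (f c) (g c)) :=
  (inferInstance : Fn (fun c => (f c + g c) * (f c + g c) + f c))

theorem sat_beta {e : ℕ → A.Num} {E : ℕ → Set A.Num} {a b i x : Tm}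
    (ha : a.Below 47 = true) (hb : b.Below 47 = true) (hi : i.Below 47 = true)
    (hx : x.Below 47 = true) : (Arith.beta a b i x).Sat A e E ↔
      x.eval A e = bt (a.eval A e) (b.eval A e) (i.eval A e) := by
  have hu (q : A.Num) {t : Tm} (ht : t.Below 47 = true) :
      t.eval A (Function.update e 47 q) = t.eval A e :=
    Tm.Below.eval ht fun i hi => Function.update_of_ne hi.ne _ _
  rw [eq_bt_iff]
  simp only [Arith.beta, Fml.Sat, Tm.eval, hu _ ha, hu _ hb, hu _ hi, hu _ hx, Arith.vQ,
    Function.update_self]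
  rfl

theorem Tm.Below.mono {m n : ℕ} (hmn : m ≤ n) {t : Tm} (h : t.Below m = true) :
    t.Below n = true := by
  induction t with
  | var k => simp only [Tm.Below, decide_eq_true_eq] at *; omega
  | zero => rfl
  | one => rfl
  | add s t hs ht =>
    simp only [Tm.Below, Bool.and_eq_true] at *
    exact ⟨hs h.1, ht h.2⟩
  | mul s t hs ht =>
    simp only [Tm.Below, Bool.and_eq_true] at *
    exact ⟨hs h.1, ht h.2⟩

theorem sat_entry {e : ℕ → A.Num} {E : ℕ → Set A.Num} : Arith.entry.Sat A e E ↔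
    pr (e 13) (pr (e 27) (e 28)) = bt (e 25) (e 26) (e 29) :=
  sat_beta rfl rfl rfl rfl

/-- The side condition of a clause. -/
def SideCond (φ : Fml) (e : ℕ → A.Num) : Prop :=
  φ = Arith.entry → pr (e 13) (pr (e 27) (e 28)) = bt (e 25) (e 26) (e 29)

theorem sat_side {c : Arith.Clause} (hc : c ∈ Arith.clauses) {e : ℕ → A.Num}
    {E : ℕ → Set A.Num} : c.side.Sat A e E ↔ SideCond c.side e := by
  rcases clauses_side c hc with h | h
  · rw [h]
    exact ⟨fun _ h => by simp [Arith.entry, Arith.beta] at h, fun _ => rfl⟩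
  · rw [h]
    exact sat_entry.trans ⟨fun h _ => h, fun h => h rfl⟩

/-- The rules given by the clauses. -/
def ClRl (circ : Bool) (l : List A.Num) (y : A.Num) : Prop :=
  ∃ c ∈ Arith.clauses, ∃ e : ℕ → A.Num, circ = c.circular ∧ l = c.prems.map (Tm.eval A e) ∧
    y = c.concl.eval A e ∧ SideCond c.side e

theorem concl_below {c : Arith.Clause} (hc : c ∈ Arith.clauses) : c.concl.Below 30 = true := by
  have := List.all_eq_true.1 clauses_below c hc
  simp only [Bool.and_eq_true] at this
  exact this.1

theorem prems_below {c : Arith.Clause} (hc : c ∈ Arith.clauses) {p : Tm} (hp : p ∈ c.prems) :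
    p.Below 30 = true := by
  have := List.all_eq_true.1 clauses_below c hc
  simp only [Bool.and_eq_true, List.all_eq_true] at this
  exact this.2 p hp

theorem SideCond.congr {φ : Fml} {e f : ℕ → A.Num} (h : ∀ i < 30, e i = f i) :
    SideCond φ e ↔ SideCond φ f := by
  simp only [SideCond, h 13 (by norm_num), h 27 (by norm_num), h 28 (by norm_num),
    h 25 (by norm_num), h 26 (by norm_num), h 29 (by norm_num)]

/-- Clause instances in terms of assignments that agree with a given one from index 30 on. -/
theorem step_clRl_iff {P Q : A.Num → Prop} {y : A.Num} (e : ℕ → A.Num) :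
    Step ClRl P Q y ↔ ∃ c ∈ Arith.clauses, ∃ f : ℕ → A.Num, (∀ i, i ∉ List.range 30 → f i = e i) ∧
      y = c.concl.eval A f ∧ SideCond c.side f ∧
      ∀ p ∈ c.prems, (c.circular = false → P (p.eval A f)) ∧ (c.circular = true → Q (p.eval A f)) := by
  constructor
  · rintro ⟨_, _, ⟨c, hc, f, rfl, rfl, rfl, hs⟩, h⟩
    have hf : ∀ i < 30, f i = if i < 30 then f i else e i := fun i hi => (if_pos hi).symm
    refine ⟨c, hc, fun i => if i < 30 then f i else e i, fun i hi => if_neg (by simpa using hi),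
      Tm.Below.eval (concl_below hc) hf, (SideCond.congr hf).1 hs, fun p hp => ?_⟩
    rw [← Tm.Below.eval (prems_below hc hp) hf]
    exact h _ (List.mem_map_of_mem hp)
  · rintro ⟨c, hc, f, -, h1, h2, h3⟩
    refine ⟨_, _, ⟨c, hc, f, rfl, rfl, h1, h2⟩, fun x hx => ?_⟩
    obtain ⟨p, hp, rfl⟩ := List.mem_map.1 hx
    exact h3 p hp

theorem sat_applies {c : Arith.Clause} (hc : c ∈ Arith.clauses) {e : ℕ → A.Num}
    {E : ℕ → Set A.Num} : c.applies.Sat A e E ↔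
      ∃ f : ℕ → A.Num, (∀ i, i ∉ List.range 30 → f i = e i) ∧
        e 45 = c.concl.eval A f ∧ SideCond c.side f ∧
        ∀ p ∈ c.prems, (c.circular = false → In (e 40) (e 41) (e 43) (p.eval A f)) ∧
          (c.circular = true → In (e 40) (e 41) (e 42 + 1) (p.eval A f)) := by
  rw [Arith.Clause.applies, Fml.sat_foldr_ex]
  refine exists_congr fun f => and_congr_right fun hf => ?_
  have hf' {i : ℕ} (hi : 30 ≤ i) : f i = e i := hf i (by simpa using hi)
  have h40 := hf' (i := 40) (by norm_num)
  have h41 := hf' (i := 41) (by norm_num)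
  have h42 := hf' (i := 42) (by norm_num)
  have h43 := hf' (i := 43) (by norm_num)
  simp only [Fml.Sat, Tm.eval, hf' (i := Arith.vY) (by norm_num), sat_side hc, Fml.sat_conj,
    List.forall_mem_map]
  refine and_congr_right fun _ => and_congr_right fun _ => forall₂_congr fun p hp => ?_
  have hp' := prems_below hc hp
  have hb (x : A.Num) : (Arith.beta Arith.vA Arith.vB Arith.vJ p).Sat A
      (Function.update f Arith.vJ x) E ↔ bt (e 40) (e 41) x = p.eval A f := by
    rw [sat_beta rfl rfl rfl (Tm.Below.mono (by norm_num) hp')]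
    rw [Tm.Below.eval hp' (f := f) fun i hi => Function.update_of_ne (by unfold Arith.vJ; omega) _ _]
    simp [Tm.eval, h40, h41, eq_comm]
  simp only [hb]
  cases c.circular with
  | false => simp [Tm.eval, In, h43]; rfl
  | true => simp [Tm.eval, In, h42]; rfl

theorem sat_derivable {e : ℕ → A.Num} {E : ℕ → Set A.Num} :
    Arith.derivable.Sat A e E ↔ Der (A := A) ClRl (e 46) := by
  have key : Arith.derivable.Sat A e E ↔
      ∃ a b n, e 46 = bt a b n ∧ IsDer (A := A) ClRl a b (n + 1) := by
    rw [Arith.derivable]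
    simp only [Fml.Sat]
    refine exists_congr fun a => exists_congr fun b => exists_congr fun n => ?_
    rw [sat_beta rfl rfl rfl rfl]
    refine and_congr (by simp [Tm.eval]) (forall_congr' fun i => ?_)
    refine imp_congr (by simp [Tm.eval]; rfl) ?_
    simp only [sat_beta (a := .var Arith.vA) (b := .var Arith.vB) (i := .var Arith.vI)
      (x := .var Arith.vY) rfl rfl rfl rfl, Fml.sat_disj, List.mem_map, exists_exists_and_eq_and]
    constructor
    · intro h
      obtain ⟨c, hc, h⟩ := h (bt a b i) (by simp [Tm.eval])
      obtain ⟨f, h1, h2, h3, h4⟩ := (sat_applies hc).1 h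
      exact (step_clRl_iff _).2 ⟨c, hc, f, h1, by simpa using h2, h3, by simpa using h4⟩
    · rintro h y hy
      have hy : y = bt a b i := by simpa [Tm.eval] using hy
      obtain ⟨c, hc, f, h1, h2, h3, h4⟩ := (step_clRl_iff (Function.update (Function.update
        (Function.update (Function.update (Function.update e 40 a) 41 b) 42 n) 43 i) 45 y)).1 h
      exact ⟨c, hc, (sat_applies hc).2 ⟨f, h1, by simpa [hy] using h2, h3, by simpa using h4⟩⟩
  rw [key]
  constructor
  · rintro ⟨a, b, n, h1, h2⟩
    exact ⟨a, b, n + 1, ⟨n, Num.lt_succ_self n, h1.symm⟩, h2⟩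
  · intro h
    obtain ⟨a, b, n, h1, h2⟩ := h.last
    exact ⟨a, b, n, h1.symm, h2⟩

theorem sat_holds {e : ℕ → A.Num} {E : ℕ → Set A.Num} {p : Tm} (hp : p.Below 46 = true) :
    (Arith.holds p).Sat A e E ↔ Der (A := A) ClRl (p.eval A e) := by
  simp only [Arith.holds, Fml.Sat, sat_derivable, Tm.eval, Function.update_self]
  have (x : A.Num) : p.eval A (Function.update e Arith.vX x) = p.eval A e :=
    Tm.Below.eval hp fun i hi => Function.update_of_ne hi.ne _ _
  simp [this]

/-! ### Definability of clause instances -/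

theorem Fn.eval {C : Type u} [Ctx A C] {e : C → ℕ → A.Num} (he : ∀ i, Fn (fun c => e c i))
    (t : Tm) : Fn (fun c => t.eval A (e c)) := by
  induction t with
  | var i => exact he i
  | zero => exact Fn.const _
  | one => exact Fn.const _
  | add s t hs ht => exact Fn.add
  | mul s t hs ht => exact Fn.mul

theorem Sg.list_ball {α : Type*} (l : List α) {C : Type u} [Ctx A C] {P : α → C → Prop}
    (h : ∀ x ∈ l, Sg (P x)) : Sg (fun c => ∀ x ∈ l, P x c) := by
  induction l with
  | nil => exact (inferInstance : Sg fun _ : C => (0 : A.Num) = 0).congr (by simp)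
  | cons x l ih =>
    have := h x (.head _)
    have := ih fun y hy => h y (.tail _ hy)
    exact (inferInstance : Sg fun c => P x c ∧ ∀ y ∈ l, P y c).congr (by simp)

theorem Sg.list_bex {α : Type*} (l : List α) {C : Type u} [Ctx A C] {P : α → C → Prop}
    (h : ∀ x ∈ l, Sg (P x)) : Sg (fun c => ∃ x ∈ l, P x c) := by
  induction l with
  | nil => exact (inferInstance : Sg fun _ : C => (0 : A.Num) ≠ 0).congr (by simp)
  | cons x l ih =>
    have := h x (.head _)
    have := ih fun y hy => h y (.tail _ hy)
    exact (inferInstance : Sg fun c => P x c ∨ ∃ y ∈ l, P y c).congr (by simp)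

/-- The quantifier over assignments is unwound one variable at a time, each adding a coordinate to
the context and one update to `e`. -/
theorem Sg.clause_instance (cl : Arith.Clause) (vs : List ℕ) {C : Type u} [Ctx A C]
    {P Q : C → A.Num → Prop} {g : C → A.Num} (hP : Sg (fun d : C × A.Num => P d.1 d.2))
    (hQ : Sg (fun d : C × A.Num => Q d.1 d.2)) (hg : Fn g) {e : C → ℕ → A.Num}
    (he : ∀ i, Fn (fun c => e c i)) :
    Sg (fun c => ∃ f : ℕ → A.Num, (∀ i, i ∉ vs → f i = e c i) ∧
      g c = cl.concl.eval A f ∧ SideCond cl.side f ∧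
      ∀ p ∈ cl.prems, (cl.circular = false → P c (p.eval A f)) ∧
        (cl.circular = true → Q c (p.eval A f))) := by
  induction vs generalizing C with
  | nil =>
    have h1 := Fn.eval he cl.concl
    have h2 : Sg (fun c => SideCond cl.side (e c)) := by
      by_cases h : cl.side = Arith.entry
      · simpa [SideCond, h] using (inferInstance : Sg (fun c =>
          pr (e c 13) (pr (e c 27) (e c 28)) = bt (e c 25) (e c 26) (e c 29)))
      · simpa [SideCond, h] using (inferInstance : Sg (fun _ : C => (0 : A.Num) = 0))
    have h3 : Sg (fun c => ∀ p ∈ cl.prems, (cl.circular = false → P c (p.eval A (e c))) ∧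
        (cl.circular = true → Q c (p.eval A (e c)))) := by
      refine Sg.list_ball _ fun p _ => ?_
      cases cl.circular
      · simpa using Sg.subst hP (Fn.eval he p)
      · simpa using Sg.subst hQ (Fn.eval he p)
    refine (inferInstance : Sg (fun c => g c = cl.concl.eval A (e c) ∧ SideCond cl.side (e c) ∧
      ∀ p ∈ cl.prems, (cl.circular = false → P c (p.eval A (e c))) ∧
        (cl.circular = true → Q c (p.eval A (e c))))).congr fun c => ?_
    constructor
    · rintro ⟨f, h, h'⟩
      rwa [show f = e c from funext fun i => h i (by simp)] at h'
    · exact fun h => ⟨e c, fun _ _ => rfl, h⟩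
  | cons v vs ih =>
    have := ih (C := C × A.Num) (P := fun d => P d.1) (Q := fun d => Q d.1) hP.insert hQ.insert
      hg.fst (e := fun d => Function.update (e d.1) v d.2) fun i => by
        by_cases h : i = v
        · subst h
          simpa using (inferInstance : Fn fun d : C × A.Num => d.2)
        · simpa [Function.update_of_ne h] using (he i).fst
    refine (Sg.ex (P := fun c x => ∃ f : ℕ → A.Num,
      (∀ i, i ∉ vs → f i = Function.update (e c) v x i) ∧ g c = cl.concl.eval A f ∧
      SideCond cl.side f ∧ ∀ p ∈ cl.prems, (cl.circular = false → P c (p.eval A f)) ∧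
        (cl.circular = true → Q c (p.eval A f))) (hP := this)).congr fun c => ?_
    constructor
    · rintro ⟨f, h1, h2⟩
      refine ⟨f v, f, fun i hi => ?_, h2⟩
      by_cases h : i = v
      · rw [h, Function.update_self]
      · rw [Function.update_of_ne h, h1 i (by simp [h, hi])]
    · rintro ⟨x, f, h1, h2⟩
      refine ⟨f, fun i hi => ?_, h2⟩
      simp only [List.mem_cons, not_or] at hi
      rw [h1 i hi.2, Function.update_of_ne hi.1]

instance ClRl.rules : Rules (A := A) ClRl where
  sg hP hQ hf := (Sg.list_bex Arith.clauses fun cl _ =>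
    Sg.clause_instance cl (List.range 30) hP hQ hf (e := fun _ _ => 0) fun _ =>
      inferInstance).congr fun _ => step_clRl_iff (fun _ => 0)

end

/-! ## Judgments -/

section

variable {M : Structure2.{u}} [hM : Fact M.IsModelRCA0]

def num : ℕ → M.Num
  | 0 => M.zero
  | k + 1 => M.add (num k) M.one

/-- `cd k [x₁, …, xₙ]` is the compound object with constructor number `k` and components
`x₁, …, xₙ`. -/
def cd (k : ℕ) (l : List M.Num) : M.Num := pr (num k) (l.foldr pr M.zero)

theorem num_eq_cast (k : ℕ) : (num k : M.Num) = k := by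
  induction k with
  | zero => exact Nat.cast_zero.symm
  | succ k ih => rw [Nat.cast_succ, ← ih]; rfl

/-- The value `pr s t` lies between `(s + t)²` and `(s + t + 1)²`, so it determines the sum and then
the first component. -/
theorem pr_inj {s t s' t' : M.Num} : pr s t = pr s' t' ↔ s = s' ∧ t = t' := by
  have key {s t s' t' : M.Num} (h : s + t < s' + t') : pr s t < pr s' t' := by
    have h1 : s + t + 1 ≤ s' + t' := Num.succ_le_iff.2 h
    calc pr s t < (s + t + 1) * (s + t + 1) := by
          rw [pr, show (s + t + 1) * (s + t + 1) = (s + t) * (s + t) + s + (s + t + t + 1) by ring]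
          exact lt_add_of_pos_right _ (Num.zero_lt_one''.trans_le le_add_self)
      _ ≤ (s' + t') * (s' + t') :=
          mul_le_mul h1 h1 (Num.zero_le' _) (Num.zero_le' _)
      _ ≤ pr s' t' := le_self_add
  constructor
  · intro h
    rcases lt_trichotomy (s + t) (s' + t') with h' | h' | h'
    · exact absurd h (key h').ne
    · rw [pr, pr, h'] at h
      obtain rfl := add_left_cancel h
      exact ⟨rfl, add_left_cancel h'⟩
    · exact absurd h (key h').ne'
  · rintro ⟨rfl, rfl⟩
    rfl

@[simp] theorem cd_inj {k k' : ℕ} {l l' : List M.Num} :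
    cd k l = cd k' l' ↔ k = k' ∧ l.foldr pr 0 = l'.foldr pr 0 := by
  rw [cd, cd, pr_inj, num_eq_cast, num_eq_cast, Nat.cast_inj]
  rfl

theorem le_pr_left (s t : M.Num) : s ≤ pr s t := le_add_self

theorem le_pr_right (s t : M.Num) : t ≤ pr s t := by
  rcases (Num.zero_le' t).eq_or_lt with rfl | h
  · exact Num.zero_le' _
  · have h1 : 1 ≤ s + t := (by simpa using Num.succ_le_iff.2 h : 1 ≤ t).trans le_add_self
    calc t ≤ s + t := le_add_self
      _ ≤ (s + t) * (s + t) := le_mul_of_one_le_left (Num.zero_le' _) h1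
      _ ≤ _ := le_self_add

theorem pr_mono {s t s' t' : M.Num} (h : s ≤ s') (h' : t ≤ t') : pr s t ≤ pr s' t' :=
  add_le_add (mul_le_mul (add_le_add h h') (add_le_add h h') (Num.zero_le' _) (Num.zero_le' _)) h

section

variable {C : Type u} [Ctx M C] {k : ℕ} {f g h f' g' : C → M.Num} [Fn f] [Fn g] [Fn h] [Fn f'] [Fn g']

instance Fn.cd₀ : Fn (fun _ : C => cd (M := M) k []) := Fn.const _

instance Fn.cd₁ : Fn (fun c => cd k [f c]) :=
  (inferInstance : Fn fun c => CT.pr (num k) (CT.pr (f c) 0))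

instance Fn.cd₂ : Fn (fun c => cd k [f c, g c]) :=
  (inferInstance : Fn fun c => CT.pr (num k) (CT.pr (f c) (CT.pr (g c) 0)))

instance Fn.cd₃ : Fn (fun c => cd k [f c, g c, h c]) :=
  (inferInstance : Fn fun c => CT.pr (num k) (CT.pr (f c) (CT.pr (g c) (CT.pr (h c) 0))))

instance Fn.cd₄ : Fn (fun c => cd k [f c, g c, h c, f' c]) :=
  (inferInstance : Fn fun c => CT.pr (num k) (CT.pr (f c) (CT.pr (g c) (CT.pr (h c) (CT.pr (f' c) 0)))))

instance Fn.cd₅ : Fn (fun c => cd k [f c, g c, h c, f' c, g' c]) :=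
  (inferInstance : Fn fun c =>
    CT.pr (num k) (CT.pr (f c) (CT.pr (g c) (CT.pr (h c) (CT.pr (f' c) (CT.pr (g' c) 0))))))

end

abbrev oN : M.Num := cd 1 []
abbrev oArr (σ τ : M.Num) : M.Num := cd 2 [σ, τ]
abbrev oNil : M.Num := cd 3 []
abbrev oSnoc (Γ σ : M.Num) : M.Num := cd 4 [Γ, σ]
abbrev rEx (Γ ρ σ Δ τ : M.Num) : M.Num := cd 5 [Γ, ρ, σ, Δ, τ]
abbrev rWk (Γ σ τ : M.Num) : M.Num := cd 6 [Γ, σ, τ]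
abbrev rCntr (Γ σ τ : M.Num) : M.Num := cd 7 [Γ, σ, τ]
abbrev rCut (Γ σ τ : M.Num) : M.Num := cd 8 [Γ, σ, τ]
abbrev rId (σ : M.Num) : M.Num := cd 9 [σ]
abbrev rL (Γ ρ σ τ : M.Num) : M.Num := cd 10 [Γ, ρ, σ, τ]
abbrev rR (Γ σ τ : M.Num) : M.Num := cd 11 [Γ, σ, τ]
abbrev rZero : M.Num := cd 12 []
abbrev rSucc : M.Num := cd 13 []
abbrev rRecr (Γ τ : M.Num) : M.Num := cd 14 [Γ, τ]
abbrev rCond (Γ τ : M.Num) : M.Num := cd 15 [Γ, τ]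
abbrev oV (σ k : M.Num) : M.Num := cd 16 [σ, k]
abbrev oK (r : M.Num) : M.Num := cd 17 [r]
abbrev oA (s t : M.Num) : M.Num := cd 18 [s, t]
abbrev oNode (a b k : M.Num) : M.Num := cd 19 [a, b, k]
abbrev oSeq (Γ τ : M.Num) : M.Num := cd 20 [Γ, τ]

/-- The kind of a judgment belongs to the metatheory, its components to the model. This permits case
analysis on the kind, which bare codes would not. -/
inductive Jd (M : Structure2.{u}) : Type u
  | ty (σ : M.Num)
  | ctx (Γ : M.Num)
  | arrow (Γ τ θ : M.Num)
  | append (Γ Δ Θ : M.Num)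
  | inst0 (r S : M.Num)
  | inst1 (r S₁ S : M.Num)
  | inst2 (r S₁ S₂ S : M.Num)
  | const (r θ : M.Num)
  | coder (a b k S : M.Num)
  | farc (t θ : M.Num)
  | unf (t u : M.Num)
  | eq (s t : M.Num)
  | spine (Γ s u t v : M.Num)
  | step (s t : M.Num)
  | red (θ s t : M.Num)
  | reds (θ s t : M.Num)
  | conv (θ s t : M.Num)

@[reducible] def Jd.code : Jd M → M.Num
  | .ty σ => cd 21 [σ]
  | .ctx Γ => cd 22 [Γ]
  | .arrow Γ τ θ => cd 23 [Γ, τ, θ]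
  | .append Γ Δ Θ => cd 24 [Γ, Δ, Θ]
  | .inst0 r S => cd 25 [r, S]
  | .inst1 r S₁ S => cd 26 [r, S₁, S]
  | .inst2 r S₁ S₂ S => cd 27 [r, S₁, S₂, S]
  | .const r θ => cd 28 [r, θ]
  | .coder a b k S => cd 29 [a, b, k, S]
  | .farc t θ => cd 30 [t, θ]
  | .unf t u => cd 31 [t, u]
  | .eq s t => cd 32 [s, t]
  | .spine Γ s u t v => cd 33 [Γ, s, u, t, v]
  | .step s t => cd 34 [s, t]
  | .red θ s t => cd 35 [θ, s, t]
  | .reds θ s t => cd 36 [θ, s, t]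
  | .conv θ s t => cd 37 [θ, s, t]

theorem Jd.code_injective : Function.Injective (Jd.code (M := M)) := by
  intro j j' h
  cases j <;> cases j' <;> simp [pr_inj] at h <;> simp [h]

def env (Γ Δ Θ Θ' ρ σ τ θ θ₁ θ₂ S S₁ S₂ r s s' t t' u v v' w w' x y a b i j k : M.Num := 0) : ℕ → M.Num := fun n =>
  [Γ, Δ, Θ, Θ', ρ, σ, τ, θ, θ₁, θ₂, S, S₁, S₂, r, s, s', t, t', u, v, v', w, w', x, y, a, b, i, j, k].getD n 0

/-- `Rule P Q j`: the judgment `j` follows by an instance of a clause whose premisses satisfy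
`P`, or `Q` if the clause is circular. -/
inductive Rule (P Q : M.Num → Prop) : Jd M → Prop
  -- Compound arguments of a conclusion are variables with equations, so that case analysis on a
  -- rule with a given conclusion does not have to unify codes.
  | tyN {z₁ : M.Num} (e₁ : z₁ = oN) :
      Rule P Q (.ty z₁)
  | tyArr (σ τ : M.Num) {z₁ : M.Num} (e₁ : z₁ = oArr σ τ) (h₁ : P (Jd.ty σ).code)
      (h₂ : P (Jd.ty τ).code) :
      Rule P Q (.ty z₁)
  | ctxNil {z₁ : M.Num} (e₁ : z₁ = oNil) :
      Rule P Q (.ctx z₁)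
  | ctxSnoc (Γ σ : M.Num) {z₁ : M.Num} (e₁ : z₁ = oSnoc Γ σ) (h₁ : P (Jd.ctx Γ).code)
      (h₂ : P (Jd.ty σ).code) :
      Rule P Q (.ctx z₁)
  | arrowNil (τ : M.Num) {z₁ z₃ : M.Num} (e₁ : z₁ = oNil) (e₃ : τ = z₃) :
      Rule P Q (.arrow z₁ τ z₃)
  | arrowSnoc (Γ σ τ θ : M.Num) {z₁ : M.Num} (e₁ : z₁ = oSnoc Γ σ)
      (h₁ : P (Jd.arrow Γ (oArr σ τ) θ).code) :
      Rule P Q (.arrow z₁ τ θ)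
  | appendNil (Γ : M.Num) {z₂ z₃ : M.Num} (e₂ : z₂ = oNil) (e₃ : Γ = z₃) :
      Rule P Q (.append Γ z₂ z₃)
  | appendSnoc (Γ Δ Θ σ : M.Num) {z₂ z₃ : M.Num} (e₂ : z₂ = oSnoc Δ σ) (e₃ : z₃ = oSnoc Θ σ)
      (h₁ : P (Jd.append Γ Δ Θ).code) :
      Rule P Q (.append Γ z₂ z₃)
  | instId (σ : M.Num) {z₁ z₂ : M.Num} (e₁ : z₁ = rId σ) (e₂ : z₂ = oSeq (oSnoc oNil σ) σ)
      (h₁ : P (Jd.ty σ).code) :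
      Rule P Q (.inst0 z₁ z₂)
  | instZero {z₁ z₂ : M.Num} (e₁ : z₁ = rZero) (e₂ : z₂ = oSeq oNil oN) :
      Rule P Q (.inst0 z₁ z₂)
  | instSucc {z₁ z₂ : M.Num} (e₁ : z₁ = rSucc) (e₂ : z₂ = oSeq (oSnoc oNil oN) oN) :
      Rule P Q (.inst0 z₁ z₂)
  | instEx (Γ Δ Θ Θ' ρ σ τ : M.Num) {z₁ z₂ z₃ : M.Num} (e₁ : z₁ = rEx Γ ρ σ Δ τ)
      (e₂ : z₂ = oSeq Θ' τ) (e₃ : z₃ = oSeq Θ τ) (h₁ : P (Jd.ctx Γ).code) (h₂ : P (Jd.ty ρ).code)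
      (h₃ : P (Jd.ty σ).code) (h₄ : P (Jd.ctx Δ).code) (h₅ : P (Jd.ty τ).code)
      (h₆ : P (Jd.append (oSnoc (oSnoc Γ ρ) σ) Δ Θ).code)
      (h₇ : P (Jd.append (oSnoc (oSnoc Γ σ) ρ) Δ Θ').code) :
      Rule P Q (.inst1 z₁ z₂ z₃)
  | instWk (Γ σ τ : M.Num) {z₁ z₂ z₃ : M.Num} (e₁ : z₁ = rWk Γ σ τ) (e₂ : z₂ = oSeq Γ τ)
      (e₃ : z₃ = oSeq (oSnoc Γ σ) τ) (h₁ : P (Jd.ctx Γ).code) (h₂ : P (Jd.ty σ).code)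
      (h₃ : P (Jd.ty τ).code) :
      Rule P Q (.inst1 z₁ z₂ z₃)
  | instCntr (Γ σ τ : M.Num) {z₁ z₂ z₃ : M.Num} (e₁ : z₁ = rCntr Γ σ τ)
      (e₂ : z₂ = oSeq (oSnoc (oSnoc Γ σ) σ) τ) (e₃ : z₃ = oSeq (oSnoc Γ σ) τ)
      (h₁ : P (Jd.ctx Γ).code) (h₂ : P (Jd.ty σ).code) (h₃ : P (Jd.ty τ).code) :
      Rule P Q (.inst1 z₁ z₂ z₃)
  | instR (Γ σ τ : M.Num) {z₁ z₂ z₃ : M.Num} (e₁ : z₁ = rR Γ σ τ) (e₂ : z₂ = oSeq (oSnoc Γ σ) τ)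
      (e₃ : z₃ = oSeq Γ (oArr σ τ)) (h₁ : P (Jd.ctx Γ).code) (h₂ : P (Jd.ty σ).code)
      (h₃ : P (Jd.ty τ).code) :
      Rule P Q (.inst1 z₁ z₂ z₃)
  | instCut (Γ σ τ : M.Num) {z₁ z₂ z₃ z₄ : M.Num} (e₁ : z₁ = rCut Γ σ τ) (e₂ : z₂ = oSeq Γ σ)
      (e₃ : z₃ = oSeq (oSnoc Γ σ) τ) (e₄ : z₄ = oSeq Γ τ) (h₁ : P (Jd.ctx Γ).code)
      (h₂ : P (Jd.ty σ).code) (h₃ : P (Jd.ty τ).code) :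
      Rule P Q (.inst2 z₁ z₂ z₃ z₄)
  | instL (Γ ρ σ τ : M.Num) {z₁ z₂ z₃ z₄ : M.Num} (e₁ : z₁ = rL Γ ρ σ τ) (e₂ : z₂ = oSeq Γ ρ)
      (e₃ : z₃ = oSeq (oSnoc Γ σ) τ) (e₄ : z₄ = oSeq (oSnoc Γ (oArr ρ σ)) τ)
      (h₁ : P (Jd.ctx Γ).code) (h₂ : P (Jd.ty ρ).code) (h₃ : P (Jd.ty σ).code)
      (h₄ : P (Jd.ty τ).code) :
      Rule P Q (.inst2 z₁ z₂ z₃ z₄)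
  | instCond (Γ τ : M.Num) {z₁ z₂ z₃ z₄ : M.Num} (e₁ : z₁ = rCond Γ τ) (e₂ : z₂ = oSeq Γ τ)
      (e₃ : z₃ = oSeq (oSnoc Γ oN) τ) (e₄ : z₄ = oSeq (oSnoc Γ oN) τ) (h₁ : P (Jd.ctx Γ).code)
      (h₂ : P (Jd.ty τ).code) :
      Rule P Q (.inst2 z₁ z₂ z₃ z₄)
  | const0 (Γ τ θ r : M.Num) (h₁ : P (Jd.inst0 r (oSeq Γ τ)).code) (h₂ : P (Jd.arrow Γ τ θ).code) :
      Rule P Q (.const r θ)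
  | const1 (Γ Δ σ τ θ θ₁ r : M.Num) {z₂ : M.Num} (e₂ : z₂ = oArr θ₁ θ)
      (h₁ : P (Jd.inst1 r (oSeq Δ σ) (oSeq Γ τ)).code) (h₂ : P (Jd.arrow Δ σ θ₁).code)
      (h₃ : P (Jd.arrow Γ τ θ).code) :
      Rule P Q (.const r z₂)
  | const2 (Γ Δ Θ ρ σ τ θ θ₁ θ₂ r : M.Num) {z₂ : M.Num} (e₂ : z₂ = oArr θ₁ (oArr θ₂ θ))
      (h₁ : P (Jd.inst2 r (oSeq Δ σ) (oSeq Θ ρ) (oSeq Γ τ)).code) (h₂ : P (Jd.arrow Δ σ θ₁).code)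
      (h₃ : P (Jd.arrow Θ ρ θ₂).code) (h₄ : P (Jd.arrow Γ τ θ).code) :
      Rule P Q (.const r z₂)
  | constRecr (Γ τ θ θ₁ θ₂ : M.Num) {z₁ z₂ : M.Num} (e₁ : z₁ = rRecr Γ τ)
      (e₂ : z₂ = oArr θ₁ (oArr θ₂ θ)) (h₁ : P (Jd.ctx Γ).code) (h₂ : P (Jd.ty τ).code)
      (h₃ : P (Jd.arrow Γ τ θ₁).code) (h₄ : P (Jd.arrow (oSnoc (oSnoc Γ oN) τ) τ θ₂).code)
      (h₅ : P (Jd.arrow (oSnoc Γ oN) τ θ).code) :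
      Rule P Q (.const z₁ z₂)
  | coder0 (S r a b i j k : M.Num) (hs : pr r (pr i j) = bt a b k) (h₁ : Q (Jd.inst0 r S).code) :
      Rule P Q (.coder a b k S)
  | coder1 (S S₁ r a b i j k : M.Num) (hs : pr r (pr i j) = bt a b k)
      (h₁ : Q (Jd.inst1 r S₁ S).code) (h₂ : Q (Jd.coder a b i S₁).code) :
      Rule P Q (.coder a b k S)
  | coder2 (S S₁ S₂ r a b i j k : M.Num) (hs : pr r (pr i j) = bt a b k)
      (h₁ : Q (Jd.inst2 r S₁ S₂ S).code) (h₂ : Q (Jd.coder a b i S₁).code)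
      (h₃ : Q (Jd.coder a b j S₂).code) :
      Rule P Q (.coder a b k S)
  | farcV (σ k : M.Num) {z₁ : M.Num} (e₁ : z₁ = oV σ k) (h₁ : P (Jd.ty σ).code) :
      Rule P Q (.farc z₁ σ)
  | farcK (θ r : M.Num) {z₁ : M.Num} (e₁ : z₁ = oK r) (h₁ : P (Jd.const r θ).code) :
      Rule P Q (.farc z₁ θ)
  | farcNode (Γ τ θ a b k : M.Num) {z₁ : M.Num} (e₁ : z₁ = oNode a b k)
      (h₁ : P (Jd.coder a b k (oSeq Γ τ)).code) (h₂ : P (Jd.arrow Γ τ θ).code) :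
      Rule P Q (.farc z₁ θ)
  | farcA (σ τ s t : M.Num) {z₁ : M.Num} (e₁ : z₁ = oA s t) (h₁ : P (Jd.farc s (oArr σ τ)).code)
      (h₂ : P (Jd.farc t σ).code) :
      Rule P Q (.farc z₁ τ)
  | unf0 (S r a b i j k : M.Num) {z₁ z₂ : M.Num} (e₁ : z₁ = oNode a b k) (e₂ : z₂ = oK r)
      (hs : pr r (pr i j) = bt a b k) (h₁ : P (Jd.inst0 r S).code) :
      Rule P Q (.unf z₁ z₂)
  | unf1 (S S₁ r a b i j k : M.Num) {z₁ z₂ : M.Num} (e₁ : z₁ = oNode a b k)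
      (e₂ : z₂ = oA (oK r) (oNode a b i)) (hs : pr r (pr i j) = bt a b k)
      (h₁ : P (Jd.inst1 r S₁ S).code) :
      Rule P Q (.unf z₁ z₂)
  | unf2 (S S₁ S₂ r a b i j k : M.Num) {z₁ z₂ : M.Num} (e₁ : z₁ = oNode a b k)
      (e₂ : z₂ = oA (oA (oK r) (oNode a b i)) (oNode a b j)) (hs : pr r (pr i j) = bt a b k)
      (h₁ : P (Jd.inst2 r S₁ S₂ S).code) :
      Rule P Q (.unf z₁ z₂)
  | eqV (σ k : M.Num) {z₁ z₂ : M.Num} (e₁ : z₁ = oV σ k) (e₂ : z₂ = oV σ k) :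
      Rule P Q (.eq z₁ z₂)
  | eqK (r : M.Num) {z₁ z₂ : M.Num} (e₁ : z₁ = oK r) (e₂ : z₂ = oK r) :
      Rule P Q (.eq z₁ z₂)
  | eqA (s s' t t' : M.Num) {z₁ z₂ : M.Num} (e₁ : z₁ = oA s t) (e₂ : z₂ = oA s' t')
      (h₁ : Q (Jd.eq s s').code) (h₂ : Q (Jd.eq t t').code) :
      Rule P Q (.eq z₁ z₂)
  | eqLeft (t u a b k : M.Num) {z₁ : M.Num} (e₁ : z₁ = oNode a b k)
      (h₁ : Q (Jd.unf (oNode a b k) u).code) (h₂ : Q (Jd.eq u t).code) :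
      Rule P Q (.eq z₁ t)
  | eqRight (s u a b k : M.Num) {z₂ : M.Num} (e₂ : z₂ = oNode a b k)
      (h₁ : Q (Jd.unf (oNode a b k) u).code) (h₂ : Q (Jd.eq s u).code) :
      Rule P Q (.eq s z₂)
  | spineNil (s t : M.Num) {z₁ z₃ z₅ : M.Num} (e₁ : z₁ = oNil) (e₃ : s = z₃) (e₅ : t = z₅) :
      Rule P Q (.spine z₁ s z₃ t z₅)
  | spineSnoc (Γ σ s t u v x : M.Num) {z₁ z₃ z₅ : M.Num} (e₁ : z₁ = oSnoc Γ σ) (e₃ : z₃ = oA u x)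
      (e₅ : z₅ = oA v x) (h₁ : P (Jd.spine Γ s u t v).code) :
      Rule P Q (.spine z₁ s z₃ t z₅)
  | stepId (σ x : M.Num) {z₁ : M.Num} (e₁ : z₁ = oA (oK (rId σ)) x) :
      Rule P Q (.step z₁ x)
  | stepEx (Γ Δ ρ σ τ t u v w w' x y : M.Num)
      (h₁ : P (Jd.spine Γ (oA (oK (rEx Γ ρ σ Δ τ)) t) u t v).code)
      (h₂ : P (Jd.spine Δ (oA (oA u x) y) w (oA (oA v y) x) w').code) :
      Rule P Q (.step w w')
  | stepWk (Γ σ τ t u v x : M.Num) {z₁ : M.Num} (e₁ : z₁ = oA u x)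
      (h₁ : P (Jd.spine Γ (oA (oK (rWk Γ σ τ)) t) u t v).code) :
      Rule P Q (.step z₁ v)
  | stepCntr (Γ σ τ t u v x : M.Num) {z₁ z₂ : M.Num} (e₁ : z₁ = oA u x) (e₂ : z₂ = oA (oA v x) x)
      (h₁ : P (Jd.spine Γ (oA (oK (rCntr Γ σ τ)) t) u t v).code) :
      Rule P Q (.step z₁ z₂)
  | stepCut (Γ σ τ s t u v v' : M.Num) {z₂ : M.Num} (e₂ : z₂ = oA v' v)
      (h₁ : P (Jd.spine Γ (oA (oA (oK (rCut Γ σ τ)) s) t) u s v).code)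
      (h₂ : P (Jd.spine Γ (oA (oA (oK (rCut Γ σ τ)) s) t) u t v').code) :
      Rule P Q (.step u z₂)
  | stepL (Γ ρ σ τ s t u v v' y : M.Num) {z₁ z₂ : M.Num} (e₁ : z₁ = oA u y)
      (e₂ : z₂ = oA v' (oA y v)) (h₁ : P (Jd.spine Γ (oA (oA (oK (rL Γ ρ σ τ)) s) t) u s v).code)
      (h₂ : P (Jd.spine Γ (oA (oA (oK (rL Γ ρ σ τ)) s) t) u t v').code) :
      Rule P Q (.step z₁ z₂)
  | stepR (Γ σ τ t u v x : M.Num) {z₁ z₂ : M.Num} (e₁ : z₁ = oA u x) (e₂ : z₂ = oA v x)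
      (h₁ : P (Jd.spine Γ (oA (oK (rR Γ σ τ)) t) u t v).code) :
      Rule P Q (.step z₁ z₂)
  | stepRecrZero (Γ τ s t u v : M.Num) {z₁ : M.Num} (e₁ : z₁ = oA u (oK rZero))
      (h₁ : P (Jd.spine Γ (oA (oA (oK (rRecr Γ τ)) s) t) u s v).code) :
      Rule P Q (.step z₁ v)
  | stepRecrSucc (Γ τ s t u v y : M.Num) {z₁ z₂ : M.Num} (e₁ : z₁ = oA u (oA (oK rSucc) y))
      (e₂ : z₂ = oA (oA v y) (oA u y))
      (h₁ : P (Jd.spine Γ (oA (oA (oK (rRecr Γ τ)) s) t) u t v).code) :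
      Rule P Q (.step z₁ z₂)
  | stepCondZero (Γ τ s t u v : M.Num) {z₁ : M.Num} (e₁ : z₁ = oA u (oK rZero))
      (h₁ : P (Jd.spine Γ (oA (oA (oK (rCond Γ τ)) s) t) u s v).code) :
      Rule P Q (.step z₁ v)
  | stepCondSucc (Γ τ s t u v y : M.Num) {z₁ z₂ : M.Num} (e₁ : z₁ = oA u (oA (oK rSucc) y))
      (e₂ : z₂ = oA v y) (h₁ : P (Jd.spine Γ (oA (oA (oK (rCond Γ τ)) s) t) u t v).code) :
      Rule P Q (.step z₁ z₂)
  | stepLeft (s s' t : M.Num) {z₁ z₂ : M.Num} (e₁ : z₁ = oA s t) (e₂ : z₂ = oA s' t)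
      (h₁ : P (Jd.step s s').code) :
      Rule P Q (.step z₁ z₂)
  | stepRight (s t t' : M.Num) {z₁ z₂ : M.Num} (e₁ : z₁ = oA s t) (e₂ : z₂ = oA s t')
      (h₁ : P (Jd.step t t').code) :
      Rule P Q (.step z₁ z₂)
  | red (θ s s' t t' : M.Num) (h₁ : P (Jd.farc s θ).code) (h₂ : P (Jd.farc s' θ).code)
      (h₃ : P (Jd.farc t' θ).code) (h₄ : P (Jd.farc t θ).code) (h₅ : P (Jd.eq s s').code)
      (h₆ : P (Jd.step s' t').code) (h₇ : P (Jd.eq t' t).code) :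
      Rule P Q (.red θ s t)
  | redsRefl (θ s t : M.Num) (h₁ : P (Jd.farc s θ).code) (h₂ : P (Jd.farc t θ).code)
      (h₃ : P (Jd.eq s t).code) :
      Rule P Q (.reds θ s t)
  | redsStep (θ s t u : M.Num) (h₁ : P (Jd.reds θ s t).code) (h₂ : P (Jd.red θ t u).code) :
      Rule P Q (.reds θ s u)
  | convRefl (θ s t : M.Num) (h₁ : P (Jd.farc s θ).code) (h₂ : P (Jd.farc t θ).code)
      (h₃ : P (Jd.eq s t).code) :
      Rule P Q (.conv θ s t)
  | convStep (θ s t u : M.Num) (h₁ : P (Jd.conv θ s t).code) (h₂ : P (Jd.red θ t u).code) :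
      Rule P Q (.conv θ s u)
  | convBack (θ s t u : M.Num) (h₁ : P (Jd.conv θ s t).code) (h₂ : P (Jd.red θ u t).code) :
      Rule P Q (.conv θ s u)

/-- All terms of a list have values in `R`. -/
def AllIn (R : M.Num → Prop) (e : ℕ → M.Num) : List Tm → Prop
  | [] => True
  | p :: l => R (p.eval M e) ∧ AllIn R e l

theorem allIn_iff {R : M.Num → Prop} {e : ℕ → M.Num} {l : List Tm} :
    AllIn R e l ↔ ∀ p ∈ l, R (p.eval M e) := by
  induction l with
  | nil => simp [AllIn]
  | cons p l ih => simp [AllIn, ih]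

variable {P Q : M.Num → Prop}

/-- One component for each clause, in the order of `Arith.clauses`. That the conclusion evaluates to
the code of the judgment is a matter of computation. -/
theorem clauses_rule : Arith.clauses.Forall (fun c => ∀ e : ℕ → M.Num, SideCond c.side e →
    AllIn (bif c.circular then Q else P) e c.prems →
    ∃ j : Jd M, c.concl.eval M e = j.code ∧ Rule P Q j) :=
  ⟨
    fun _ _ _ => ⟨.ty oN, rfl, .tyN  rfl⟩,
    fun e _ ⟨h₁, h₂, _⟩ => ⟨.ty (oArr (e 5) (e 6)), rfl, .tyArr (e 5) (e 6) rfl h₁ h₂⟩,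
    fun _ _ _ => ⟨.ctx oNil, rfl, .ctxNil  rfl⟩,
    fun e _ ⟨h₁, h₂, _⟩ => ⟨.ctx (oSnoc (e 0) (e 5)), rfl, .ctxSnoc (e 0) (e 5) rfl h₁ h₂⟩,
    fun e _ _ => ⟨.arrow oNil (e 6) (e 6), rfl, .arrowNil (e 6) rfl rfl⟩,
    fun e _ ⟨h₁, _⟩ =>
      ⟨.arrow (oSnoc (e 0) (e 5)) (e 6) (e 7), rfl, .arrowSnoc (e 0) (e 5) (e 6) (e 7) rfl h₁⟩,
    fun e _ _ => ⟨.append (e 0) oNil (e 0), rfl, .appendNil (e 0) rfl rfl⟩,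
    fun e _ ⟨h₁, _⟩ =>
      ⟨.append (e 0) (oSnoc (e 1) (e 5)) (oSnoc (e 2) (e 5)), rfl, .appendSnoc (e 0) (e 1) (e 2)
      (e 5) rfl rfl h₁⟩,
    fun e _ ⟨h₁, _⟩ =>
      ⟨.inst0 (rId (e 5)) (oSeq (oSnoc oNil (e 5)) (e 5)), rfl, .instId (e 5) rfl rfl h₁⟩,
    fun _ _ _ => ⟨.inst0 rZero (oSeq oNil oN), rfl, .instZero  rfl rfl⟩,
    fun _ _ _ => ⟨.inst0 rSucc (oSeq (oSnoc oNil oN) oN), rfl, .instSucc  rfl rfl⟩,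
    fun e _ ⟨h₁, h₂, h₃, h₄, h₅, h₆, h₇, _⟩ =>
      ⟨.inst1 (rEx (e 0) (e 4) (e 5) (e 1) (e 6)) (oSeq (e 3) (e 6)) (oSeq (e 2) (e 6)), rfl,
      .instEx (e 0) (e 1) (e 2) (e 3) (e 4) (e 5) (e 6) rfl rfl rfl h₁ h₂ h₃ h₄ h₅ h₆ h₇⟩,
    fun e _ ⟨h₁, h₂, h₃, _⟩ =>
      ⟨.inst1 (rWk (e 0) (e 5) (e 6)) (oSeq (e 0) (e 6)) (oSeq (oSnoc (e 0) (e 5)) (e 6)), rfl,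
      .instWk (e 0) (e 5) (e 6) rfl rfl rfl h₁ h₂ h₃⟩,
    fun e _ ⟨h₁, h₂, h₃, _⟩ =>
      ⟨.inst1 (rCntr (e 0) (e 5) (e 6)) (oSeq (oSnoc (oSnoc (e 0) (e 5)) (e 5)) (e 6))
      (oSeq (oSnoc (e 0) (e 5)) (e 6)), rfl, .instCntr (e 0) (e 5) (e 6) rfl rfl rfl h₁ h₂ h₃⟩,
    fun e _ ⟨h₁, h₂, h₃, _⟩ =>
      ⟨.inst1 (rR (e 0) (e 5) (e 6)) (oSeq (oSnoc (e 0) (e 5)) (e 6))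
      (oSeq (e 0) (oArr (e 5) (e 6))), rfl, .instR (e 0) (e 5) (e 6) rfl rfl rfl h₁ h₂ h₃⟩,
    fun e _ ⟨h₁, h₂, h₃, _⟩ =>
      ⟨.inst2 (rCut (e 0) (e 5) (e 6)) (oSeq (e 0) (e 5)) (oSeq (oSnoc (e 0) (e 5)) (e 6))
      (oSeq (e 0) (e 6)), rfl, .instCut (e 0) (e 5) (e 6) rfl rfl rfl rfl h₁ h₂ h₃⟩,
    fun e _ ⟨h₁, h₂, h₃, h₄, _⟩ =>
      ⟨.inst2 (rL (e 0) (e 4) (e 5) (e 6)) (oSeq (e 0) (e 4)) (oSeq (oSnoc (e 0) (e 5)) (e 6))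
      (oSeq (oSnoc (e 0) (oArr (e 4) (e 5))) (e 6)), rfl, .instL (e 0) (e 4) (e 5) (e 6) rfl rfl
      rfl rfl h₁ h₂ h₃ h₄⟩,
    fun e _ ⟨h₁, h₂, _⟩ =>
      ⟨.inst2 (rCond (e 0) (e 6)) (oSeq (e 0) (e 6)) (oSeq (oSnoc (e 0) oN) (e 6))
      (oSeq (oSnoc (e 0) oN) (e 6)), rfl, .instCond (e 0) (e 6) rfl rfl rfl rfl h₁ h₂⟩,
    fun e _ ⟨h₁, h₂, _⟩ => ⟨.const (e 13) (e 7), rfl, .const0 (e 0) (e 6) (e 7) (e 13) h₁ h₂⟩,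
    fun e _ ⟨h₁, h₂, h₃, _⟩ =>
      ⟨.const (e 13) (oArr (e 8) (e 7)), rfl, .const1 (e 0) (e 1) (e 5) (e 6) (e 7) (e 8) (e 13)
      rfl h₁ h₂ h₃⟩,
    fun e _ ⟨h₁, h₂, h₃, h₄, _⟩ =>
      ⟨.const (e 13) (oArr (e 8) (oArr (e 9) (e 7))), rfl, .const2 (e 0) (e 1) (e 2) (e 4) (e 5)
      (e 6) (e 7) (e 8) (e 9) (e 13) rfl h₁ h₂ h₃ h₄⟩,
    fun e _ ⟨h₁, h₂, h₃, h₄, h₅, _⟩ =>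
      ⟨.const (rRecr (e 0) (e 6)) (oArr (e 8) (oArr (e 9) (e 7))), rfl, .constRecr (e 0) (e 6)
      (e 7) (e 8) (e 9) rfl rfl h₁ h₂ h₃ h₄ h₅⟩,
    fun e hs ⟨h₁, _⟩ =>
      ⟨.coder (e 25) (e 26) (e 29) (e 10), rfl, .coder0 (e 10) (e 13) (e 25) (e 26) (e 27) (e 28)
      (e 29) (hs rfl) h₁⟩,
    fun e hs ⟨h₁, h₂, _⟩ =>
      ⟨.coder (e 25) (e 26) (e 29) (e 10), rfl, .coder1 (e 10) (e 11) (e 13) (e 25) (e 26) (e 27)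
      (e 28) (e 29) (hs rfl) h₁ h₂⟩,
    fun e hs ⟨h₁, h₂, h₃, _⟩ =>
      ⟨.coder (e 25) (e 26) (e 29) (e 10), rfl, .coder2 (e 10) (e 11) (e 12) (e 13) (e 25) (e 26)
      (e 27) (e 28) (e 29) (hs rfl) h₁ h₂ h₃⟩,
    fun e _ ⟨h₁, _⟩ => ⟨.farc (oV (e 5) (e 29)) (e 5), rfl, .farcV (e 5) (e 29) rfl h₁⟩,
    fun e _ ⟨h₁, _⟩ => ⟨.farc (oK (e 13)) (e 7), rfl, .farcK (e 7) (e 13) rfl h₁⟩,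
    fun e _ ⟨h₁, h₂, _⟩ =>
      ⟨.farc (oNode (e 25) (e 26) (e 29)) (e 7), rfl, .farcNode (e 0) (e 6) (e 7) (e 25) (e 26)
      (e 29) rfl h₁ h₂⟩,
    fun e _ ⟨h₁, h₂, _⟩ =>
      ⟨.farc (oA (e 14) (e 16)) (e 6), rfl, .farcA (e 5) (e 6) (e 14) (e 16) rfl h₁ h₂⟩,
    fun e hs ⟨h₁, _⟩ =>
      ⟨.unf (oNode (e 25) (e 26) (e 29)) (oK (e 13)), rfl, .unf0 (e 10) (e 13) (e 25) (e 26) (e 27)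
      (e 28) (e 29) rfl rfl (hs rfl) h₁⟩,
    fun e hs ⟨h₁, _⟩ =>
      ⟨.unf (oNode (e 25) (e 26) (e 29)) (oA (oK (e 13)) (oNode (e 25) (e 26) (e 27))), rfl, .unf1
      (e 10) (e 11) (e 13) (e 25) (e 26) (e 27) (e 28) (e 29) rfl rfl (hs rfl) h₁⟩,
    fun e hs ⟨h₁, _⟩ =>
      ⟨.unf (oNode (e 25) (e 26) (e 29))
      (oA (oA (oK (e 13)) (oNode (e 25) (e 26) (e 27))) (oNode (e 25) (e 26) (e 28))), rfl, .unf2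
      (e 10) (e 11) (e 12) (e 13) (e 25) (e 26) (e 27) (e 28) (e 29) rfl rfl (hs rfl) h₁⟩,
    fun e _ _ => ⟨.eq (oV (e 5) (e 29)) (oV (e 5) (e 29)), rfl, .eqV (e 5) (e 29) rfl rfl⟩,
    fun e _ _ => ⟨.eq (oK (e 13)) (oK (e 13)), rfl, .eqK (e 13) rfl rfl⟩,
    fun e _ ⟨h₁, h₂, _⟩ =>
      ⟨.eq (oA (e 14) (e 16)) (oA (e 15) (e 17)), rfl, .eqA (e 14) (e 15) (e 16) (e 17) rfl rfl h₁
      h₂⟩,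
    fun e _ ⟨h₁, h₂, _⟩ =>
      ⟨.eq (oNode (e 25) (e 26) (e 29)) (e 16), rfl, .eqLeft (e 16) (e 18) (e 25) (e 26) (e 29) rfl
      h₁ h₂⟩,
    fun e _ ⟨h₁, h₂, _⟩ =>
      ⟨.eq (e 14) (oNode (e 25) (e 26) (e 29)), rfl, .eqRight (e 14) (e 18) (e 25) (e 26) (e 29)
      rfl h₁ h₂⟩,
    fun e _ _ => ⟨.spine oNil (e 14) (e 14) (e 16) (e 16), rfl, .spineNil (e 14) (e 16) rfl rfl
      rfl⟩,
    fun e _ ⟨h₁, _⟩ =>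
      ⟨.spine (oSnoc (e 0) (e 5)) (e 14) (oA (e 18) (e 23)) (e 16) (oA (e 19) (e 23)), rfl,
      .spineSnoc (e 0) (e 5) (e 14) (e 16) (e 18) (e 19) (e 23) rfl rfl rfl h₁⟩,
    fun e _ _ => ⟨.step (oA (oK (rId (e 5))) (e 23)) (e 23), rfl, .stepId (e 5) (e 23) rfl⟩,
    fun e _ ⟨h₁, h₂, _⟩ =>
      ⟨.step (e 21) (e 22), rfl, .stepEx (e 0) (e 1) (e 4) (e 5) (e 6) (e 16) (e 18) (e 19) (e 21)
      (e 22) (e 23) (e 24) h₁ h₂⟩,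
    fun e _ ⟨h₁, _⟩ =>
      ⟨.step (oA (e 18) (e 23)) (e 19), rfl, .stepWk (e 0) (e 5) (e 6) (e 16) (e 18) (e 19) (e 23)
      rfl h₁⟩,
    fun e _ ⟨h₁, _⟩ =>
      ⟨.step (oA (e 18) (e 23)) (oA (oA (e 19) (e 23)) (e 23)), rfl, .stepCntr (e 0) (e 5) (e 6)
      (e 16) (e 18) (e 19) (e 23) rfl rfl h₁⟩,
    fun e _ ⟨h₁, h₂, _⟩ =>
      ⟨.step (e 18) (oA (e 20) (e 19)), rfl, .stepCut (e 0) (e 5) (e 6) (e 14) (e 16) (e 18) (e 19)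
      (e 20) rfl h₁ h₂⟩,
    fun e _ ⟨h₁, h₂, _⟩ =>
      ⟨.step (oA (e 18) (e 24)) (oA (e 20) (oA (e 24) (e 19))), rfl, .stepL (e 0) (e 4) (e 5) (e 6)
      (e 14) (e 16) (e 18) (e 19) (e 20) (e 24) rfl rfl h₁ h₂⟩,
    fun e _ ⟨h₁, _⟩ =>
      ⟨.step (oA (e 18) (e 23)) (oA (e 19) (e 23)), rfl, .stepR (e 0) (e 5) (e 6) (e 16) (e 18)
      (e 19) (e 23) rfl rfl h₁⟩,
    fun e _ ⟨h₁, _⟩ =>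
      ⟨.step (oA (e 18) (oK rZero)) (e 19), rfl, .stepRecrZero (e 0) (e 6) (e 14) (e 16) (e 18)
      (e 19) rfl h₁⟩,
    fun e _ ⟨h₁, _⟩ =>
      ⟨.step (oA (e 18) (oA (oK rSucc) (e 24))) (oA (oA (e 19) (e 24)) (oA (e 18) (e 24))), rfl,
      .stepRecrSucc (e 0) (e 6) (e 14) (e 16) (e 18) (e 19) (e 24) rfl rfl h₁⟩,
    fun e _ ⟨h₁, _⟩ =>
      ⟨.step (oA (e 18) (oK rZero)) (e 19), rfl, .stepCondZero (e 0) (e 6) (e 14) (e 16) (e 18)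
      (e 19) rfl h₁⟩,
    fun e _ ⟨h₁, _⟩ =>
      ⟨.step (oA (e 18) (oA (oK rSucc) (e 24))) (oA (e 19) (e 24)), rfl, .stepCondSucc (e 0) (e 6)
      (e 14) (e 16) (e 18) (e 19) (e 24) rfl rfl h₁⟩,
    fun e _ ⟨h₁, _⟩ =>
      ⟨.step (oA (e 14) (e 16)) (oA (e 15) (e 16)), rfl, .stepLeft (e 14) (e 15) (e 16) rfl rfl h₁⟩,
    fun e _ ⟨h₁, _⟩ =>
      ⟨.step (oA (e 14) (e 16)) (oA (e 14) (e 17)), rfl, .stepRight (e 14) (e 16) (e 17) rfl rfl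
      h₁⟩,
    fun e _ ⟨h₁, h₂, h₃, h₄, h₅, h₆, h₇, _⟩ =>
      ⟨.red (e 7) (e 14) (e 16), rfl, .red (e 7) (e 14) (e 15) (e 16) (e 17) h₁ h₂ h₃ h₄ h₅ h₆ h₇⟩,
    fun e _ ⟨h₁, h₂, h₃, _⟩ =>
      ⟨.reds (e 7) (e 14) (e 16), rfl, .redsRefl (e 7) (e 14) (e 16) h₁ h₂ h₃⟩,
    fun e _ ⟨h₁, h₂, _⟩ =>
      ⟨.reds (e 7) (e 14) (e 18), rfl, .redsStep (e 7) (e 14) (e 16) (e 18) h₁ h₂⟩,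
    fun e _ ⟨h₁, h₂, h₃, _⟩ =>
      ⟨.conv (e 7) (e 14) (e 16), rfl, .convRefl (e 7) (e 14) (e 16) h₁ h₂ h₃⟩,
    fun e _ ⟨h₁, h₂, _⟩ =>
      ⟨.conv (e 7) (e 14) (e 18), rfl, .convStep (e 7) (e 14) (e 16) (e 18) h₁ h₂⟩,
    fun e _ ⟨h₁, h₂, _⟩ =>
      ⟨.conv (e 7) (e 14) (e 18), rfl, .convBack (e 7) (e 14) (e 16) (e 18) h₁ h₂⟩⟩

theorem step_clause (i : ℕ) (e : ℕ → M.Num) {y : M.Num} (hi : i < Arith.clauses.length)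
    (hs : SideCond Arith.clauses[i].side e)
    (h : AllIn (bif Arith.clauses[i].circular then Q else P) e Arith.clauses[i].prems)
    (hy : y = Arith.clauses[i].concl.eval M e) : Step ClRl P Q y := by
  refine ⟨_, _, ⟨_, List.getElem_mem hi, e, rfl, rfl, hy, hs⟩, fun x hx => ?_⟩
  obtain ⟨p, hp, rfl⟩ := List.mem_map.1 hx
  have := allIn_iff.1 h p hp
  cases hc : Arith.clauses[i].circular <;> rw [hc] at this <;> simpa using this

/-- The bridge from the syntactic clauses to the inductive predicate `Rule`, through which all
inversions go. In the converse direction the numerals are the positions of the clauses in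
`Arith.clauses`, and `env` lists the values of their variables. -/
theorem step_iff {j : Jd M} : Step ClRl P Q j.code ↔ Rule P Q j := by
  constructor
  · rintro ⟨_, _, ⟨c, hc, e, rfl, rfl, h1, h2⟩, h3⟩
    obtain ⟨j', h4, h5⟩ := List.forall_iff_forall_mem.1 clauses_rule c hc e h2 (allIn_iff.2
      fun p hp => by
        have := h3 _ (List.mem_map_of_mem hp)
        cases hc : c.circular <;> simpa [hc] using this)
    rwa [Jd.code_injective (h1.trans h4)]
  · intro h
    cases h with
  | tyN e₁ =>
      subst e₁
      exact step_clause 0 (env ) (by decide) (by rintro ⟨⟩) trivial rfl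
  | tyArr σ τ e₁ h₁ h₂ =>
      subst e₁
      exact step_clause 1 (env (σ := σ) (τ := τ)) (by decide) (by rintro ⟨⟩) ⟨h₁, h₂, trivial⟩ rfl
  | ctxNil e₁ =>
      subst e₁
      exact step_clause 2 (env ) (by decide) (by rintro ⟨⟩) trivial rfl
  | ctxSnoc Γ σ e₁ h₁ h₂ =>
      subst e₁
      exact step_clause 3 (env (Γ := Γ) (σ := σ)) (by decide) (by rintro ⟨⟩) ⟨h₁, h₂, trivial⟩ rfl
  | arrowNil τ e₁ e₃ =>
      subst e₁ e₃
      exact step_clause 4 (env (τ := τ)) (by decide) (by rintro ⟨⟩) trivial rfl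
  | arrowSnoc Γ σ τ θ e₁ h₁ =>
      subst e₁
      exact step_clause 5 (env (Γ := Γ) (σ := σ) (τ := τ) (θ := θ)) (by decide) (by rintro ⟨⟩)
        ⟨h₁, trivial⟩ rfl
  | appendNil Γ e₂ e₃ =>
      subst e₂ e₃
      exact step_clause 6 (env (Γ := Γ)) (by decide) (by rintro ⟨⟩) trivial rfl
  | appendSnoc Γ Δ Θ σ e₂ e₃ h₁ =>
      subst e₂ e₃
      exact step_clause 7 (env (Γ := Γ) (Δ := Δ) (Θ := Θ) (σ := σ)) (by decide) (by rintro ⟨⟩)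
        ⟨h₁, trivial⟩ rfl
  | instId σ e₁ e₂ h₁ =>
      subst e₁ e₂
      exact step_clause 8 (env (σ := σ)) (by decide) (by rintro ⟨⟩) ⟨h₁, trivial⟩ rfl
  | instZero e₁ e₂ =>
      subst e₁ e₂
      exact step_clause 9 (env ) (by decide) (by rintro ⟨⟩) trivial rfl
  | instSucc e₁ e₂ =>
      subst e₁ e₂
      exact step_clause 10 (env ) (by decide) (by rintro ⟨⟩) trivial rfl
  | instEx Γ Δ Θ Θ' ρ σ τ e₁ e₂ e₃ h₁ h₂ h₃ h₄ h₅ h₆ h₇ =>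
      subst e₁ e₂ e₃
      exact step_clause 11 (env (Γ := Γ) (Δ := Δ) (Θ := Θ) (Θ' := Θ') (ρ := ρ) (σ := σ) (τ := τ))
        (by decide) (by rintro ⟨⟩) ⟨h₁, h₂, h₃, h₄, h₅, h₆, h₇, trivial⟩ rfl
  | instWk Γ σ τ e₁ e₂ e₃ h₁ h₂ h₃ =>
      subst e₁ e₂ e₃
      exact step_clause 12 (env (Γ := Γ) (σ := σ) (τ := τ)) (by decide) (by rintro ⟨⟩)
        ⟨h₁, h₂, h₃, trivial⟩ rfl
  | instCntr Γ σ τ e₁ e₂ e₃ h₁ h₂ h₃ =>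
      subst e₁ e₂ e₃
      exact step_clause 13 (env (Γ := Γ) (σ := σ) (τ := τ)) (by decide) (by rintro ⟨⟩)
        ⟨h₁, h₂, h₃, trivial⟩ rfl
  | instR Γ σ τ e₁ e₂ e₃ h₁ h₂ h₃ =>
      subst e₁ e₂ e₃
      exact step_clause 14 (env (Γ := Γ) (σ := σ) (τ := τ)) (by decide) (by rintro ⟨⟩)
        ⟨h₁, h₂, h₃, trivial⟩ rfl
  | instCut Γ σ τ e₁ e₂ e₃ e₄ h₁ h₂ h₃ =>
      subst e₁ e₂ e₃ e₄
      exact step_clause 15 (env (Γ := Γ) (σ := σ) (τ := τ)) (by decide) (by rintro ⟨⟩)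
        ⟨h₁, h₂, h₃, trivial⟩ rfl
  | instL Γ ρ σ τ e₁ e₂ e₃ e₄ h₁ h₂ h₃ h₄ =>
      subst e₁ e₂ e₃ e₄
      exact step_clause 16 (env (Γ := Γ) (ρ := ρ) (σ := σ) (τ := τ)) (by decide) (by rintro ⟨⟩)
        ⟨h₁, h₂, h₃, h₄, trivial⟩ rfl
  | instCond Γ τ e₁ e₂ e₃ e₄ h₁ h₂ =>
      subst e₁ e₂ e₃ e₄
      exact step_clause 17 (env (Γ := Γ) (τ := τ)) (by decide) (by rintro ⟨⟩) ⟨h₁, h₂, trivial⟩ rfl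
  | const0 Γ τ θ r h₁ h₂ =>
      exact step_clause 18 (env (Γ := Γ) (τ := τ) (θ := θ) (r := r)) (by decide) (by rintro ⟨⟩)
        ⟨h₁, h₂, trivial⟩ rfl
  | const1 Γ Δ σ τ θ θ₁ r e₂ h₁ h₂ h₃ =>
      subst e₂
      exact step_clause 19 (env (Γ := Γ) (Δ := Δ) (σ := σ) (τ := τ) (θ := θ) (θ₁ := θ₁) (r := r))
        (by decide) (by rintro ⟨⟩) ⟨h₁, h₂, h₃, trivial⟩ rfl
  | const2 Γ Δ Θ ρ σ τ θ θ₁ θ₂ r e₂ h₁ h₂ h₃ h₄ =>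
      subst e₂
      exact step_clause 20
        (env (Γ := Γ) (Δ := Δ) (Θ := Θ) (ρ := ρ) (σ := σ) (τ := τ) (θ := θ) (θ₁ := θ₁) (θ₂ := θ₂)
        (r := r)) (by decide) (by rintro ⟨⟩) ⟨h₁, h₂, h₃, h₄, trivial⟩ rfl
  | constRecr Γ τ θ θ₁ θ₂ e₁ e₂ h₁ h₂ h₃ h₄ h₅ =>
      subst e₁ e₂
      exact step_clause 21 (env (Γ := Γ) (τ := τ) (θ := θ) (θ₁ := θ₁) (θ₂ := θ₂)) (by decide)
        (by rintro ⟨⟩) ⟨h₁, h₂, h₃, h₄, h₅, trivial⟩ rfl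
  | coder0 S r a b i j k hs h₁ =>
      exact step_clause 22 (env (S := S) (r := r) (a := a) (b := b) (i := i) (j := j) (k := k))
        (by decide) (fun _ => hs) ⟨h₁, trivial⟩ rfl
  | coder1 S S₁ r a b i j k hs h₁ h₂ =>
      exact step_clause 23
        (env (S := S) (S₁ := S₁) (r := r) (a := a) (b := b) (i := i) (j := j) (k := k)) (by decide)
        (fun _ => hs) ⟨h₁, h₂, trivial⟩ rfl
  | coder2 S S₁ S₂ r a b i j k hs h₁ h₂ h₃ =>
      exact step_clause 24
        (env (S := S) (S₁ := S₁) (S₂ := S₂) (r := r) (a := a) (b := b) (i := i) (j := j) (k := k))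
        (by decide) (fun _ => hs) ⟨h₁, h₂, h₃, trivial⟩ rfl
  | farcV σ k e₁ h₁ =>
      subst e₁
      exact step_clause 25 (env (σ := σ) (k := k)) (by decide) (by rintro ⟨⟩) ⟨h₁, trivial⟩ rfl
  | farcK θ r e₁ h₁ =>
      subst e₁
      exact step_clause 26 (env (θ := θ) (r := r)) (by decide) (by rintro ⟨⟩) ⟨h₁, trivial⟩ rfl
  | farcNode Γ τ θ a b k e₁ h₁ h₂ =>
      subst e₁
      exact step_clause 27 (env (Γ := Γ) (τ := τ) (θ := θ) (a := a) (b := b) (k := k)) (by decide)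
        (by rintro ⟨⟩) ⟨h₁, h₂, trivial⟩ rfl
  | farcA σ τ s t e₁ h₁ h₂ =>
      subst e₁
      exact step_clause 28 (env (σ := σ) (τ := τ) (s := s) (t := t)) (by decide) (by rintro ⟨⟩)
        ⟨h₁, h₂, trivial⟩ rfl
  | unf0 S r a b i j k e₁ e₂ hs h₁ =>
      subst e₁ e₂
      exact step_clause 29 (env (S := S) (r := r) (a := a) (b := b) (i := i) (j := j) (k := k))
        (by decide) (fun _ => hs) ⟨h₁, trivial⟩ rfl
  | unf1 S S₁ r a b i j k e₁ e₂ hs h₁ =>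
      subst e₁ e₂
      exact step_clause 30
        (env (S := S) (S₁ := S₁) (r := r) (a := a) (b := b) (i := i) (j := j) (k := k)) (by decide)
        (fun _ => hs) ⟨h₁, trivial⟩ rfl
  | unf2 S S₁ S₂ r a b i j k e₁ e₂ hs h₁ =>
      subst e₁ e₂
      exact step_clause 31
        (env (S := S) (S₁ := S₁) (S₂ := S₂) (r := r) (a := a) (b := b) (i := i) (j := j) (k := k))
        (by decide) (fun _ => hs) ⟨h₁, trivial⟩ rfl
  | eqV σ k e₁ e₂ =>
      subst e₁ e₂
      exact step_clause 32 (env (σ := σ) (k := k)) (by decide) (by rintro ⟨⟩) trivial rfl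
  | eqK r e₁ e₂ =>
      subst e₁ e₂
      exact step_clause 33 (env (r := r)) (by decide) (by rintro ⟨⟩) trivial rfl
  | eqA s s' t t' e₁ e₂ h₁ h₂ =>
      subst e₁ e₂
      exact step_clause 34 (env (s := s) (s' := s') (t := t) (t' := t')) (by decide) (by rintro ⟨⟩)
        ⟨h₁, h₂, trivial⟩ rfl
  | eqLeft t u a b k e₁ h₁ h₂ =>
      subst e₁
      exact step_clause 35 (env (t := t) (u := u) (a := a) (b := b) (k := k)) (by decide)
        (by rintro ⟨⟩) ⟨h₁, h₂, trivial⟩ rfl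
  | eqRight s u a b k e₂ h₁ h₂ =>
      subst e₂
      exact step_clause 36 (env (s := s) (u := u) (a := a) (b := b) (k := k)) (by decide)
        (by rintro ⟨⟩) ⟨h₁, h₂, trivial⟩ rfl
  | spineNil s t e₁ e₃ e₅ =>
      subst e₁ e₃ e₅
      exact step_clause 37 (env (s := s) (t := t)) (by decide) (by rintro ⟨⟩) trivial rfl
  | spineSnoc Γ σ s t u v x e₁ e₃ e₅ h₁ =>
      subst e₁ e₃ e₅
      exact step_clause 38 (env (Γ := Γ) (σ := σ) (s := s) (t := t) (u := u) (v := v) (x := x))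
        (by decide) (by rintro ⟨⟩) ⟨h₁, trivial⟩ rfl
  | stepId σ x e₁ =>
      subst e₁
      exact step_clause 39 (env (σ := σ) (x := x)) (by decide) (by rintro ⟨⟩) trivial rfl
  | stepEx Γ Δ ρ σ τ t u v w w' x y h₁ h₂ =>
      exact step_clause 40
        (env (Γ := Γ) (Δ := Δ) (ρ := ρ) (σ := σ) (τ := τ) (t := t) (u := u) (v := v) (w := w)
        (w' := w') (x := x) (y := y)) (by decide) (by rintro ⟨⟩) ⟨h₁, h₂, trivial⟩ rfl
  | stepWk Γ σ τ t u v x e₁ h₁ =>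
      subst e₁
      exact step_clause 41 (env (Γ := Γ) (σ := σ) (τ := τ) (t := t) (u := u) (v := v) (x := x))
        (by decide) (by rintro ⟨⟩) ⟨h₁, trivial⟩ rfl
  | stepCntr Γ σ τ t u v x e₁ e₂ h₁ =>
      subst e₁ e₂
      exact step_clause 42 (env (Γ := Γ) (σ := σ) (τ := τ) (t := t) (u := u) (v := v) (x := x))
        (by decide) (by rintro ⟨⟩) ⟨h₁, trivial⟩ rfl
  | stepCut Γ σ τ s t u v v' e₂ h₁ h₂ =>
      subst e₂
      exact step_clause 43
        (env (Γ := Γ) (σ := σ) (τ := τ) (s := s) (t := t) (u := u) (v := v) (v' := v')) (by decide)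
        (by rintro ⟨⟩) ⟨h₁, h₂, trivial⟩ rfl
  | stepL Γ ρ σ τ s t u v v' y e₁ e₂ h₁ h₂ =>
      subst e₁ e₂
      exact step_clause 44
        (env (Γ := Γ) (ρ := ρ) (σ := σ) (τ := τ) (s := s) (t := t) (u := u) (v := v) (v' := v')
        (y := y)) (by decide) (by rintro ⟨⟩) ⟨h₁, h₂, trivial⟩ rfl
  | stepR Γ σ τ t u v x e₁ e₂ h₁ =>
      subst e₁ e₂
      exact step_clause 45 (env (Γ := Γ) (σ := σ) (τ := τ) (t := t) (u := u) (v := v) (x := x))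
        (by decide) (by rintro ⟨⟩) ⟨h₁, trivial⟩ rfl
  | stepRecrZero Γ τ s t u v e₁ h₁ =>
      subst e₁
      exact step_clause 46 (env (Γ := Γ) (τ := τ) (s := s) (t := t) (u := u) (v := v)) (by decide)
        (by rintro ⟨⟩) ⟨h₁, trivial⟩ rfl
  | stepRecrSucc Γ τ s t u v y e₁ e₂ h₁ =>
      subst e₁ e₂
      exact step_clause 47 (env (Γ := Γ) (τ := τ) (s := s) (t := t) (u := u) (v := v) (y := y))
        (by decide) (by rintro ⟨⟩) ⟨h₁, trivial⟩ rfl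
  | stepCondZero Γ τ s t u v e₁ h₁ =>
      subst e₁
      exact step_clause 48 (env (Γ := Γ) (τ := τ) (s := s) (t := t) (u := u) (v := v)) (by decide)
        (by rintro ⟨⟩) ⟨h₁, trivial⟩ rfl
  | stepCondSucc Γ τ s t u v y e₁ e₂ h₁ =>
      subst e₁ e₂
      exact step_clause 49 (env (Γ := Γ) (τ := τ) (s := s) (t := t) (u := u) (v := v) (y := y))
        (by decide) (by rintro ⟨⟩) ⟨h₁, trivial⟩ rfl
  | stepLeft s s' t e₁ e₂ h₁ =>
      subst e₁ e₂
      exact step_clause 50 (env (s := s) (s' := s') (t := t)) (by decide) (by rintro ⟨⟩)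
        ⟨h₁, trivial⟩ rfl
  | stepRight s t t' e₁ e₂ h₁ =>
      subst e₁ e₂
      exact step_clause 51 (env (s := s) (t := t) (t' := t')) (by decide) (by rintro ⟨⟩)
        ⟨h₁, trivial⟩ rfl
  | red θ s s' t t' h₁ h₂ h₃ h₄ h₅ h₆ h₇ =>
      exact step_clause 52 (env (θ := θ) (s := s) (s' := s') (t := t) (t' := t')) (by decide)
        (by rintro ⟨⟩) ⟨h₁, h₂, h₃, h₄, h₅, h₆, h₇, trivial⟩ rfl
  | redsRefl θ s t h₁ h₂ h₃ =>
      exact step_clause 53 (env (θ := θ) (s := s) (t := t)) (by decide) (by rintro ⟨⟩)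
        ⟨h₁, h₂, h₃, trivial⟩ rfl
  | redsStep θ s t u h₁ h₂ =>
      exact step_clause 54 (env (θ := θ) (s := s) (t := t) (u := u)) (by decide) (by rintro ⟨⟩)
        ⟨h₁, h₂, trivial⟩ rfl
  | convRefl θ s t h₁ h₂ h₃ =>
      exact step_clause 55 (env (θ := θ) (s := s) (t := t)) (by decide) (by rintro ⟨⟩)
        ⟨h₁, h₂, h₃, trivial⟩ rfl
  | convStep θ s t u h₁ h₂ =>
      exact step_clause 56 (env (θ := θ) (s := s) (t := t) (u := u)) (by decide) (by rintro ⟨⟩)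
        ⟨h₁, h₂, trivial⟩ rfl
  | convBack θ s t u h₁ h₂ =>
      exact step_clause 57 (env (θ := θ) (s := s) (t := t) (u := u)) (by decide) (by rintro ⟨⟩)
        ⟨h₁, h₂, trivial⟩ rfl

end

/-! ## Judgments as definable relations -/

section

variable {M : Structure2.{u}} [hM : Fact M.IsModelRCA0]

theorem of_rule {j : Jd M} (h : Rule (Der ClRl) (Der ClRl) j) : Der ClRl j.code :=
  Der.of_step (step_iff.2 h)

section

variable {C : Type u} [Ctx M C] {f g h f' g' : C → M.Num} [Fn f] [Fn g] [Fn h] [Fn f'] [Fn g']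

def jCtx (Γ : M.Num) : Prop := Der ClRl (Jd.ctx Γ).code

def jArrow (Γ τ θ : M.Num) : Prop := Der ClRl (Jd.arrow Γ τ θ).code

theorem jArrow.rule {Γ τ θ : M.Num} (h : jArrow Γ τ θ) :
    Rule (Der ClRl) (Der ClRl) (.arrow Γ τ θ) := step_iff.1 h.step

instance jArrow.sg : Sg (fun c => jArrow (f c) (g c) (h c)) :=
  Sg.comp (Sg.der ClRl) (fun c => (Jd.arrow (f c) (g c) (h c)).code)

def jAppend (Γ Δ Θ : M.Num) : Prop := Der ClRl (Jd.append Γ Δ Θ).code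

theorem jAppend.rule {Γ Δ Θ : M.Num} (h : jAppend Γ Δ Θ) :
    Rule (Der ClRl) (Der ClRl) (.append Γ Δ Θ) := step_iff.1 h.step

instance jAppend.sg : Sg (fun c => jAppend (f c) (g c) (h c)) :=
  Sg.comp (Sg.der ClRl) (fun c => (Jd.append (f c) (g c) (h c)).code)

def jInst0 (r S : M.Num) : Prop := Der ClRl (Jd.inst0 r S).code

theorem jInst0.rule {r S : M.Num} (h : jInst0 r S) :
    Rule (Der ClRl) (Der ClRl) (.inst0 r S) := step_iff.1 h.step

def jInst1 (r S₁ S : M.Num) : Prop := Der ClRl (Jd.inst1 r S₁ S).code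

theorem jInst1.rule {r S₁ S : M.Num} (h : jInst1 r S₁ S) :
    Rule (Der ClRl) (Der ClRl) (.inst1 r S₁ S) := step_iff.1 h.step

def jInst2 (r S₁ S₂ S : M.Num) : Prop := Der ClRl (Jd.inst2 r S₁ S₂ S).code

theorem jInst2.rule {r S₁ S₂ S : M.Num} (h : jInst2 r S₁ S₂ S) :
    Rule (Der ClRl) (Der ClRl) (.inst2 r S₁ S₂ S) := step_iff.1 h.step

def jConst (r θ : M.Num) : Prop := Der ClRl (Jd.const r θ).code

theorem jConst.rule {r θ : M.Num} (h : jConst r θ) :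
    Rule (Der ClRl) (Der ClRl) (.const r θ) := step_iff.1 h.step

def jCoder (a b k S : M.Num) : Prop := Der ClRl (Jd.coder a b k S).code

theorem jCoder.rule {a b k S : M.Num} (h : jCoder a b k S) :
    Rule (Der ClRl) (Der ClRl) (.coder a b k S) := step_iff.1 h.step

def jFarc (t θ : M.Num) : Prop := Der ClRl (Jd.farc t θ).code

theorem jFarc.rule {t θ : M.Num} (h : jFarc t θ) :
    Rule (Der ClRl) (Der ClRl) (.farc t θ) := step_iff.1 h.step

instance jFarc.sg : Sg (fun c => jFarc (f c) (g c)) :=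
  Sg.comp (Sg.der ClRl) (fun c => (Jd.farc (f c) (g c)).code)

def jUnf (t u : M.Num) : Prop := Der ClRl (Jd.unf t u).code

theorem jUnf.rule {t u : M.Num} (h : jUnf t u) :
    Rule (Der ClRl) (Der ClRl) (.unf t u) := step_iff.1 h.step

instance jUnf.sg : Sg (fun c => jUnf (f c) (g c)) :=
  Sg.comp (Sg.der ClRl) (fun c => (Jd.unf (f c) (g c)).code)

def jEq (s t : M.Num) : Prop := Der ClRl (Jd.eq s t).code

theorem jEq.rule {s t : M.Num} (h : jEq s t) :
    Rule (Der ClRl) (Der ClRl) (.eq s t) := step_iff.1 h.step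

instance jEq.sg : Sg (fun c => jEq (f c) (g c)) :=
  Sg.comp (Sg.der ClRl) (fun c => (Jd.eq (f c) (g c)).code)

def jSpine (Γ s u t v : M.Num) : Prop := Der ClRl (Jd.spine Γ s u t v).code

instance jSpine.sg : Sg (fun c => jSpine (f c) (g c) (h c) (f' c) (g' c)) :=
  Sg.comp (Sg.der ClRl) (fun c => (Jd.spine (f c) (g c) (h c) (f' c) (g' c)).code)

def jStep (s t : M.Num) : Prop := Der ClRl (Jd.step s t).code

def jRed (θ s t : M.Num) : Prop := Der ClRl (Jd.red θ s t).code

theorem jRed.rule {θ s t : M.Num} (h : jRed θ s t) :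
    Rule (Der ClRl) (Der ClRl) (.red θ s t) := step_iff.1 h.step

def jReds (θ s t : M.Num) : Prop := Der ClRl (Jd.reds θ s t).code

theorem jReds.rule {θ s t : M.Num} (h : jReds θ s t) :
    Rule (Der ClRl) (Der ClRl) (.reds θ s t) := step_iff.1 h.step

instance jReds.sg : Sg (fun c => jReds (f c) (g c) (h c)) :=
  Sg.comp (Sg.der ClRl) (fun c => (Jd.reds (f c) (g c) (h c)).code)

def jConv (θ s t : M.Num) : Prop := Der ClRl (Jd.conv θ s t).code

theorem jConv.rule {θ s t : M.Num} (h : jConv θ s t) :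
    Rule (Der ClRl) (Der ClRl) (.conv θ s t) := step_iff.1 h.step

instance jConv.sg : Sg (fun c => jConv (f c) (g c) (h c)) :=
  Sg.comp (Sg.der ClRl) (fun c => (Jd.conv (f c) (g c) (h c)).code)

end

/-! ### Induction along derivations of one kind of judgment -/

theorem le_cd {k : ℕ} {l : List M.Num} {x : M.Num} (hx : x ∈ l) : x ≤ cd k l := by
  refine le_trans ?_ (le_pr_right _ _)
  induction l with
  | nil => simp at hx
  | cons y l ih =>
    rcases List.mem_cons.1 hx with rfl | hx
    exacts [le_pr_left _ _, (ih hx).trans (le_pr_right _ _)]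

theorem cd_le_cd {k : ℕ} {l l' : List M.Num} (h : List.Forall₂ (· ≤ ·) l l') :
    cd k l ≤ cd k l' := by
  refine pr_mono le_rfl ?_
  induction h with
  | nil => exact le_rfl
  | cons h _ ih => exact pr_mono h ih

/-- The components of a code are at most the code, so the universal quantifier is bounded and the
predicate stays `Σ⁰₁`. -/
theorem Sg.forall_code₁ {Φ : M.Num → Prop} (hΦ : Sg (fun d : M.Num => Φ d))
    (k : ℕ) : Sg (fun y : M.Num => ∀ s, y = cd k [s] → Φ s) := by
  have := fun (C : Type u) [Ctx M C] (f : C → M.Num) [Fn f] => hΦ.comp f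
  refine (inferInstance : Sg (fun y : M.Num => ∀ s, s ≤ y →
    y = cd k [s] → Φ s)).congr fun y =>
      ⟨fun h s _ => h s, fun h s e => h s ?_ e⟩
  all_goals
    rw [e]
    exact le_cd (by simp)

theorem Pg.forall_code₁ {Φ : M.Num → Prop} (hΦ : Pg (fun d : M.Num => Φ d))
    (k : ℕ) : Pg (fun y : M.Num => ∀ s, y = cd k [s] → Φ s) := by
  have := fun (C : Type u) [Ctx M C] (f : C → M.Num) [Fn f] =>
    Sg.comp (P := fun s => ¬ Φ s) hΦ f
  infer_instance

theorem Sg.forall_code₂ {Φ : M.Num → M.Num → Prop} (hΦ : Sg (fun d : M.Num × M.Num => Φ d.1 d.2))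
    (k : ℕ) : Sg (fun y : M.Num => ∀ s t, y = cd k [s, t] → Φ s t) := by
  have := fun (C : Type u) [Ctx M C] (f g : C → M.Num) [Fn f] [Fn g] => hΦ.comp₂ f g
  refine (inferInstance : Sg (fun y : M.Num => ∀ s, s ≤ y → ∀ t, t ≤ y →
    y = cd k [s, t] → Φ s t)).congr fun y =>
      ⟨fun h s _ t _ => h s t, fun h s t e => h s ?_ t ?_ e⟩
  all_goals
    rw [e]
    exact le_cd (by simp)

theorem Pg.forall_code₂ {Φ : M.Num → M.Num → Prop} (hΦ : Pg (fun d : M.Num × M.Num => Φ d.1 d.2))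
    (k : ℕ) : Pg (fun y : M.Num => ∀ s t, y = cd k [s, t] → Φ s t) := by
  have := fun (C : Type u) [Ctx M C] (f g : C → M.Num) [Fn f] [Fn g] =>
    Sg.comp₂ (P := fun s t => ¬ Φ s t) hΦ f g
  infer_instance

theorem Sg.forall_code₃ {Φ : M.Num → M.Num → M.Num → Prop} (hΦ : Sg (fun d : (M.Num × M.Num) × M.Num => Φ d.1.1 d.1.2 d.2))
    (k : ℕ) : Sg (fun y : M.Num => ∀ s t u, y = cd k [s, t, u] → Φ s t u) := by
  have := fun (C : Type u) [Ctx M C] (f g h : C → M.Num) [Fn f] [Fn g] [Fn h] => hΦ.comp₃ f g h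
  refine (inferInstance : Sg (fun y : M.Num => ∀ s, s ≤ y → ∀ t, t ≤ y → ∀ u, u ≤ y →
    y = cd k [s, t, u] → Φ s t u)).congr fun y =>
      ⟨fun h s _ t _ u _ => h s t u, fun h s t u e => h s ?_ t ?_ u ?_ e⟩
  all_goals
    rw [e]
    exact le_cd (by simp)

theorem Pg.forall_code₃ {Φ : M.Num → M.Num → M.Num → Prop} (hΦ : Pg (fun d : (M.Num × M.Num) × M.Num => Φ d.1.1 d.1.2 d.2))
    (k : ℕ) : Pg (fun y : M.Num => ∀ s t u, y = cd k [s, t, u] → Φ s t u) := by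
  have := fun (C : Type u) [Ctx M C] (f g h : C → M.Num) [Fn f] [Fn g] [Fn h] =>
    Sg.comp₃ (P := fun s t u => ¬ Φ s t u) hΦ f g h
  infer_instance

/-- The induction predicate speaks of codes of this kind only and holds vacuously of all other
judgments. The same scheme serves the other judgments below. -/
theorem jCtx.induct {Φ : M.Num → Prop}
    (hΦ : Sg (fun d : M.Num => Φ d) ∨ Pg (fun d : M.Num => Φ d))
    (hs : ∀ Γ, jCtx Γ → Rule (fun y => Der ClRl y ∧ ∀ Γ, y = (Jd.ctx Γ).code → Φ Γ)
      (Der ClRl) (.ctx Γ) → Φ Γ) {Γ : M.Num} (h : jCtx Γ) : Φ Γ :=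
  Der.induct (P := fun y => ∀ Γ, y = (Jd.ctx Γ).code → Φ Γ)
    (hΦ.imp (Sg.forall_code₁ · _) (Pg.forall_code₁ · _))
    (fun y hy h Γ e => by subst e; exact hs Γ hy (step_iff.1 h)) h _ rfl

theorem jArrow.induct {Φ : M.Num → M.Num → M.Num → Prop}
    (hΦ : Sg (fun d : (M.Num × M.Num) × M.Num => Φ d.1.1 d.1.2 d.2) ∨ Pg (fun d : (M.Num × M.Num) × M.Num => Φ d.1.1 d.1.2 d.2))
    (hs : ∀ Γ τ θ, jArrow Γ τ θ → Rule (fun y => Der ClRl y ∧ ∀ Γ τ θ, y = (Jd.arrow Γ τ θ).code → Φ Γ τ θ)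
      (Der ClRl) (.arrow Γ τ θ) → Φ Γ τ θ) {Γ τ θ : M.Num} (h : jArrow Γ τ θ) : Φ Γ τ θ :=
  Der.induct (P := fun y => ∀ Γ τ θ, y = (Jd.arrow Γ τ θ).code → Φ Γ τ θ)
    (hΦ.imp (Sg.forall_code₃ · _) (Pg.forall_code₃ · _))
    (fun y hy h Γ τ θ e => by subst e; exact hs Γ τ θ hy (step_iff.1 h)) h _ _ _ rfl

theorem jAppend.induct {Φ : M.Num → M.Num → M.Num → Prop}
    (hΦ : Sg (fun d : (M.Num × M.Num) × M.Num => Φ d.1.1 d.1.2 d.2) ∨ Pg (fun d : (M.Num × M.Num) × M.Num => Φ d.1.1 d.1.2 d.2))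
    (hs : ∀ Γ Δ Θ, jAppend Γ Δ Θ → Rule (fun y => Der ClRl y ∧ ∀ Γ Δ Θ, y = (Jd.append Γ Δ Θ).code → Φ Γ Δ Θ)
      (Der ClRl) (.append Γ Δ Θ) → Φ Γ Δ Θ) {Γ Δ Θ : M.Num} (h : jAppend Γ Δ Θ) : Φ Γ Δ Θ :=
  Der.induct (P := fun y => ∀ Γ Δ Θ, y = (Jd.append Γ Δ Θ).code → Φ Γ Δ Θ)
    (hΦ.imp (Sg.forall_code₃ · _) (Pg.forall_code₃ · _))
    (fun y hy h Γ Δ Θ e => by subst e; exact hs Γ Δ Θ hy (step_iff.1 h)) h _ _ _ rfl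

theorem jFarc.induct {Φ : M.Num → M.Num → Prop}
    (hΦ : Sg (fun d : M.Num × M.Num => Φ d.1 d.2) ∨ Pg (fun d : M.Num × M.Num => Φ d.1 d.2))
    (hs : ∀ t θ, jFarc t θ → Rule (fun y => Der ClRl y ∧ ∀ t θ, y = (Jd.farc t θ).code → Φ t θ)
      (Der ClRl) (.farc t θ) → Φ t θ) {t θ : M.Num} (h : jFarc t θ) : Φ t θ :=
  Der.induct (P := fun y => ∀ t θ, y = (Jd.farc t θ).code → Φ t θ)
    (hΦ.imp (Sg.forall_code₂ · _) (Pg.forall_code₂ · _))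
    (fun y hy h t θ e => by subst e; exact hs t θ hy (step_iff.1 h)) h _ _ rfl

theorem jReds.induct {Φ : M.Num → M.Num → M.Num → Prop}
    (hΦ : Sg (fun d : (M.Num × M.Num) × M.Num => Φ d.1.1 d.1.2 d.2) ∨ Pg (fun d : (M.Num × M.Num) × M.Num => Φ d.1.1 d.1.2 d.2))
    (hs : ∀ θ s t, jReds θ s t → Rule (fun y => Der ClRl y ∧ ∀ θ s t, y = (Jd.reds θ s t).code → Φ θ s t)
      (Der ClRl) (.reds θ s t) → Φ θ s t) {θ s t : M.Num} (h : jReds θ s t) : Φ θ s t :=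
  Der.induct (P := fun y => ∀ θ s t, y = (Jd.reds θ s t).code → Φ θ s t)
    (hΦ.imp (Sg.forall_code₃ · _) (Pg.forall_code₃ · _))
    (fun y hy h θ s t e => by subst e; exact hs θ s t hy (step_iff.1 h)) h _ _ _ rfl

theorem jConv.induct {Φ : M.Num → M.Num → M.Num → Prop}
    (hΦ : Sg (fun d : (M.Num × M.Num) × M.Num => Φ d.1.1 d.1.2 d.2) ∨ Pg (fun d : (M.Num × M.Num) × M.Num => Φ d.1.1 d.1.2 d.2))
    (hs : ∀ θ s t, jConv θ s t → Rule (fun y => Der ClRl y ∧ ∀ θ s t, y = (Jd.conv θ s t).code → Φ θ s t)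
      (Der ClRl) (.conv θ s t) → Φ θ s t) {θ s t : M.Num} (h : jConv θ s t) : Φ θ s t :=
  Der.induct (P := fun y => ∀ θ s t, y = (Jd.conv θ s t).code → Φ θ s t)
    (hΦ.imp (Sg.forall_code₃ · _) (Pg.forall_code₃ · _))
    (fun y hy h θ s t e => by subst e; exact hs θ s t hy (step_iff.1 h)) h _ _ _ rfl

end

/-! ## Contexts and types -/

section

variable {M : Structure2.{u}} [hM : Fact M.IsModelRCA0]

/-- `Γ` is a list of length `n`. -/
def Len (Γ n : M.Num) : Prop := ∃ a b, bt a b 0 = oNil ∧ bt a b n = Γ ∧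
  ∀ i, i < n → ∃ σ, bt a b (i + 1) = oSnoc (bt a b i) σ

instance Len.sg {C : Type u} [Ctx M C] {f g : C → M.Num} [hf : Fn f] [hg : Fn g] :
    Sg (fun c => Len (f c) (g c)) :=
  (inferInstance : Sg (fun d : M.Num × M.Num => ∃ a b, bt a b 0 = oNil ∧ bt a b d.2 = d.1 ∧
    ∀ i, i < d.2 → ∃ σ, bt a b (i + 1) = oSnoc (bt a b i) σ)).comp₂ (P := Len) f g

theorem Len.nil : Len (M := M) oNil 0 := by
  obtain ⟨a, b, -, h⟩ := exists_append (0 : M.Num) 0 0 oNil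
  exact ⟨a, b, h, h, fun i hi => (Num.not_lt_zero i hi).elim⟩

theorem Len.snoc {Γ n : M.Num} (h : Len Γ n) (σ : M.Num) : Len (oSnoc Γ σ) (n + 1) := by
  obtain ⟨a, b, h0, rfl, h⟩ := h
  obtain ⟨a', b', h1, h2⟩ := exists_append a b (n + 1) (oSnoc (bt a b n) σ)
  refine ⟨a', b', ?_, h2, fun i hi => ?_⟩
  · rw [h1 0 (Num.lt_succ_iff.2 (Num.zero_le' n)), h0]
  · rw [h1 i hi]
    rcases Num.lt_succ_cases hi with hi | rfl
    · rw [h1 _ (Num.succ_lt_succ hi)]; exact h i hi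
    · exact ⟨σ, h2⟩

theorem Len.eq_nil {Γ : M.Num} (h : Len Γ 0) : Γ = oNil := by
  obtain ⟨a, b, h0, rfl, -⟩ := h
  exact h0

theorem Len.eq_snoc {Γ n : M.Num} (h : Len Γ (n + 1)) : ∃ Δ σ, Γ = oSnoc Δ σ ∧ Len Δ n := by
  obtain ⟨a, b, h0, rfl, h⟩ := h
  obtain ⟨σ, hσ⟩ := h n (Num.lt_succ_self n)
  exact ⟨_, σ, hσ, a, b, h0, rfl, fun i hi => h i (hi.trans (Num.lt_succ_self n))⟩

theorem Len.eq_zero {n : M.Num} (h : Len oNil n) : n = 0 := by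
  rcases Num.cases' n with rfl | ⟨m, rfl⟩
  · rfl
  · obtain ⟨Δ, σ, h, -⟩ := h.eq_snoc
    simp at h

theorem Len.eq_succ {Γ σ n : M.Num} (h : Len (oSnoc Γ σ) n) : ∃ m, n = m + 1 ∧ Len Γ m := by
  rcases Num.cases' n with rfl | ⟨m, rfl⟩
  · simpa using h.eq_nil
  · obtain ⟨Δ, σ', h, hm⟩ := h.eq_snoc
    simp [pr_inj] at h
    exact ⟨m, rfl, h.1 ▸ hm⟩

/-- With `Σ⁰₁` hypotheses and an equation as conclusion the claim is `Π⁰₁`, so `Π⁰₁` induction is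
the right tool; the same holds for the other uniqueness statements. -/
theorem Len.unique {Γ n m : M.Num} (h : Len Γ n) (h' : Len Γ m) : n = m := by
  refine Pg.induct (P := fun n => ∀ Γ m : M.Num, Len Γ n → Len Γ m → n = m) inferInstance ?_ ?_ n
    Γ m h h'
  · intro Γ m h h'
    rw [h.eq_nil] at h'
    exact h'.eq_zero.symm
  · intro n ih Γ m h h'
    obtain ⟨Δ, σ, rfl, h1⟩ := h.eq_snoc
    obtain ⟨k, rfl, h2⟩ := h'.eq_succ
    rw [ih Δ k h1 h2]

theorem jCtx.len {Γ : M.Num} (h : jCtx Γ) : ∃ n, Len Γ n := by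
  refine jCtx.induct (Φ := fun Γ => ∃ n, Len Γ n) (.inl inferInstance) ?_ h
  intro Γ _ h
  cases h with
  | ctxNil e => exact ⟨0, e ▸ Len.nil⟩
  | ctxSnoc Γ σ e h =>
    obtain ⟨n, hn⟩ := h.2 _ rfl
    exact ⟨n + 1, e ▸ hn.snoc σ⟩

theorem jAppend.len {Γ Δ Θ n : M.Num} (h : jAppend Γ Δ Θ) (hn : Len Γ n) :
    ∃ m, Len Δ m ∧ Len Θ (n + m) := by
  refine jAppend.induct (Φ := fun Γ' Δ Θ => Γ' = Γ → ∃ m, Len Δ m ∧ Len Θ (n + m))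
    (.inl inferInstance) ?_ h rfl
  rintro Γ' Δ Θ _ h rfl
  cases h with
  | appendNil Γ e₂ e₃ => exact ⟨0, e₂ ▸ Len.nil, by rwa [← e₃, add_zero]⟩
  | appendSnoc Γ Δ Θ σ e₂ e₃ h =>
    obtain ⟨m, h1, h2⟩ := h.2 _ _ _ rfl rfl
    exact ⟨m + 1, e₂ ▸ h1.snoc σ, by rw [e₃, ← add_assoc]; exact h2.snoc σ⟩

theorem jArrow.nil (τ : M.Num) : jArrow oNil τ τ := of_rule (.arrowNil τ rfl rfl)

theorem jArrow.snoc {Γ σ τ θ : M.Num} (h : jArrow Γ (oArr σ τ) θ) : jArrow (oSnoc Γ σ) τ θ :=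
  of_rule (.arrowSnoc Γ σ τ θ rfl h)

theorem Len.exists_arrow {Γ n : M.Num} (h : Len Γ n) (τ : M.Num) : ∃ θ, jArrow Γ τ θ := by
  obtain ⟨a, b, h0, rfl, h⟩ := h
  -- Entry `n` is `τ`, and going down each entry gets the next type of the context as its domain.
  -- Entry `0` is therefore the type of the whole sequent.
  obtain ⟨a', b', h1, -, h2⟩ := exists_chain_descending (P := fun _ _ => (0 : M.Num) = 0)
    (S := fun i y x => ∃ σ, bt a b (i + 1) = oSnoc (bt a b i) σ ∧ y = oArr σ x)
    inferInstance inferInstance n (x := τ) rfl fun i hi x _ => by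
      obtain ⟨σ, hσ⟩ := h i hi
      exact ⟨_, rfl, σ, hσ, rfl⟩
  have key : ∀ i, i ≤ n → jArrow (bt a b i) (bt a' b' i) (bt a' b' 0) := by
    refine Sg.induct inferInstance (fun _ => ?_) fun i ih hi => ?_
    · rw [h0]; exact .nil _
    · obtain ⟨σ, h3, h4⟩ := h2 i (Num.succ_le_iff.1 hi)
      rw [h3]
      have := ih ((Num.lt_succ_self i).le.trans hi)
      rw [h4] at this
      exact this.snoc
  exact ⟨_, h1 ▸ key n le_rfl⟩

theorem jArrow.unique {Γ τ θ θ' : M.Num} (h : jArrow Γ τ θ) (h' : jArrow Γ τ θ') : θ = θ' := by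
  refine jArrow.induct (Φ := fun Γ τ θ => ∀ θ', jArrow Γ τ θ' → θ = θ') (.inr inferInstance) ?_
    h θ' h'
  intro Γ τ θ _ h θ' h'
  cases h with
  | arrowNil τ e₁ e₃ =>
    subst e₁ e₃
    cases h'.rule with
    | arrowNil _ _ e => exact e
    | arrowSnoc Γ σ _ _ e => simp at e
  | arrowSnoc Γ σ _ _ e h =>
    subst e
    cases h'.rule with
    | arrowNil _ e => simp at e
    | arrowSnoc Γ' σ' _ _ e h' =>
      simp [pr_inj] at e
      obtain ⟨rfl, rfl⟩ := e
      exact h.2 _ _ _ rfl _ h'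

theorem jAppend.unique {Γ Δ Θ Θ' : M.Num} (h : jAppend Γ Δ Θ) (h' : jAppend Γ Δ Θ') : Θ = Θ' := by
  refine jAppend.induct (Φ := fun Γ Δ Θ => ∀ Θ', jAppend Γ Δ Θ' → Θ = Θ') (.inr inferInstance) ?_
    h Θ' h'
  intro Γ Δ Θ _ h Θ' h'
  cases h with
  | appendNil _ e₁ e₃ =>
    subst e₁ e₃
    cases h'.rule with
    | appendNil _ _ e => exact e
    | appendSnoc Γ Δ Θ σ e => simp at e
  | appendSnoc _ Δ Θ σ e e' h =>
    subst e e'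
    cases h'.rule with
    | appendNil _ e => simp at e
    | appendSnoc _ Δ' Θ' σ' e e' h' =>
      simp [pr_inj] at e
      obtain ⟨rfl, rfl⟩ := e
      rw [e', h.2 _ _ _ rfl _ h']

/-! ### Rule instances -/

theorem jInst0.unique {r S S' : M.Num} (h : jInst0 r S) (h' : jInst0 r S') : S = S' := by
  cases h.rule <;> cases h'.rule <;> simp_all [pr_inj]

theorem jInst1.unique {r S₁ S S₁' S' : M.Num} (h : jInst1 r S₁ S) (h' : jInst1 r S₁' S') :
    S₁ = S₁' ∧ S = S' := by
  cases h.rule with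
  | instEx Γ Δ Θ Θ' ρ σ τ e₁ e₂ e₃ _ _ _ _ _ h₆ h₇ =>
    subst e₁ e₂ e₃
    cases h'.rule with
    | instEx Γ' Δ' Ξ Ξ' ρ' σ' τ' e₁ e₂ e₃ _ _ _ _ _ h₆' h₇' =>
      simp [pr_inj] at e₁
      obtain ⟨rfl, rfl, rfl, rfl, rfl⟩ := e₁
      rw [e₂, e₃, jAppend.unique h₆ h₆', jAppend.unique h₇ h₇']
      exact ⟨rfl, rfl⟩
    | _ => simp_all
  | _ => cases h'.rule <;> simp_all [pr_inj]

theorem jInst2.unique {r S₁ S₂ S S₁' S₂' S' : M.Num} (h : jInst2 r S₁ S₂ S)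
    (h' : jInst2 r S₁' S₂' S') : S₁ = S₁' ∧ S₂ = S₂' ∧ S = S' := by
  cases h.rule <;> cases h'.rule <;> simp_all [pr_inj]

theorem jInst0.not_inst1 {r S S₁' S' : M.Num} (h : jInst0 r S) (h' : jInst1 r S₁' S') : False := by
  cases h.rule <;> cases h'.rule <;> simp_all

theorem jInst0.not_inst2 {r S S₁' S₂' S' : M.Num} (h : jInst0 r S) (h' : jInst2 r S₁' S₂' S') :
    False := by
  cases h.rule <;> cases h'.rule <;> simp_all

theorem jInst1.not_inst2 {r S₁ S S₁' S₂' S' : M.Num} (h : jInst1 r S₁ S)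
    (h' : jInst2 r S₁' S₂' S') : False := by
  cases h.rule <;> cases h'.rule <;> simp_all

theorem jInst0.not_recr {Γ τ S : M.Num} (h : jInst0 (rRecr Γ τ) S) : False := by
  cases h.rule <;> simp_all

theorem jInst1.not_recr {Γ τ S₁ S : M.Num} (h : jInst1 (rRecr Γ τ) S₁ S) : False := by
  cases h.rule <;> simp_all

theorem jInst2.not_recr {Γ τ S₁ S₂ S : M.Num} (h : jInst2 (rRecr Γ τ) S₁ S₂ S) : False := by
  cases h.rule <;> simp_all

theorem jConst.unique {r θ θ' : M.Num} (h : jConst r θ) (h' : jConst r θ') : θ = θ' := by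
  cases h.rule with
  | const0 Γ τ _ _ h₁ h₂ =>
    cases h'.rule with
    | const0 Γ' τ' _ _ h₁' h₂' =>
      have e := jInst0.unique h₁ h₁'
      simp [pr_inj] at e
      obtain ⟨rfl, rfl⟩ := e
      exact jArrow.unique h₂ h₂'
    | const1 _ _ _ _ _ _ _ _ h₁' => exact (jInst0.not_inst1 h₁ h₁').elim
    | const2 _ _ _ _ _ _ _ _ _ _ _ h₁' => exact (jInst0.not_inst2 h₁ h₁').elim
    | constRecr _ _ _ _ _ e => subst e; exact (jInst0.not_recr h₁).elim
  | const1 Γ Δ σ τ θ θ₁ _ e₂ h₁ h₂ h₃ =>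
    cases h'.rule with
    | const0 _ _ _ _ h₁' => exact (jInst0.not_inst1 h₁' h₁).elim
    | const1 Γ' Δ' σ' τ' θ' θ₁' _ e₂' h₁' h₂' h₃' =>
      have e := jInst1.unique h₁ h₁'
      simp [pr_inj] at e
      obtain ⟨⟨rfl, rfl⟩, rfl, rfl⟩ := e
      rw [e₂, e₂', jArrow.unique h₂ h₂', jArrow.unique h₃ h₃']
    | const2 _ _ _ _ _ _ _ _ _ _ _ h₁' => exact (jInst1.not_inst2 h₁ h₁').elim
    | constRecr _ _ _ _ _ e => subst e; exact (jInst1.not_recr h₁).elim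
  | const2 Γ Δ Θ ρ σ τ θ θ₁ θ₂ _ e₂ h₁ h₂ h₃ h₄ =>
    cases h'.rule with
    | const0 _ _ _ _ h₁' => exact (jInst0.not_inst2 h₁' h₁).elim
    | const1 _ _ _ _ _ _ _ _ h₁' => exact (jInst1.not_inst2 h₁' h₁).elim
    | const2 Γ' Δ' Θ' ρ' σ' τ' θ' θ₁' θ₂' _ e₂' h₁' h₂' h₃' h₄' =>
      have e := jInst2.unique h₁ h₁'
      simp [pr_inj] at e
      obtain ⟨⟨rfl, rfl⟩, ⟨rfl, rfl⟩, rfl, rfl⟩ := e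
      rw [e₂, e₂', jArrow.unique h₂ h₂', jArrow.unique h₃ h₃', jArrow.unique h₄ h₄']
    | constRecr _ _ _ _ _ e => subst e; exact (jInst2.not_recr h₁).elim
  | constRecr Γ τ θ θ₁ θ₂ e₁ e₂ _ _ h₁ h₂ h₃ =>
    subst e₁
    cases h'.rule with
    | const0 _ _ _ _ h₁' => exact (jInst0.not_recr h₁').elim
    | const1 _ _ _ _ _ _ _ _ h₁' => exact (jInst1.not_recr h₁').elim
    | const2 _ _ _ _ _ _ _ _ _ _ _ h₁' => exact (jInst2.not_recr h₁').elim
    | constRecr Γ' τ' θ' θ₁' θ₂' e₁' e₂' _ _ h₁' h₂' h₃' =>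
      simp [pr_inj] at e₁'
      obtain ⟨rfl, rfl⟩ := e₁'
      rw [e₂, e₂', jArrow.unique h₁ h₁', jArrow.unique h₂ h₂', jArrow.unique h₃ h₃']

/-- The premiss of a rule instance has a context with a length, hence a type. This is needed for
typing the components of an unfolded graph node. -/
theorem jInst1.len {r S₁ S : M.Num} (h : jInst1 r S₁ S) :
    ∃ Γ τ n, S₁ = oSeq Γ τ ∧ Len Γ n := by
  cases h.rule with
  | instEx Γ Δ Θ Θ' ρ σ τ e₁ e₂ e₃ h₁ _ _ _ _ h₆ h₇ =>
    obtain ⟨n, hn⟩ := jCtx.len h₁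
    obtain ⟨m, -, hm⟩ := jAppend.len h₇ ((hn.snoc _).snoc _)
    exact ⟨_, _, _, e₂, hm⟩
  | instWk Γ σ τ e₁ e₂ e₃ h₁ =>
    obtain ⟨n, hn⟩ := jCtx.len h₁
    exact ⟨_, _, _, e₂, hn⟩
  | instCntr Γ σ τ e₁ e₂ e₃ h₁ =>
    obtain ⟨n, hn⟩ := jCtx.len h₁
    exact ⟨_, _, _, e₂, (hn.snoc _).snoc _⟩
  | instR Γ σ τ e₁ e₂ e₃ h₁ =>
    obtain ⟨n, hn⟩ := jCtx.len h₁
    exact ⟨_, _, _, e₂, hn.snoc _⟩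

theorem jInst2.len {r S₁ S₂ S : M.Num} (h : jInst2 r S₁ S₂ S) :
    ∃ Γ τ n Γ' τ' n', S₁ = oSeq Γ τ ∧ Len Γ n ∧ S₂ = oSeq Γ' τ' ∧ Len Γ' n' := by
  cases h.rule with
  | instCut Γ σ τ e₁ e₂ e₃ e₄ h₁ =>
    obtain ⟨n, hn⟩ := jCtx.len h₁
    exact ⟨_, _, _, _, _, _, e₂, hn, e₃, hn.snoc _⟩
  | instL Γ ρ σ τ e₁ e₂ e₃ e₄ h₁ =>
    obtain ⟨n, hn⟩ := jCtx.len h₁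
    exact ⟨_, _, _, _, _, _, e₂, hn, e₃, hn.snoc _⟩
  | instCond Γ τ e₁ e₂ e₃ e₄ h₁ =>
    obtain ⟨n, hn⟩ := jCtx.len h₁
    exact ⟨_, _, _, _, _, _, e₂, hn, e₃, hn.snoc _⟩

end

/-! ## Equality of presented coterms -/

section

variable {M : Structure2.{u}} [hM : Fact M.IsModelRCA0]

theorem jUnf.shape {z u : M.Num} (h : jUnf z u) : ∃ r, u = oK r ∨ (∃ y, u = oA (oK r) y) ∨
    ∃ y y', u = oA (oA (oK r) y) y' := by
  cases h.rule with
  | unf0 S r a b i j k e₁ e₂ => exact ⟨r, .inl e₂⟩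
  | unf1 S S₁ r a b i j k e₁ e₂ => exact ⟨r, .inr (.inl ⟨_, e₂⟩)⟩
  | unf2 S S₁ S₂ r a b i j k e₁ e₂ => exact ⟨r, .inr (.inr ⟨_, _, e₂⟩)⟩

theorem jUnf.eq_node {z u : M.Num} (h : jUnf z u) : ∃ a b k, z = oNode a b k := by
  cases h.rule with
  | unf0 S r a b i j k e₁ e₂ => exact ⟨_, _, _, e₁⟩
  | unf1 S S₁ r a b i j k e₁ e₂ => exact ⟨_, _, _, e₁⟩
  | unf2 S S₁ S₂ r a b i j k e₁ e₂ => exact ⟨_, _, _, e₁⟩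

theorem jUnf.ne_node {z u a b k : M.Num} (h : jUnf z u) : u ≠ oNode a b k := by
  obtain ⟨r, rfl | ⟨y, rfl⟩ | ⟨y, y', rfl⟩⟩ := h.shape <;> simp

theorem jUnf.unique {z u u' : M.Num} (h : jUnf z u) (h' : jUnf z u') : u = u' := by
  cases h.rule with
  | unf0 S r a b i j k e₁ e₂ hs hi =>
    subst e₁ e₂
    cases h'.rule with
    | unf0 S' r' a' b' i' j' k' e₁ e₂ hs' hi' =>
      simp [pr_inj] at e₁
      obtain ⟨rfl, rfl, rfl⟩ := e₁
      obtain ⟨rfl, -⟩ := pr_inj.1 (hs.trans hs'.symm)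
      exact e₂.symm
    | unf1 S' S₁' r' a' b' i' j' k' e₁ e₂ hs' hi' =>
      simp [pr_inj] at e₁
      obtain ⟨rfl, rfl, rfl⟩ := e₁
      obtain ⟨rfl, -⟩ := pr_inj.1 (hs.trans hs'.symm)
      exact (jInst0.not_inst1 hi hi').elim
    | unf2 S' S₁' S₂' r' a' b' i' j' k' e₁ e₂ hs' hi' =>
      simp [pr_inj] at e₁
      obtain ⟨rfl, rfl, rfl⟩ := e₁
      obtain ⟨rfl, -⟩ := pr_inj.1 (hs.trans hs'.symm)
      exact (jInst0.not_inst2 hi hi').elim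
  | unf1 S S₁ r a b i j k e₁ e₂ hs hi =>
    subst e₁ e₂
    cases h'.rule with
    | unf0 S' r' a' b' i' j' k' e₁ e₂ hs' hi' =>
      simp [pr_inj] at e₁
      obtain ⟨rfl, rfl, rfl⟩ := e₁
      obtain ⟨rfl, -⟩ := pr_inj.1 (hs.trans hs'.symm)
      exact (jInst0.not_inst1 hi' hi).elim
    | unf1 S' S₁' r' a' b' i' j' k' e₁ e₂ hs' hi' =>
      simp [pr_inj] at e₁
      obtain ⟨rfl, rfl, rfl⟩ := e₁
      obtain ⟨rfl, e⟩ := pr_inj.1 (hs.trans hs'.symm)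
      obtain ⟨rfl, rfl⟩ := pr_inj.1 e
      exact e₂.symm
    | unf2 S' S₁' S₂' r' a' b' i' j' k' e₁ e₂ hs' hi' =>
      simp [pr_inj] at e₁
      obtain ⟨rfl, rfl, rfl⟩ := e₁
      obtain ⟨rfl, -⟩ := pr_inj.1 (hs.trans hs'.symm)
      exact (jInst1.not_inst2 hi hi').elim
  | unf2 S S₁ S₂ r a b i j k e₁ e₂ hs hi =>
    subst e₁ e₂
    cases h'.rule with
    | unf0 S' r' a' b' i' j' k' e₁ e₂ hs' hi' =>
      simp [pr_inj] at e₁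
      obtain ⟨rfl, rfl, rfl⟩ := e₁
      obtain ⟨rfl, -⟩ := pr_inj.1 (hs.trans hs'.symm)
      exact (jInst0.not_inst2 hi' hi).elim
    | unf1 S' S₁' r' a' b' i' j' k' e₁ e₂ hs' hi' =>
      simp [pr_inj] at e₁
      obtain ⟨rfl, rfl, rfl⟩ := e₁
      obtain ⟨rfl, -⟩ := pr_inj.1 (hs.trans hs'.symm)
      exact (jInst1.not_inst2 hi' hi).elim
    | unf2 S' S₁' S₂' r' a' b' i' j' k' e₁ e₂ hs' hi' =>
      simp [pr_inj] at e₁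
      obtain ⟨rfl, rfl, rfl⟩ := e₁
      obtain ⟨rfl, e⟩ := pr_inj.1 (hs.trans hs'.symm)
      obtain ⟨rfl, rfl⟩ := pr_inj.1 e
      exact e₂.symm

/-- The rule instance and the children of a node are read from an entry of the coded graph, which is
at most the code. Unfolding is thus bounded, as coinduction requires. -/
theorem jUnf.le {z u B : M.Num} (h : jUnf z u) (hz : z ≤ B) :
    u ≤ oA (oA (oK B) (oNode B B B)) (oNode B B B) := by
  have key {a b k r i j : M.Num} (hz : oNode a b k ≤ B) (hs : pr r (pr i j) = bt a b k) :
      r ≤ B ∧ oNode a b i ≤ oNode B B B ∧ oNode a b j ≤ oNode B B B := by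
    have ha : a ≤ B := (le_cd (by simp)).trans hz
    have hb : b ≤ B := (le_cd (by simp)).trans hz
    have hs : pr r (pr i j) ≤ B := hs ▸ (bt_le a b k).trans ha
    have hij := (le_pr_right _ _).trans hs
    have hi := (le_pr_left _ _).trans hij
    have hj := (le_pr_right _ _).trans hij
    exact ⟨(le_pr_left _ _).trans hs, cd_le_cd (by simp [ha, hb, hi]),
      cd_le_cd (by simp [ha, hb, hj])⟩
  have hA {s t : M.Num} : s ≤ oA s t := le_cd (by simp)
  cases h.rule with
  | unf0 S r a b i j k e₁ e₂ hs hi =>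
    subst e₁ e₂
    obtain ⟨h1, -⟩ := key hz hs
    exact le_trans (cd_le_cd (by simp [h1])) (hA.trans hA)
  | unf1 S S₁ r a b i j k e₁ e₂ hs hi =>
    subst e₁ e₂
    obtain ⟨h1, h2, -⟩ := key hz hs
    have h3 : oK r ≤ oK B := cd_le_cd (by simp [h1])
    exact le_trans (cd_le_cd (by simp [h2, h3])) hA
  | unf2 S S₁ S₂ r a b i j k e₁ e₂ hs hi =>
    subst e₁ e₂
    obtain ⟨h1, h2, h4⟩ := key hz hs
    have h3 : oK r ≤ oK B := cd_le_cd (by simp [h1])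
    have h5 : oA (oK r) (oNode a b i) ≤ oA (oK B) (oNode B B B) := cd_le_cd (by simp [h2, h3])
    exact cd_le_cd (by simp [h4, h5])

/-- One step of a comparison of presentations. -/
inductive EqStep (X : M.Num → M.Num → Prop) (s t : M.Num) : Prop
  | V (σ k : M.Num) (hs : s = oV σ k) (ht : t = oV σ k)
  | K (r : M.Num) (hs : s = oK r) (ht : t = oK r)
  | A (s₁ s₂ t₁ t₂ : M.Num) (hs : s = oA s₁ s₂) (ht : t = oA t₁ t₂) (h₁ : X s₁ t₁) (h₂ : X s₂ t₂)
  | left (u : M.Num) (hu : jUnf s u) (h : X u t)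
  | right (u : M.Num) (hu : jUnf t u) (h : X s u)

theorem EqStep.mono {X Y : M.Num → M.Num → Prop} {s t : M.Num} (h : EqStep X s t)
    (hXY : ∀ s t, X s t → Y s t) : EqStep Y s t := by
  cases h with
  | V σ k hs ht => exact .V σ k hs ht
  | K r hs ht => exact .K r hs ht
  | A s₁ s₂ t₁ t₂ hs ht h₁ h₂ => exact .A _ _ _ _ hs ht (hXY _ _ h₁) (hXY _ _ h₂)
  | left u hu h => exact .left u hu (hXY _ _ h)
  | right u hu h => exact .right u hu (hXY _ _ h)

theorem EqStep.rule {P Q : M.Num → Prop} {s t : M.Num}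
    (hQ : ∀ y, Der ClRl y → Q y) (h : EqStep (fun s t => Q (Jd.eq s t).code) s t) :
    Rule P Q (.eq s t) := by
  cases h with
  | V σ k hs ht => exact .eqV σ k hs ht
  | K r hs ht => exact .eqK r hs ht
  | A s₁ s₂ t₁ t₂ hs ht h₁ h₂ => exact .eqA _ _ _ _ hs ht h₁ h₂
  | left u hu h =>
    obtain ⟨a, b, k, rfl⟩ := hu.eq_node
    exact .eqLeft t u a b k rfl (hQ _ hu) h
  | right u hu h =>
    obtain ⟨a, b, k, rfl⟩ := hu.eq_node
    exact .eqRight s u a b k rfl (hQ _ hu) h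

theorem EqStep.of_rule {P Q : M.Num → Prop} {s t : M.Num}
    (hQ : ∀ y, Q y → Der ClRl y) (h : Rule P Q (.eq s t)) :
    EqStep (fun s t => Q (Jd.eq s t).code) s t := by
  cases h with
  | eqV σ k hs ht => exact .V σ k hs ht
  | eqK r hs ht => exact .K r hs ht
  | eqA s₁ s₂ t₁ t₂ hs ht h₁ h₂ => exact .A _ _ _ _ hs ht h₁ h₂
  | eqLeft t u a b k e hu h => exact .left u (e ▸ hQ _ hu) h
  | eqRight s u a b k e hu h => exact .right u (e ▸ hQ _ hu) h

theorem jEq.of_step {s t : M.Num} (h : EqStep jEq s t) : jEq s t :=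
  CT.of_rule (EqStep.rule (fun _ h => h) h)

theorem jEq.step {s t : M.Num} (h : jEq s t) : EqStep jEq s t :=
  EqStep.of_rule (fun _ h => h) h.rule

theorem jEq.coinduct {W : M.Num → M.Num → Prop} (hW : Sg (fun d : M.Num × M.Num => W d.1 d.2))
    (B : M.Num) (hB : ∀ s t, W s t → s ≤ B ∧ t ≤ B)
    (h : ∀ s t, W s t → EqStep (fun s t => W s t ∨ jEq s t) s t) {s t : M.Num} (hst : W s t) :
    jEq s t := by
  have := fun (C : Type u) [Ctx M C] (f g : C → M.Num) [Fn f] [Fn g] => hW.comp₂ f g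
  refine Der.coinduct (W := fun y => ∃ s t, y = cd 32 [s, t] ∧ W s t) inferInstance
    (cd 32 [B, B] + 1) ?_ ?_ ⟨s, t, rfl, hst⟩
  · rintro _ ⟨s, t, rfl, h⟩
    exact Num.lt_succ_iff.2 (cd_le_cd (by simp [hB s t h]))
  · rintro _ ⟨s, t, rfl, hst⟩
    exact step_iff.2 (EqStep.rule (t := t) (fun y h => .inr h) ((h s t hst).mono
      fun s t => Or.imp (fun h => ⟨s, t, rfl, h⟩) fun h => h))

theorem IsDer.eqStep {a b n s t : M.Num} (hd : IsDer ClRl a b n)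
    (h : In a b n (Jd.eq s t).code) : EqStep (fun s t => In a b n (Jd.eq s t).code) s t :=
  EqStep.of_rule (fun _ => hd.der) (step_iff.1 (hd.step h))

theorem In.le {a b n y : M.Num} (h : In a b n y) : y ≤ a := by
  obtain ⟨i, -, rfl⟩ := h
  exact bt_le a b i

/-- The converse of the relation listed in a finite derivation is again closed under comparison
steps. -/
theorem jEq.symm {s t : M.Num} (h : jEq s t) : jEq t s := by
  obtain ⟨a, b, n, h, hd⟩ := h
  refine jEq.coinduct (W := fun t s => In a b n (Jd.eq s t).code) inferInstance a
    (fun t s h => ⟨(le_cd (by simp)).trans h.le, (le_cd (by simp)).trans h.le⟩) ?_ h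
  intro t s h
  cases hd.eqStep h with
  | V σ k hs ht => exact .V σ k ht hs
  | K r hs ht => exact .K r ht hs
  | A s₁ s₂ t₁ t₂ hs ht h₁ h₂ => exact .A _ _ _ _ ht hs (.inl h₁) (.inl h₂)
  | left u hu h => exact .right u hu (.inl h)
  | right u hu h => exact .left u hu (.inl h)

/-- If the middle presentation is not a graph node, neither comparison can unfold it. Unfoldings of
the outer presentations are passed on, and otherwise both comparisons show the same constructor. -/
theorem EqStep.trans_of_ne {X Y : M.Num → M.Num → Prop} {s t u : M.Num} (h : EqStep X s t)
    (h' : EqStep Y t u) (hst : X s t) (htu : Y t u) (hn : ∀ z, ¬ jUnf t z) :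
    EqStep (fun s u => ∃ t, X s t ∧ Y t u) s u := by
  cases h with
  | left z hz h => exact .left z hz ⟨t, h, htu⟩
  | right z hz h => exact (hn z hz).elim
  | V σ k hs ht =>
    cases h' with
    | right z hz h => exact .right z hz ⟨t, hst, h⟩
    | left z hz h => exact (hn z hz).elim
    | V σ' k' hs' ht' => exact .V σ k hs (by rw [ht', ← hs', ht])
    | _ => simp_all
  | K r hs ht =>
    cases h' with
    | right z hz h => exact .right z hz ⟨t, hst, h⟩
    | left z hz h => exact (hn z hz).elim
    | K r' hs' ht' => exact .K r hs (by rw [ht', ← hs', ht])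
    | _ => simp_all
  | A s₁ s₂ t₁ t₂ hs ht h₁ h₂ =>
    cases h' with
    | right z hz h => exact .right z hz ⟨t, hst, h⟩
    | left z hz h => exact (hn z hz).elim
    | A t₁' t₂' u₁ u₂ ht' hu h₁' h₂' =>
      rw [ht] at ht'
      simp [pr_inj] at ht'
      obtain ⟨rfl, rfl⟩ := ht'
      exact .A _ _ _ _ hs hu ⟨_, h₁, h₁'⟩ ⟨_, h₂, h₂'⟩
    | _ => simp_all

/-- If both comparisons unfold a middle node, these unfoldings agree and cancel. Their result is not
a node, so a single cancellation leads to the case of `EqStep.trans_of_ne`. -/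
theorem EqStep.trans {X Y : M.Num → M.Num → Prop} (hX : ∀ s t, X s t → EqStep X s t)
    (hY : ∀ s t, Y s t → EqStep Y s t) {s t u : M.Num} (hst : X s t) (htu : Y t u) :
    EqStep (fun s u => ∃ t, X s t ∧ Y t u) s u := by
  by_cases hn : ∃ z, jUnf t z
  · obtain ⟨z, hz⟩ := hn
    obtain ⟨a, b, k, rfl⟩ := hz.eq_node
    have hz' : ∀ y, ¬ jUnf z y := fun y hy => by
      obtain ⟨a, b, k, e⟩ := hy.eq_node
      exact hz.ne_node e
    cases hX _ _ hst with
    | left y hy h => exact .left y hy ⟨_, h, htu⟩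
    | right y hy h =>
      obtain rfl := hy.unique hz
      cases hY _ _ htu with
      | right y' hy' h' => exact .right y' hy' ⟨_, hst, h'⟩
      | left y' hy' h' =>
        obtain rfl := hy'.unique hz
        exact (hX _ _ h).trans_of_ne (hY _ _ h') h h' hz'
      | _ => simp_all
    | _ => simp_all
  · exact (hX _ _ hst).trans_of_ne (hY _ _ htu) hst htu fun z hz => hn ⟨z, hz⟩

/-- Coinduction for the relational composition of the pairs listed in the two derivations, which is
bounded by their codes. -/
theorem jEq.trans {s t u : M.Num} (h : jEq s t) (h' : jEq t u) : jEq s u := by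
  obtain ⟨a, b, n, h, hd⟩ := h
  obtain ⟨a', b', n', h', hd'⟩ := h'
  refine jEq.coinduct (W := fun s u => ∃ t, In a b n (Jd.eq s t).code ∧ In a' b' n' (Jd.eq t u).code)
    inferInstance (max a a') ?_ ?_ ⟨t, h, h'⟩
  · rintro s u ⟨t, h, h'⟩
    exact ⟨((le_cd (by simp)).trans h.le).trans (le_max_left _ _),
      ((le_cd (by simp)).trans h'.le).trans (le_max_right _ _)⟩
  · rintro s u ⟨t, h, h'⟩
    exact (EqStep.trans (fun _ _ => hd.eqStep) (fun _ _ => hd'.eqStep) h h').mono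
      fun s t h => .inl h

theorem jEq.V (σ k : M.Num) : jEq (oV σ k) (oV σ k) := .of_step (.V σ k rfl rfl)

theorem jEq.K (r : M.Num) : jEq (oK r) (oK r) := .of_step (.K r rfl rfl)

theorem jEq.A {s t s' t' : M.Num} (h : jEq s s') (h' : jEq t t') : jEq (oA s t) (oA s' t') :=
  .of_step (.A _ _ _ _ rfl rfl h h')

theorem jEq.A_inv {s t s' t' : M.Num} (h : jEq (oA s t) (oA s' t')) : jEq s s' ∧ jEq t t' := by
  cases h.step with
  | A s₁ s₂ t₁ t₂ hs ht h₁ h₂ =>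
    simp [pr_inj] at hs ht
    obtain ⟨rfl, rfl⟩ := hs
    obtain ⟨rfl, rfl⟩ := ht
    exact ⟨h₁, h₂⟩
  | left u hu h => obtain ⟨a, b, k, e⟩ := hu.eq_node; simp at e
  | right u hu h => obtain ⟨a, b, k, e⟩ := hu.eq_node; simp at e
  | _ => simp_all

theorem jEq.K_inv {r r' : M.Num} (h : jEq (oK r) (oK r')) : r = r' := by
  cases h.step with
  | K r hs ht =>
    simp [pr_inj] at hs ht
    rw [hs, ht]
  | left u hu h => obtain ⟨a, b, k, e⟩ := hu.eq_node; simp at e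
  | right u hu h => obtain ⟨a, b, k, e⟩ := hu.eq_node; simp at e
  | _ => simp_all

theorem jEq.V_inv {σ k σ' k' : M.Num} (h : jEq (oV σ k) (oV σ' k')) : σ = σ' ∧ k = k' := by
  cases h.step with
  | V σ k hs ht =>
    simp [pr_inj] at hs ht
    rw [hs.1, hs.2, ht.1, ht.2]
    exact ⟨rfl, rfl⟩
  | left u hu h => obtain ⟨a, b, k, e⟩ := hu.eq_node; simp at e
  | right u hu h => obtain ⟨a, b, k, e⟩ := hu.eq_node; simp at e
  | _ => simp_all

theorem jEq.not_K_A {r s t : M.Num} (h : jEq (oK r) (oA s t)) : False := by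
  cases h.step with
  | left u hu h => obtain ⟨a, b, k, e⟩ := hu.eq_node; simp at e
  | right u hu h => obtain ⟨a, b, k, e⟩ := hu.eq_node; simp at e
  | _ => simp_all

theorem jEq.not_V_A {σ k s t : M.Num} (h : jEq (oV σ k) (oA s t)) : False := by
  cases h.step with
  | left u hu h => obtain ⟨a, b, k, e⟩ := hu.eq_node; simp at e
  | right u hu h => obtain ⟨a, b, k, e⟩ := hu.eq_node; simp at e
  | _ => simp_all

theorem jEq.not_V_K {σ k r : M.Num} (h : jEq (oV σ k) (oK r)) : False := by
  cases h.step with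
  | left u hu h => obtain ⟨a, b, k, e⟩ := hu.eq_node; simp at e
  | right u hu h => obtain ⟨a, b, k, e⟩ := hu.eq_node; simp at e
  | _ => simp_all

/-! ### Coderivations -/

theorem jCoder.exists_unf {a b n a' b' k S : M.Num} (hd : IsDer ClRl a b n)
    (h : In a b n (Jd.coder a' b' k S).code) : ∃ u r, jUnf (oNode a' b' k) u ∧ (u = oK r ∨
      (∃ i S, u = oA (oK r) (oNode a' b' i) ∧ In a b n (Jd.coder a' b' i S).code) ∨
      ∃ i S j S', u = oA (oA (oK r) (oNode a' b' i)) (oNode a' b' j) ∧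
        In a b n (Jd.coder a' b' i S).code ∧ In a b n (Jd.coder a' b' j S').code) := by
  cases step_iff.1 (hd.step h) with
  | coder0 S r a b i j k hs h₁ =>
    exact ⟨_, r, of_rule (.unf0 S r a' b' i j k rfl rfl hs (hd.der h₁)), .inl rfl⟩
  | coder1 S S₁ r a b i j k hs h₁ h₂ =>
    exact ⟨_, r, of_rule (.unf1 S S₁ r a' b' i j k rfl rfl hs (hd.der h₁)),
      .inr (.inl ⟨_, _, rfl, h₂⟩)⟩
  | coder2 S S₁ S₂ r a b i j k hs h₁ h₂ h₃ =>
    exact ⟨_, r, of_rule (.unf2 S S₁ S₂ r a' b' i j k rfl rfl hs (hd.der h₁)),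
      .inr (.inr ⟨_, _, _, _, rfl, h₂, h₃⟩)⟩

/-- Bisimilarity of a node with itself has to be shown by coinduction, as the graph may be cyclic.
The invariant consists of the diagonal on the finitely many coterms met when the graph is traversed,
together with the pairs that arise when only one side has been unfolded. -/
theorem jCoder.refl {a b k S : M.Num} (h : jCoder a b k S) : jEq (oNode a b k) (oNode a b k) := by
  obtain ⟨c, d, n, h, hd⟩ := h
  let X : M.Num → Prop := fun z => ∃ a b k S, z = oNode a b k ∧ In c d n (Jd.coder a b k S).code
  have hX : Sg X := by unfold X; infer_instance
  have := fun (C : Type u) [Ctx M C] (f : C → M.Num) [Fn f] => hX.comp f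
  -- Nodes typed in the given derivation, their unfoldings, and the function parts of these
  -- unfoldings. A function part is a constant, or for rules with two premisses a constant applied
  -- to a node.
  let Z : M.Num → Prop := fun z => X z ∨ (∃ x, X x ∧ jUnf x z) ∨ ∃ x y, X x ∧ jUnf x (oA z y)
  have hZ : Sg Z := by unfold Z; infer_instance
  have := fun (C : Type u) [Ctx M C] (f : C → M.Num) [Fn f] => hZ.comp f
  have hXle : ∀ z, X z → z ≤ oNode c c c := by
    rintro z ⟨a, b, k, S, rfl, h⟩
    have h1 : a ≤ c := (le_cd (by simp)).trans h.le
    have h2 : b ≤ c := (le_cd (by simp)).trans h.le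
    have h3 : k ≤ c := (le_cd (by simp)).trans h.le
    exact cd_le_cd (by simp [h1, h2, h3])
  obtain ⟨B, hB⟩ : ∃ B, B = oNode c c c := ⟨_, rfl⟩
  rw [← hB] at hXle
  have hle : B ≤ oA (oA (oK B) (oNode B B B)) (oNode B B B) :=
    (le_cd (k := 19) (l := [B, B, B]) (by simp)).trans (le_cd (by simp))
  have hZle : ∀ z, Z z → z ≤ oA (oA (oK B) (oNode B B B)) (oNode B B B) := by
    rintro z (h | ⟨x, hx, h⟩ | ⟨x, y, hx, h⟩)
    · exact (hXle z h).trans hle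
    · exact h.le (hXle x hx)
    · exact (le_cd (by simp)).trans (h.le (hXle x hx))
  have hsub : ∀ x u, X x → jUnf x u → EqStep (fun s t => (s = t ∧ Z s) ∨ jEq s t) u u ∧
      ∀ z y, u = oA z y → EqStep (fun s t => (s = t ∧ Z s) ∨ jEq s t) z z := by
    rintro _ u ⟨a, b, k, S, rfl, h⟩ hu
    obtain ⟨u', r, hu', h'⟩ := jCoder.exists_unf hd h
    obtain rfl := hu.unique hu'
    rcases h' with rfl | ⟨i, S₁, rfl, h1⟩ | ⟨i, S₁, j, S₂, rfl, h1, h2⟩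
    · exact ⟨.K r rfl rfl, fun z y e => by simp at e⟩
    · refine ⟨.A _ _ _ _ rfl rfl (.inr (.K r)) (.inl ⟨rfl, .inl ⟨_, _, _, _, rfl, h1⟩⟩), fun z y e => ?_⟩
      simp only [cd_inj, List.foldr, pr_inj] at e
      exact .K r e.2.1.symm e.2.1.symm
    · have hr : EqStep (fun s t => (s = t ∧ Z s) ∨ jEq s t) (oA (oK r) (oNode a b i))
          (oA (oK r) (oNode a b i)) :=
        .A _ _ _ _ rfl rfl (.inr (.K r)) (.inl ⟨rfl, .inl ⟨_, _, _, _, rfl, h1⟩⟩)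
      refine ⟨.A _ _ _ _ rfl rfl (.inl ⟨rfl, .inr (.inr ⟨_, _, ⟨_, _, _, _, rfl, h⟩, hu⟩)⟩)
        (.inl ⟨rfl, .inl ⟨_, _, _, _, rfl, h2⟩⟩), fun z y e => ?_⟩
      simp only [cd_inj, List.foldr, pr_inj] at e
      obtain ⟨-, rfl, -⟩ := e
      exact hr
  -- A node is compared with itself by unfolding the left copy and then the right one; the second
  -- disjunct is the state between.
  refine jEq.coinduct (W := fun s t => (s = t ∧ Z s) ∨ (X t ∧ jUnf t s)) inferInstance
    (oA (oA (oK B) (oNode B B B)) (oNode B B B)) ?_ ?_ (.inl ⟨rfl, .inl ⟨a, b, k, S, rfl, h⟩⟩)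
  · rintro s t (⟨rfl, h⟩ | ⟨h, h'⟩)
    · exact ⟨hZle s h, hZle s h⟩
    · exact ⟨h'.le (hXle t h), (hXle t h).trans hle⟩
  · rintro s t (⟨rfl, h | ⟨x, hx, h⟩ | ⟨x, y, hx, h⟩⟩ | ⟨h, h'⟩)
    · obtain ⟨a, b, k, S, rfl, h1⟩ := h
      obtain ⟨u, r, hu, -⟩ := jCoder.exists_unf hd h1
      exact .left u hu (.inl (.inr ⟨⟨a, b, k, S, rfl, h1⟩, hu⟩))
    · exact (hsub x s hx h).1.mono fun _ _ => Or.imp_left .inl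
    · exact ((hsub x _ hx h).2 s y rfl).mono fun _ _ => Or.imp_left .inl
    · exact .right s h' (.inl (.inl ⟨rfl, .inr (.inl ⟨t, h, h'⟩)⟩))

end

/-! ## Typing of presentations -/

section

variable {M : Structure2.{u}} [hM : Fact M.IsModelRCA0]

/-- Reflexivity is a matter of typed presentations: an arbitrary number need not present a coterm.
-/
theorem jFarc.refl {s θ : M.Num} (h : jFarc s θ) : jEq s s := by
  refine jFarc.induct (Φ := fun s _ => jEq s s) (.inl inferInstance) ?_ h
  intro s θ _ h
  cases h with
  | farcV σ k e => exact e ▸ .V _ _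
  | farcK θ r e => exact e ▸ .K _
  | farcNode Γ τ θ a b k e h => exact e ▸ jCoder.refl h.1
  | farcA σ τ s t e h h' => exact e ▸ .A (h.2 _ _ rfl) (h'.2 _ _ rfl)

theorem jFarc.A {s t σ θ : M.Num} (h : jFarc s (oArr σ θ)) (h' : jFarc t σ) : jFarc (oA s t) θ :=
  of_rule (.farcA σ θ s t rfl h h')

theorem jFarc.A_inv {s t θ : M.Num} (h : jFarc (oA s t) θ) :
    ∃ σ, jFarc s (oArr σ θ) ∧ jFarc t σ := by
  cases h.rule with
  | farcV σ k e => simp at e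
  | farcK θ r e => simp at e
  | farcNode Γ τ θ a b k e h => simp at e
  | farcA σ τ s t e h h' =>
    simp [pr_inj] at e
    obtain ⟨rfl, rfl⟩ := e
    exact ⟨σ, h, h'⟩

theorem jFarc.K_inv {r θ : M.Num} (h : jFarc (oK r) θ) : jConst r θ := by
  cases h.rule with
  | farcK θ r e h =>
    simp [pr_inj] at e
    exact e ▸ h
  | _ => simp_all

theorem jFarc.V_inv {σ k θ : M.Num} (h : jFarc (oV σ k) θ) : θ = σ := by
  cases h.rule with
  | farcV σ k e h =>
    simp [pr_inj] at e
    exact e.1.symm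
  | _ => simp_all

theorem jUnf.eq {z u : M.Num} (h : jUnf z u) (hu : jEq u u) : jEq z u := .of_step (.left u h hu)

/-- A typed graph node can be unfolded. -/
theorem jFarc.unfold {a b k θ : M.Num} (h : jFarc (oNode a b k) θ) :
    ∃ u, jUnf (oNode a b k) u ∧ jFarc u θ := by
  cases h.rule with
  | farcV σ k e => simp at e
  | farcK θ r e => simp at e
  | farcA σ τ s t e h h' => simp at e
  | farcNode Γ τ θ a b k e h h' =>
    simp [pr_inj] at e
    obtain ⟨rfl, rfl, rfl⟩ := e
    cases jCoder.rule h with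
    | coder0 S r a b i j k hs h₁ =>
      exact ⟨_, of_rule (.unf0 _ r _ _ i j _ rfl rfl hs h₁),
        of_rule (.farcK _ _ rfl (of_rule (.const0 Γ τ θ r h₁ h')))⟩
    | coder1 S S₁ r a b i j k hs h₁ h₂ =>
      obtain ⟨Δ, σ, n, rfl, hn⟩ := jInst1.len h₁
      obtain ⟨θ₁, h₃⟩ := hn.exists_arrow σ
      exact ⟨_, of_rule (.unf1 _ _ r _ _ i j _ rfl rfl hs h₁), .A
        (of_rule (.farcK _ _ rfl (of_rule (.const1 Γ Δ σ τ θ θ₁ r rfl h₁ h₃ h'))))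
        (of_rule (.farcNode _ _ _ _ _ _ rfl h₂ h₃))⟩
    | coder2 S S₁ S₂ r a b i j k hs h₁ h₂ h₂' =>
      obtain ⟨Δ, σ, n, Δ', σ', n', rfl, hn, rfl, hn'⟩ := jInst2.len h₁
      obtain ⟨θ₁, h₃⟩ := hn.exists_arrow σ
      obtain ⟨θ₂, h₄⟩ := hn'.exists_arrow σ'
      exact ⟨_, of_rule (.unf2 _ _ _ r _ _ i j _ rfl rfl hs h₁), .A (.A
        (of_rule (.farcK _ _ rfl
          (of_rule (.const2 Γ Δ Δ' σ' σ τ θ θ₁ θ₂ r rfl h₁ h₃ h₄ h'))))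
        (of_rule (.farcNode _ _ _ _ _ _ rfl h₂ h₃))) (of_rule (.farcNode _ _ _ _ _ _ rfl h₂' h₄))⟩

theorem jFarc.expose {s θ : M.Num} (h : jFarc s θ) : ∃ s', jFarc s' θ ∧ jEq s s' ∧
    ((∃ σ k, s' = oV σ k) ∨ (∃ r, s' = oK r) ∨ ∃ x y, s' = oA x y) := by
  cases h.rule with
  | farcV σ k e => exact ⟨s, h, h.refl, .inl ⟨_, _, e⟩⟩
  | farcK θ r e => exact ⟨s, h, h.refl, .inr (.inl ⟨_, e⟩)⟩
  | farcA σ τ s t e => exact ⟨_, h, h.refl, .inr (.inr ⟨_, _, e⟩)⟩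
  | farcNode Γ τ θ a b k e _ _ =>
    subst e
    obtain ⟨u, h1, h2⟩ := h.unfold
    refine ⟨u, h2, h1.eq h2.refl, ?_⟩
    obtain ⟨r, rfl | ⟨y, rfl⟩ | ⟨y, y', rfl⟩⟩ := h1.shape
    exacts [.inr (.inl ⟨_, rfl⟩), .inr (.inr ⟨_, _, rfl⟩), .inr (.inr ⟨_, _, rfl⟩)]

theorem jFarc.expose_A {s θ x y : M.Num} (h : jFarc s θ) (he : jEq s (oA x y)) :
    ∃ x' y' σ, jEq s (oA x' y') ∧ jEq x x' ∧ jEq y y' ∧ jFarc x' (oArr σ θ) ∧ jFarc y' σ := by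
  obtain ⟨s', h1, h2, ⟨σ, k, rfl⟩ | ⟨r, rfl⟩ | ⟨x', y', rfl⟩⟩ := h.expose
  · exact (jEq.not_V_A (h2.symm.trans he)).elim
  · exact (jEq.not_K_A (h2.symm.trans he)).elim
  · obtain ⟨σ, h3, h4⟩ := h1.A_inv
    obtain ⟨h5, h6⟩ := (he.symm.trans h2).A_inv
    exact ⟨x', y', σ, h2, h5, h6, h3, h4⟩

/-- Types are preserved by bisimilarity. Derivations of typing do not descend into the children of a
graph node, so nodes are treated by unfolding: the constant at the head is found below at most two
applications, and the type of the constant decides. -/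
theorem jFarc.unique {s t θ θ' : M.Num} (h : jFarc s θ) (h' : jFarc t θ') (he : jEq s t) :
    θ = θ' := by
  have hK : ∀ r θ t θ' : M.Num, jFarc (oK r) θ → jFarc t θ' → jEq (oK r) t → θ = θ' := by
    intro r θ t θ' h h' he
    obtain ⟨t', h1, h2, ⟨σ, k, rfl⟩ | ⟨r', rfl⟩ | ⟨x', y', rfl⟩⟩ := h'.expose
    · exact (jEq.not_V_K (he.trans h2).symm).elim
    · obtain rfl := (he.trans h2).K_inv
      exact h.K_inv.unique h1.K_inv
    · exact (jEq.not_K_A (he.trans h2)).elim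
  -- The type of an application is determined by that of its function part.
  have hA : ∀ x y : M.Num, (∀ θ t θ', jFarc x θ → jFarc t θ' → jEq x t → θ = θ') →
      ∀ θ t θ', jFarc (oA x y) θ → jFarc t θ' → jEq (oA x y) t → θ = θ' := by
    intro x y hx θ t θ' h h' he
    obtain ⟨σ, h1, -⟩ := h.A_inv
    obtain ⟨x', y', σ', -, h2, -, h3, -⟩ := h'.expose_A he.symm
    have := hx _ _ _ h1 h3 h2
    simp [pr_inj] at this
    exact this.2
  refine jFarc.induct (Φ := fun s θ => ∀ t θ', jFarc t θ' → jEq s t → θ = θ') (.inr inferInstance)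
    ?_ h t θ' h' he
  intro s θ hs h t θ' h' he
  cases h with
  | farcV σ k e =>
    subst e
    obtain ⟨t', h1, h2, ⟨σ, k, rfl⟩ | ⟨r', rfl⟩ | ⟨x', y', rfl⟩⟩ := h'.expose
    · exact (he.trans h2).V_inv.1.trans h1.V_inv.symm
    · exact (jEq.not_V_K (he.trans h2)).elim
    · exact (jEq.not_V_A (he.trans h2)).elim
  | farcK θ r e => subst e; exact hK _ _ _ _ hs h' he
  | farcNode Γ τ θ a b k e _ _ =>
    subst e
    obtain ⟨u, h1, h2⟩ := hs.unfold
    have he' := (h1.eq h2.refl).symm.trans he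
    obtain ⟨r, rfl | ⟨y, rfl⟩ | ⟨y, y', rfl⟩⟩ := h1.shape
    · exact hK _ _ _ _ h2 h' he'
    · exact hA _ _ (hK r) _ _ _ h2 h' he'
    · exact hA _ _ (hA _ _ (hK r)) _ _ _ h2 h' he'
  | farcA σ τ x y e h _ =>
    subst e
    obtain ⟨x', y', σ', -, h2, -, h3, -⟩ := h'.expose_A he.symm
    have := h.2 _ _ rfl _ _ h3 h2
    simp [pr_inj] at this
    exact this.2

/-! ### Presentations of the same type -/

/-- `s` is typed. -/
def Typed (s : M.Num) : Prop := ∃ θ, jFarc s θ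

/-- `s` and `t` have the same type. -/
def STy (s t : M.Num) : Prop := ∃ θ, jFarc s θ ∧ jFarc t θ

section

variable {C : Type u} [Ctx M C] {f g : C → M.Num} [hf : Fn f] [hg : Fn g]

instance Typed.sg : Sg (fun c => Typed (f c)) :=
  (inferInstance : Sg (fun d : M.Num => ∃ θ, jFarc d θ)).comp (P := Typed) f

instance STy.sg : Sg (fun c => STy (f c) (g c)) :=
  (inferInstance : Sg (fun d : M.Num × M.Num => ∃ θ, jFarc d.1 θ ∧ jFarc d.2 θ)).comp₂
    (P := STy) f g

end

theorem jFarc.typed {s θ : M.Num} (h : jFarc s θ) : Typed s := ⟨θ, h⟩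

theorem Typed.refl {s : M.Num} (h : Typed s) : jEq s s := h.elim fun _ h => h.refl

theorem Typed.A_inv {s t : M.Num} (h : Typed (oA s t)) : Typed s ∧ Typed t := by
  obtain ⟨θ, h⟩ := h
  obtain ⟨σ, h1, h2⟩ := h.A_inv
  exact ⟨h1.typed, h2.typed⟩

theorem STy.symm {s t : M.Num} (h : STy s t) : STy t s := h.imp fun _ => And.symm

theorem STy.left {s t : M.Num} (h : STy s t) : Typed s := h.imp fun _ => And.left

theorem STy.right {s t : M.Num} (h : STy s t) : Typed t := h.imp fun _ => And.right

theorem STy.trans {s t u : M.Num} (h : STy s t) (h' : STy t u) : STy s u := by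
  obtain ⟨θ, h1, h2⟩ := h
  obtain ⟨θ', h3, h4⟩ := h'
  obtain rfl := h2.unique h3 h2.refl
  exact ⟨θ, h1, h4⟩

theorem Typed.sty {s : M.Num} (h : Typed s) : STy s s := h.imp fun _ h => ⟨h, h⟩

theorem jEq.sty {s t : M.Num} (h : jEq s t) (hs : Typed s) (ht : Typed t) : STy s t := by
  obtain ⟨θ, hs⟩ := hs
  obtain ⟨θ', ht⟩ := ht
  obtain rfl := hs.unique ht h
  exact ⟨θ, hs, ht⟩

theorem STy.farc {s t θ : M.Num} (h : STy s t) (hs : jFarc s θ) : jFarc t θ := by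
  obtain ⟨θ', h1, h2⟩ := h
  obtain rfl := hs.unique h1 h1.refl
  exact h2

/-- Replacing the components of a typed application. -/
theorem STy.A {s t s' t' : M.Num} (h : Typed (oA s t)) (hs : STy s s') (ht : STy t t') :
    STy (oA s t) (oA s' t') := by
  obtain ⟨θ, h⟩ := h
  obtain ⟨σ, h1, h2⟩ := h.A_inv
  exact ⟨θ, h, (hs.farc h1).A (ht.farc h2)⟩

/-- The type of the argument is determined by that of the function. -/
theorem STy.of_A {s t s' t' : M.Num} (h : STy (oA s t) (oA s' t')) (ht : STy t t') : STy s s' := by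
  obtain ⟨θ, h1, h2⟩ := h
  obtain ⟨σ, h3, h4⟩ := h1.A_inv
  obtain ⟨σ', h5, h6⟩ := h2.A_inv
  obtain rfl := (ht.farc h4).unique h6 h6.refl
  exact ⟨_, h3, h5⟩

theorem STy.of_A' {s t s' t' : M.Num} (h : STy (oA s t) (oA s' t')) (hs : STy s s') : STy t t' := by
  obtain ⟨θ, h1, h2⟩ := h
  obtain ⟨σ, h3, h4⟩ := h1.A_inv
  obtain ⟨σ', h5, h6⟩ := h2.A_inv
  have := (hs.farc h3).unique h5 h5.refl
  simp [pr_inj] at this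
  obtain rfl := this
  exact ⟨_, h4, h6⟩

end

/-! ## Iterated application -/

section

variable {M : Structure2.{u}} [hM : Fact M.IsModelRCA0]

/-- `u` is `s` applied to the first `n` entries of the sequence coded by `a`, `b`. -/
def IsAp (s a b n u : M.Num) : Prop := ∃ c d, bt c d 0 = s ∧ bt c d n = u ∧
  ∀ i, i < n → bt c d (i + 1) = oA (bt c d i) (bt a b i)

theorem exists_isAp (s a b n : M.Num) : ∃ u, IsAp s a b n u := by
  obtain ⟨c, d, h1, -, h2⟩ := exists_chain (P := fun _ _ => (0 : M.Num) = 0)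
    (S := fun i x y => y = oA x (bt a b i)) inferInstance inferInstance n (x := s) rfl
    fun i _ x _ => ⟨_, rfl, rfl⟩
  exact ⟨_, c, d, h1, rfl, h2⟩

theorem IsAp.unique {s a b n u v : M.Num} (h : IsAp s a b n u) (h' : IsAp s a b n v) : u = v := by
  obtain ⟨c, d, h0, rfl, h⟩ := h
  obtain ⟨c', d', h0', rfl, h'⟩ := h'
  have key : ∀ i, i ≤ n → bt c d i = bt c' d' i := by
    refine Sg.induct inferInstance (fun _ => h0.trans h0'.symm) fun i ih hi => ?_
    rw [h i (Num.succ_le_iff.1 hi), h' i (Num.succ_le_iff.1 hi),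
      ih ((Num.lt_succ_self i).le.trans hi)]
  exact key n le_rfl

/-- `s` applied to the first `n` entries of the sequence coded by `a`, `b`. -/
noncomputable def ap (s a b n : M.Num) : M.Num := (exists_isAp s a b n).choose

theorem isAp_ap (s a b n : M.Num) : IsAp s a b n (ap s a b n) := (exists_isAp s a b n).choose_spec

instance Fn.ap {C : Type u} [Ctx M C] {f g h k : C → M.Num} [hf : Fn f] [hg : Fn g] [hh : Fn h]
    [hk : Fn k] : Fn (fun c => ap (f c) (g c) (h c) (k c)) := by
  have := hf.fst
  have := hg.fst
  have := hh.fst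
  have := hk.fst
  have := hf.fst.fst.fst
  have := hk.fst.fst.fst
  have := hg.fst.fst.fst.fst
  have := hh.fst.fst.fst.fst
  refine ⟨(inferInstance : Sg (fun d : C × M.Num => ∃ p q, CT.bt p q 0 = f d.1 ∧
    CT.bt p q (k d.1) = d.2 ∧ ∀ i, i < k d.1 → CT.bt p q (i + 1) =
      oA (CT.bt p q i) (CT.bt (g d.1) (h d.1) i))).congr fun d => ?_⟩
  constructor
  · intro e
    rw [e]
    exact isAp_ap _ _ _ _
  · exact fun h => IsAp.unique h (isAp_ap _ _ _ _)

instance Fn.ap_eta (s a b : M.Num) : Fn (CT.ap s a b) :=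
  Fn.ap (f := fun _ : M.Num => s) (g := fun _ => a) (h := fun _ => b) (k := fun i => i)

@[simp] theorem ap_zero (s a b : M.Num) : ap s a b 0 = s := by
  obtain ⟨c, d, h0, h, -⟩ := isAp_ap s a b 0
  rw [← h, h0]

@[simp] theorem ap_succ (s a b n : M.Num) : ap s a b (n + 1) = oA (ap s a b n) (bt a b n) := by
  obtain ⟨c, d, h0, hn, h⟩ := isAp_ap s a b (n + 1)
  rw [← hn, h n (Num.lt_succ_self n), IsAp.unique (isAp_ap s a b n) ⟨c, d, h0, rfl,
    fun i hi => h i (hi.trans (Num.lt_succ_self n))⟩]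

theorem ap_congr {s a b a' b' n : M.Num} (h : ∀ i < n, bt a b i = bt a' b' i) :
    ap s a b n = ap s a' b' n := by
  have key : ∀ i, i ≤ n → ap s a b i = ap s a' b' i := by
    refine Sg.induct inferInstance (fun _ => by simp) fun i ih hi => ?_
    rw [ap_succ, ap_succ, ih ((Num.lt_succ_self i).le.trans hi), h i (Num.succ_le_iff.1 hi)]
  exact key n le_rfl

theorem exists_ap_succ (s a b n x : M.Num) : ∃ a' b', ap s a' b' (n + 1) = oA (ap s a b n) x := by
  obtain ⟨a', b', h1, h2⟩ := exists_append a b n x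
  exact ⟨a', b', by rw [ap_succ, h2, ap_congr h1]⟩

theorem jEq.ap {s s' a b a' b' n : M.Num} (h : jEq s s')
    (hx : ∀ i < n, jEq (bt a b i) (bt a' b' i)) : jEq (ap s a b n) (ap s' a' b' n) := by
  have key : ∀ i, i ≤ n → jEq (CT.ap s a b i) (CT.ap s' a' b' i) := by
    refine Sg.induct inferInstance (fun _ => by simpa using h) fun i ih hi => ?_
    rw [ap_succ, ap_succ]
    exact (ih ((Num.lt_succ_self i).le.trans hi)).A (hx i (Num.succ_le_iff.1 hi))
  exact key n le_rfl

/-- Arguments are peeled off from the last one by backward induction; the number of arguments may be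
nonstandard. -/
theorem jEq.ap_inv {s s' a b a' b' n : M.Num} (h : jEq (CT.ap s a b n) (CT.ap s' a' b' n)) :
    jEq s s' ∧ ∀ i < n, jEq (bt a b i) (bt a' b' i) := by
  have key : ∀ i, i ≤ n → jEq (CT.ap s a b i) (CT.ap s' a' b' i) := fun i =>
    Sg.descend (P := fun i => jEq (CT.ap s a b i) (CT.ap s' a' b' i)) inferInstance h fun i _ h => by
      rw [ap_succ, ap_succ] at h
      exact h.A_inv.1
  refine ⟨by simpa using key 0 (Num.zero_le' n), fun i hi => ?_⟩
  have := key (i + 1) (Num.succ_le_iff.2 hi)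
  rw [ap_succ, ap_succ] at this
  exact this.A_inv.2

theorem Typed.ap_inv {s a b n : M.Num} (h : Typed (ap s a b n)) :
    (∀ i ≤ n, Typed (ap s a b i)) ∧ ∀ i < n, Typed (bt a b i) := by
  have key : ∀ i, i ≤ n → Typed (CT.ap s a b i) := fun i =>
    Sg.descend (P := fun i => Typed (CT.ap s a b i)) inferInstance h fun i _ h => by
      rw [ap_succ] at h
      exact h.A_inv.1
  refine ⟨key, fun i hi => ?_⟩
  have := key (i + 1) (Num.succ_le_iff.2 hi)
  rw [ap_succ] at this
  exact this.A_inv.2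

theorem Typed.of_ap {s a b n : M.Num} (h : Typed (ap s a b n)) : Typed s := by
  simpa using h.ap_inv.1 0 (Num.zero_le' n)

-- Translates spine judgments into iterated application, with one coded sequence of arguments for
-- both coterms. The components are quantified below the code to keep the induction statement `Σ⁰₁`.
set_option synthInstance.maxHeartbeats 400000 in
set_option synthInstance.maxSize 4000 in
theorem jSpine.exists_ap {Γ s u t v : M.Num} (h : jSpine Γ s u t v) :
    ∃ n a b, Len Γ n ∧ u = ap s a b n ∧ v = ap t a b n := by
  refine Der.induct (P := fun y => ∀ Γ, Γ ≤ y → ∀ s, s ≤ y → ∀ u, u ≤ y → ∀ t, t ≤ y →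
    ∀ v, v ≤ y → y = cd 33 [Γ, s, u, t, v] →
      ∃ n a b, Len Γ n ∧ u = CT.ap s a b n ∧ v = CT.ap t a b n) (.inl inferInstance) ?_ h
    _ (le_cd (by simp)) _ (le_cd (by simp)) _ (le_cd (by simp)) _ (le_cd (by simp)) _
    (le_cd (by simp)) rfl
  rintro y - hr Γ - s - u - t - v - rfl
  cases step_iff (j := .spine Γ s u t v).1 hr with
  | spineNil s t e₁ e₃ e₅ =>
    subst e₁ e₃ e₅
    exact ⟨0, 0, 0, Len.nil, by simp, by simp⟩
  | spineSnoc Γ σ s t u v x e₁ e₂ e₃ h =>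
    subst e₁ e₂ e₃
    obtain ⟨n, a, b, h1, rfl, rfl⟩ := h.2 _ (le_cd (by simp)) _ (le_cd (by simp)) _
      (le_cd (by simp)) _ (le_cd (by simp)) _ (le_cd (by simp)) rfl
    obtain ⟨a', b', h2, h3⟩ := exists_append a b n x
    exact ⟨n + 1, a', b', h1.snoc σ, by rw [ap_succ, h3, ap_congr h2],
      by rw [ap_succ, h3, ap_congr h2]⟩

theorem Len.spine {Γ n : M.Num} (h : Len Γ n) (s t a b : M.Num) :
    jSpine Γ s (ap s a b n) t (ap t a b n) := by
  obtain ⟨p, q, h0, rfl, h⟩ := h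
  have key : ∀ i, i ≤ n → jSpine (bt p q i) s (CT.ap s a b i) t (CT.ap t a b i) := by
    refine Sg.induct inferInstance (fun _ => ?_) fun i ih hi => ?_
    · rw [h0, ap_zero, ap_zero]
      exact of_rule (.spineNil s t rfl rfl rfl)
    · obtain ⟨σ, hσ⟩ := h i (Num.succ_le_iff.1 hi)
      rw [hσ, ap_succ, ap_succ]
      exact of_rule (.spineSnoc _ σ s t _ _ _ rfl rfl rfl (ih ((Num.lt_succ_self i).le.trans hi)))
  exact key n le_rfl

/-! ### Heads -/

theorem jEq.refl_right {s t : M.Num} (h : jEq s t) : jEq t t := h.symm.trans h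

/-- `h` is a variable or a constant and `u` is `h` applied to `m` arguments. -/
def Hd (h m u : M.Num) : Prop := ((∃ r, h = oK r) ∨ ∃ σ k, h = oV σ k) ∧ ∃ a b, jEq u (ap h a b m)

instance Hd.sg {C : Type u} [Ctx M C] {f g h : C → M.Num} [hf : Fn f] [hg : Fn g] [hh : Fn h] :
    Sg (fun c => Hd (f c) (g c) (h c)) :=
  (inferInstance : Sg (fun d : (M.Num × M.Num) × M.Num => ((∃ r, d.1.1 = oK r) ∨
    ∃ σ k, d.1.1 = oV σ k) ∧ ∃ a b, jEq d.2 (CT.ap d.1.1 a b d.1.2))).comp₃ (P := Hd) f g h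

theorem Hd.congr {h m u u' : M.Num} (hu : Hd h m u) (e : jEq u' u) : Hd h m u' :=
  ⟨hu.1, hu.2.imp fun _ => Exists.imp fun _ h => e.trans h⟩

theorem Hd.K {r u : M.Num} (h : jEq u (oK r)) : Hd (oK r) 0 u :=
  ⟨.inl ⟨r, rfl⟩, 0, 0, by simpa using h⟩

theorem Hd.V {σ k u : M.Num} (h : jEq u (oV σ k)) : Hd (oV σ k) 0 u :=
  ⟨.inr ⟨σ, k, rfl⟩, 0, 0, by simpa using h⟩

theorem Hd.zero {h u : M.Num} (hu : Hd h 0 u) : jEq u h := by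
  obtain ⟨-, a, b, h⟩ := hu
  simpa using h

theorem Hd.succ {h m u : M.Num} (hu : Hd h (m + 1) u) :
    ∃ s x, Hd h m s ∧ jEq u (oA s x) := by
  obtain ⟨h1, a, b, h⟩ := hu
  rw [ap_succ] at h
  exact ⟨_, _, ⟨h1, a, b, h.refl_right.A_inv.1⟩, h⟩

theorem Hd.A {h m s u x : M.Num} (hs : Hd h m s) (e : jEq u (oA s x)) : Hd h (m + 1) u := by
  obtain ⟨h1, a, b, h2⟩ := hs
  obtain ⟨a', b', h3⟩ := exists_ap_succ h a b m x
  exact ⟨h1, a', b', h3 ▸ e.trans (h2.A e.refl_right.A_inv.2)⟩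

theorem Hd.not_zero {h s x u : M.Num} (hu : Hd h 0 u) (e : jEq u (oA s x)) : False := by
  have e' := hu.zero.symm.trans e
  obtain ⟨⟨r, rfl⟩ | ⟨σ, k, rfl⟩, -⟩ := hu
  exacts [e'.not_K_A, e'.not_V_A]

theorem Hd.A_inv {h m s u x : M.Num} (hu : Hd h m u) (e : jEq u (oA s x)) :
    ∃ k, m = k + 1 ∧ Hd h k s := by
  rcases Num.cases' m with rfl | ⟨k, rfl⟩
  · exact (hu.not_zero e).elim
  · obtain ⟨s', x', h1, h2⟩ := hu.succ
    exact ⟨k, rfl, h1.congr (e.symm.trans h2).A_inv.1⟩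

/-- Both decompositions lose their last argument together. A variable or constant is not bisimilar
to an application, so they also end together. -/
theorem Hd.unique {h h' m m' u : M.Num} (hu : Hd h m u) (hu' : Hd h' m' u) : h = h' ∧ m = m' := by
  refine Pg.induct (P := fun m => ∀ u m', Hd h m u → Hd h' m' u → h = h' ∧ m = m')
    inferInstance ?_ ?_ m u m' hu hu'
  · intro u m' hu hu'
    rcases Num.cases' m' with rfl | ⟨k, rfl⟩
    · have e := hu.zero.symm.trans hu'.zero
      obtain ⟨⟨r, rfl⟩ | ⟨σ, k, rfl⟩, -⟩ := hu <;> obtain ⟨⟨r', rfl⟩ | ⟨σ', k', rfl⟩, -⟩ := hu'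
      · exact ⟨by rw [e.K_inv], rfl⟩
      · exact e.symm.not_V_K.elim
      · exact e.not_V_K.elim
      · exact ⟨by rw [e.V_inv.1, e.V_inv.2], rfl⟩
    · obtain ⟨s, x, -, h2⟩ := hu'.succ
      exact (hu.not_zero h2).elim
  · intro m ih u m' hu hu'
    obtain ⟨s, x, h1, h2⟩ := hu.succ
    obtain ⟨k, rfl, h3⟩ := hu'.A_inv h2
    obtain ⟨rfl, rfl⟩ := ih s k h1 h3
    exact ⟨rfl, rfl⟩

/-- Left spines are finite although the coterms may be infinite: one unfolding of a node brings its
constant to the head of at most two applications. -/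
theorem Typed.exists_hd {s : M.Num} (h : Typed s) : ∃ h m, Hd h m s := by
  obtain ⟨θ, h⟩ := h
  refine jFarc.induct (Φ := fun s _ => ∃ h m, Hd h m s) (.inl inferInstance) ?_ h
  intro s θ hs h
  cases h with
  | farcV σ k e => subst e; exact ⟨_, _, .V hs.refl⟩
  | farcK θ r e => subst e; exact ⟨_, _, .K hs.refl⟩
  | farcNode Γ τ θ a b k e _ _ =>
    subst e
    obtain ⟨u, h1, h2⟩ := hs.unfold
    have he := h1.eq h2.refl
    obtain ⟨r, rfl | ⟨y, rfl⟩ | ⟨y, y', rfl⟩⟩ := h1.shape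
    · exact ⟨_, _, .K he⟩
    · exact ⟨_, _, (Hd.K he.refl_right.A_inv.1).A he⟩
    · exact ⟨_, _, ((Hd.K he.refl_right.A_inv.1.A_inv.1).A he.refl_right.A_inv.1).A he⟩
  | farcA σ τ s t e h h' =>
    obtain ⟨h0, m, h1⟩ := h.2 _ _ rfl
    subst e
    exact ⟨h0, m + 1, h1.A hs.refl⟩

end

/-! ## Root contraction -/

section

variable {M : Structure2.{u}} [hM : Fact M.IsModelRCA0]

instance Fn.add_eta (k : M.Num) : Fn (HAdd.hAdd k : M.Num → M.Num) :=
  (inferInstance : Fn fun i => (fun _ => k) i + (fun i => i) i)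

theorem exists_shift (a b k n : M.Num) : ∃ a' b', ∀ i < n, bt a' b' i = bt a b (k + i) :=
  exists_seq (fun i => bt a b (k + i)) n

theorem exists_concat (a b k a' b' n : M.Num) : ∃ c d, (∀ i < k, bt c d i = bt a b i) ∧
    ∀ i < n, bt c d (k + i) = bt a' b' i := by
  obtain ⟨c, d, h⟩ := exists_seq
    (fun i : M.Num => if i < k then bt a b i else bt a' b' (CT.monus i k)) (k + n)
  refine ⟨c, d, fun i hi => ?_, fun i hi => ?_⟩
  · rw [h i (hi.trans_le le_self_add), if_pos hi]
  · rw [h _ (add_lt_add_right hi k), if_neg (not_lt.2 le_self_add), add_monus]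

/-- `s` applied to the `n` entries from the `k`-th one on of the sequence coded by `a`, `b`. -/
noncomputable def aps (s a b k n : M.Num) : M.Num :=
  ap s (exists_shift a b k n).choose (exists_shift a b k n).choose_spec.choose n

theorem aps_eq {s a b k n a' b' : M.Num} (h : ∀ i < n, bt a' b' i = bt a b (k + i)) :
    aps s a b k n = ap s a' b' n :=
  ap_congr fun i hi => ((exists_shift a b k n).choose_spec.choose_spec i hi).trans (h i hi).symm

theorem exists_aps (a b k n : M.Num) : ∃ a' b', (∀ i < n, bt a' b' i = bt a b (k + i)) ∧
    ∀ s, aps s a b k n = ap s a' b' n := by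
  obtain ⟨a', b', h⟩ := exists_shift a b k n
  exact ⟨a', b', h, fun s => aps_eq h⟩

theorem ap_aps (s a b k n : M.Num) : aps (ap s a b k) a b k n = ap s a b (k + n) := by
  obtain ⟨a', b', h, h'⟩ := exists_aps a b k n
  rw [h']
  have key : ∀ i, i ≤ n → ap (ap s a b k) a' b' i = ap s a b (k + i) := by
    refine Sg.induct inferInstance (fun _ => by simp) fun i ih hi => ?_
    rw [ap_succ, ih ((Num.lt_succ_self i).le.trans hi), h i (Num.succ_le_iff.1 hi), ← add_assoc,
      ap_succ]
  exact key n le_rfl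

theorem jEq.aps {s s' a b a' b' k n : M.Num} (h : jEq s s')
    (hx : ∀ i < n, jEq (bt a b (k + i)) (bt a' b' (k + i))) :
    jEq (CT.aps s a b k n) (CT.aps s' a' b' k n) := by
  obtain ⟨c, d, h1, h2⟩ := exists_aps a b k n
  obtain ⟨c', d', h1', h2'⟩ := exists_aps a' b' k n
  rw [h2, h2']
  exact h.ap fun i hi => by rw [h1 i hi, h1' i hi]; exact hx i hi

theorem Len.spine' {Γ n : M.Num} (h : Len Γ n) (s t a b k : M.Num) :
    jSpine Γ s (aps s a b k n) t (aps t a b k n) := by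
  obtain ⟨c, d, -, h2⟩ := exists_aps a b k n
  rw [h2, h2]
  exact h.spine _ _ _ _

/-- Spines as iterated applications to a common sequence of arguments that extends a given one. -/
theorem jSpine.exists_aps {Γ s u t v h a b k : M.Num} (hs : jSpine Γ s u t v)
    (e : s = ap h a b k) : ∃ n c d, Len Γ n ∧ (∀ i < k, bt c d i = bt a b i) ∧
      u = ap h c d (k + n) ∧ v = aps t c d k n := by
  obtain ⟨n, a', b', hn, rfl, rfl⟩ := hs.exists_ap
  obtain ⟨c, d, h1, h2⟩ := exists_concat a b k a' b' n
  refine ⟨n, c, d, hn, h1, ?_, (aps_eq fun i hi => (h2 i hi).symm).symm⟩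
  rw [← ap_aps, aps_eq fun i hi => (h2 i hi).symm, e, ap_congr h1]

theorem exists_ap_one (h x : M.Num) : ∃ a b, oA h x = ap h a b 1 ∧ bt a b 0 = x := by
  obtain ⟨a, b, -, h1⟩ := exists_append (0 : M.Num) 0 0 x
  exact ⟨a, b, by rw [← zero_add (1 : M.Num), ap_succ, ap_zero, h1], h1⟩

theorem exists_ap_append (h a b n x : M.Num) : ∃ c d, (∀ i < n, bt c d i = bt a b i) ∧
    bt c d n = x ∧ oA (ap h a b n) x = ap h c d (n + 1) := by
  obtain ⟨c, d, h1, h2⟩ := exists_append a b n x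
  exact ⟨c, d, h1, h2, by rw [ap_succ, h2, ap_congr h1]⟩

theorem aps_congr {s a b a' b' k n : M.Num} (h : ∀ i < n, bt a b (k + i) = bt a' b' (k + i)) :
    aps s a b k n = aps s a' b' k n := by
  obtain ⟨c, d, h1, h2⟩ := exists_aps a b k n
  rw [h2, aps_eq fun i hi => (h1 i hi).trans (h i hi)]

theorem Typed.aps_inv {s a b k n : M.Num} (h : Typed (aps s a b k n)) :
    Typed s ∧ ∀ i < n, Typed (bt a b (k + i)) := by
  obtain ⟨c, d, h1, h2⟩ := exists_aps a b k n
  rw [h2] at h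
  exact ⟨h.of_ap, fun i hi => h1 i hi ▸ h.ap_inv.2 i hi⟩

/-- The constant `r` applied to the `N` arguments coded by `a`, `b` contracts to `w`. -/
inductive Ctr (r N a b w : M.Num) : Prop
  | id (σ : M.Num) (hr : r = rId σ) (hN : N = 0 + 1) (hw : w = bt a b 0)
  | ex (Γ ρ σ Δ τ n m : M.Num) (hr : r = rEx Γ ρ σ Δ τ) (hn : Len Γ n) (hm : Len Δ m)
      (hN : N = 1 + n + 1 + 1 + m) (hw : w = aps (oA (oA (aps (bt a b 0) a b 1 n)
        (bt a b (1 + n + 1))) (bt a b (1 + n))) a b (1 + n + 1 + 1) m)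
  | wk (Γ σ τ n : M.Num) (hr : r = rWk Γ σ τ) (hn : Len Γ n) (hN : N = 1 + n + 1)
      (hw : w = aps (bt a b 0) a b 1 n)
  | cntr (Γ σ τ n : M.Num) (hr : r = rCntr Γ σ τ) (hn : Len Γ n) (hN : N = 1 + n + 1)
      (hw : w = oA (oA (aps (bt a b 0) a b 1 n) (bt a b (1 + n))) (bt a b (1 + n)))
  | cut (Γ σ τ n : M.Num) (hr : r = rCut Γ σ τ) (hn : Len Γ n) (hN : N = 1 + 1 + n)
      (hw : w = oA (aps (bt a b 1) a b (1 + 1) n) (aps (bt a b 0) a b (1 + 1) n))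
  | L (Γ ρ σ τ n : M.Num) (hr : r = rL Γ ρ σ τ) (hn : Len Γ n) (hN : N = 1 + 1 + n + 1)
      (hw : w = oA (aps (bt a b 1) a b (1 + 1) n)
        (oA (bt a b (1 + 1 + n)) (aps (bt a b 0) a b (1 + 1) n)))
  | R (Γ σ τ n : M.Num) (hr : r = rR Γ σ τ) (hn : Len Γ n) (hN : N = 1 + n + 1)
      (hw : w = oA (aps (bt a b 0) a b 1 n) (bt a b (1 + n)))
  -- The last argument may be a graph node presenting `0` or `s y`, so it is matched only up to
  -- `jEq`; `STy` ensures that it can be replaced without loss of typing.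
  | recrZero (Γ τ n : M.Num) (hr : r = rRecr Γ τ) (hn : Len Γ n) (hN : N = 1 + 1 + n + 1)
      (he : jEq (bt a b (1 + 1 + n)) (oK rZero)) (ht : STy (bt a b (1 + 1 + n)) (oK rZero))
      (hw : w = aps (bt a b 0) a b (1 + 1) n)
  | recrSucc (Γ τ n y : M.Num) (hr : r = rRecr Γ τ) (hn : Len Γ n) (hN : N = 1 + 1 + n + 1)
      (he : jEq (bt a b (1 + 1 + n)) (oA (oK rSucc) y))
      (ht : STy (bt a b (1 + 1 + n)) (oA (oK rSucc) y))
      (hw : w = oA (oA (aps (bt a b 1) a b (1 + 1) n) y) (oA (ap (oK r) a b (1 + 1 + n)) y))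
  | condZero (Γ τ n : M.Num) (hr : r = rCond Γ τ) (hn : Len Γ n) (hN : N = 1 + 1 + n + 1)
      (he : jEq (bt a b (1 + 1 + n)) (oK rZero)) (ht : STy (bt a b (1 + 1 + n)) (oK rZero))
      (hw : w = aps (bt a b 0) a b (1 + 1) n)
  | condSucc (Γ τ n y : M.Num) (hr : r = rCond Γ τ) (hn : Len Γ n) (hN : N = 1 + 1 + n + 1)
      (he : jEq (bt a b (1 + 1 + n)) (oA (oK rSucc) y))
      (ht : STy (bt a b (1 + 1 + n)) (oA (oK rSucc) y))
      (hw : w = oA (aps (bt a b 1) a b (1 + 1) n) y)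

section

variable {P : M.Num → Prop} {n : M.Num}

theorem args_one (h : ∀ i < 1 + n + 1, P i) : P 0 ∧ (∀ i < n, P (1 + i)) ∧ P (1 + n) :=
  ⟨h 0 ((Num.zero_le' _).trans_lt (Num.lt_succ_self _)),
    fun i hi => h _ ((add_lt_add_right hi 1).trans (Num.lt_succ_self _)), h _ (Num.lt_succ_self _)⟩

theorem args_two (h : ∀ i < 1 + 1 + n, P i) : P 0 ∧ P 1 ∧ ∀ i < n, P (1 + 1 + i) :=
  ⟨h 0 ((Num.zero_lt_one''.trans (Num.lt_succ_self 1)).trans_le le_self_add),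
    h 1 ((Num.lt_succ_self 1).trans_le le_self_add), fun i hi => h _ (add_lt_add_right hi _)⟩

theorem args_succ (h : ∀ i < n + 1, P i) : (∀ i < n, P i) ∧ P n :=
  ⟨fun i hi => h i (hi.trans (Num.lt_succ_self n)), h n (Num.lt_succ_self n)⟩

theorem args_ex {m : M.Num} (h : ∀ i < 1 + n + 1 + 1 + m, P i) :
    P 0 ∧ (∀ i < n, P (1 + i)) ∧ P (1 + n) ∧ P (1 + n + 1) ∧ ∀ i < m, P (1 + n + 1 + 1 + i) := by
  obtain ⟨h1, h2⟩ := args_succ fun i hi => h i (hi.trans_le le_self_add)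
  obtain ⟨h3, h4, h5⟩ := args_one h1
  exact ⟨h3, h4, h5, h2, fun i hi => h _ (add_lt_add_right hi _)⟩

end

/-- The constant alone fixes the number of arguments, since lengths of contexts are unique. Equal
arguments then select the same rule, because `0` and `s y` are not bisimilar, and give equal
contracta. -/
theorem Ctr.det {r N a b w N' a' b' w' : M.Num} (h : Ctr r N a b w) (h' : Ctr r N' a' b' w') :
    N = N' ∧ ((∀ i < N, jEq (bt a b i) (bt a' b' i)) → jEq w w') := by
  cases h
  case id σ hr hN hw =>
    cases h'
    case id =>
      subst_vars
      exact ⟨rfl, fun e => (args_succ e).2⟩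
    all_goals exact absurd (hr.symm.trans ‹_›) (by simp)
  case ex Γ ρ σ Δ τ n m hr hn hm hN hw =>
    cases h'
    case ex Γ' ρ' σ' Δ' τ' n' m' hr' hn' hm' hN' hw' =>
      subst hr
      simp [pr_inj] at hr'
      obtain ⟨rfl, rfl, rfl, rfl, rfl⟩ := hr'
      obtain rfl := hn.unique hn'
      obtain rfl := hm.unique hm'
      subst hN hN' hw hw'
      refine ⟨rfl, fun e => ?_⟩
      obtain ⟨e0, e1, e2, e3, e4⟩ := args_ex e
      exact .aps (.A (.A (.aps e0 e1) e3) e2) e4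
    all_goals exact absurd (hr.symm.trans ‹_›) (by simp)
  case wk Γ σ τ n hr hn hN hw =>
    cases h'
    case wk Γ' σ' τ' n' hr' hn' hN' hw' =>
      subst hr
      simp [pr_inj] at hr'
      obtain ⟨rfl, rfl, rfl⟩ := hr'
      obtain rfl := hn.unique hn'
      subst hN hN' hw hw'
      refine ⟨rfl, fun e => ?_⟩
      obtain ⟨e0, e1, e2⟩ := args_one e
      exact .aps e0 e1
    all_goals exact absurd (hr.symm.trans ‹_›) (by simp)
  case cntr Γ σ τ n hr hn hN hw =>
    cases h'
    case cntr Γ' σ' τ' n' hr' hn' hN' hw' =>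
      subst hr
      simp [pr_inj] at hr'
      obtain ⟨rfl, rfl, rfl⟩ := hr'
      obtain rfl := hn.unique hn'
      subst hN hN' hw hw'
      refine ⟨rfl, fun e => ?_⟩
      obtain ⟨e0, e1, e2⟩ := args_one e
      exact .A (.A (.aps e0 e1) e2) e2
    all_goals exact absurd (hr.symm.trans ‹_›) (by simp)
  case cut Γ σ τ n hr hn hN hw =>
    cases h'
    case cut Γ' σ' τ' n' hr' hn' hN' hw' =>
      subst hr
      simp [pr_inj] at hr'
      obtain ⟨rfl, rfl, rfl⟩ := hr'
      obtain rfl := hn.unique hn'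
      subst hN hN' hw hw'
      refine ⟨rfl, fun e => ?_⟩
      obtain ⟨e0, e1, e2⟩ := args_two e
      exact .A (.aps e1 e2) (.aps e0 e2)
    all_goals exact absurd (hr.symm.trans ‹_›) (by simp)
  case L Γ ρ σ τ n hr hn hN hw =>
    cases h'
    case L Γ' ρ' σ' τ' n' hr' hn' hN' hw' =>
      subst hr
      simp [pr_inj] at hr'
      obtain ⟨rfl, rfl, rfl, rfl⟩ := hr'
      obtain rfl := hn.unique hn'
      subst hN hN' hw hw'
      refine ⟨rfl, fun e => ?_⟩
      obtain ⟨e, e3⟩ := args_succ e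
      obtain ⟨e0, e1, e2⟩ := args_two e
      exact .A (.aps e1 e2) (.A e3 (.aps e0 e2))
    all_goals exact absurd (hr.symm.trans ‹_›) (by simp)
  case R Γ σ τ n hr hn hN hw =>
    cases h'
    case R Γ' σ' τ' n' hr' hn' hN' hw' =>
      subst hr
      simp [pr_inj] at hr'
      obtain ⟨rfl, rfl, rfl⟩ := hr'
      obtain rfl := hn.unique hn'
      subst hN hN' hw hw'
      refine ⟨rfl, fun e => ?_⟩
      obtain ⟨e0, e1, e2⟩ := args_one e
      exact .A (.aps e0 e1) e2
    all_goals exact absurd (hr.symm.trans ‹_›) (by simp)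
  case recrZero Γ τ n hr hn hN he ht hw =>
    cases h'
    case recrZero Γ' τ' n' hr' hn' hN' he' ht' hw' =>
      subst hr
      simp [pr_inj] at hr'
      obtain ⟨rfl, rfl⟩ := hr'
      obtain rfl := hn.unique hn'
      subst hN hN' hw hw'
      refine ⟨rfl, fun e => ?_⟩
      obtain ⟨e, e3⟩ := args_succ e
      obtain ⟨e0, -, e2⟩ := args_two e
      exact .aps e0 e2
    case recrSucc Γ' τ' n' y' hr' hn' hN' he' ht' hw' =>
      subst hr
      simp [pr_inj] at hr'
      obtain ⟨rfl, rfl⟩ := hr'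
      obtain rfl := hn.unique hn'
      subst hN hN' hw hw'
      refine ⟨rfl, fun e => ?_⟩
      obtain ⟨e, e3⟩ := args_succ e
      exact (jEq.not_K_A ((he.symm.trans e3).trans he')).elim
    all_goals exact absurd (hr.symm.trans ‹_›) (by simp)
  case recrSucc Γ τ n y hr hn hN he ht hw =>
    cases h'
    case recrZero Γ' τ' n' hr' hn' hN' he' ht' hw' =>
      subst hr
      simp [pr_inj] at hr'
      obtain ⟨rfl, rfl⟩ := hr'
      obtain rfl := hn.unique hn'
      subst hN hN' hw hw'
      refine ⟨rfl, fun e => ?_⟩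
      obtain ⟨e, e3⟩ := args_succ e
      exact (jEq.not_K_A ((he.symm.trans e3).trans he').symm).elim
    case recrSucc Γ' τ' n' y' hr' hn' hN' he' ht' hw' =>
      subst hr
      simp [pr_inj] at hr'
      obtain ⟨rfl, rfl⟩ := hr'
      obtain rfl := hn.unique hn'
      subst hN hN' hw hw'
      refine ⟨rfl, fun e => ?_⟩
      obtain ⟨e, e3⟩ := args_succ e
      have e4 := ((he.symm.trans e3).trans he').A_inv.2
      obtain ⟨-, e1, e2⟩ := args_two e
      exact .A (.A (.aps e1 e2) e4) (.A (.ap (.K _) e) e4)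
    all_goals exact absurd (hr.symm.trans ‹_›) (by simp)
  case condZero Γ τ n hr hn hN he ht hw =>
    cases h'
    case condZero Γ' τ' n' hr' hn' hN' he' ht' hw' =>
      subst hr
      simp [pr_inj] at hr'
      obtain ⟨rfl, rfl⟩ := hr'
      obtain rfl := hn.unique hn'
      subst hN hN' hw hw'
      refine ⟨rfl, fun e => ?_⟩
      obtain ⟨e, e3⟩ := args_succ e
      obtain ⟨e0, -, e2⟩ := args_two e
      exact .aps e0 e2
    case condSucc Γ' τ' n' y' hr' hn' hN' he' ht' hw' =>
      subst hr
      simp [pr_inj] at hr'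
      obtain ⟨rfl, rfl⟩ := hr'
      obtain rfl := hn.unique hn'
      subst hN hN' hw hw'
      refine ⟨rfl, fun e => ?_⟩
      obtain ⟨e, e3⟩ := args_succ e
      exact (jEq.not_K_A ((he.symm.trans e3).trans he')).elim
    all_goals exact absurd (hr.symm.trans ‹_›) (by simp)
  case condSucc Γ τ n y hr hn hN he ht hw =>
    cases h'
    case condZero Γ' τ' n' hr' hn' hN' he' ht' hw' =>
      subst hr
      simp [pr_inj] at hr'
      obtain ⟨rfl, rfl⟩ := hr'
      obtain rfl := hn.unique hn'
      subst hN hN' hw hw'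
      refine ⟨rfl, fun e => ?_⟩
      obtain ⟨e, e3⟩ := args_succ e
      exact (jEq.not_K_A ((he.symm.trans e3).trans he').symm).elim
    case condSucc Γ' τ' n' y' hr' hn' hN' he' ht' hw' =>
      subst hr
      simp [pr_inj] at hr'
      obtain ⟨rfl, rfl⟩ := hr'
      obtain rfl := hn.unique hn'
      subst hN hN' hw hw'
      refine ⟨rfl, fun e => ?_⟩
      obtain ⟨e, e3⟩ := args_succ e
      have e4 := ((he.symm.trans e3).trans he').A_inv.2
      obtain ⟨-, e1, e2⟩ := args_two e
      exact .A (.aps e1 e2) e4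
    all_goals exact absurd (hr.symm.trans ‹_›) (by simp)

end

/-! ## Parallel reduction -/

section

variable {M : Structure2.{u}} [hM : Fact M.IsModelRCA0]

instance Fn.aps {C : Type u} [Ctx M C] {f g h k l : C → M.Num} [hf : Fn f] [hg : Fn g] [hh : Fn h]
    [hk : Fn k] [hl : Fn l] : Fn (fun c => aps (f c) (g c) (h c) (k c) (l c)) := by
  have := hf.fst
  have := hg.fst
  have := hh.fst
  have := hk.fst
  have := hl.fst
  have := hf.fst.fst.fst
  have := hl.fst.fst.fst
  have := hg.fst.fst.fst.fst
  have := hh.fst.fst.fst.fst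
  have := hk.fst.fst.fst.fst
  have := hl.fst.fst.fst
  refine ⟨(inferInstance : Sg (fun d : C × M.Num => ∃ p q, (∀ i, i < l d.1 →
    CT.bt p q i = CT.bt (g d.1) (h d.1) (k d.1 + i)) ∧ d.2 = CT.ap (f d.1) p q (l d.1))).congr
      fun d => ?_⟩
  constructor
  · intro e
    obtain ⟨p, q, h1, h2⟩ := exists_aps (g d.1) (h d.1) (k d.1) (l d.1)
    exact ⟨p, q, h1, e.trans (h2 _)⟩
  · rintro ⟨p, q, h1, h2⟩
    rw [h2, aps_eq h1]

theorem Ctr.ne_zero {r N a b w : M.Num} (h : Ctr r N a b w) : N ≠ 0 := by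
  have : ∀ n : M.Num, 1 + n ≠ 0 := fun n =>
    (Num.zero_lt_one''.trans_le (le_self_add : 1 ≤ 1 + n)).ne'
  cases h <;> subst_vars <;> simp only [add_assoc, zero_add] <;> first | exact this _ | simp

/-- `w` contracts to `v`. -/
def Root (w v : M.Num) : Prop := ∃ r N a b w', Ctr r N a b w' ∧ jEq w (ap (oK r) a b N) ∧
  jEq w' v ∧ STy w (ap (oK r) a b N) ∧ STy (ap (oK r) a b N) w' ∧ STy w' v

-- The rules are spelled out as a disjunction of existential formulas that instance search can
-- handle; the zero cases of recursion and of case distinction share one disjunct.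
set_option synthInstance.maxHeartbeats 400000 in
set_option synthInstance.maxSize 4000 in
theorem Ctr.sg : Sg (fun d : (((M.Num × M.Num) × M.Num) × M.Num) × M.Num =>
    Ctr d.1.1.1.1 d.1.1.1.2 d.1.1.2 d.1.2 d.2) := by
  let C := (((M.Num × M.Num) × M.Num) × M.Num) × M.Num
  have h1 : Sg (fun d : C => ∃ σ, d.1.1.1.1 = rId σ ∧ d.1.1.1.2 = 0 + 1 ∧ d.2 = bt d.1.1.2 d.1.2 0) :=
    inferInstance
  have h2 : Sg (fun d : C => ∃ Γ ρ σ Δ τ n m, d.1.1.1.1 = rEx Γ ρ σ Δ τ ∧ Len Γ n ∧ Len Δ m ∧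
      d.1.1.1.2 = 1 + n + 1 + 1 + m ∧ d.2 = aps (oA (oA (aps (bt d.1.1.2 d.1.2 0) d.1.1.2 d.1.2 1 n)
        (bt d.1.1.2 d.1.2 (1 + n + 1))) (bt d.1.1.2 d.1.2 (1 + n))) d.1.1.2 d.1.2 (1 + n + 1 + 1) m) :=
    inferInstance
  have h3 : Sg (fun d : C => ∃ Γ σ τ n, d.1.1.1.1 = rWk Γ σ τ ∧ Len Γ n ∧ d.1.1.1.2 = 1 + n + 1 ∧
      d.2 = aps (bt d.1.1.2 d.1.2 0) d.1.1.2 d.1.2 1 n) := inferInstance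
  have h4 : Sg (fun d : C => ∃ Γ σ τ n, d.1.1.1.1 = rCntr Γ σ τ ∧ Len Γ n ∧ d.1.1.1.2 = 1 + n + 1 ∧
      d.2 = oA (oA (aps (bt d.1.1.2 d.1.2 0) d.1.1.2 d.1.2 1 n) (bt d.1.1.2 d.1.2 (1 + n)))
        (bt d.1.1.2 d.1.2 (1 + n))) := inferInstance
  have h5 : Sg (fun d : C => ∃ Γ σ τ n, d.1.1.1.1 = rCut Γ σ τ ∧ Len Γ n ∧ d.1.1.1.2 = 1 + 1 + n ∧
      d.2 = oA (aps (bt d.1.1.2 d.1.2 1) d.1.1.2 d.1.2 (1 + 1) n)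
        (aps (bt d.1.1.2 d.1.2 0) d.1.1.2 d.1.2 (1 + 1) n)) := inferInstance
  have h6 : Sg (fun d : C => ∃ Γ ρ σ τ n, d.1.1.1.1 = rL Γ ρ σ τ ∧ Len Γ n ∧
      d.1.1.1.2 = 1 + 1 + n + 1 ∧ d.2 = oA (aps (bt d.1.1.2 d.1.2 1) d.1.1.2 d.1.2 (1 + 1) n)
        (oA (bt d.1.1.2 d.1.2 (1 + 1 + n)) (aps (bt d.1.1.2 d.1.2 0) d.1.1.2 d.1.2 (1 + 1) n))) :=
    inferInstance
  have h7 : Sg (fun d : C => ∃ Γ σ τ n, d.1.1.1.1 = rR Γ σ τ ∧ Len Γ n ∧ d.1.1.1.2 = 1 + n + 1 ∧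
      d.2 = oA (aps (bt d.1.1.2 d.1.2 0) d.1.1.2 d.1.2 1 n) (bt d.1.1.2 d.1.2 (1 + n))) :=
    inferInstance
  have h8 : Sg (fun d : C => ∃ Γ τ n, (d.1.1.1.1 = rRecr Γ τ ∨ d.1.1.1.1 = rCond Γ τ) ∧ Len Γ n ∧
      d.1.1.1.2 = 1 + 1 + n + 1 ∧ jEq (bt d.1.1.2 d.1.2 (1 + 1 + n)) (oK rZero) ∧
      STy (bt d.1.1.2 d.1.2 (1 + 1 + n)) (oK rZero) ∧
      d.2 = aps (bt d.1.1.2 d.1.2 0) d.1.1.2 d.1.2 (1 + 1) n) := inferInstance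
  have h9 : Sg (fun d : C => ∃ Γ τ n y, d.1.1.1.1 = rRecr Γ τ ∧ Len Γ n ∧
      d.1.1.1.2 = 1 + 1 + n + 1 ∧ jEq (bt d.1.1.2 d.1.2 (1 + 1 + n)) (oA (oK rSucc) y) ∧
      STy (bt d.1.1.2 d.1.2 (1 + 1 + n)) (oA (oK rSucc) y) ∧
      d.2 = oA (oA (aps (bt d.1.1.2 d.1.2 1) d.1.1.2 d.1.2 (1 + 1) n) y)
        (oA (ap (oK d.1.1.1.1) d.1.1.2 d.1.2 (1 + 1 + n)) y)) := inferInstance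
  have h10 : Sg (fun d : C => ∃ Γ τ n y, d.1.1.1.1 = rCond Γ τ ∧ Len Γ n ∧
      d.1.1.1.2 = 1 + 1 + n + 1 ∧ jEq (bt d.1.1.2 d.1.2 (1 + 1 + n)) (oA (oK rSucc) y) ∧
      STy (bt d.1.1.2 d.1.2 (1 + 1 + n)) (oA (oK rSucc) y) ∧
      d.2 = oA (aps (bt d.1.1.2 d.1.2 1) d.1.1.2 d.1.2 (1 + 1) n) y) := inferInstance
  refine (h1.or (hQ := h2.or (hQ := h3.or (hQ := h4.or (hQ := h5.or (hQ := h6.or (hQ := h7.or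
    (hQ := h8.or (hQ := h9.or (hQ := h10)))))))))).congr fun d => ⟨fun h => ?_, ?_⟩
  · cases h
    case id σ hr hN hw => exact .inl ⟨σ, hr, hN, hw⟩
    case ex Γ ρ σ Δ τ n m hr hn hm hN hw =>
      exact .inr (.inl ⟨Γ, ρ, σ, Δ, τ, n, m, hr, hn, hm, hN, hw⟩)
    case wk Γ σ τ n hr hn hN hw => exact .inr (.inr (.inl ⟨Γ, σ, τ, n, hr, hn, hN, hw⟩))
    case cntr Γ σ τ n hr hn hN hw => exact .inr (.inr (.inr (.inl ⟨Γ, σ, τ, n, hr, hn, hN, hw⟩)))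
    case cut Γ σ τ n hr hn hN hw =>
      exact .inr (.inr (.inr (.inr (.inl ⟨Γ, σ, τ, n, hr, hn, hN, hw⟩))))
    case L Γ ρ σ τ n hr hn hN hw =>
      exact .inr (.inr (.inr (.inr (.inr (.inl ⟨Γ, ρ, σ, τ, n, hr, hn, hN, hw⟩)))))
    case R Γ σ τ n hr hn hN hw =>
      exact .inr (.inr (.inr (.inr (.inr (.inr (.inl ⟨Γ, σ, τ, n, hr, hn, hN, hw⟩))))))
    case recrZero Γ τ n hr hn hN he ht hw => exact .inr (.inr (.inr (.inr (.inr (.inr (.inr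
      (.inl ⟨Γ, τ, n, .inl hr, hn, hN, he, ht, hw⟩)))))))
    case condZero Γ τ n hr hn hN he ht hw => exact .inr (.inr (.inr (.inr (.inr (.inr (.inr
      (.inl ⟨Γ, τ, n, .inr hr, hn, hN, he, ht, hw⟩)))))))
    case recrSucc Γ τ n y hr hn hN he ht hw => exact .inr (.inr (.inr (.inr (.inr (.inr (.inr
      (.inr (.inl ⟨Γ, τ, n, y, hr, hn, hN, he, ht, hw⟩))))))))
    case condSucc Γ τ n y hr hn hN he ht hw => exact .inr (.inr (.inr (.inr (.inr (.inr (.inr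
      (.inr (.inr ⟨Γ, τ, n, y, hr, hn, hN, he, ht, hw⟩))))))))
  · rintro (⟨σ, hr, hN, hw⟩ | ⟨Γ, ρ, σ, Δ, τ, n, m, hr, hn, hm, hN, hw⟩ | ⟨Γ, σ, τ, n, hr, hn, hN, hw⟩ |
      ⟨Γ, σ, τ, n, hr, hn, hN, hw⟩ | ⟨Γ, σ, τ, n, hr, hn, hN, hw⟩ | ⟨Γ, ρ, σ, τ, n, hr, hn, hN, hw⟩ |
      ⟨Γ, σ, τ, n, hr, hn, hN, hw⟩ | ⟨Γ, τ, n, hr | hr, hn, hN, he, ht, hw⟩ |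
      ⟨Γ, τ, n, y, hr, hn, hN, he, ht, hw⟩ | ⟨Γ, τ, n, y, hr, hn, hN, he, ht, hw⟩)
    exacts [.id σ hr hN hw, .ex Γ ρ σ Δ τ n m hr hn hm hN hw, .wk Γ σ τ n hr hn hN hw,
      .cntr Γ σ τ n hr hn hN hw, .cut Γ σ τ n hr hn hN hw, .L Γ ρ σ τ n hr hn hN hw,
      .R Γ σ τ n hr hn hN hw, .recrZero Γ τ n hr hn hN he ht hw, .condZero Γ τ n hr hn hN he ht hw,
      .recrSucc Γ τ n y hr hn hN he ht hw, .condSucc Γ τ n y hr hn hN he ht hw]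

instance Ctr.shift {C : Type u} [Ctx M C] :
    Sg (fun d : ((((C × M.Num) × M.Num) × M.Num) × M.Num) × M.Num =>
      Ctr d.1.1.1.1.2 d.1.1.1.2 d.1.1.2 d.1.2 d.2) :=
  Ctr.sg.pullback (g := (· + Ctx.len C)) (add_left_injective _) (by simp [Ctx.len]; omega)
    (fun d : ((((C × M.Num) × M.Num) × M.Num) × M.Num) × M.Num =>
      ((((d.1.1.1.1.2, d.1.1.1.2), d.1.1.2), d.1.2), d.2)) fun d e h => by
      have key : ∀ k x, e (2 * (Ctx.len C + k)) = x → e (evenMap (· + Ctx.len C) (2 * k)) = x :=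
        fun k x hx => by rw [← hx, evenMap_even, add_comm k]
      exact ⟨⟨⟨⟨key 0 _ h.1.1.1.1.2, key 1 _ h.1.1.1.2⟩, key 2 _ h.1.1.2⟩, key 3 _ h.1.2⟩,
        key 4 _ h.2⟩

set_option synthInstance.maxHeartbeats 400000 in
set_option synthInstance.maxSize 4000 in
instance Root.sg {C : Type u} [Ctx M C] {f g : C → M.Num} [Fn f] [Fn g] :
    Sg (fun c => Root (f c) (g c)) :=
  (inferInstance : Sg (fun d : M.Num × M.Num => ∃ r N a b w', Ctr r N a b w' ∧
    jEq d.1 (ap (oK r) a b N) ∧ jEq w' d.2 ∧ STy d.1 (ap (oK r) a b N) ∧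
    STy (ap (oK r) a b N) w' ∧ STy w' d.2)).comp₂ (P := Root) f g

end

/-! ### Parallel reduction as derivability by rules -/

section

variable {M : Structure2.{u}} [hM : Fact M.IsModelRCA0]

/-- One step of a parallel reduction of `s` to `t`, the components being reduced by `X`. -/
def PrStep (X : M.Num → M.Num → Prop) (s t : M.Num) : Prop :=
  (Typed s ∧ Typed t ∧ jEq s t) ∨ ∃ s₁ s₂ t₁ t₂, Typed s ∧ jEq s (oA s₁ s₂) ∧ Typed (oA s₁ s₂) ∧
    X s₁ t₁ ∧ X s₂ t₂ ∧ ((jEq (oA t₁ t₂) t ∧ Typed t) ∨ Root (oA t₁ t₂) t)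

theorem PrStep.mono {X Y : M.Num → M.Num → Prop} {s t : M.Num} (h : PrStep X s t)
    (hXY : ∀ s t, X s t → Y s t) : PrStep Y s t := by
  obtain h | ⟨s₁, s₂, t₁, t₂, h1, h2, h3, h4, h5, h6⟩ := h
  exacts [.inl h, .inr ⟨s₁, s₂, t₁, t₂, h1, h2, h3, hXY _ _ h4, hXY _ _ h5, h6⟩]

/-- The rules that generate parallel reduction. -/
def PrRl (c : Bool) (l : List M.Num) (y : M.Num) : Prop :=
  c = false ∧ ∃ s t, y = pr s t ∧ PrStep (fun s t => pr s t ∈ l) s t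

theorem step_prRl_iff {P Q : M.Num → Prop} {y : M.Num} :
    Step PrRl P Q y ↔ ∃ s t, y = pr s t ∧ PrStep (fun s t => P (pr s t)) s t := by
  constructor
  · rintro ⟨c, l, ⟨rfl, s, t, rfl, h⟩, hl⟩
    exact ⟨s, t, rfl, h.mono fun s t hst => (hl _ hst).1 rfl⟩
  · rintro ⟨s, t, rfl, h | ⟨s₁, s₂, t₁, t₂, h1, h2, h3, h4, h5, h6⟩⟩
    · exact ⟨false, [], ⟨rfl, s, t, rfl, .inl h⟩, by simp⟩
    · exact ⟨false, [pr s₁ t₁, pr s₂ t₂], ⟨rfl, s, t, rfl, .inr ⟨s₁, s₂, t₁, t₂, h1, h2, h3,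
        by simp, by simp, h6⟩⟩, by simp [h4, h5]⟩

set_option synthInstance.maxHeartbeats 400000 in
set_option synthInstance.maxSize 4000 in
instance PrRl.rules : Rules (A := M) PrRl where
  sg {C _ P Q f} hP _ hf := by
    have := hf.fst
    have := hf.fst.fst
    have a1 := Sg.insert (P := P) hP
    have a2 := Sg.insert (P := fun c : C × M.Num => P c.1) a1
    have a3 := Sg.insert (P := fun c : (C × M.Num) × M.Num => P c.1.1) a2
    have a4 := Sg.insert (P := fun c : ((C × M.Num) × M.Num) × M.Num => P c.1.1.1) a3
    have a5 := Sg.insert (P := fun c : (((C × M.Num) × M.Num) × M.Num) × M.Num => P c.1.1.1.1) a4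
    have a6 := Sg.insert
      (P := fun c : ((((C × M.Num) × M.Num) × M.Num) × M.Num) × M.Num => P c.1.1.1.1.1) a5
    have h1 : Sg (fun d : (((((C × M.Num) × M.Num) × M.Num) × M.Num) × M.Num) × M.Num =>
      P d.1.1.1.1.1.1 (pr d.1.1.1.2 d.1.2)) :=
      Sg.subst (P := fun d : (((((C × M.Num) × M.Num) × M.Num) × M.Num) × M.Num) × M.Num =>
        P d.1.1.1.1.1.1) a6 (f := fun d => pr d.1.1.1.2 d.1.2) inferInstance
    have h2 : Sg (fun d : (((((C × M.Num) × M.Num) × M.Num) × M.Num) × M.Num) × M.Num =>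
      P d.1.1.1.1.1.1 (pr d.1.1.2 d.2)) :=
      Sg.subst (P := fun d : (((((C × M.Num) × M.Num) × M.Num) × M.Num) × M.Num) × M.Num =>
        P d.1.1.1.1.1.1) a6 (f := fun d => pr d.1.1.2 d.2) inferInstance
    exact (inferInstance : Sg (fun c => ∃ s t, f c = pr s t ∧ ((Typed s ∧ Typed t ∧ jEq s t) ∨
      ∃ s₁ s₂ t₁ t₂, Typed s ∧ jEq s (oA s₁ s₂) ∧ Typed (oA s₁ s₂) ∧
      P c (pr s₁ t₁) ∧ P c (pr s₂ t₂) ∧ ((jEq (oA t₁ t₂) t ∧ Typed t) ∨ Root (oA t₁ t₂) t)))).congr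
        fun c => step_prRl_iff

/-- Parallel reduction. -/
def Pr (s t : M.Num) : Prop := Der PrRl (pr s t)

instance Pr.sg {C : Type u} [Ctx M C] {f g : C → M.Num} [Fn f] [Fn g] :
    Sg (fun c => Pr (f c) (g c)) := Sg.comp (Sg.der PrRl) fun c => CT.pr (f c) (g c)

theorem step_prRl {P Q : M.Num → Prop} {s t : M.Num} :
    Step PrRl P Q (pr s t) ↔ PrStep (fun s t => P (pr s t)) s t := by
  rw [step_prRl_iff]
  constructor
  · rintro ⟨s', t', e, h⟩
    obtain ⟨rfl, rfl⟩ := pr_inj.1 e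
    exact h
  · exact fun h => ⟨s, t, rfl, h⟩

theorem Pr.step {s t : M.Num} (h : Pr s t) : PrStep Pr s t := step_prRl.1 (Der.step h)

theorem Pr.of_step {s t : M.Num} (h : PrStep Pr s t) : Pr s t := Der.of_step (step_prRl.2 h)

theorem IsDer.prStep {a b n s t : M.Num} (hd : IsDer PrRl a b n) (h : In a b n (pr s t)) :
    PrStep (fun s t => In a b n (pr s t)) s t := step_prRl.1 (hd.step h)

theorem Der.exists_pr {y : M.Num} (h : Der PrRl y) : ∃ s t, y = pr s t := by
  obtain ⟨s, t, h, -⟩ := step_prRl_iff.1 h.step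
  exact ⟨s, t, h⟩

-- Every derivable code is a pair, so decoding by existential quantifiers loses nothing and keeps
-- the predicate `Σ⁰₁`.
set_option synthInstance.maxHeartbeats 400000 in
theorem Pr.induct {Φ : M.Num → M.Num → Prop} (hΦ : Sg (fun d : M.Num × M.Num => Φ d.1 d.2))
    (hs : ∀ s t, Pr s t → PrStep (fun s t => Pr s t ∧ Φ s t) s t → Φ s t) {s t : M.Num}
    (h : Pr s t) : Φ s t := by
  have := fun (C : Type u) [Ctx M C] (f g : C → M.Num) [Fn f] [Fn g] => hΦ.comp₂ f g
  have key := Der.induct (Rl := PrRl) (P := fun y => ∃ s t, y = pr s t ∧ Φ s t)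
    (.inl inferInstance) ?_ h
  · obtain ⟨s', t', e, h⟩ := key
    obtain ⟨rfl, rfl⟩ := pr_inj.1 e
    exact h
  · intro y hy h
    obtain ⟨s, t, rfl⟩ := hy.exists_pr
    refine ⟨s, t, rfl, hs _ _ hy ((step_prRl.1 h).mono ?_)⟩
    rintro s t ⟨h1, s', t', e, h2⟩
    obtain ⟨rfl, rfl⟩ := pr_inj.1 e
    exact ⟨h1, h2⟩

/-! ### Typing and bisimilarity under parallel reduction -/

theorem Root.sty {w v : M.Num} (h : Root w v) : STy w v := by
  obtain ⟨r, N, a, b, w', -, -, -, h1, h2, h3⟩ := h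
  exact (h1.trans h2).trans h3

theorem Root.eq_left {w w' v : M.Num} (h : Root w v) (e : jEq w' w) (hw : Typed w') : Root w' v := by
  obtain ⟨r, N, a, b, u, h0, h1, h2, h3, h4, h5⟩ := h
  exact ⟨r, N, a, b, u, h0, e.trans h1, h2, (e.sty hw h3.left).trans h3, h4, h5⟩

theorem Root.eq_right {w v v' : M.Num} (h : Root w v) (e : jEq v v') (hv : Typed v') : Root w v' := by
  obtain ⟨r, N, a, b, u, h0, h1, h2, h3, h4, h5⟩ := h
  exact ⟨r, N, a, b, u, h0, h1, h2.trans e, h3, h4, h5.trans (e.sty h5.right hv)⟩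

/-- Uniqueness of heads gives both redexes the same constant and the same number of arguments, which
are then bisimilar, so `Ctr.det` applies. -/
theorem Root.det {w v v' : M.Num} (h : Root w v) (h' : Root w v') : jEq v v' := by
  obtain ⟨r, N, a, b, u, h0, h1, h2, -⟩ := h
  obtain ⟨r', N', a', b', u', h0', h1', h2', -⟩ := h'
  obtain ⟨e, rfl⟩ := Hd.unique ⟨.inl ⟨r, rfl⟩, a, b, h1⟩ ⟨.inl ⟨r', rfl⟩, a', b', h1'⟩
  simp [pr_inj] at e
  obtain rfl := e
  exact h2.symm.trans (((h0.det h0').2 (h1.symm.trans h1').ap_inv.2).trans h2')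

/-- Root contractions carry their typing within `Root`, and components are replaced by components of
the same type. -/
theorem Pr.sty {s t : M.Num} (h : Pr s t) : STy s t := by
  refine Pr.induct (Φ := fun s t => STy s t) inferInstance ?_ h
  rintro s t - (⟨h1, h2, h3⟩ | ⟨s₁, s₂, t₁, t₂, h1, h2, h3, h4, h5, h6⟩)
  · exact h3.sty h1 h2
  · have h7 := (h2.sty h1 h3).trans (h4.2.A h3 h5.2)
    obtain ⟨h6, h8⟩ | h6 := h6
    · exact h7.trans (h6.sty h7.right h8)
    · exact h7.trans h6.sty

theorem Pr.of_eq {s t : M.Num} (e : jEq s t) (hs : Typed s) (ht : Typed t) : Pr s t :=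
  .of_step (.inl ⟨hs, ht, e⟩)

theorem Typed.pr {s : M.Num} (h : Typed s) : Pr s s := .of_eq h.refl h h

theorem Pr.eq_left {s s' t : M.Num} (h : Pr s t) (e : jEq s' s) (hs : Typed s') : Pr s' t := by
  obtain ⟨h1, h2, h3⟩ | ⟨s₁, s₂, t₁, t₂, h1, h2, h3, h4, h5, h6⟩ := h.step
  · exact .of_eq (e.trans h3) hs h2
  · exact .of_step (.inr ⟨s₁, s₂, t₁, t₂, hs, e.trans h2, h3, h4, h5, h6⟩)

theorem Pr.eq_right {s t t' : M.Num} (h : Pr s t) (e : jEq t t') (ht : Typed t') : Pr s t' := by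
  obtain ⟨h1, h2, h3⟩ | ⟨s₁, s₂, t₁, t₂, h1, h2, h3, h4, h5, h6⟩ := h.step
  · exact .of_eq (h3.trans e) h1 ht
  · refine .of_step (.inr ⟨s₁, s₂, t₁, t₂, h1, h2, h3, h4, h5, h6.imp ?_ ?_⟩)
    exacts [fun h => ⟨h.1.trans e, ht⟩, fun h => h.eq_right e ht]

theorem Pr.A {s t s' t' : M.Num} (h : Typed (oA s t)) (hs : Pr s s') (ht : Pr t t') :
    Pr (oA s t) (oA s' t') :=
  have h' := (hs.sty.A h ht.sty).right
  .of_step (.inr ⟨s, t, s', t', h, h.refl, h, hs, ht, .inl ⟨h'.refl, h'⟩⟩)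

theorem Pr.root {s t s' t' w : M.Num} (h : Typed (oA s t)) (hs : Pr s s') (ht : Pr t t')
    (hw : Root (oA s' t') w) : Pr (oA s t) w :=
  .of_step (.inr ⟨s, t, s', t', h, h.refl, h, hs, ht, .inr hw⟩)

theorem Pr.ap {s s' a b a' b' n : M.Num} (ht : Typed (CT.ap s a b n)) (h : Pr s s')
    (hx : ∀ i < n, Pr (bt a b i) (bt a' b' i)) : Pr (CT.ap s a b n) (CT.ap s' a' b' n) := by
  have key : ∀ i, i ≤ n → Pr (CT.ap s a b i) (CT.ap s' a' b' i) := by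
    refine Sg.induct inferInstance (fun _ => by simpa using h) fun i ih hi => ?_
    have := ht.ap_inv.1 _ hi
    rw [ap_succ] at this
    rw [ap_succ, ap_succ]
    exact .A this (ih ((Num.lt_succ_self i).le.trans hi)) (hx i (Num.succ_le_iff.1 hi))
  exact key n le_rfl

theorem Pr.aps {s s' a b a' b' k n : M.Num} (ht : Typed (CT.aps s a b k n)) (h : Pr s s')
    (hx : ∀ i < n, Pr (bt a b (k + i)) (bt a' b' (k + i))) :
    Pr (CT.aps s a b k n) (CT.aps s' a' b' k n) := by
  obtain ⟨c, d, h1, h2⟩ := exists_aps a b k n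
  obtain ⟨c', d', h1', h2'⟩ := exists_aps a' b' k n
  rw [h2] at ht
  rw [h2, h2']
  exact .ap ht h fun i hi => by rw [h1 i hi, h1' i hi]; exact hx i hi

/-- A contractible coterm is an application. -/
theorem Root.exists_A {w v : M.Num} (h : Root w v) :
    ∃ s t, jEq w (oA s t) ∧ Typed w ∧ Typed (oA s t) ∧ Root (oA s t) v := by
  have h' := h
  obtain ⟨r, N, a, b, u, h0, h1, h2, h3, h4, h5⟩ := h
  obtain rfl | ⟨k, rfl⟩ := Num.cases' N
  · exact (h0.ne_zero rfl).elim
  · have h6 := h3.right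
    rw [ap_succ] at h1 h6
    exact ⟨_, _, h1, h3.left, h6, h'.eq_left h1.symm h6⟩

theorem Root.pr {w v : M.Num} (h : Root w v) : Pr w v := by
  obtain ⟨s, t, h1, h2, h3, h4⟩ := h.exists_A
  exact (Pr.root h3 h3.A_inv.1.pr h3.A_inv.2.pr h4).eq_left h1 h2

/-! ### Coterms that cannot be contracted at the root -/

-- Counterpart of `Par.apps_const_inv`: fewer than `K` arguments do not suffice for a contraction of
-- `r`, so the head and the number of arguments persist. By uniqueness of heads a root contraction
-- would have to be one of `r` with too few arguments.
set_option synthInstance.maxHeartbeats 400000 in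
theorem Pr.hd_aux {r K : M.Num} (hK : ∀ N a b w, Ctr r N a b w → K ≤ N) (m : M.Num) :
    ∀ u u' h m', Hd (oK r) m u → m < K → Pr u u' → Hd h m' u' → h = oK r ∧ m' = m := by
  refine Pg.induct (P := fun m => ∀ u u' h m', Hd (oK r) m u → m < K → Pr u u' → Hd h m' u' →
    h = oK r ∧ m' = m) inferInstance ?_ ?_ m
  · intro u u' h m' h1 h2 h3 h4
    obtain ⟨-, -, h5⟩ | ⟨s₁, s₂, t₁, t₂, -, h5, -⟩ := h3.step
    · exact (h4.congr h5).unique h1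
    · exact (h1.not_zero h5).elim
  · intro m ih u u' h m' h1 h2 h3 h4
    obtain ⟨-, -, h5⟩ | ⟨s₁, s₂, t₁, t₂, -, h5, h6, h7, h8, h9⟩ := h3.step
    · exact (h4.congr h5).unique h1
    · obtain ⟨k, e, h10⟩ := h1.A_inv h5
      obtain rfl := add_right_cancel e
      obtain ⟨h', k, h11⟩ := h7.sty.right.exists_hd
      obtain ⟨rfl, rfl⟩ := ih _ _ _ _ h10 ((Num.lt_succ_self _).trans h2) h7 h11
      have h12 := h11.A ((h7.sty.A h6 h8.sty).right).refl
      obtain ⟨h9, -⟩ | h9 := h9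
      · exact (h4.congr h9).unique h12
      · obtain ⟨r', N, a, b, w, h13, h14, -⟩ := h9
        obtain ⟨e, rfl⟩ := h12.unique ⟨.inl ⟨r', rfl⟩, a, b, h14⟩
        simp [pr_inj] at e
        obtain rfl := e
        exact absurd (hK _ _ _ _ h13) (not_le.2 h2)

theorem Pr.hd {r K m u u' : M.Num} (hK : ∀ N a b w, Ctr r N a b w → K ≤ N) (h : Hd (oK r) m u)
    (hm : m < K) (hu : Pr u u') : Hd (oK r) m u' := by
  obtain ⟨h', m', h1⟩ := hu.sty.right.exists_hd
  obtain ⟨rfl, rfl⟩ := Pr.hd_aux hK m _ _ _ _ h hm hu h1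
  exact h1

/-- Below the redex arity an application is not contracted at its root, so its two parts reduce
independently. -/
theorem Pr.under {r K m x y u : M.Num} (hK : ∀ N a b w, Ctr r N a b w → K ≤ N)
    (h : Hd (oK r) m x) (hm : m + 1 < K) (hu : Pr (oA x y) u) :
    ∃ x' y', Pr x x' ∧ Pr y y' ∧ jEq u (oA x' y') := by
  obtain ⟨h1, -, h2⟩ | ⟨s₁, s₂, t₁, t₂, h1, h5, h6, h7, h8, h9⟩ := hu.step
  · exact ⟨x, y, h1.A_inv.1.pr, h1.A_inv.2.pr, h2.symm⟩
  · obtain ⟨e1, e2⟩ := h5.A_inv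
    refine ⟨t₁, t₂, h7.eq_left e1 h1.A_inv.1, h8.eq_left e2 h1.A_inv.2, ?_⟩
    obtain ⟨h9, -⟩ | h9 := h9
    · exact h9.symm
    · have h12 := (Pr.hd hK (h.congr e1.symm) ((Num.lt_succ_self _).trans hm) h7).A
        ((h7.sty.A h6 h8.sty).right).refl
      obtain ⟨r', N, a, b, w, h13, h14, -⟩ := h9
      obtain ⟨e, rfl⟩ := h12.unique ⟨.inl ⟨r', rfl⟩, a, b, h14⟩
      simp [pr_inj] at e
      obtain rfl := e
      exact absurd (hK _ _ _ _ h13) (not_le.2 hm)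

theorem exists_choice {P : M.Num → M.Num → Prop} (hP : Sg (fun d : M.Num × M.Num => P d.1 d.2))
    (n : M.Num) (h : ∀ i < n, ∃ x, P i x) : ∃ a b, ∀ i < n, P i (bt a b i) := by
  have := fun (C : Type u) [Ctx M C] (f g : C → M.Num) [Fn f] [Fn g] => hP.comp₂ f g
  obtain ⟨a, b, -, -, h1⟩ := exists_chain (P := fun _ _ => (0 : M.Num) = 0)
    (S := fun i _ y => P i y) inferInstance inferInstance n (x := 0) rfl fun i hi _ _ =>
      (h i hi).imp fun _ h => ⟨rfl, h⟩
  -- The chain stores the choice for `i` at position `i + 1`.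
  obtain ⟨a', b', h2⟩ := exists_shift a b 1 n
  exact ⟨a', b', fun i hi => by rw [h2 i hi, add_comm]; exact h1 i hi⟩

-- The number of arguments may be nonstandard, so they are not treated by recursion: a descending
-- chain records reducts of all initial parts of the spine, and the reduced arguments are then
-- chosen along it.
set_option synthInstance.maxHeartbeats 400000 in
set_option synthInstance.maxSize 4000 in
theorem Pr.ap_inv {r K m a b u : M.Num} (hK : ∀ N a b w, Ctr r N a b w → K ≤ N) (hm : m < K)
    (hu : Pr (CT.ap (oK r) a b m) u) :
    ∃ a' b', (∀ i < m, Pr (bt a b i) (bt a' b' i)) ∧ jEq u (CT.ap (oK r) a' b' m) := by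
  obtain ⟨c, d, rfl, h1, h2⟩ := exists_chain_descending
    (P := fun i x => Pr (CT.ap (oK r) a b i) x) (S := fun i y x => ∃ z, Pr (bt a b i) z ∧
      jEq x (oA y z)) inferInstance inferInstance m hu fun i hi x hx => by
    rw [ap_succ] at hx
    have h3 := hx.sty.left
    obtain ⟨x', y', h4, h5, h6⟩ := Pr.under hK (m := i)
      ⟨.inl ⟨r, rfl⟩, a, b, h3.A_inv.1.refl⟩ ((Num.succ_le_iff.2 hi).trans_lt hm) hx
    exact ⟨x', h4, y', h5, h6⟩
  have : Fn (fun e : M.Num × M.Num => bt c d (e.1 + 1)) := inferInstance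
  obtain ⟨a', b', h3⟩ := exists_choice (P := fun i z => Pr (bt a b i) z ∧
    jEq (bt c d (i + 1)) (oA (bt c d i) z)) inferInstance m h2
  refine ⟨a', b', fun i hi => (h3 i hi).1, ?_⟩
  have key : ∀ i, i ≤ m → jEq (bt c d i) (CT.ap (oK r) a' b' i) := by
    refine Sg.induct inferInstance (fun h0 => ?_) fun i ih hi => ?_
    · have h4 := h1 0 h0
      rw [ap_zero] at h4 ⊢
      exact (Pr.hd hK (.K (.K r)) (h0.trans_lt hm) h4).zero
    · obtain ⟨h4, h5⟩ := h3 i (Num.succ_le_iff.1 hi)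
      rw [ap_succ]
      exact h5.trans ((ih ((Num.lt_succ_self i).le.trans hi)).A h4.sty.right.refl)
  exact key m le_rfl

theorem Ctr.not_zero {N a b w : M.Num} (h : Ctr rZero N a b w) : False := by
  cases h <;> exact absurd ‹rZero = _› (by simp)

theorem Ctr.not_succ {N a b w : M.Num} (h : Ctr rSucc N a b w) : False := by
  cases h <;> exact absurd ‹rSucc = _› (by simp)

/-- The constant `0` heads no contraction, so any `K` is a lower bound; `1` exceeds its number of
arguments. For `succ` the bound `1 + 1` plays this role. -/
theorem Pr.zero {s u : M.Num} (h : Pr s u) (e : jEq s (oK rZero)) : jEq u (oK rZero) :=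
  (Pr.hd (K := 1) (fun _ _ _ _ h => h.not_zero.elim) (.K e) Num.zero_lt_one'' h).zero

theorem Pr.succ {s u y : M.Num} (h : Pr s u) (e : jEq s (oA (oK rSucc) y))
    (ht : Typed (oA (oK rSucc) y)) :
    ∃ y', Pr y y' ∧ jEq u (oA (oK rSucc) y') ∧ Typed (oA (oK rSucc) y') := by
  have hK : ∀ N a b w, Ctr (M := M) rSucc N a b w → 1 + 1 ≤ N := fun _ _ _ _ h => h.not_succ.elim
  obtain ⟨x', y', h1, h2, h3⟩ := Pr.under hK (m := 0) (.K (.K _))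
    (by rw [zero_add]; exact Num.lt_succ_self 1) (h.eq_left e.symm ht)
  have h4 := (Pr.hd hK (.K (.K _)) (Num.zero_lt_one''.trans (Num.lt_succ_self 1)) h1).zero
  exact ⟨y', h2, h3.trans (h4.A h2.sty.right.refl), (ht.A_inv.1.sty.A ht h2.sty).right⟩

end

/-! ## The diamond property -/

section

variable {M : Structure2.{u}} [hM : Fact M.IsModelRCA0]

/-- Counterpart of `Contr.par`. The contractum is an iterated application of the arguments, and
reducts of arguments bisimilar to `0` or `s y` again have this form, by `Pr.zero` and `Pr.succ`. -/
theorem Ctr.commute {r N a b w a' b' : M.Num} (h : Ctr r N a b w) (ht : Typed w)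
    (hp : ∀ i < N, Pr (bt a b i) (bt a' b' i)) : ∃ w', Ctr r N a' b' w' ∧ Pr w w' := by
  cases h
  case id σ hr hN hw =>
    subst hN hw
    exact ⟨_, .id σ hr rfl rfl, (args_succ hp).2⟩
  case ex Γ ρ σ Δ τ n m hr hn hm hN hw =>
    subst hN hw
    refine ⟨_, .ex Γ ρ σ Δ τ n m hr hn hm rfl rfl, ?_⟩
    obtain ⟨e0, e1, e2, e3, e4⟩ := args_ex hp
    exact .aps ht (.A ht.aps_inv.1 (.A ht.aps_inv.1.A_inv.1
      (.aps ht.aps_inv.1.A_inv.1.A_inv.1 e0 e1) e3) e2) e4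
  case wk Γ σ τ n hr hn hN hw =>
    subst hN hw
    obtain ⟨e0, e1, e2⟩ := args_one hp
    exact ⟨_, .wk Γ σ τ n hr hn rfl rfl, .aps ht e0 e1⟩
  case cntr Γ σ τ n hr hn hN hw =>
    subst hN hw
    obtain ⟨e0, e1, e2⟩ := args_one hp
    exact ⟨_, .cntr Γ σ τ n hr hn rfl rfl,
      .A ht (.A ht.A_inv.1 (.aps ht.A_inv.1.A_inv.1 e0 e1) e2) e2⟩
  case cut Γ σ τ n hr hn hN hw =>
    subst hN hw
    obtain ⟨e0, e1, e2⟩ := args_two hp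
    exact ⟨_, .cut Γ σ τ n hr hn rfl rfl, .A ht (.aps ht.A_inv.1 e1 e2) (.aps ht.A_inv.2 e0 e2)⟩
  case L Γ ρ σ τ n hr hn hN hw =>
    subst hN hw
    obtain ⟨hp, e3⟩ := args_succ hp
    obtain ⟨e0, e1, e2⟩ := args_two hp
    exact ⟨_, .L Γ ρ σ τ n hr hn rfl rfl, .A ht (.aps ht.A_inv.1 e1 e2)
      (.A ht.A_inv.2 e3 (.aps ht.A_inv.2.A_inv.2 e0 e2))⟩
  case R Γ σ τ n hr hn hN hw =>
    subst hN hw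
    obtain ⟨e0, e1, e2⟩ := args_one hp
    exact ⟨_, .R Γ σ τ n hr hn rfl rfl, .A ht (.aps ht.A_inv.1 e0 e1) e2⟩
  case recrZero Γ τ n hr hn hN he h0 hw =>
    subst hN hw
    obtain ⟨hp, e3⟩ := args_succ hp
    obtain ⟨e0, e1, e2⟩ := args_two hp
    exact ⟨_, .recrZero Γ τ n hr hn rfl (e3.zero he) ((e3.zero he).sty e3.sty.right h0.right) rfl,
      .aps ht e0 e2⟩
  case condZero Γ τ n hr hn hN he h0 hw =>
    subst hN hw
    obtain ⟨hp, e3⟩ := args_succ hp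
    obtain ⟨e0, e1, e2⟩ := args_two hp
    exact ⟨_, .condZero Γ τ n hr hn rfl (e3.zero he) ((e3.zero he).sty e3.sty.right h0.right) rfl,
      .aps ht e0 e2⟩
  case recrSucc Γ τ n y hr hn hN he h0 hw =>
    subst hN hw
    obtain ⟨hp, e3⟩ := args_succ hp
    obtain ⟨e0, e1, e2⟩ := args_two hp
    obtain ⟨y', h1, h2, h3⟩ := e3.succ he h0.right
    exact ⟨_, .recrSucc Γ τ n y' hr hn rfl h2 (h2.sty e3.sty.right h3) rfl,
      .A ht (.A ht.A_inv.1 (.aps ht.A_inv.1.A_inv.1 e1 e2) h1)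
        (.A ht.A_inv.2 (.ap ht.A_inv.2.A_inv.1 ht.A_inv.2.A_inv.1.of_ap.pr hp) h1)⟩
  case condSucc Γ τ n y hr hn hN he h0 hw =>
    subst hN hw
    obtain ⟨hp, e3⟩ := args_succ hp
    obtain ⟨e0, e1, e2⟩ := args_two hp
    obtain ⟨y', h1, h2, h3⟩ := e3.succ he h0.right
    exact ⟨_, .condSucc Γ τ n y' hr hn rfl h2 (h2.sty e3.sty.right h3) rfl,
      .A ht (.aps ht.A_inv.1 e1 e2) h1⟩

theorem Root.commute {s t s' t' w : M.Num} (h : Root (oA s t) w) (hs : Pr s s') (ht : Pr t t') :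
    ∃ w', Root (oA s' t') w' ∧ Pr w w' := by
  obtain ⟨r, N, a, b, v, h0, h1, h2, h3, h4, h5⟩ := h
  obtain rfl | ⟨k, rfl⟩ := Num.cases' N
  · exact (h0.ne_zero rfl).elim
  have hA := h4.left
  rw [ap_succ] at h1 hA
  obtain ⟨e1, e2⟩ := h1.A_inv
  -- All contractions of `r` have the same number `k + 1` of arguments, so the function part, with
  -- `k` of them, reduces argumentwise.
  obtain ⟨c, d, h6, h7⟩ := Pr.ap_inv (K := k + 1) (fun N' _ _ _ h => (h0.det h).1.le)
    (Num.lt_succ_self k) (hs.eq_left e1.symm hA.A_inv.1)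
  obtain ⟨a', b', h8, h9⟩ := exists_append c d k t'
  have hp : ∀ i < k + 1, Pr (bt a b i) (bt a' b' i) := fun i hi => by
    obtain hi | rfl := Num.lt_succ_cases hi
    · rw [h8 i hi]; exact h6 i hi
    · rw [h9]; exact ht.eq_left e2.symm hA.A_inv.2
  obtain ⟨v', h10, h11⟩ := h0.commute h5.left hp
  have h12 := (Pr.ap h4.left h4.left.of_ap.pr hp).sty
  refine ⟨v', ⟨r, k + 1, a', b', v', h10, ?_, h11.sty.right.refl, ?_, ?_, h11.sty.right.sty⟩,
    h11.eq_left h2.symm h5.right⟩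
  · rw [ap_succ, h9]
    refine .A (h7.trans ?_) ht.sty.right.refl
    rw [ap_congr fun i hi => (h8 i hi).symm]
    exact (h12.right.ap_inv.1 k (Num.lt_succ_self k).le).refl
  · exact ((Pr.A h3.left hs ht).sty.symm.trans h3).trans h12
  · exact (h12.symm.trans h4).trans h11.sty

-- The cases are those of `Par.diamond`. Since components are determined only up to bisimilarity,
-- the induction treats peaks over bisimilar sources `s` and `s'`.
set_option synthInstance.maxHeartbeats 400000 in
set_option synthInstance.maxSize 4000 in
theorem Pr.diamond {s t t' : M.Num} (h : Pr s t) (h' : Pr s t') : ∃ r, Pr t r ∧ Pr t' r := by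
  obtain ⟨a, b, n, hy, hd⟩ := h
  obtain ⟨a', b', n', hy', hd'⟩ := h'
  -- Bisimilarity occurs as a hypothesis in the induction statement and has to be `Δ⁰₁` there. The
  -- sources in the two derivations are at most `a` and `a'`, so the pairs concerned are at most `pr
  -- a a'`.
  obtain ⟨Q, hQ, hQ', hiff⟩ := exists_bounded_compr
    (P := fun x : M.Num => ∃ s s', x = pr s s' ∧ jEq s s') inferInstance (pr a a' + 1)
  have := fun (C : Type u) [Ctx M C] (f : C → M.Num) [Fn f] => hQ.comp f
  have := fun (C : Type u) [Ctx M C] (f : C → M.Num) [Fn f] => hQ'.comp f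
  have hiff' : ∀ s s', s ≤ a → s' ≤ a' → (Q (pr s s') ↔ jEq s s') := fun s s' hs hs' => by
    rw [← hiff _ (Num.lt_succ_iff.2 (pr_mono hs hs'))]
    constructor
    · rintro ⟨_, _, e, h⟩
      obtain ⟨rfl, rfl⟩ := pr_inj.1 e
      exact h
    · exact fun h => ⟨_, _, rfl, h⟩
  -- The second reduction enters as an entry of its own coded derivation. All universal quantifiers
  -- are bounded and all hypotheses are `Δ⁰₁`; only the conclusion has an unbounded quantifier.
  have key := hd.induct (P := fun y => ∀ s, s ≤ y → ∀ t, t ≤ y → y = pr s t → ∀ j, j < n' →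
    ∀ s', s' ≤ a' → ∀ t', t' ≤ a' → bt a' b' j = pr s' t' → Q (pr s s') →
    ∃ r, Pr t r ∧ Pr t' r) (.inl inferInstance) ?_ hy
  · obtain ⟨j, hj, e⟩ := hy'
    have h1 := e ▸ bt_le a' b' j
    have h2 := (le_pr_left _ _).trans (In.le hy)
    have h3 := (le_pr_left _ _).trans h1
    exact key s (le_pr_left _ _) t (le_pr_right _ _) rfl j hj s h3 t' ((le_pr_right _ _).trans h1) e
      ((hiff' s s h2 h3).2 (Pr.sty (hd.der hy)).left.refl)
  rintro _ hy h s - t - rfl j hj s' hs' t' ht' ej hq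
  have h1 : In a' b' n' (pr s' t') := ⟨j, hj, ej⟩
  have e := (hiff' s s' ((le_pr_left _ _).trans hy.le) hs').1 hq
  have hst : Pr s t := hd.der hy
  have hst' : Pr s' t' := hd'.der h1
  obtain ⟨h2, h3, h4⟩ | ⟨s₁, s₂, t₁, t₂, h2, h3, h4, h5, h6, h7⟩ := step_prRl.1 h
  · exact ⟨t', hst'.eq_left (h4.symm.trans e) h3, hst'.sty.right.pr⟩
  obtain ⟨k2, k3, k4⟩ | ⟨s₁', s₂', t₁', t₂', k2, k3, k4, k5, k6, k7⟩ := hd'.prStep h1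
  · exact ⟨t, hst.sty.right.pr, hst.eq_left (k4.symm.trans e.symm) k3⟩
  have ih : ∀ s t s' t', In a b n (pr s t) → In a' b' n' (pr s' t') → jEq s s' →
      (∀ s₁, s₁ ≤ pr s t → ∀ t₁, t₁ ≤ pr s t → pr s t = pr s₁ t₁ → ∀ j, j < n' →
        ∀ s', s' ≤ a' → ∀ t', t' ≤ a' → bt a' b' j = pr s' t' → Q (pr s₁ s') →
        ∃ r, Pr t₁ r ∧ Pr t' r) → ∃ r, Pr t r ∧ Pr t' r := by
    rintro s t s' t' h1 ⟨j, hj, h2⟩ h3 h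
    have h4 := h2 ▸ bt_le a' b' j
    have h5 := (le_pr_left _ _).trans h4
    exact h _ (le_pr_left _ _) _ (le_pr_right _ _) rfl j hj _ h5 _ ((le_pr_right _ _).trans h4) h2
      ((hiff' _ _ ((le_pr_left _ _).trans h1.le) h5).2 h3)
  obtain ⟨e1, e2⟩ := ((h3.symm.trans e).trans k3).A_inv
  obtain ⟨r₁, i1, i1'⟩ := ih _ _ _ _ h5.1 k5 e1 h5.2
  obtain ⟨r₂, i2, i2'⟩ := ih _ _ _ _ h6.1 k6 e2 h6.2
  have j1 : Typed (oA t₁ t₂) := (STy.A h4 (Pr.sty (hd.der h5.1)) (Pr.sty (hd.der h6.1))).right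
  have j2 : Typed (oA t₁' t₂') := (STy.A k4 (Pr.sty (hd'.der k5)) (Pr.sty (hd'.der k6))).right
  obtain ⟨h7, h8⟩ | h7 := h7 <;> obtain ⟨k7, k8⟩ | k7 := k7
  · exact ⟨_, (Pr.A j1 i1 i2).eq_left h7.symm h8, (Pr.A j2 i1' i2').eq_left k7.symm k8⟩
  · obtain ⟨w, l1, l2⟩ := k7.commute i1' i2'
    exact ⟨w, (Pr.root j1 i1 i2 l1).eq_left h7.symm h8, l2⟩
  · obtain ⟨w, l1, l2⟩ := h7.commute i1 i2
    exact ⟨w, l2, (Pr.root j2 i1' i2' l1).eq_left k7.symm k8⟩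
  -- Both contractions carry over to the joined application; its contracta are bisimilar by
  -- `Root.det`.
  · obtain ⟨w, l1, l2⟩ := h7.commute i1 i2
    obtain ⟨w', l1', l2'⟩ := k7.commute i1' i2'
    exact ⟨w, l2, l2'.eq_right (l1'.det l1) l2.sty.right⟩

end

/-! ## Reduction and parallel reduction -/

section

variable {M : Structure2.{u}} [hM : Fact M.IsModelRCA0]

theorem Num.one_add_pos (n : M.Num) : 0 < 1 + n := Num.zero_lt_one''.trans_le le_self_add

theorem ap_one (h a b : M.Num) : ap h a b 1 = oA h (bt a b 0) := by
  rw [← zero_add (1 : M.Num), ap_succ, ap_zero]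

theorem ap_two (h a b : M.Num) : ap h a b (1 + 1) = oA (oA h (bt a b 0)) (bt a b 1) := by
  rw [ap_succ, ap_one]

theorem Len.spine_one {Γ n : M.Num} (h : Len Γ n) (r a b : M.Num) :
    jSpine Γ (oA (oK r) (bt a b 0)) (ap (oK r) a b (1 + n)) (bt a b 0)
      (aps (bt a b 0) a b 1 n) := by
  rw [← ap_aps, ap_one]
  exact h.spine' _ _ _ _ _

theorem Len.spine_two {Γ n : M.Num} (h : Len Γ n) (r a b z : M.Num) :
    jSpine Γ (oA (oA (oK r) (bt a b 0)) (bt a b 1)) (ap (oK r) a b (1 + 1 + n)) z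
      (aps z a b (1 + 1) n) := by
  rw [← ap_aps, ap_two]
  exact h.spine' _ _ _ _ _

theorem ap_inj {h a b a' b' n : M.Num} (e : ap h a b n = ap h a' b' n) :
    ∀ i < n, bt a b i = bt a' b' i := by
  intro i hi
  have := Sg.descend (P := fun i => ap h a b i = ap h a' b' i) inferInstance e
    (fun i _ h => by
      rw [ap_succ, ap_succ] at h
      simp [pr_inj] at h
      exact h.1) (Num.succ_le_iff.2 hi)
  rw [ap_succ, ap_succ] at this
  simp [pr_inj] at this
  exact this.2

theorem jSpine.one {Γ r t u v : M.Num} (h : jSpine Γ (oA (oK r) t) u t v) :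
    ∃ n a b, Len Γ n ∧ u = ap (oK r) a b (1 + n) ∧ v = aps (bt a b 0) a b 1 n := by
  obtain ⟨a, b, e, e'⟩ := exists_ap_one (oK r) t
  obtain ⟨n, c, d, hn, h1, h2, h3⟩ := h.exists_aps e
  exact ⟨n, c, d, hn, h2, by rw [h1 0 Num.zero_lt_one'', e', h3]⟩

theorem jSpine.one_A {Γ r t u v : M.Num} (h : jSpine Γ (oA (oK r) t) u t v) (x : M.Num) :
    ∃ n a b, Len Γ n ∧ oA u x = ap (oK r) a b (1 + n + 1) ∧ bt a b (1 + n) = x ∧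
      v = aps (bt a b 0) a b 1 n := by
  obtain ⟨n, a, b, hn, rfl, rfl⟩ := h.one
  obtain ⟨c, d, h1, h2, h3⟩ := exists_ap_append (oK r) a b (1 + n) x
  exact ⟨n, c, d, hn, h3, h2, by
    rw [h1 0 (Num.one_add_pos n), aps_congr fun i hi => (h1 _ (add_lt_add_right hi 1)).symm]⟩

theorem jSpine.two {Γ r s t u z v : M.Num} (h : jSpine Γ (oA (oA (oK r) s) t) u z v) :
    ∃ n a b, Len Γ n ∧ bt a b 0 = s ∧ bt a b 1 = t ∧ u = ap (oK r) a b (1 + 1 + n) ∧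
      v = aps z a b (1 + 1) n := by
  obtain ⟨a, b, e, e'⟩ := exists_ap_one (oK r) s
  obtain ⟨a', b', h1, h2, h3⟩ := exists_ap_append (oK r) a b 1 t
  obtain ⟨n, c, d, hn, h4, h5, h6⟩ := h.exists_aps (e ▸ h3)
  exact ⟨n, c, d, hn, by rw [h4 0 (Num.zero_lt_one''.trans (Num.lt_succ_self 1)),
    h1 0 Num.zero_lt_one'', e'], by rw [h4 1 (Num.lt_succ_self 1), h2], h5, h6⟩

/-- Both spines end in the same number `u`, so their arguments agree literally and one coded
sequence serves for both parts of the contractum. -/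
theorem jSpine.two_two {Γ r s t u v v' : M.Num} (h : jSpine Γ (oA (oA (oK r) s) t) u s v)
    (h' : jSpine Γ (oA (oA (oK r) s) t) u t v') :
    ∃ n a b, Len Γ n ∧ u = ap (oK r) a b (1 + 1 + n) ∧ v = aps (bt a b 0) a b (1 + 1) n ∧
      v' = aps (bt a b 1) a b (1 + 1) n := by
  obtain ⟨n, a, b, hn, rfl, rfl, rfl, rfl⟩ := h.two
  obtain ⟨n', a', b', hn', h1, h2, h3, h4⟩ := h'.two
  obtain rfl := hn.unique hn'
  exact ⟨n, a, b, hn, rfl, rfl, h4.trans (aps_congr fun i hi =>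
    (ap_inj h3 _ (add_lt_add_right hi _)).symm)⟩

theorem exists_append_two (r a b n x : M.Num) :
    ∃ c d, oA (ap (oK r) a b (1 + 1 + n)) x = ap (oK r) c d (1 + 1 + n + 1) ∧
      bt c d (1 + 1 + n) = x ∧ bt c d 0 = bt a b 0 ∧ bt c d 1 = bt a b 1 ∧
      (∀ z, aps z a b (1 + 1) n = aps z c d (1 + 1) n) ∧
      ap (oK r) a b (1 + 1 + n) = ap (oK r) c d (1 + 1 + n) := by
  obtain ⟨c, d, h1, h2, h3⟩ := exists_ap_append (oK r) a b (1 + 1 + n) x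
  obtain ⟨h4, h5, h6⟩ := args_two h1
  exact ⟨c, d, h3, h2, h4, h5, fun z => aps_congr fun i hi => (h6 i hi).symm,
    ap_congr fun i hi => (h1 i hi).symm⟩

theorem Ctr.root {r N a b w v : M.Num} (h : Ctr r N a b v) (e : w = ap (oK r) a b N)
    (ht : STy w v) : Root w v := by
  subst e
  exact ⟨r, N, a, b, v, h, ht.left.refl, ht.right.refl, ht.left.sty, ht, ht.right.sty⟩

/-- A reduction step is a contraction or takes place in a component. -/
theorem jStep.cases {P : M.Num → Prop} {s t : M.Num} (h : Rule P (Der ClRl) (.step s t))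
    (hP : ∀ Γ s u t v, P (Jd.spine Γ s u t v).code → jSpine Γ s u t v) (ht : STy s t) :
    Root s t ∨ (∃ u v x, s = oA u x ∧ t = oA v x ∧ P (Jd.step u v).code) ∨
      ∃ u v x, s = oA x u ∧ t = oA x v ∧ P (Jd.step u v).code := by
  have hA {h' a b n : M.Num} {w v : M.Num} (e : w = ap h' a b (n + 1)) (ht : STy w v) :
      Typed (bt a b n) := (e ▸ ht.left).ap_inv.2 n (Num.lt_succ_self n)
  cases h with
  | stepId σ x e =>
    subst e
    obtain ⟨a, b, e, e'⟩ := exists_ap_one (oK (rId σ)) t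
    rw [← zero_add (1 : M.Num)] at e
    exact .inl (Ctr.root (.id σ rfl rfl e'.symm) e ht)
  | stepEx Γ Δ ρ σ τ t u v w w' x y h h' =>
    obtain ⟨n, a, b, hn, rfl, rfl⟩ := (hP _ _ _ _ _ h).one
    obtain ⟨c, d, h1, h2, h3⟩ := exists_ap_append (oK (rEx Γ ρ σ Δ τ)) a b (1 + n) x
    obtain ⟨c', d', h1', h2', h3'⟩ := exists_ap_append (oK (rEx Γ ρ σ Δ τ)) c d (1 + n + 1) y
    rw [h3] at h'
    obtain ⟨m, p, q, hm, h4, h5, h6⟩ := (hP _ _ _ _ _ h').exists_aps h3'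
    refine .inl (Ctr.root (.ex Γ ρ σ Δ τ n m rfl hn hm rfl ?_) h5 ht)
    obtain ⟨h4, k1⟩ := args_succ h4
    obtain ⟨k2, k3, k4⟩ := args_one fun i hi => (h4 i hi).trans (h1' i hi)
    rw [h6, k1, h2', k4, h2, k2, h1 0 (Num.one_add_pos n), aps_congr fun i hi =>
      ((k3 i hi).trans (h1 _ (add_lt_add_right hi 1)))]
  | stepWk Γ σ τ _ u v x e h =>
    subst e
    obtain ⟨n, a, b, hn, e, rfl, rfl⟩ := (hP _ _ _ _ _ h).one_A x
    exact .inl (Ctr.root (.wk Γ σ τ n rfl hn rfl rfl) e ht)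
  | stepCntr Γ σ τ _ u v x e e' h =>
    subst e e'
    obtain ⟨n, a, b, hn, e, rfl, rfl⟩ := (hP _ _ _ _ _ h).one_A x
    exact .inl (Ctr.root (.cntr Γ σ τ n rfl hn rfl rfl) e ht)
  | stepR Γ σ τ _ u v x e e' h =>
    subst e e'
    obtain ⟨n, a, b, hn, e, rfl, rfl⟩ := (hP _ _ _ _ _ h).one_A x
    exact .inl (Ctr.root (.R Γ σ τ n rfl hn rfl rfl) e ht)
  | stepCut Γ σ τ _ _ u v v' e h h' =>
    subst e
    obtain ⟨n, a, b, hn, e, rfl, rfl⟩ := (hP _ _ _ _ _ h).two_two (hP _ _ _ _ _ h')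
    exact .inl (Ctr.root (.cut Γ σ τ n rfl hn rfl rfl) e ht)
  | stepL Γ ρ σ τ _ _ u v v' y e e' h h' =>
    subst e e'
    obtain ⟨n, a, b, hn, rfl, rfl, rfl⟩ := (hP _ _ _ _ _ h).two_two (hP _ _ _ _ _ h')
    obtain ⟨c, d, e, rfl, e0, e1, e2, -⟩ := exists_append_two (rL Γ ρ σ τ) a b n y
    exact .inl (Ctr.root (.L Γ ρ σ τ n rfl hn rfl (by rw [e2, e2, e0, e1])) e ht)
  | stepRecrZero Γ τ _ _ u v e h =>
    subst e
    obtain ⟨n, a, b, hn, rfl, rfl, rfl, rfl⟩ := (hP _ _ _ _ _ h).two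
    obtain ⟨c, d, e, e3, e0, e1, e2, -⟩ := exists_append_two (rRecr Γ τ) a b n (oK rZero)
    have h0 := hA e ht
    rw [e3] at h0
    exact .inl (Ctr.root (.recrZero Γ τ n rfl hn rfl (by rw [e3]; exact .K _)
      (by rw [e3]; exact h0.sty) (by rw [e2, e0])) e ht)
  | stepCondZero Γ τ _ _ u v e h =>
    subst e
    obtain ⟨n, a, b, hn, rfl, rfl, rfl, rfl⟩ := (hP _ _ _ _ _ h).two
    obtain ⟨c, d, e, e3, e0, e1, e2, -⟩ := exists_append_two (rCond Γ τ) a b n (oK rZero)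
    have h0 := hA e ht
    rw [e3] at h0
    exact .inl (Ctr.root (.condZero Γ τ n rfl hn rfl (by rw [e3]; exact .K _)
      (by rw [e3]; exact h0.sty) (by rw [e2, e0])) e ht)
  | stepRecrSucc Γ τ _ _ u v y e e' h =>
    subst e e'
    obtain ⟨n, a, b, hn, rfl, rfl, rfl, rfl⟩ := (hP _ _ _ _ _ h).two
    obtain ⟨c, d, e, e3, e0, e1, e2, e4⟩ := exists_append_two (rRecr Γ τ) a b n (oA (oK rSucc) y)
    have h0 := hA e ht
    rw [e3] at h0
    exact .inl (Ctr.root (.recrSucc Γ τ n y rfl hn rfl (by rw [e3]; exact h0.refl)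
      (by rw [e3]; exact h0.sty) (by rw [e2, e1, e4])) e ht)
  | stepCondSucc Γ τ _ _ u v y e e' h =>
    subst e e'
    obtain ⟨n, a, b, hn, rfl, rfl, rfl, rfl⟩ := (hP _ _ _ _ _ h).two
    obtain ⟨c, d, e, e3, e0, e1, e2, e4⟩ := exists_append_two (rCond Γ τ) a b n (oA (oK rSucc) y)
    have h0 := hA e ht
    rw [e3] at h0
    exact .inl (Ctr.root (.condSucc Γ τ n y rfl hn rfl (by rw [e3]; exact h0.refl)
      (by rw [e3]; exact h0.sty) (by rw [e2, e1])) e ht)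
  | stepLeft s s' x e e' h => exact .inr (.inl ⟨s, s', x, e, e', h⟩)
  | stepRight x s s' e e' h => exact .inr (.inr ⟨s, s', x, e, e', h⟩)

-- Equality of types is a `Σ⁰₁` hypothesis in an induction with a `Σ⁰₁` conclusion. As in
-- `Pr.diamond` it is made `Δ⁰₁` by bounded comprehension, here on the entries of the derivation. It
-- passes to the component in which a step takes place, since the other component is unchanged.
set_option synthInstance.maxHeartbeats 400000 in
theorem jStep.pr {s t : M.Num} (h : jStep s t) (ht : STy s t) : Pr s t := by
  obtain ⟨a, b, n, hy, hd⟩ := h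
  obtain ⟨Q, hQ, hQ', hiff⟩ := exists_bounded_compr
    (P := fun x : M.Num => ∃ s t, x = (Jd.step s t).code ∧ STy s t) inferInstance (a + 1)
  have := fun (C : Type u) [Ctx M C] (f : C → M.Num) [Fn f] => hQ.comp f
  have := fun (C : Type u) [Ctx M C] (f : C → M.Num) [Fn f] => hQ'.comp f
  have hiff' : ∀ s t, In a b n (Jd.step s t).code → (Q (Jd.step s t).code ↔ STy s t) :=
    fun s t hst => by
      rw [← hiff _ (Num.lt_succ_iff.2 hst.le)]
      constructor
      · rintro ⟨s', t', e, h⟩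
        obtain h := Jd.code_injective e
        simp at h
        obtain ⟨rfl, rfl⟩ := h
        assumption
      · exact fun h => ⟨s, t, rfl, h⟩
  refine hd.induct (P := fun y => ∀ s, s ≤ y → ∀ t, t ≤ y → y = (Jd.step s t).code → Q y → Pr s t)
    (.inl inferInstance) ?_ hy s (le_cd (by simp)) t (le_cd (by simp)) rfl ((hiff' _ _ hy).2 ht)
  rintro _ hy hr s - t - rfl hq
  have ht := (hiff' _ _ hy).1 hq
  obtain h | ⟨u, v, x, rfl, rfl, h⟩ | ⟨u, v, x, rfl, rfl, h⟩ := jStep.cases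
    ((step_iff (j := .step s t)).1 (hr.mono (fun x hx => hx) fun x hx => hd.der hx))
    (fun _ _ _ _ _ h => hd.der h.1) ht
  · exact h.pr
  · have hx := ht.left.A_inv.2
    exact .A ht.left (h.2 _ (le_cd (by simp)) _ (le_cd (by simp)) rfl
      ((hiff' _ _ h.1).2 (ht.of_A hx.sty))) hx.pr
  · have hx := ht.left.A_inv.1
    exact .A ht.left hx.pr (h.2 _ (le_cd (by simp)) _ (le_cd (by simp)) rfl
      ((hiff' _ _ h.1).2 (ht.of_A' hx.sty)))

end

/-! ### From parallel reduction back to reduction -/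

section

variable {M : Structure2.{u}} [hM : Fact M.IsModelRCA0]

instance jEq.sg_eta (s : M.Num) : Sg (jEq s) :=
  jEq.sg (f := fun _ => s) (g := fun t => t)

instance jReds.sg_eta (θ s : M.Num) : Sg (jReds θ s) :=
  jReds.sg (f := fun _ => θ) (g := fun _ => s) (h := fun t => t)

instance jConv.sg_eta (θ s : M.Num) : Sg (jConv θ s) :=
  jConv.sg (f := fun _ => θ) (g := fun _ => s) (h := fun t => t)

theorem jStep.of_rule {s t : M.Num} (h : Rule (Der ClRl) (Der ClRl) (.step s t)) : jStep s t :=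
  CT.of_rule h

/-- The clauses for `jStep` match `0` and `s y` literally. The last argument is first replaced by
this form, which `jRed` allows because it works up to bisimilarity. -/
theorem Ctr.step {r N a b w : M.Num} (h : Ctr r N a b w) (ht : Typed (ap (oK r) a b N)) :
    ∃ z, jEq z (ap (oK r) a b N) ∧ Typed z ∧ jStep z w := by
  have hz {n x : M.Num} (h1 : Typed (ap (oK r) a b (n + 1))) (h2 : jEq (bt a b n) x)
      (h3 : STy (bt a b n) x) : jEq (oA (ap (oK r) a b n) x) (ap (oK r) a b (n + 1)) ∧
        Typed (oA (ap (oK r) a b n) x) := by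
    rw [ap_succ] at h1 ⊢
    exact ⟨h1.A_inv.1.refl.A h2.symm, (STy.A h1 h1.A_inv.1.sty h3).right⟩
  cases h
  case id σ hr hN hw =>
    subst hr hN hw
    refine ⟨_, ht.refl, ht, ?_⟩
    rw [zero_add, ap_one]
    exact jStep.of_rule (.stepId σ _ rfl)
  case ex Γ ρ σ Δ τ n m hr hn hm hN hw =>
    subst hr hN hw
    have h := hm.spine' (ap (oK (rEx Γ ρ σ Δ τ)) a b (1 + n + 1 + 1))
      (oA (oA (aps (bt a b 0) a b 1 n) (bt a b (1 + n + 1))) (bt a b (1 + n))) a b (1 + n + 1 + 1)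
    rw [ap_aps, ap_succ _ _ _ (1 + n + 1), ap_succ _ _ _ (1 + n)] at h
    exact ⟨_, ht.refl, ht, jStep.of_rule (.stepEx Γ Δ ρ σ τ _ _ _ _ _ _ _ (hn.spine_one _ a b) h)⟩
  case wk Γ σ τ n hr hn hN hw =>
    subst hr hN hw
    exact ⟨_, ht.refl, ht, jStep.of_rule (.stepWk Γ σ τ _ _ _ _ (ap_succ _ _ _ _) (hn.spine_one _ a b))⟩
  case cntr Γ σ τ n hr hn hN hw =>
    subst hr hN hw
    exact ⟨_, ht.refl, ht,
      jStep.of_rule (.stepCntr Γ σ τ _ _ _ _ (ap_succ _ _ _ _) rfl (hn.spine_one _ a b))⟩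
  case cut Γ σ τ n hr hn hN hw =>
    subst hr hN hw
    exact ⟨_, ht.refl, ht, jStep.of_rule (.stepCut Γ σ τ _ _ _ _ _ rfl (hn.spine_two _ a b _)
      (hn.spine_two _ a b _))⟩
  case L Γ ρ σ τ n hr hn hN hw =>
    subst hr hN hw
    exact ⟨_, ht.refl, ht, jStep.of_rule (.stepL Γ ρ σ τ _ _ _ _ _ _ (ap_succ _ _ _ _) rfl
      (hn.spine_two _ a b _) (hn.spine_two _ a b _))⟩
  case R Γ σ τ n hr hn hN hw =>
    subst hr hN hw
    exact ⟨_, ht.refl, ht,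
      jStep.of_rule (.stepR Γ σ τ _ _ _ _ (ap_succ _ _ _ _) rfl (hn.spine_one _ a b))⟩
  case recrZero Γ τ n hr hn hN he h0 hw =>
    subst hr hN hw
    obtain ⟨h1, h2⟩ := hz ht he h0
    exact ⟨_, h1, h2, jStep.of_rule (.stepRecrZero Γ τ _ _ _ _ rfl (hn.spine_two _ a b _))⟩
  case condZero Γ τ n hr hn hN he h0 hw =>
    subst hr hN hw
    obtain ⟨h1, h2⟩ := hz ht he h0
    exact ⟨_, h1, h2, jStep.of_rule (.stepCondZero Γ τ _ _ _ _ rfl (hn.spine_two _ a b _))⟩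
  case recrSucc Γ τ n y hr hn hN he h0 hw =>
    subst hr hN hw
    obtain ⟨h1, h2⟩ := hz ht he h0
    exact ⟨_, h1, h2, jStep.of_rule (.stepRecrSucc Γ τ _ _ _ _ _ rfl rfl (hn.spine_two _ a b _))⟩
  case condSucc Γ τ n y hr hn hN he h0 hw =>
    subst hr hN hw
    obtain ⟨h1, h2⟩ := hz ht he h0
    exact ⟨_, h1, h2, jStep.of_rule (.stepCondSucc Γ τ _ _ _ _ _ rfl rfl (hn.spine_two _ a b _))⟩

theorem jRed.inv {θ s t : M.Num} (h : jRed θ s t) : ∃ s' t', jFarc s θ ∧ jFarc s' θ ∧ jFarc t' θ ∧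
    jFarc t θ ∧ jEq s s' ∧ jStep s' t' ∧ jEq t' t := by
  cases h.rule with
  | red _ _ s' _ t' h₁ h₂ h₃ h₄ h₅ h₆ h₇ => exact ⟨s', t', h₁, h₂, h₃, h₄, h₅, h₆, h₇⟩

theorem jRed.intro {θ s s' t t' : M.Num} (h₁ : jFarc s θ) (h₂ : jFarc s' θ) (h₃ : jFarc t' θ)
    (h₄ : jFarc t θ) (h₅ : jEq s s') (h₆ : jStep s' t') (h₇ : jEq t' t) : jRed θ s t :=
  of_rule (.red θ s s' t t' h₁ h₂ h₃ h₄ h₅ h₆ h₇)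

theorem jRed.eq_left {θ s s' t : M.Num} (h : jRed θ s t) (e : jEq s' s) (hs : jFarc s' θ) :
    jRed θ s' t := by
  obtain ⟨u, v, h1, h2, h3, h4, h5, h6, h7⟩ := h.inv
  exact .intro hs h2 h3 h4 (e.trans h5) h6 h7

theorem jRed.eq_right {θ s t t' : M.Num} (h : jRed θ s t) (e : jEq t t') (ht : jFarc t' θ) :
    jRed θ s t' := by
  obtain ⟨u, v, h1, h2, h3, h4, h5, h6, h7⟩ := h.inv
  exact .intro h1 h2 h3 ht h5 h6 (h7.trans e)

theorem jRed.farc {θ s t : M.Num} (h : jRed θ s t) : jFarc s θ ∧ jFarc t θ := by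
  obtain ⟨u, v, h1, h2, h3, h4, h5, h6, h7⟩ := h.inv
  exact ⟨h1, h4⟩

theorem jRed.A_left {σ θ s t x : M.Num} (h : jRed (oArr σ θ) s t) (hx : jFarc x σ) :
    jRed θ (oA s x) (oA t x) := by
  obtain ⟨u, v, h1, h2, h3, h4, h5, h6, h7⟩ := h.inv
  exact .intro (h1.A hx) (h2.A hx) (h3.A hx) (h4.A hx) (h5.A hx.refl)
    (of_rule (.stepLeft _ _ x rfl rfl h6)) (h7.A hx.refl)

theorem jRed.A_right {σ θ s t x : M.Num} (h : jRed σ s t) (hx : jFarc x (oArr σ θ)) :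
    jRed θ (oA x s) (oA x t) := by
  obtain ⟨u, v, h1, h2, h3, h4, h5, h6, h7⟩ := h.inv
  exact .intro (hx.A h1) (hx.A h2) (hx.A h3) (hx.A h4) (hx.refl.A h5)
    (of_rule (.stepRight x _ _ rfl rfl h6)) (hx.refl.A h7)

theorem Root.red {w v θ : M.Num} (h : Root w v) (hw : jFarc w θ) : jRed θ w v := by
  obtain ⟨r, N, a, b, u, h0, h1, h2, h3, h4, h5⟩ := h
  obtain ⟨z, h6, h7, h8⟩ := h0.step h4.left
  exact .intro hw (((h3.trans (h6.symm.sty h4.left h7))).farc hw) ((h3.trans h4).farc hw)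
    (((h3.trans h4).trans h5).farc hw) (h1.trans h6.symm) h8 h2

theorem jRed.pr {θ s t : M.Num} (h : jRed θ s t) : Pr s t := by
  obtain ⟨u, v, h1, h2, h3, h4, h5, h6, h7⟩ := h.inv
  exact ((h6.pr ⟨θ, h2, h3⟩).eq_left h5 h1.typed).eq_right h7 h4.typed

theorem jReds.of_eq {θ s t : M.Num} (h : jEq s t) (hs : jFarc s θ) (ht : jFarc t θ) :
    jReds θ s t := of_rule (.redsRefl θ s t hs ht h)

theorem jReds.snoc {θ s t u : M.Num} (h : jReds θ s t) (h' : jRed θ t u) : jReds θ s u :=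
  of_rule (.redsStep θ s t u h h')

theorem jReds.ind {θ s t : M.Num} (h : jReds θ s t) {P : M.Num → Prop} (hP : Sg P)
    (h0 : ∀ t, jEq s t → jFarc s θ → jFarc t θ → P t)
    (hs : ∀ t u, jReds θ s t → P t → jRed θ t u → P u) : P t := by
  have := fun (C : Type u) [Ctx M C] (f : C → M.Num) [Fn f] => hP.comp f
  refine jReds.induct (Φ := fun θ' s' t => θ' = θ → s' = s → P t) (.inl inferInstance) ?_ h rfl rfl
  rintro θ' s' t _ h rfl rfl
  cases h with
  | redsRefl _ _ _ h1 h2 h3 => exact h0 _ h3.1 h1.1 h2.1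
  | redsStep _ _ t u h1 h2 => exact hs _ _ h1.1 (h1.2 _ _ _ rfl rfl rfl) h2.1

theorem jReds.farc {θ s t : M.Num} (h : jReds θ s t) : jFarc s θ ∧ jFarc t θ :=
  h.ind (P := fun t => jFarc s θ ∧ jFarc t θ) inferInstance (fun _ _ h h' => ⟨h, h'⟩)
    fun _ _ _ h h' => ⟨h.1, h'.farc.2⟩

theorem jReds.eq_right {θ s t t' : M.Num} (h : jReds θ s t) (e : jEq t t') (ht : jFarc t' θ) :
    jReds θ s t' := by
  cases h.rule with
  | redsRefl _ _ _ h1 h2 h3 => exact .of_eq (jEq.trans h3 e) h1 ht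
  | redsStep _ _ u _ h1 h2 => exact .snoc h1 (jRed.eq_right h2 e ht)

theorem jReds.trans {θ s t u : M.Num} (h : jReds θ s t) (h' : jReds θ t u) : jReds θ s u :=
  h'.ind (P := fun u => jReds θ s u) inferInstance (fun _ e _ hu => h.eq_right e hu)
    fun _ _ _ h h' => h.snoc h'

theorem jRed.reds {θ s t : M.Num} (h : jRed θ s t) : jReds θ s t :=
  (jReds.of_eq h.farc.1.refl h.farc.1 h.farc.1).snoc h

theorem jReds.A_left {σ θ s t x : M.Num} (h : jReds (oArr σ θ) s t) (hx : jFarc x σ) :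
    jReds θ (oA s x) (oA t x) :=
  h.ind (P := fun t => jReds θ (oA s x) (oA t x)) inferInstance
    (fun _ e h h' => .of_eq (e.A hx.refl) (h.A hx) (h'.A hx)) fun _ _ _ h h' => h.snoc (h'.A_left hx)

theorem jReds.A_right {σ θ s t x : M.Num} (h : jReds σ s t) (hx : jFarc x (oArr σ θ)) :
    jReds θ (oA x s) (oA x t) :=
  h.ind (P := fun t => jReds θ (oA x s) (oA x t)) inferInstance
    (fun _ e h h' => .of_eq (hx.refl.A e) (hx.A h) (hx.A h')) fun _ _ _ h h' =>
      h.snoc (h'.A_right hx)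

/-- The components have types other than `θ`, so the induction leaves the type existentially
quantified; uniqueness of types recovers it at the end. -/
theorem Pr.reds {θ s t : M.Num} (h : Pr s t) (hs : jFarc s θ) : jReds θ s t := by
  have key : ∃ θ, jReds θ s t := by
    refine Pr.induct (Φ := fun s t => ∃ θ, jReds θ s t) inferInstance ?_ h
    rintro s t - (⟨⟨θ, h1⟩, h2, h3⟩ | ⟨s₁, s₂, t₁, t₂, ⟨θ, h1⟩, h2, h3, ⟨-, θ₁, h4⟩, ⟨-, θ₂, h5⟩, h6⟩)
    · exact ⟨θ, .of_eq h3 h1 ((h3.sty ⟨θ, h1⟩ h2).farc h1)⟩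
    · have h7 := (h2.sty ⟨θ, h1⟩ h3).farc h1
      obtain ⟨σ, h8, h9⟩ := h7.A_inv
      obtain rfl := h4.farc.1.unique h8 h8.refl
      obtain rfl := h5.farc.1.unique h9 h9.refl
      have h10 := ((jReds.of_eq h2 h1 h7).trans (h4.A_left h9)).trans (h5.A_right h4.farc.2)
      obtain ⟨h6, h11⟩ | h6 := h6
      · exact ⟨θ, h10.eq_right h6 ((h6.sty h10.farc.2.typed h11).farc h10.farc.2)⟩
      · exact ⟨θ, h10.snoc (h6.red h10.farc.2)⟩
  obtain ⟨θ', h'⟩ := key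
  obtain rfl := hs.unique h'.farc.1 hs.refl
  exact h'

/-! ## Confluence -/

/-- A single parallel step is carried along a reduction by repeated use of the diamond. The claim
has only an existential quantifier over `Σ⁰₁` conditions, so induction along the reduction is
available. -/
theorem jReds.strip {θ s t u : M.Num} (h : jReds θ s u) (h' : Pr s t) :
    ∃ r, jReds θ t r ∧ Pr u r := by
  refine h.ind (P := fun u => ∃ r, jReds θ t r ∧ Pr u r) inferInstance ?_ ?_
  · intro u e hs hu
    have ht := h'.sty.farc hs
    exact ⟨t, .of_eq ht.refl ht ht, h'.eq_left e.symm hu.typed⟩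
  · rintro u v - ⟨r, h1, h2⟩ h3
    obtain ⟨r', h4, h5⟩ := h2.diamond h3.pr
    exact ⟨r', h1.trans (h4.reds h1.farc.2), h5⟩

theorem jReds.confluent {θ s t u : M.Num} (h : jReds θ s t) (h' : jReds θ s u) :
    ∃ r, jReds θ t r ∧ jReds θ u r := by
  refine h.ind (P := fun t => ∃ r, jReds θ t r ∧ jReds θ u r) inferInstance ?_ ?_
  · intro t e hs ht
    exact ⟨u, (jReds.of_eq e.symm ht hs).trans h', .of_eq h'.farc.2.refl h'.farc.2 h'.farc.2⟩
  · rintro t v - ⟨r, h1, h2⟩ h3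
    obtain ⟨r', h4, h5⟩ := h1.strip h3.pr
    exact ⟨r', h4, h2.trans (h5.reds h2.farc.2)⟩

theorem jReds.eq_of_normal {θ s t : M.Num} (h : jReds θ s t) (hs : ∀ w, ¬ jRed θ s w) :
    jEq s t := by
  have hs' := h.farc.1
  exact h.ind (P := fun t => jEq s t) inferInstance (fun _ e _ _ => e) fun t u _ e h =>
    (hs u (h.eq_left e hs')).elim

theorem jConv.of_eq {θ s t : M.Num} (h : jEq s t) (hs : jFarc s θ) (ht : jFarc t θ) :
    jConv θ s t := of_rule (.convRefl θ s t hs ht h)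

theorem jConv.snoc {θ s t u : M.Num} (h : jConv θ s t) (h' : jRed θ t u) : jConv θ s u :=
  of_rule (.convStep θ s t u h h')

theorem jConv.back {θ s t u : M.Num} (h : jConv θ s t) (h' : jRed θ u t) : jConv θ s u :=
  of_rule (.convBack θ s t u h h')

theorem jConv.ind {θ s t : M.Num} (h : jConv θ s t) {P : M.Num → Prop} (hP : Sg P)
    (h0 : ∀ t, jEq s t → jFarc s θ → jFarc t θ → P t)
    (hs : ∀ t u, P t → jRed θ t u → P u) (hb : ∀ t u, P t → jRed θ u t → P u) : P t := by
  have := fun (C : Type u) [Ctx M C] (f : C → M.Num) [Fn f] => hP.comp f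
  refine jConv.induct (Φ := fun θ' s' t => θ' = θ → s' = s → P t) (.inl inferInstance) ?_ h rfl rfl
  rintro θ' s' t _ h rfl rfl
  cases h with
  | convRefl _ _ _ h1 h2 h3 => exact h0 _ h3.1 h1.1 h2.1
  | convStep _ _ t u h1 h2 => exact hs _ _ (h1.2 _ _ _ rfl rfl rfl) h2.1
  | convBack _ _ t u h1 h2 => exact hb _ _ (h1.2 _ _ _ rfl rfl rfl) h2.1

theorem jConv.eq_right {θ s t t' : M.Num} (h : jConv θ s t) (e : jEq t t') (ht : jFarc t' θ) :
    jConv θ s t' := by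
  cases h.rule with
  | convRefl _ _ _ h1 h2 h3 => exact .of_eq (jEq.trans h3 e) h1 ht
  | convStep _ _ u _ h1 h2 => exact .snoc h1 (jRed.eq_right h2 e ht)
  | convBack _ _ u _ h1 h2 => exact .back h1 (jRed.eq_left h2 e.symm ht)

theorem jConv.trans {θ s t u : M.Num} (h : jConv θ s t) (h' : jConv θ t u) : jConv θ s u :=
  h'.ind (P := fun u => jConv θ s u) inferInstance (fun _ e _ hu => h.eq_right e hu)
    (fun _ _ h h' => h.snoc h') fun _ _ h h' => h.back h'

theorem jReds.conv {θ s t : M.Num} (h : jReds θ s t) : jConv θ s t :=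
  h.ind (P := fun t => jConv θ s t) inferInstance (fun _ => .of_eq) fun _ _ _ h h' => h.snoc h'

theorem jReds.conv_symm {θ s t : M.Num} (h : jReds θ s t) : jConv θ t s :=
  h.ind (P := fun t => jConv θ t s) inferInstance (fun _ e h h' => .of_eq e.symm h' h)
    fun _ _ _ h h' => .trans (.back (.of_eq h'.farc.2.refl h'.farc.2 h'.farc.2) h') h

/-- Induction along the conversion: a forward step is absorbed by `jReds.strip`, a backward step
only lengthens the reduction to the common reduct. -/
theorem jConv.common {θ s t : M.Num} (h : jConv θ s t) : ∃ r, jReds θ s r ∧ jReds θ t r := by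
  refine h.ind (P := fun t => ∃ r, jReds θ s r ∧ jReds θ t r) inferInstance ?_ ?_ ?_
  · exact fun t e hs ht => ⟨t, .of_eq e hs ht, .of_eq ht.refl ht ht⟩
  · rintro t u ⟨r, h1, h2⟩ h3
    obtain ⟨r', h4, h5⟩ := h2.strip h3.pr
    exact ⟨r', h1.trans (h5.reds h1.farc.2), h4⟩
  · rintro t u ⟨r, h1, h2⟩ h3
    exact ⟨r, h1, h3.reds.trans h2⟩

end

/-! ## The sentences of arithmetic -/

section

variable {M : Structure2.{u}} {e : ℕ → M.Num} {E : ℕ → Set M.Num}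

theorem sat_all {n : ℕ} {φ : Fml} :
    (Fml.all n φ).Sat M e E ↔ ∀ x, φ.Sat M (Function.update e n x) E := Iff.rfl

theorem sat_ex {n : ℕ} {φ : Fml} :
    (Fml.ex n φ).Sat M e E ↔ ∃ x, φ.Sat M (Function.update e n x) E := Iff.rfl

theorem sat_imp {φ ψ : Fml} : (Fml.imp φ ψ).Sat M e E ↔ (φ.Sat M e E → ψ.Sat M e E) := Iff.rfl

theorem sat_and {φ ψ : Fml} : (Fml.and φ ψ).Sat M e E ↔ φ.Sat M e E ∧ ψ.Sat M e E := Iff.rfl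

theorem sat_neg {φ : Fml} : (Fml.neg φ).Sat M e E ↔ ¬ φ.Sat M e E := Iff.rfl

end

section

open Arith

variable {M : Structure2.{u}} [hM : Fact M.IsModelRCA0] {e : ℕ → M.Num} {E : ℕ → Set M.Num}

theorem Tm.below_numeral (k : ℕ) : (numeral k).Below 46 = true := by
  induction k with
  | zero => rfl
  | succ k ih => simp [numeral, Tm.Below, ih]

theorem sat_jFarc {m n : ℕ} (hm : m < 46) (hn : n < 46) :
    (holds (Arith.jFarc m n)).Sat M e E ↔ CT.jFarc (e m) (e n) :=
  sat_holds (by simp [Arith.jFarc, Tm.Below, code, pair, Tm.below_numeral, hm, hn])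

theorem sat_jEq {m n : ℕ} (hm : m < 46) (hn : n < 46) :
    (holds (Arith.jEq m n)).Sat M e E ↔ CT.jEq (e m) (e n) :=
  sat_holds (by simp [Arith.jEq, Tm.Below, code, pair, Tm.below_numeral, hm, hn])

theorem sat_jRed {l m n : ℕ} (hl : l < 46) (hm : m < 46) (hn : n < 46) :
    (holds (Arith.jRed l m n)).Sat M e E ↔ CT.jRed (e l) (e m) (e n) :=
  sat_holds (by simp [Arith.jRed, Tm.Below, code, pair, Tm.below_numeral, hl, hm, hn])

theorem sat_jReds {l m n : ℕ} (hl : l < 46) (hm : m < 46) (hn : n < 46) :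
    (holds (Arith.jReds l m n)).Sat M e E ↔ CT.jReds (e l) (e m) (e n) :=
  sat_holds (by simp [Arith.jReds, Tm.Below, code, pair, Tm.below_numeral, hl, hm, hn])

theorem sat_jConv {l m n : ℕ} (hl : l < 46) (hm : m < 46) (hn : n < 46) :
    (holds (Arith.jConv l m n)).Sat M e E ↔ CT.jConv (e l) (e m) (e n) :=
  sat_holds (by simp [Arith.jConv, Tm.Below, code, pair, Tm.below_numeral, hl, hm, hn])

/-- The formula `normal` binds the variable with number `21`; the bound on `n` prevents capture. -/
theorem sat_normal {n : ℕ} (hn : n < 21) :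
    (normal n).Sat M e E ↔ ∀ x, ¬ CT.jRed (e 7) (e n) x := by
  simp [normal, sat_all, sat_neg, sat_jRed, hn.trans (by norm_num : 21 < 46), hn.ne, θ, w]

end

theorem rca0_churchRosser : RCA0Proves.{u} Arith.churchRosser := by
  intro M hM e E _
  have : Fact M.IsModelRCA0 := ⟨hM⟩
  simp only [Arith.churchRosser, Arith.alls, List.foldr, sat_all, sat_ex, sat_imp]
  simp [Fml.sat_conj, sat_jFarc, sat_jReds, Arith.θ, Arith.t, Arith.t',
    Arith.u, Arith.v]
  intro θ t u v _ h h'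
  obtain ⟨r, h1, h2⟩ := h.confluent h'
  exact ⟨r, h1.farc.2, h1, h2⟩

theorem rca0_peaksAndValleys : RCA0Proves.{u} Arith.peaksAndValleys := by
  intro M hM e E _
  have : Fact M.IsModelRCA0 := ⟨hM⟩
  simp only [Arith.peaksAndValleys, Arith.alls, List.foldr, sat_all, sat_ex, sat_imp, sat_and]
  simp [Fml.sat_conj, sat_jFarc, sat_jReds, sat_jConv, Arith.θ, Arith.s, Arith.t, Arith.u]
  exact fun θ s t _ _ => ⟨jConv.common, fun u h h' => h.conv.trans h'.conv_symm⟩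

theorem rca0_uniqueNormalReds : RCA0Proves.{u} Arith.uniqueNormalReds := by
  intro M hM e E _
  have : Fact M.IsModelRCA0 := ⟨hM⟩
  simp only [Arith.uniqueNormalReds, Arith.alls, List.foldr, sat_all, sat_imp]
  simp [Fml.sat_conj, sat_jFarc, sat_jReds, sat_normal, sat_jEq, Arith.θ, Arith.t,
    Arith.u, Arith.v]
  intro θ t u v _ hu hv h h'
  obtain ⟨r, h1, h2⟩ := h.confluent h'
  exact (h1.eq_of_normal hu).trans (h2.eq_of_normal hv).symm

theorem rca0_uniqueNormalConv : RCA0Proves.{u} Arith.uniqueNormalConv := by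
  intro M hM e E _
  have : Fact M.IsModelRCA0 := ⟨hM⟩
  simp only [Arith.uniqueNormalConv, Arith.alls, List.foldr, sat_all, sat_imp]
  simp [Fml.sat_conj, sat_jFarc, sat_jConv, sat_normal, sat_jEq, Arith.θ, Arith.t,
    Arith.u, Arith.v]
  intro θ t u v _ hu hv h h'
  obtain ⟨r, h1, h2⟩ := (h.trans h').common
  exact (h1.eq_of_normal hu).trans (h2.eq_of_normal hv).symm

end CT

/-! ### The Church–Rosser theorem and its provability in `RCA₀` -/

theorem mainTheorem7 :
    -- reduction on farcs is confluent
    (∀ (σ : CT.Ty) (t t₀ t₁ : CT.Coterm), CT.Farc t σ → CT.Reds t t₀ → CT.Reds t t₁ →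
      ∃ t' : CT.Coterm, CT.Farc t' σ ∧ CT.Reds t₀ t' ∧ CT.Reds t₁ t') ∧
    -- convertible farcs are those with a common reduct
    (∀ s t : CT.Coterm, CT.IsFarc s → CT.IsFarc t →
      (CT.Conv s t ↔ ∃ r : CT.Coterm, CT.Reds s r ∧ CT.Reds t r)) ∧
    -- unique normal forms for reduction
    (∀ t s₀ s₁ : CT.Coterm, CT.IsFarc t → CT.Normal s₀ → CT.Normal s₁ →
      CT.Reds t s₀ → CT.Reds t s₁ → s₀ = s₁) ∧
    -- unique normal forms for conversion
    (∀ t s₀ s₁ : CT.Coterm, CT.IsFarc t → CT.IsFarc s₀ → CT.IsFarc s₁ →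
      CT.Normal s₀ → CT.Normal s₁ → CT.Conv s₀ t → CT.Conv t s₁ → s₀ = s₁) ∧
    -- all of this is provable in RCA₀
    CT.RCA0Proves.{u} CT.Arith.churchRosser ∧
    CT.RCA0Proves.{u} CT.Arith.peaksAndValleys ∧
    CT.RCA0Proves.{u} CT.Arith.uniqueNormalReds ∧
    CT.RCA0Proves.{u} CT.Arith.uniqueNormalConv := by
  refine ⟨fun σ t t₀ t₁ ht h₀ h₁ => ?_, fun s t _ _ => CT.conv_iff, fun t s₀ s₁ _ h₀ h₁ hr₀ hr₁ => ?_,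
    fun t s₀ s₁ _ _ _ h₀ h₁ hc₀ hc₁ => ?_, CT.rca0_churchRosser, CT.rca0_peaksAndValleys,
    CT.rca0_uniqueNormalReds, CT.rca0_uniqueNormalConv⟩
  -- Subject reduction along the first of the two paths shows that the common reduct is a farc of
  -- the same type.
  · obtain ⟨t', h, h'⟩ := h₀.confluent h₁
    exact ⟨t', (ht.reds h₀).reds h, h, h'⟩
  · obtain ⟨r, h, h'⟩ := hr₀.confluent hr₁
    rw [← h₀.eq_of_reds h, h₁.eq_of_reds h']
  · obtain ⟨r, h, h'⟩ := CT.conv_iff.1 (hc₀.trans _ _ _ hc₁)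
    rw [← h₀.eq_of_reds h, h₁.eq_of_reds h']
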